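/- **Setting.** A *map* is a connected graph cellularly embedded in a compact connected oriented surface, described by its finite set of directed edges (darts) together with the permutation $x$ rotating each dart to the next one around its initial vertex and the fixed-point-free involution $y$ reversing the darts, where $\langle x,y\rangle$ is transitive; the faces are the cycles of $z=(xy)^{-1}$. Morphisms (possibly branched coverings) commute with $x$ and $y$. A map $\mathcal M$ is *orientably regular* if its orientation-preserving automorphism group ${\rm Aut}^+\mathcal M$ is transitive on darts; a map is *regular* if it is isomorphic to its mirror image, and *chiral* otherwise. A map has *type* $\{n,m\}$ if all faces are $n$-gons and all vertices are $m$-valent. The *Platonic map* $\{n,m\}$ is the orientably regular map of genus $0$ and type $\{n,m\}$. Let $\mathcal M=\{n,m\}$ be a Platonic map with $f$ faces, let $G={\rm Aut}^+\mathcal M$, and let $p$ be a prime not dividing $|G|$. By a *covering* of rank $c$ we mean an orientably regular map $\mathcal N$ with a regular covering $\mathcal N\to\mathcal M$, unbranched outside the face-centres of $\mathcal M$, whose group $K$ of covering transformations is elementary abelian of order $p^c$; coverings are counted up to isomorphism. (For the coverings in question, isomorphism as maps and isomorphism as coverings of $\mathcal M$ give the same count.) A covering is *irreducible* if $c\ge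 1$ and $G$ acts irreducibly by conjugation on $K$; the *join* of a non-empty set of coverings is the smallest covering of $\mathcal M$ which covers all of them. **Theorem.** The coverings of $\mathcal M$ of rank $c\ge 1$ are as follows. - The tetrahedron $\{3,3\}$ has exactly one covering, with $c=3$; it is regular. - The cube $\{4,3\}$ has exactly three coverings, with $c=2,3,5$, all regular. - The octahedron $\{3,4\}$ has exactly seven coverings, with $c=1,3,3,4,4,6,7$, all regular. - The dodecahedron $\{5,3\}$ has exactly seven coverings, with $c=3,3,5,6,8,8,11$, if $p\equiv\pm1$ mod $5$, and exactly three, with $c=5,6,11$, if $p\equiv\pm2$ mod $5$; all are regular. - The icosahedron $\{3,5\}$ has exactly $8p+23$ coverings, $31$ regular and $8(p-1)$ chiral, if $p\equiv\pm1$ mod $5$, and the set of values of $c$ is $\{3,4,\ldots,16,19\}$; it has exactly $4p+11$ coverings, $15$ regular and $4(p-1)$ chiral, if $p\equiv\pm2$ mod $5$, and the set of values of $c$ is $\{4,5,6,8,9,10,11,13,14,15,19\}$. - The dihedron $\{n,2\}$ has exactly one covering, with $c=1$; it is regular. - The hosohedron $\{2,n\}$ has exactly $2^{\nu}-1$ coverings,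 all regular, where $\nu$ is the number of orbits $\Delta\neq\{1\}$ of the group generated by the Frobenius automorphism and inversion on the set of $n$th roots of $1$ in $\overline{\mathbb F}_p$. Every covering of $\mathcal M$ of rank $c\ge1$ has type $\{np,m\}$ and genus $$\left(\frac f2-1\right)p^c-\frac f2\,p^{c-1}+1,$$ and all of them are quotients of a single covering of rank $f-1$. If $\mathcal M$ is not the icosahedron, then for some $\nu$ there are $\nu$ irreducible coverings of $\mathcal M$ whose joins, over the $2^\nu-1$ non-empty subsets of them, are pairwise non-isomorphic and are all the coverings of $\mathcal M$ of rank $c\ge1$. -/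

import Mathlib

/-- A finite oriented combinatorial map, that is, a map on a compact connected oriented surface.
`D` is the set of darts (directed edges), `x` rotates each dart to the next one around its initial
vertex following the orientation, and `y` reverses each dart. -/
structure OMap where
  D : Type
  finite : Finite D
  nonempty : Nonempty D
  x : Equiv.Perm D
  y : Equiv.Perm D
  y_invol : ∀ d, y (y d) = d
  y_free : ∀ d, y d ≠ d
  connected : ∀ d e, ∃ g ∈ Subgroup.closure ({x, y} : Set (Equiv.Perm D)), g d = e

namespace OMap

/-- The permutation `z` with `x y z = 1`, whose cycles are the faces. -/
def z (M : OMap) : Equiv.Perm M.D := (M.x * M.y)⁻¹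

/-- The number of cycles of a permutation, fixed points included. -/
noncomputable def numCycles {D : Type} (g : Equiv.Perm D) : ℕ :=
  Nat.card (Quotient (Equiv.Perm.SameCycle.setoid g))

noncomputable def numVertices (M : OMap) : ℕ := numCycles M.x
noncomputable def numEdges (M : OMap) : ℕ := numCycles M.y
noncomputable def numFaces (M : OMap) : ℕ := numCycles M.z

/-- The genus `g`, determined by `V - E + F = 2 - 2 g`. -/
noncomputable def genus (M : OMap) : ℚ :=
  1 - ((M.numVertices : ℚ) - M.numEdges + M.numFaces) / 2

/-- Type `{n, m}`: all faces are `n`-gons and all vertices have valency `m`. -/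
def HasType (M : OMap) (n m : ℕ) : Prop :=
  ∀ d, Function.minimalPeriod M.z d = n ∧ Function.minimalPeriod M.x d = m

/-- Orientation-preserving morphisms of maps, that is, (possibly branched) coverings `N → M`. -/
structure Hom (N M : OMap) where
  toFun : N.D → M.D
  map_x : ∀ d, toFun (N.x d) = M.x (toFun d)
  map_y : ∀ d, toFun (N.y d) = M.y (toFun d)

/-- Orientation-preserving isomorphism of maps. -/
def Iso (N M : OMap) : Prop := ∃ f : Hom N M, Function.Bijective f.toFun

/-- The orientation-preserving automorphism group `Aut⁺ M`: the permutations of the darts which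
commute with `x` and `y`. -/
def aut (M : OMap) : Subgroup (Equiv.Perm M.D) :=
  Subgroup.centralizer ({M.x, M.y} : Set (Equiv.Perm M.D))

/-- `Aut⁺ M` is transitive on directed edges. -/
def OrientablyRegular (M : OMap) : Prop := ∀ d e : M.D, ∃ a ∈ M.aut, a d = e

theorem closure_inv_pair {G : Type} [Group G] (a b : G) :
    Subgroup.closure ({a, b} : Set G) ≤ Subgroup.closure ({a⁻¹, b} : Set G) := by
  rw [Subgroup.closure_le]
  rintro g (rfl | rfl)
  · have h : g⁻¹ ∈ Subgroup.closure ({g⁻¹, b} : Set G) := Subgroup.subset_closure (by simp)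
    simpa using inv_mem h
  · exact Subgroup.subset_closure (by simp)

/-- The mirror image: the same embedded graph, with the orientation of the surface reversed. -/
def mirror (M : OMap) : OMap where
  D := M.D
  finite := M.finite
  nonempty := M.nonempty
  x := M.x⁻¹
  y := M.y
  y_invol := M.y_invol
  y_free := M.y_free
  connected := fun d e =>
    let ⟨g, hg, h⟩ := M.connected d e
    ⟨g, closure_inv_pair _ _ hg, h⟩

/-- A map is regular if it is isomorphic to its mirror image, and chiral otherwise. -/
def Regular (M : OMap) : Prop := M.Iso M.mirror

def Chiral (M : OMap) : Prop := ¬ M.Regular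

/-- The Platonic map `{n, m}`: the orientably regular map of genus `0` with `n`-gonal faces
and `m`-valent vertices. -/
def IsPlatonic (M : OMap) (n m : ℕ) : Prop :=
  M.OrientablyRegular ∧ M.genus = 0 ∧ M.HasType n m

/-- The group of covering transformations of a covering. -/
def Hom.deck {N M : OMap} (φ : Hom N M) : Subgroup N.aut where
  carrier := {a | ∀ d, φ.toFun (a.1 d) = φ.toFun d}
  one_mem' := fun _ => rfl
  mul_mem' := fun {a b} ha hb d => (ha (b.1 d)).trans (hb d)
  inv_mem' := fun {a} ha d => by
    have h := ha ((a⁻¹).1 d)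
    simpa using h.symm

end OMap

open OMap

/-- An orientably regular map `N` with a regular covering `φ : N → M`, unbranched outside the
face-centres, whose covering group is an elementary abelian `p`-group of rank `c`.
(The rank `c = 0` gives the trivial covering.) There is never branching over edges, as `y` has no
fixed points; at a vertex the covering is unbranched when the valency is preserved. -/
structure ElemAbCover (M : OMap) (p : ℕ) where
  N : OMap
  φ : OMap.Hom N M
  c : ℕ
  orientablyRegular : N.OrientablyRegular
  unbranched_vertices :
    ∀ d, Function.minimalPeriod N.x d = Function.minimalPeriod M.x (φ.toFun d)
  regular_covering : ∀ d e, φ.toFun d = φ.toFun e → ∃ a ∈ φ.deck, a.1 d = e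
  deck_comm : ∀ a ∈ φ.deck, ∀ b ∈ φ.deck, a * b = b * a
  deck_exponent : ∀ a ∈ φ.deck, a ^ p = 1
  deck_card : Nat.card φ.deck = p ^ c

namespace ElemAbCover

variable {M : OMap} {p : ℕ}

/-- Isomorphism of coverings of `M`. -/
def Equivalent (C C' : ElemAbCover M p) : Prop :=
  ∃ f : OMap.Hom C.N C'.N, Function.Bijective f.toFun ∧
    ∀ d, C'.φ.toFun (f.toFun d) = C.φ.toFun d

/-- The covering `ψ : X → M` factors through the covering `C`. -/
def FactorsThrough {X : OMap} (ψ : OMap.Hom X M) (C : ElemAbCover M p) : Prop :=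
  ∃ f : OMap.Hom X C.N, ∀ d, C.φ.toFun (f.toFun d) = ψ.toFun d

/-- `C` is a quotient of `C'`, as coverings of `M`. -/
def IsQuotientOf (C C' : ElemAbCover M p) : Prop := FactorsThrough C'.φ C

/-- `Aut⁺ N` acts irreducibly by conjugation on the covering group `K`. As `K` is elementary
abelian, its invariant subspaces are the subgroups of `K` which are normal in `Aut⁺ N`; the
induced action of `Aut⁺ M` has the same invariant subspaces. -/
def Irreducible (C : ElemAbCover M p) : Prop :=
  1 ≤ C.c ∧ ∀ H : Subgroup C.N.aut, H.Normal → H ≤ C.φ.deck → H = ⊥ ∨ H = C.φ.deck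

/-- `C` is the join of the coverings `I i` with `i ∈ S`: the smallest covering of `M` which
covers all of them. -/
def IsJoin {ι : Type} (C : ElemAbCover M p) (I : ι → ElemAbCover M p) (S : Finset ι) : Prop :=
  (∀ i ∈ S, (I i).IsQuotientOf C) ∧
  ∀ (X : OMap) (ψ : OMap.Hom X M), (∀ i ∈ S, FactorsThrough ψ (I i)) → FactorsThrough ψ C

/-- `L` lists the coverings of rank `c ≥ 1` without repetition: the listed covering maps are
pairwise non-isomorphic as maps, and each covering is isomorphic, as a covering of `M`, to a
listed one. -/
def IsClassification {ι : Type} (L : ι → ElemAbCover M p) : Prop :=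
  (∀ i, 1 ≤ (L i).c) ∧ (∀ i j, (L i).N.Iso (L j).N → i = j) ∧
  ∀ C : ElemAbCover M p, 1 ≤ C.c → ∃ i, C.Equivalent (L i)

end ElemAbCover

open ElemAbCover

/-- Up to isomorphism, `M` has exactly `k` coverings; their ranks are the entries of `c`, and
all of them are regular maps. -/
def HasRegularCoverings (M : OMap) (p : ℕ) {k : ℕ} (c : Fin k → ℕ) : Prop :=
  ∃ L : Fin k → ElemAbCover M p,
    IsClassification L ∧ (∀ i, (L i).c = c i) ∧ ∀ i, (L i).N.Regular

/-- Up to isomorphism, `M` has exactly `k` coverings, of which `r` are regular and `s` are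
chiral, and `R` is the set of their ranks. -/
def HasCoverings (M : OMap) (p k r s : ℕ) (R : Set ℕ) : Prop :=
  ∃ L : Fin k → ElemAbCover M p, IsClassification L ∧
    Nat.card {i // (L i).N.Regular} = r ∧ Nat.card {i // (L i).N.Chiral} = s ∧
    Set.range (fun i => (L i).c) = R

/-- There are `ν` irreducible coverings of `M` whose joins over the `2 ^ ν - 1` non-empty
subfamilies are, without repetition, all the coverings of `M`. -/
def CoveringsAreJoins (M : OMap) (p ν : ℕ) : Prop :=
  ∃ (I : Fin ν → ElemAbCover M p) (L : {S : Finset (Fin ν) // S.Nonempty} → ElemAbCover M p),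
    (∀ i, (I i).Irreducible) ∧ IsClassification L ∧ ∀ S, (L S).IsJoin I S.1

/-- The permutation group of the algebraic closure of `𝔽_p` generated by the Frobenius
automorphism and inversion. -/
noncomputable def frobInvGroup (p : ℕ) [Fact p.Prime] :
    Subgroup (Equiv.Perm (AlgebraicClosure (ZMod p))) :=
  Subgroup.closure
    {(frobeniusEquiv (AlgebraicClosure (ZMod p)) p).toEquiv,
      Equiv.inv (AlgebraicClosure (ZMod p))}

/-- The number of orbits other than `{1}` of the Frobenius automorphism and inversion on the
`n`th roots of `1` in the algebraic closure of `𝔽_p`. -/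
noncomputable def numRootOrbits (p : ℕ) [Fact p.Prime] (n : ℕ) : ℕ :=
  Set.ncard {Δ : Set (AlgebraicClosure (ZMod p)) |
    (∃ ω, ω ^ n = 1 ∧ Δ = MulAction.orbit (frobInvGroup p) ω) ∧ Δ ≠ {1}}

/-! ### Monodromy representation, morphisms and cycle counts. -/

section

namespace OMap

noncomputable section

/-! An orientably regular map is determined by the kernel of its monodromy representation, a normal
subgroup of the free group on X and Y. If K is the kernel for M, the coverings in question
correspond to the normal subgroups R ≤ K which contain X^m, Y^2, and the commutators and pth powers
of elements of K (`Admissible`). A homomorphism K → 𝔽_p that is trivial on the conjugates of X^m and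
Y^2 is a voltage assignment, a skew function on the darts summed along words (`exists_tau_eq`). On
the sphere a voltage assignment with zero face sums is a coboundary, by a dimension count with
Euler's formula (`HasType.skew_inf_ker`), so these homomorphisms amount to the functions on the
faces with sum zero. Duality then turns the coverings of rank c into the c-dimensional subspaces of
`faceSpace` over 𝔽_p invariant under Aut⁺ M (`annKer_annSpace`, `annSpace_annKer`,
`relIndex_annKer`). The whole space, of dimension f - 1, gives the covering of which all others are
quotients; joins are sums of subspaces; regularity is invariance under a reflection of M, which
exists because a spherical map of given type is unique (`exists_iso`).

It remains to find the invariant subspaces of a permutation module in coprime characteristic. By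
Maschke's theorem each is the image of an equivariant projection, and that projection is a
combination of Hecke operators, one for each double coset of a face stabiliser
(`exists_projection`). Except for the icosahedron, all Hecke operators are polynomials in the
adjacency operator T of the faces. The module is then multiplicity-free, and its submodules are the
sums of the kernels of the irreducible factors of a polynomial killing T (`MultFree`). For the
solids the relations are read off finite tables; traces give the dimensions modulo p, and the known
total makes them exact. For the hosohedron the eigenvalues of T are the ω + ω⁻¹ with ω^m = 1 and ω ≠
1, where m is the valency, and their minimal polynomials are indexed by the orbits of Frobenius and
inversion.

For the icosahedron one constituent, of dimension 4, occurs twice, as ker T and ker (T + 2), and a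
further Hecke operator U exchanges the two copies (`Exchange`). The submodules of this double
component are 0, the whole, and p + 1 lines indexed by a slope; they combine freely with the 2^ν
sums of the other components. Automorphisms commute with U, whereas a reflection changes its sign
and so carries slope t to slope -t. Hence precisely the finite non-zero slopes give chiral
coverings. -/

theorem perm_apply_inv {D : Type} (g : Equiv.Perm D) (d : D) : g (g⁻¹ d) = d :=
  g.apply_symm_apply d

theorem perm_inv_apply {D : Type} (g : Equiv.Perm D) (d : D) : g⁻¹ (g d) = d :=
  g.symm_apply_apply d

instance (M : OMap) : Finite M.D := M.finite
instance (M : OMap) : Nonempty M.D := M.nonempty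
instance (M : OMap) : Fintype M.D := Fintype.ofFinite _
instance (M : OMap) : DecidableEq M.D := Classical.decEq _

/-- The monodromy representation of the free group on `X = of true` and `Y = of false`. -/
def mon (M : OMap) : FreeGroup Bool →* Equiv.Perm M.D :=
  FreeGroup.lift fun b => cond b M.x M.y

abbrev gX : FreeGroup Bool := FreeGroup.of true
abbrev gY : FreeGroup Bool := FreeGroup.of false
abbrev gZ : FreeGroup Bool := (gX * gY)⁻¹

@[simp] theorem mon_X (M : OMap) : M.mon gX = M.x := by simp [mon]
@[simp] theorem mon_Y (M : OMap) : M.mon gY = M.y := by simp [mon]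
theorem mon_Z (M : OMap) : M.mon gZ = M.z := by rw [map_inv, map_mul, mon_X, mon_Y]; rfl

theorem mem_closure_iff_mon (M : OMap) (g : Equiv.Perm M.D) :
    g ∈ Subgroup.closure ({M.x, M.y} : Set (Equiv.Perm M.D)) ↔ ∃ w, M.mon w = g := by
  have h : (M.mon).range = Subgroup.closure ({M.x, M.y} : Set (Equiv.Perm M.D)) := by
    rw [mon, FreeGroup.range_lift_eq_closure]
    congr 1
    ext g
    simp only [Set.mem_range, Bool.exists_bool, cond_false, cond_true, Set.mem_insert_iff,
      Set.mem_singleton_iff]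
    tauto
  rw [← h, MonoidHom.mem_range]

theorem exists_mon (M : OMap) (d e : M.D) : ∃ w, M.mon w d = e := by
  obtain ⟨g, hg, h⟩ := M.connected d e
  obtain ⟨w, rfl⟩ := (M.mem_closure_iff_mon g).1 hg
  exact ⟨w, h⟩

theorem Hom.map_mon {N M : OMap} (φ : Hom N M) (w : FreeGroup Bool) (d : N.D) :
    φ.toFun (N.mon w d) = M.mon w (φ.toFun d) := by
  induction w using FreeGroup.induction_on generalizing d with
  | C1 => simp
  | of b => cases b <;> simp [mon, φ.map_x, φ.map_y]
  | inv_of b ih =>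
    have := ih ((N.mon (FreeGroup.of b))⁻¹ d)
    rw [map_inv, map_inv]
    rw [perm_apply_inv] at this
    rw [this, perm_inv_apply]
  | mul a b iha ihb => rw [map_mul, map_mul, Equiv.Perm.mul_apply, Equiv.Perm.mul_apply, iha, ihb]

theorem mem_aut_iff {M : OMap} {a : Equiv.Perm M.D} :
    a ∈ M.aut ↔ (∀ d, a (M.x d) = M.x (a d)) ∧ ∀ d, a (M.y d) = M.y (a d) := by
  rw [aut, Subgroup.mem_centralizer_iff]
  simp only [Set.mem_insert_iff, Set.mem_singleton_iff, forall_eq_or_imp, forall_eq]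
  simp only [Equiv.ext_iff, Equiv.Perm.mul_apply, eq_comm]

/-- An automorphism as an endomorphism of the map. -/
def autHom {M : OMap} (a : Equiv.Perm M.D) (ha : a ∈ M.aut) : Hom M M :=
  ⟨a, (mem_aut_iff.1 ha).1, (mem_aut_iff.1 ha).2⟩

theorem aut_mon {M : OMap} {a : Equiv.Perm M.D} (ha : a ∈ M.aut) (w : FreeGroup Bool) (d : M.D) :
    a (M.mon w d) = M.mon w (a d) := (autHom a ha).map_mon w d

theorem aut_eq_of_apply_eq {M : OMap} {a b : Equiv.Perm M.D} (ha : a ∈ M.aut) (hb : b ∈ M.aut)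
    {d : M.D} (h : a d = b d) : a = b := by
  ext e
  obtain ⟨w, rfl⟩ := M.exists_mon d e
  rw [aut_mon ha, aut_mon hb, h]

/-- Automorphisms are transitive and commute with the monodromy, so agreement at one dart spreads to
all darts. Thus the stabiliser of any dart in the free group is the whole kernel. -/
theorem OrientablyRegular.mon_eq {M : OMap} (hM : M.OrientablyRegular) {v w : FreeGroup Bool}
    {d : M.D} (h : M.mon v d = M.mon w d) : M.mon v = M.mon w := by
  ext e
  obtain ⟨a, ha, rfl⟩ := hM d e
  rw [← aut_mon ha, ← aut_mon ha, h]

theorem OrientablyRegular.mem_ker {M : OMap} (hM : M.OrientablyRegular) {w : FreeGroup Bool}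
    {d : M.D} (h : M.mon w d = d) : w ∈ M.mon.ker :=
  (hM.mon_eq (w := 1) (d := d) (by simpa using h)).trans (map_one _)

/-- The map sends the end of a path from d to the end of the same path from e. The condition on
stabilisers says exactly that the choice of path is immaterial. -/
theorem exists_hom {X N : OMap} (d : X.D) (e : N.D)
    (h : ∀ w, X.mon w d = d → N.mon w e = e) : ∃ f : Hom X N, f.toFun d = e := by
  choose s hs using X.exists_mon d
  have key : ∀ w, N.mon (s (X.mon w d)) e = N.mon w e := by
    intro w
    have h1 : X.mon (w⁻¹ * s (X.mon w d)) d = d := by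
      rw [map_mul, Equiv.Perm.mul_apply, hs, map_inv, perm_inv_apply]
    have h2 := h _ h1
    rw [map_mul, Equiv.Perm.mul_apply, map_inv, Equiv.Perm.inv_eq_iff_eq] at h2
    exact h2
  refine ⟨⟨fun d' => N.mon (s d') e, fun d' => ?_, fun d' => ?_⟩, ?_⟩
  · obtain ⟨w, rfl⟩ := X.exists_mon d d'
    have := key (gX * w)
    rw [map_mul, Equiv.Perm.mul_apply, mon_X, map_mul, Equiv.Perm.mul_apply, mon_X] at this
    rw [this, key]
  · obtain ⟨w, rfl⟩ := X.exists_mon d d'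
    have := key (gY * w)
    rw [map_mul, Equiv.Perm.mul_apply, mon_Y, map_mul, Equiv.Perm.mul_apply, mon_Y] at this
    rw [this, key]
  · simpa using key 1

theorem Hom.surjective {X N : OMap} (f : Hom X N) : Function.Surjective f.toFun := by
  intro e
  obtain ⟨d⟩ := X.nonempty
  obtain ⟨w, hw⟩ := N.exists_mon (f.toFun d) e
  exact ⟨X.mon w d, by rw [f.map_mon, hw]⟩

theorem Hom.ext_of_apply {X N : OMap} {f g : Hom X N} {d : X.D} (h : f.toFun d = g.toFun d)
    (e : X.D) : f.toFun e = g.toFun e := by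
  obtain ⟨w, rfl⟩ := X.exists_mon d e
  rw [f.map_mon, g.map_mon, h]

/-! ### Counting cycles -/

theorem minimalPeriod_pos_of_perm {D : Type} [Finite D] (g : Equiv.Perm D) (d : D) :
    0 < Function.minimalPeriod g d :=
  Function.minimalPeriod_pos_of_mem_periodicPts
    (Function.Injective.mem_periodicPts g.injective d)

/-- A base point in each cycle identifies the darts with pairs (cycle, residue modulo the common
length). -/
theorem numCycles_mul {D : Type} [Finite D] (g : Equiv.Perm D) (l : ℕ)
    (h : ∀ d, Function.minimalPeriod g d = l) : numCycles g * l = Nat.card D := by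
  classical
  let s := Equiv.Perm.SameCycle.setoid g
  have e : D ≃ Quotient s × Fin l := by
    refine (Equiv.sigmaFiberEquiv (Quotient.mk s)).symm.trans
      ((Equiv.sigmaCongrRight fun q => ?_).trans (Equiv.sigmaEquivProd _ _))
    refine (Equiv.ofBijective (fun i : Fin l => (⟨(g ^ (i : ℕ)) q.out, ?_⟩ :
      {d // Quotient.mk s d = q})) ⟨?_, ?_⟩).symm
    · rw [← q.out_eq]
      apply Quotient.sound
      rw [q.out_eq]
      exact ⟨-(i : ℤ), by simp⟩
    · intro i j hij
      have hij' := congrArg Subtype.val hij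
      simp only [← Equiv.Perm.iterate_eq_pow] at hij'
      apply Fin.ext
      exact Function.iterate_injOn_Iio_minimalPeriod (f := g) (x := q.out)
        (by simp [h]) (by simp [h]) hij'
    · rintro ⟨d, hd⟩
      have h1 : g.SameCycle q.out d := by
        have : Quotient.mk s q.out = Quotient.mk s d := by rw [q.out_eq, hd]
        exact Quotient.exact this
      obtain ⟨i, hi⟩ := h1.exists_nat_pow_eq
      have hl : 0 < l := h d ▸ minimalPeriod_pos_of_perm g d
      refine ⟨⟨i % l, Nat.mod_lt _ hl⟩, Subtype.ext ?_⟩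
      change (g ^ (i % l)) q.out = d
      rw [← Equiv.Perm.iterate_eq_pow, ← h q.out, Function.iterate_mod_minimalPeriod_eq,
        Equiv.Perm.iterate_eq_pow, hi]
  rw [Nat.card_congr e, Nat.card_prod, Nat.card_fin]
  rfl

theorem minimalPeriod_y (M : OMap) (d : M.D) : Function.minimalPeriod M.y d = 2 := by
  have h : Function.IsPeriodicPt M.y 2 d := M.y_invol d
  have h1 := (Nat.dvd_prime Nat.prime_two).1 h.minimalPeriod_dvd
  rcases h1 with h1 | h1
  · rw [Function.minimalPeriod_eq_one_iff_isFixedPt] at h1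
    exact absurd h1 (M.y_free d)
  · exact h1

theorem numEdges_mul (M : OMap) : M.numEdges * 2 = Nat.card M.D :=
  numCycles_mul M.y 2 M.minimalPeriod_y

namespace HasType

variable {M : OMap} {n m : ℕ} (h : M.HasType n m)

include h

theorem numFaces_mul : M.numFaces * n = Nat.card M.D := numCycles_mul _ _ fun d => (h d).1
theorem numVertices_mul : M.numVertices * m = Nat.card M.D := numCycles_mul _ _ fun d => (h d).2

theorem n_pos : 0 < n := by
  obtain ⟨d⟩ := M.nonempty
  exact (h d).1 ▸ minimalPeriod_pos_of_perm _ d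

theorem m_pos : 0 < m := by
  obtain ⟨d⟩ := M.nonempty
  exact (h d).2 ▸ minimalPeriod_pos_of_perm _ d

theorem z_pow : M.z ^ n = 1 := by
  ext d
  rw [← Equiv.Perm.iterate_eq_pow, ← (h d).1, Function.iterate_minimalPeriod]; rfl

theorem x_pow : M.x ^ m = 1 := by
  ext d
  rw [← Equiv.Perm.iterate_eq_pow, ← (h d).2, Function.iterate_minimalPeriod]; rfl

theorem euler_char : ((M.numVertices : ℚ) - M.numEdges + M.numFaces) =
    Nat.card M.D * (1 / m - 1 / 2 + 1 / n) := by
  have h1 := h.numFaces_mul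
  have h2 := h.numVertices_mul
  have h3 := M.numEdges_mul
  have hn : (n : ℚ) ≠ 0 := by exact_mod_cast h.n_pos.ne'
  have hm : (m : ℚ) ≠ 0 := by exact_mod_cast h.m_pos.ne'
  rw [mul_add, mul_sub]
  congr 1
  · congr 1
    · rw [← h2]; push_cast; field_simp
    · rw [← h3]; push_cast; field_simp
  · rw [← h1]; push_cast; field_simp

end HasType

theorem y_mul_y (M : OMap) : M.y * M.y = 1 := by ext d; simp [M.y_invol]
theorem y_inv (M : OMap) : M.y⁻¹ = M.y := inv_eq_of_mul_eq_one_left M.y_mul_y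
theorem y_mul_z (M : OMap) : M.y * M.z = M.x⁻¹ := by
  rw [z, mul_inv_rev, ← mul_assoc, y_inv, y_mul_y, one_mul]
theorem z_mul_x (M : OMap) : M.z * M.x = M.y := by
  rw [z, mul_inv_rev, inv_mul_cancel_right, y_inv]
theorem x_eq (M : OMap) : M.x = M.z⁻¹ * M.y := by rw [← z_mul_x, inv_mul_cancel_left]

theorem aut_z {M : OMap} {a : Equiv.Perm M.D} (ha : a ∈ M.aut) (d : M.D) :
    a (M.z d) = M.z (a d) := by rw [← mon_Z, aut_mon ha]

theorem card_aut {M : OMap} (hM : M.OrientablyRegular) : Nat.card M.aut = Nat.card M.D := by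
  obtain ⟨d⟩ := M.nonempty
  refine Nat.card_congr (Equiv.ofBijective (fun a : M.aut => a.1 d) ⟨?_, ?_⟩)
  · intro a b h
    exact Subtype.ext (aut_eq_of_apply_eq a.2 b.2 h)
  · intro e
    obtain ⟨a, ha, h⟩ := hM d e
    exact ⟨⟨a, ha⟩, h⟩

/-- Iterating a bijection: induction over the darts by steps along `y` and `z`. -/
theorem dart_induction (M : OMap) {q : M.D → Prop} (d₀ : M.D) (h0 : q d₀)
    (hy : ∀ d, q d ↔ q (M.y d)) (hz : ∀ d, q d ↔ q (M.z d)) (d : M.D) : q d := by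
  -- Since z x = y, invariance under y and z implies invariance under x, and hence under all words.
  have hx : ∀ d, q d ↔ q (M.x d) := by
    intro d
    rw [hz (M.x d), ← Equiv.Perm.mul_apply, z_mul_x, ← hy]
  have key : ∀ (w : FreeGroup Bool) d, q d ↔ q (M.mon w d) := by
    intro w
    induction w using FreeGroup.induction_on with
    | C1 => simp
    | of b => cases b <;> simp only [mon_X, mon_Y] <;> assumption
    | inv_of b ih =>
      intro d
      rw [ih ((M.mon (FreeGroup.of b)⁻¹) d), map_inv, perm_apply_inv]
    | mul a b iha ihb =>
      intro d
      rw [map_mul, Equiv.Perm.mul_apply, ← iha, ← ihb]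
  obtain ⟨w, rfl⟩ := M.exists_mon d₀ d
  exact (key w _).1 h0

end

end OMap

end

/-! ### Voltage assignments, face sums and Euler's formula. -/

section

namespace OMap

noncomputable section

variable (k : Type) [Field k]

/-- The functions constant on the cycles of a permutation. -/
def fixSub {D : Type} (g : Equiv.Perm D) : Submodule k (D → k) where
  carrier := {f | ∀ d, f (g d) = f d}
  add_mem' := fun ha hb d => by simp [ha d, hb d]
  zero_mem' := fun _ => rfl
  smul_mem' := fun c f hf d => by simp [hf d]

theorem fixSub_zpow {D : Type} {g : Equiv.Perm D} {f : D → k} (hf : f ∈ fixSub k g) (i : ℤ)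
    (d : D) : f ((g ^ i) d) = f d := by
  induction i with
  | zero => simp
  | succ i ih => rw [add_comm, zpow_add, zpow_one, Equiv.Perm.mul_apply, hf, ih]
  | pred i ih =>
    rw [← ih, ← hf ((g ^ (-(i : ℤ) - 1)) d), ← Equiv.Perm.mul_apply, ← zpow_one_add]
    congr 3; ring

theorem fixSub_pow {D : Type} {g : Equiv.Perm D} {f : D → k} (hf : f ∈ fixSub k g) (i : ℕ)
    (d : D) : f ((g ^ i) d) = f d := by simpa using fixSub_zpow k hf i d

theorem finrank_fixSub {D : Type} [Finite D] (g : Equiv.Perm D) :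
    Module.finrank k (fixSub k g) = numCycles g := by
  classical
  have : Fintype (Quotient (Equiv.Perm.SameCycle.setoid g)) := Fintype.ofFinite _
  let e : (Quotient (Equiv.Perm.SameCycle.setoid g) → k) ≃ₗ[k] fixSub k g :=
    { toFun := fun u => ⟨fun d => u (Quotient.mk _ d), fun d => by
        
        have h : g.SameCycle (g d) d := ⟨-1, by simp⟩
        exact congrArg u (Quotient.sound h)⟩
      map_add' := fun _ _ => rfl
      map_smul' := fun _ _ => rfl
      invFun := fun f q => Quotient.lift f.1 (by
        rintro a b ⟨i, rfl⟩
        exact (fixSub_zpow k f.2 i a).symm) q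
      left_inv := fun u => by
        funext q
        induction q using Quotient.inductionOn
        rfl
      right_inv := fun f => rfl }
  rw [← e.finrank_eq, Module.finrank_pi, numCycles, Nat.card_eq_fintype_card]

variable (M : OMap)

/-- Antisymmetric functions on the darts: voltage assignments on the edges. -/
def skew : Submodule k (M.D → k) where
  carrier := {f | ∀ d, f (M.y d) = -f d}
  add_mem' := fun ha hb d => by simp [ha d, hb d, add_comm]
  zero_mem' := fun _ => by simp
  smul_mem' := fun c f hf d => by simp [hf d]

/-- `f ↦ f - f ∘ y`. -/
def coboundary : (M.D → k) →ₗ[k] (M.D → k) where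
  toFun f d := f d - f (M.y d)
  map_add' f g := by funext d; simp; ring
  map_smul' c f := by funext d; simp; ring

/-- The sum of a function over the cycles of `z`, all of which have length dividing `n`. -/
def faceSum (n : ℕ) : (M.D → k) →ₗ[k] (M.D → k) where
  toFun f d := ∑ i ∈ Finset.range n, f ((M.z ^ i) d)
  map_add' f g := by funext d; simp [Finset.sum_add_distrib]
  map_smul' c f := by funext d; simp [Finset.mul_sum]

/-- The sum of all values. -/
def total : (M.D → k) →ₗ[k] k where
  toFun f := ∑ d, f d
  map_add' f g := by simp [Finset.sum_add_distrib]
  map_smul' c f := by simp [Finset.mul_sum]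

/-- The functions on the faces with sum zero, as functions on the darts. -/
def faceSpace : Submodule k (M.D → k) := fixSub k M.z ⊓ LinearMap.ker (total k M)

variable {k M}

theorem coboundary_mem_skew (f : M.D → k) : coboundary k M f ∈ skew k M := by
  intro d; simp [coboundary, M.y_invol]

theorem ker_coboundary : LinearMap.ker (coboundary k M) = fixSub k M.y := by
  ext f
  rw [LinearMap.mem_ker, funext_iff]
  simp only [coboundary, LinearMap.coe_mk, AddHom.coe_mk, Pi.zero_apply, sub_eq_zero]
  exact ⟨fun h d => (h d).symm, fun h d => (h d).symm⟩

/-- Rank and nullity of f ↦ f - f ∘ y: a skew v is the image of v/2, the kernel has dimension E, and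
there are 2E darts. -/
theorem finrank_skew (h2 : (2 : k) ≠ 0) : Module.finrank k (skew k M) = M.numEdges := by
  have h1 := (coboundary k M).finrank_range_add_finrank_ker
  rw [ker_coboundary, finrank_fixSub] at h1
  have h3 : LinearMap.range (coboundary k M) = skew k M := by
    apply le_antisymm
    · rintro _ ⟨f, rfl⟩; exact coboundary_mem_skew f
    · intro v hv
      refine ⟨(2 : k)⁻¹ • v, ?_⟩
      funext d
      simp only [coboundary, LinearMap.coe_mk, AddHom.coe_mk, Pi.smul_apply, smul_eq_mul, hv d]
      field_simp; ring
  rw [h3, Module.finrank_pi, ← Nat.card_eq_fintype_card, ← M.numEdges_mul] at h1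
  change _ + M.numEdges = _ at h1
  omega

theorem fixSub_const {f : M.D → k} (hy : f ∈ fixSub k M.y) (hz : f ∈ fixSub k M.z) (d e : M.D) :
    f d = f e :=
  M.dart_induction (q := fun d => f d = f e) e rfl (fun d => by rw [hy d]) (fun d => by rw [hz d]) d

theorem fixSub_z_of_xy {f : M.D → k} (hx : f ∈ fixSub k M.x) (hy : f ∈ fixSub k M.y) :
    f ∈ fixSub k M.z := by
  intro d
  have h1 := hx (M.y (M.z d))
  rw [← Equiv.Perm.mul_apply M.y, y_mul_z, perm_apply_inv] at h1
  rw [← hy (M.z d), ← Equiv.Perm.mul_apply, y_mul_z, h1]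

/-- The face boundary of the coboundary of a function on the vertices vanishes. -/
theorem faceSum_coboundary {n : ℕ} (hz : M.z ^ n = 1) {u : M.D → k} (hu : u ∈ fixSub k M.x) :
    faceSum k M n (coboundary k M u) = 0 := by
  funext d
  have h1 : ∀ i, u (M.y ((M.z ^ (i + 1)) d)) = u ((M.z ^ i) d) := by
    intro i
    rw [pow_succ', Equiv.Perm.mul_apply, ← Equiv.Perm.mul_apply M.y, y_mul_z,
      ← hu, perm_apply_inv]
  change ∑ i ∈ Finset.range n, (u ((M.z ^ i) d) - u (M.y ((M.z ^ i) d))) = 0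
  rw [Finset.sum_sub_distrib, sub_eq_zero]
  rcases n with _ | n
  · simp
  · rw [Finset.sum_range_succ' (fun i => u (M.y ((M.z ^ i) d))), Finset.sum_range_succ]
    congr 1
    · exact Finset.sum_congr rfl fun i _ => (h1 i).symm
    · rw [← h1 n, hz]; simp

theorem faceSum_mem_fixSub {n : ℕ} (hz : M.z ^ n = 1) (f : M.D → k) :
    faceSum k M n f ∈ fixSub k M.z := by
  intro d
  change ∑ i ∈ Finset.range n, f ((M.z ^ i) (M.z d)) = ∑ i ∈ Finset.range n, f ((M.z ^ i) d)
  have h1 : ∀ i, f ((M.z ^ i) (M.z d)) = f ((M.z ^ (i + 1)) d) := fun i => by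
    rw [pow_succ, Equiv.Perm.mul_apply]
  simp_rw [h1]
  rcases n with _ | n
  · simp
  · rw [Finset.sum_range_succ, Finset.sum_range_succ' (fun i => f ((M.z ^ i) d)), hz]
    simp

theorem faceSum_of_mem_fixSub (n : ℕ) {f : M.D → k} (hf : f ∈ fixSub k M.z) :
    faceSum k M n f = (n : k) • f := by
  funext d
  change ∑ i ∈ Finset.range n, f ((M.z ^ i) d) = _
  simp [fixSub_pow k hf]

theorem total_comp (g : Equiv.Perm M.D) (f : M.D → k) :
    total k M (fun d => f (g d)) = total k M f := Equiv.sum_comp g f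

theorem total_faceSum (n : ℕ) (f : M.D → k) :
    total k M (faceSum k M n f) = n * total k M f := by
  change ∑ d, ∑ i ∈ Finset.range n, f ((M.z ^ i) d) = _
  rw [Finset.sum_comm]
  have : ∀ i ∈ Finset.range n, ∑ d, f ((M.z ^ i) d) = total k M f := fun i _ => total_comp _ f
  rw [Finset.sum_congr rfl this]
  simp

theorem total_skew (h2 : (2 : k) ≠ 0) {f : M.D → k} (hf : f ∈ skew k M) : total k M f = 0 := by
  have h1 := total_comp M.y f
  have h3 : (fun d => f (M.y d)) = -f := funext hf
  rw [h3, map_neg] at h1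
  have : 2 * total k M f = 0 := by linear_combination -h1
  simpa [h2] using this

theorem faceSum_skew_mem {n : ℕ} (hz : M.z ^ n = 1) (h2 : (2 : k) ≠ 0) {f : M.D → k}
    (hf : f ∈ skew k M) : faceSum k M n f ∈ faceSpace k M :=
  ⟨faceSum_mem_fixSub hz f, by
    change total k M _ = 0
    rw [total_faceSum, total_skew h2 hf, mul_zero]⟩

/-- Pushing a unit from one side of an edge to the other is a skew function whose face sum is a
difference of two face indicators. The map is connected, so these differences span the functions of
sum zero. -/
theorem map_faceSum_skew {n : ℕ} (hz : M.z ^ n = 1) (h2 : (2 : k) ≠ 0) (hn : (n : k) ≠ 0) :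
    (skew k M).map (faceSum k M n) = faceSpace k M := by
  apply le_antisymm
  · rintro _ ⟨v, hv, rfl⟩; exact faceSum_skew_mem hz h2 hv
  · intro f hf
    -- Here `c d` is the indicator of the face of d, with a multiplicity if the length of that face
    -- is a proper divisor of n.
    let c : M.D → (M.D → k) := fun d => faceSum k M n (Pi.single d 1)
    have hcz : ∀ d, c (M.z d) = c d := by
      intro d
      have h1 : ∀ e, faceSum k M n (Pi.single (M.z d) 1) (M.z e) =
          faceSum k M n (Pi.single d 1) e := by
        intro e
        change ∑ i ∈ Finset.range n, (Pi.single (M.z d) 1 : M.D → k) ((M.z ^ i) (M.z e)) =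
          ∑ i ∈ Finset.range n, (Pi.single d 1 : M.D → k) ((M.z ^ i) e)
        refine Finset.sum_congr rfl fun i _ => ?_
        rw [← Equiv.Perm.mul_apply, ← pow_succ, pow_succ', Equiv.Perm.mul_apply]
        simp [Pi.single_apply]
      funext e
      exact (faceSum_mem_fixSub hz (Pi.single (M.z d) 1) e).symm.trans (h1 e)
    obtain ⟨d₀⟩ := M.nonempty
    have hc : ∀ d, c d - c d₀ ∈ (skew k M).map (faceSum k M n) := by
      refine M.dart_induction d₀ (by simp) (fun d => ?_) (fun d => by rw [hcz])
      -- The skew function with value 1 at d and -1 at the reversed dart has this face sum.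
      have h1 : c d - c (M.y d) ∈ (skew k M).map (faceSum k M n) := by
        refine ⟨coboundary k M (Pi.single d 1), coboundary_mem_skew _, ?_⟩
        simp only [c]
        rw [← map_sub]
        congr 1
        funext e
        simp only [coboundary, LinearMap.coe_mk, AddHom.coe_mk, Pi.sub_apply, Pi.single_apply]
        congr 2
        rw [← M.y.injective.eq_iff, M.y_invol]
      constructor
      · intro h; have := sub_mem h h1; simpa using this
      · intro h; have := add_mem h h1; simpa using this
    -- The subtracted multiples of `c d₀` cancel because f has sum zero.
    have hf1 : (n : k) • f = ∑ d, f d • (c d - c d₀) := by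
      rw [← faceSum_of_mem_fixSub n hf.1]
      have h3 : f = ∑ d, f d • (Pi.single d (1 : k) : M.D → k) := by
        funext e; simp [Finset.sum_apply, Pi.single_apply]
      simp_rw [smul_sub]
      rw [Finset.sum_sub_distrib, ← Finset.sum_smul]
      have h4 : ∑ d, f d = 0 := hf.2
      rw [h4, zero_smul, sub_zero]
      conv_lhs => rw [h3]
      rw [map_sum]
      exact Finset.sum_congr rfl fun d _ => map_smul _ _ _
    have h5 : (n : k) • f ∈ (skew k M).map (faceSum k M n) := by
      rw [hf1]; exact Submodule.sum_mem _ fun d _ => Submodule.smul_mem _ _ (hc d)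
    simpa [hn] using (Submodule.smul_mem_iff _ hn).1 h5

/-- Summation is onto already on constant functions, as the number of darts is invertible; so it
cuts the dimension F of the face functions by one. -/
theorem finrank_faceSpace (hD : (Nat.card M.D : k) ≠ 0) :
    Module.finrank k (faceSpace k M) + 1 = M.numFaces := by
  have h1 := ((total k M).domRestrict (fixSub k M.z)).finrank_range_add_finrank_ker
  have h2 : LinearMap.range ((total k M).domRestrict (fixSub k M.z)) = ⊤ := by
    rw [LinearMap.range_eq_top]
    intro c
    refine ⟨⟨fun _ => c / Nat.card M.D, fun _ => rfl⟩, ?_⟩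
    change ∑ d : M.D, c / (Nat.card M.D : k) = c
    rw [Finset.sum_const, Finset.card_univ, ← Nat.card_eq_fintype_card, nsmul_eq_mul]
    field_simp
  have h3 : (LinearMap.ker ((total k M).domRestrict (fixSub k M.z))).map (fixSub k M.z).subtype =
      faceSpace k M := by
    rw [LinearMap.ker_domRestrict, Submodule.map_comap_subtype]; rfl
  have h4 := LinearEquiv.finrank_eq (Submodule.equivSubtypeMap (fixSub k M.z)
    (LinearMap.ker ((total k M).domRestrict (fixSub k M.z))))
  rw [h3] at h4
  rw [h2, finrank_top, Module.finrank_self, finrank_fixSub, h4] at h1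
  change _ = M.numFaces at h1
  omega

/-- The coboundaries of functions on the vertices. -/
def coboundaries (k : Type) [Field k] (M : OMap) : Submodule k (M.D → k) :=
  (fixSub k M.x).map (coboundary k M)

/-- A vertex function with zero coboundary is invariant under x and y, hence constant by
connectedness. -/
theorem finrank_coboundaries : Module.finrank k (coboundaries k M) + 1 = M.numVertices := by
  have h1 := ((coboundary k M).domRestrict (fixSub k M.x)).finrank_range_add_finrank_ker
  have h2 : Module.finrank k (LinearMap.ker ((coboundary k M).domRestrict (fixSub k M.x))) = 1 := by
    obtain ⟨d₀⟩ := M.nonempty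
    have hc : (⟨fun _ => 1, fun _ => rfl⟩ : fixSub k M.x) ∈
        LinearMap.ker ((coboundary k M).domRestrict (fixSub k M.x)) := by
      rw [LinearMap.mem_ker]; funext d; simp [coboundary]
    refine finrank_eq_one
      (⟨_, hc⟩ : LinearMap.ker ((coboundary k M).domRestrict (fixSub k M.x))) ?_ ?_
    · intro h
      have := congrFun (congrArg (fun w => w.1.1) h) d₀
      simp at this
    · rintro ⟨⟨f, hf⟩, hf'⟩
      refine ⟨f d₀, ?_⟩
      have hy : f ∈ fixSub k M.y := by rw [← ker_coboundary]; exact hf'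
      ext d
      simpa using fixSub_const hy (fixSub_z_of_xy hf hy) d₀ d
  rw [LinearMap.range_domRestrict, finrank_fixSub, h2] at h1
  exact h1

theorem coboundaries_le {n : ℕ} (hz : M.z ^ n = 1) :
    coboundaries k M ≤ skew k M ⊓ LinearMap.ker (faceSum k M n) := by
  rintro _ ⟨u, hu, rfl⟩
  exact ⟨coboundary_mem_skew u, faceSum_coboundary hz hu⟩

theorem finrank_skew_inf_ker {n : ℕ} (hz : M.z ^ n = 1) (h2 : (2 : k) ≠ 0) (hn : (n : k) ≠ 0)
    (hD : (Nat.card M.D : k) ≠ 0) :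
    Module.finrank k ↥(skew k M ⊓ LinearMap.ker (faceSum k M n)) + M.numFaces =
      M.numEdges + 1 := by
  have h1 := ((faceSum k M n).domRestrict (skew k M)).finrank_range_add_finrank_ker
  have h3 : (LinearMap.ker ((faceSum k M n).domRestrict (skew k M))).map (skew k M).subtype =
      skew k M ⊓ LinearMap.ker (faceSum k M n) := by
    rw [LinearMap.ker_domRestrict, Submodule.map_comap_subtype]
  rw [LinearMap.range_domRestrict, map_faceSum_skew hz h2 hn, finrank_skew h2] at h1
  have h4 := finrank_faceSpace hD
  have h5 := LinearEquiv.finrank_eq (Submodule.equivSubtypeMap (skew k M)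
    (LinearMap.ker ((faceSum k M n).domRestrict (skew k M))))
  rw [h3] at h5
  omega

theorem HasType.natCast_ne_zero {n m : ℕ} (h : M.HasType n m) (hD : (Nat.card M.D : k) ≠ 0) :
    (2 : k) ≠ 0 ∧ (n : k) ≠ 0 ∧ (m : k) ≠ 0 := by
  refine ⟨fun h2 => hD ?_, fun h2 => hD ?_, fun h2 => hD ?_⟩
  · rw [← M.numEdges_mul]; push_cast; rw [h2, mul_zero]
  · rw [← h.numFaces_mul]; push_cast; rw [h2, mul_zero]
  · rw [← h.numVertices_mul]; push_cast; rw [h2, mul_zero]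

/-- Euler's inequality: the genus is not negative. -/
theorem HasType.euler_le {n m : ℕ} (h : M.HasType n m) :
    M.numVertices + M.numFaces ≤ M.numEdges + 2 := by
  have hD : (Nat.card M.D : ℚ) ≠ 0 := by exact_mod_cast Nat.card_pos.ne'
  obtain ⟨h2, hn, -⟩ := h.natCast_ne_zero hD
  have h1 := finrank_skew_inf_ker h.z_pow h2 hn hD
  -- The coboundaries have dimension V - 1 and lie in a space of dimension E - F + 1.
  have h3 := Submodule.finrank_mono (coboundaries_le (k := ℚ) h.z_pow)
  have h4 := finrank_coboundaries (k := ℚ) (M := M)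
  omega

theorem numVertices_add_numFaces (hg : M.genus = 0) :
    M.numVertices + M.numFaces = M.numEdges + 2 := by
  have h1 : (M.numVertices : ℚ) + M.numFaces = M.numEdges + 2 := by
    rw [genus] at hg; linarith
  exact_mod_cast h1

/-- On the sphere, a voltage assignment with trivial face sums is a coboundary. -/
theorem HasType.skew_inf_ker {n m : ℕ} (h : M.HasType n m) (hg : M.genus = 0)
    (hD : (Nat.card M.D : k) ≠ 0) :
    skew k M ⊓ LinearMap.ker (faceSum k M n) = coboundaries k M := by
  obtain ⟨h2, hn, -⟩ := h.natCast_ne_zero hD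
  have h1 := finrank_skew_inf_ker h.z_pow h2 hn hD
  have h4 := finrank_coboundaries (k := k) (M := M)
  -- Genus 0 makes V - 1 equal to E - F + 1, so the inclusion of the coboundaries is an equality.
  have h5 := numVertices_add_numFaces hg
  exact (Submodule.eq_of_le_of_finrank_eq (coboundaries_le h.z_pow) (by omega)).symm

end

end OMap

end

/-! ### Common coverings, uniqueness of spherical maps and reflections. -/

section

namespace OMap

noncomputable section

theorem range_lift_cond {G : Type} [Group G] (x y : G) :
    (FreeGroup.lift fun b => cond b x y : FreeGroup Bool →* G).range =
      Subgroup.closure ({x, y} : Set G) := by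
  rw [FreeGroup.range_lift_eq_closure]
  congr 1
  ext g
  simp only [Set.mem_range, Bool.exists_bool, cond_false, cond_true, Set.mem_insert_iff,
    Set.mem_singleton_iff]
  tauto

/-- A map is given by a transitive action of the free group in which `Y` is a fixed-point-free
involution. -/
def ofAction (D : Type) [Finite D] [Nonempty D] (ρ : FreeGroup Bool →* Equiv.Perm D)
    (hy : ∀ d, ρ gY (ρ gY d) = d) (hf : ∀ d, ρ gY d ≠ d) (hc : ∀ d e, ∃ w, ρ w d = e) : OMap where
  D := D
  finite := inferInstance
  nonempty := inferInstance
  x := ρ gX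
  y := ρ gY
  y_invol := hy
  y_free := hf
  connected := by
    intro d e
    obtain ⟨w, hw⟩ := hc d e
    refine ⟨ρ w, ?_, hw⟩
    rw [← range_lift_cond]
    refine ⟨w, ?_⟩
    congr 1
    ext b
    cases b <;> simp

theorem mon_ofAction (D : Type) [Finite D] [Nonempty D] (ρ : FreeGroup Bool →* Equiv.Perm D)
    (hy : ∀ d, ρ gY (ρ gY d) = d) (hf : ∀ d, ρ gY d ≠ d) (hc : ∀ d e, ∃ w, ρ w d = e) :
    (ofAction D ρ hy hf hc).mon = ρ := by
  refine FreeGroup.ext_hom _ _ fun b => ?_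
  cases b
  · exact mon_Y _
  · exact mon_X _

/-- The diagonal action on pairs of darts, restricted to an orbit. -/
def orbitAction (M M' : OMap) (q₀ : M.D × M'.D) :
    FreeGroup Bool →* Equiv.Perm {q : M.D × M'.D // ∃ w, (M.mon w q₀.1, M'.mon w q₀.2) = q} where
  toFun w :=
    { toFun := fun q => ⟨(M.mon w q.1.1, M'.mon w q.1.2), by
        obtain ⟨_, v, rfl⟩ := q
        exact ⟨w * v, by simp⟩⟩
      invFun := fun q => ⟨(M.mon w⁻¹ q.1.1, M'.mon w⁻¹ q.1.2), by
        obtain ⟨_, v, rfl⟩ := q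
        exact ⟨w⁻¹ * v, by simp⟩⟩
      left_inv := fun q => by simp
      right_inv := fun q => by simp }
  map_one' := by ext q <;> simp
  map_mul' v w := by ext q <;> simp

/-- The smallest common covering of two maps, with base darts. -/
def join (M M' : OMap) (q₀ : M.D × M'.D) : OMap :=
  have : Nonempty {q : M.D × M'.D // ∃ w, (M.mon w q₀.1, M'.mon w q₀.2) = q} :=
    ⟨⟨q₀, 1, by simp⟩⟩
  ofAction _ (orbitAction M M' q₀)
    (fun q => by
      apply Subtype.ext
      simp [orbitAction, M.y_invol, M'.y_invol])
    (fun q h => by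
      have := congrArg (fun q => q.1.1) h
      simp only [orbitAction, MonoidHom.coe_mk, OneHom.coe_mk, Equiv.coe_fn_mk, mon_Y] at this
      exact M.y_free _ this)
    (by
      rintro ⟨_, v, rfl⟩ ⟨_, w, rfl⟩
      exact ⟨w * v⁻¹, by simp [orbitAction]⟩)

/-- The base dart of the join. -/
def joinBase (M M' : OMap) (q₀ : M.D × M'.D) : (join M M' q₀).D := ⟨q₀, 1, by simp⟩

def joinFst (M M' : OMap) (q₀ : M.D × M'.D) : Hom (join M M' q₀) M where
  toFun q := q.1.1
  map_x q := by
    change M.mon gX _ = _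
    rw [mon_X]
  map_y q := by
    change M.mon gY _ = _
    rw [mon_Y]

def joinSnd (M M' : OMap) (q₀ : M.D × M'.D) : Hom (join M M' q₀) M' where
  toFun q := q.1.2
  map_x q := by
    change M'.mon gX _ = _
    rw [mon_X]
  map_y q := by
    change M'.mon gY _ = _
    rw [mon_Y]

theorem join_z_pow (M M' : OMap) (q₀ : M.D × M'.D) (q : (join M M' q₀).D) (i : ℕ) (w) :
    ((((join M M' q₀).mon w)^[i] q).1) = ((M.mon w)^[i] q.1.1, (M'.mon w)^[i] q.1.2) := by
  rw [Equiv.Perm.iterate_eq_pow, Equiv.Perm.iterate_eq_pow, Equiv.Perm.iterate_eq_pow, ← map_pow,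
    ← map_pow, ← map_pow]
  exact Prod.ext ((joinFst M M' q₀).map_mon _ q) ((joinSnd M M' q₀).map_mon _ q)

theorem join_minimalPeriod (M M' : OMap) (q₀ : M.D × M'.D) (q : (join M M' q₀).D) (w) (l : ℕ)
    (h : Function.minimalPeriod (M.mon w) q.1.1 = l)
    (h' : Function.minimalPeriod (M'.mon w) q.1.2 = l) :
    Function.minimalPeriod ((join M M' q₀).mon w) q = l := by
  rw [← h, Function.minimalPeriod_eq_minimalPeriod_iff]
  intro i
  have h1 : Function.IsPeriodicPt (M.mon w) i q.1.1 ↔ Function.IsPeriodicPt (M'.mon w) i q.1.2 :=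
    Function.minimalPeriod_eq_minimalPeriod_iff.1 (h.trans h'.symm) i
  have h2 := join_z_pow M M' q₀ q i w
  constructor
  · intro h3
    have h3' : ((join M M' q₀).mon w)^[i] q = q := h3
    rw [h3'] at h2
    exact (congrArg Prod.fst h2).symm
  · intro h3
    apply Subtype.ext
    rw [h2]
    exact Prod.ext h3 (h1.1 h3)

theorem HasType.join {M M' : OMap} {n m : ℕ} (h : M.HasType n m) (h' : M'.HasType n m)
    (q₀ : M.D × M'.D) : (OMap.join M M' q₀).HasType n m := by
  intro q
  constructor
  · rw [← mon_Z]
    apply join_minimalPeriod <;> rw [mon_Z]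
    · exact (h _).1
    · exact (h' _).1
  · rw [← mon_X]
    apply join_minimalPeriod <;> rw [mon_X]
    · exact (h _).2
    · exact (h' _).2

theorem HasType.card_eq {M : OMap} {n m : ℕ} (h : M.HasType n m) (hg : M.genus = 0) :
    (Nat.card M.D : ℚ) * (1 / m - 1 / 2 + 1 / n) = 2 := by
  rw [← h.euler_char]
  rw [genus] at hg
  linarith

/-- The Euler characteristic is the number of darts times a constant depending only on the type. The
spherical map shows that the constant is positive, and no map has characteristic above 2. This plays
the role of simple connectedness. -/
theorem HasType.card_le {M M' : OMap} {n m : ℕ} (h : M.HasType n m) (hg : M.genus = 0)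
    (h' : M'.HasType n m) : Nat.card M'.D ≤ Nat.card M.D := by
  have h1 := h.card_eq hg
  have h2 : (Nat.card M'.D : ℚ) * (1 / m - 1 / 2 + 1 / n) ≤ 2 := by
    rw [← h'.euler_char]
    have := h'.euler_le
    have h3 : (M'.numVertices : ℚ) + M'.numFaces ≤ M'.numEdges + 2 := by exact_mod_cast this
    linarith
  have hpos : (0 : ℚ) < 1 / m - 1 / 2 + 1 / n := by
    by_contra hneg
    push Not at hneg
    have : (Nat.card M.D : ℚ) * (1 / m - 1 / 2 + 1 / n) ≤ 0 :=
      mul_nonpos_of_nonneg_of_nonpos (by positivity) hneg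
    linarith
  have h4 : (Nat.card M'.D : ℚ) ≤ Nat.card M.D := by
    refine le_of_mul_le_mul_right ?_ hpos
    linarith
  exact_mod_cast h4

theorem Hom.bijective_of_card_le {X N : OMap} (f : Hom X N) (h : Nat.card X.D ≤ Nat.card N.D) :
    Function.Bijective f.toFun := by
  rw [Nat.bijective_iff_surjective_and_card]
  exact ⟨f.surjective, le_antisymm h (Nat.card_le_card_of_surjective _ f.surjective)⟩

/-- A spherical map of type `{n, m}` is unique, even as a map with base dart. -/
theorem exists_iso {M M' : OMap} {n m : ℕ} (h : M.HasType n m) (hg : M.genus = 0)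
    (h' : M'.HasType n m) (hc : Nat.card M.D ≤ Nat.card M'.D) (d : M.D) (d' : M'.D) :
    ∃ f : Hom M M', Function.Bijective f.toFun ∧ f.toFun d = d' := by
  -- The common covering has the same type, so it is no larger than M and its projection to M is
  -- bijective; inverting this projection gives the morphism to M'.
  have hle := h.card_le hg (h.join h' (d, d'))
  have hb := (joinFst M M' (d, d')).bijective_of_card_le hle
  have hex : ∃ f : Hom M M', f.toFun d = d' := by
    apply exists_hom
    intro w hw
    have h1 : (OMap.join M M' (d, d')).mon w (joinBase M M' (d, d')) =
        joinBase M M' (d, d') := by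
      apply hb.1
      rw [Hom.map_mon]
      exact hw
    have h2 := congrArg (joinSnd M M' (d, d')).toFun h1
    rwa [Hom.map_mon] at h2
  obtain ⟨f, hf⟩ := hex
  exact ⟨f, f.bijective_of_card_le hc, hf⟩

/-! ### The mirror image -/

theorem mirror_minimalPeriod_inv {D : Type} (g : Equiv.Perm D) (d : D) :
    Function.minimalPeriod (g⁻¹ : Equiv.Perm D) d = Function.minimalPeriod g d := by
  rw [Function.minimalPeriod_eq_minimalPeriod_iff]
  intro i
  simp only [Function.IsPeriodicPt, Function.IsFixedPt, Equiv.Perm.iterate_eq_pow, inv_pow]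
  rw [Equiv.Perm.inv_eq_iff_eq, eq_comm]

theorem mirror_z (M : OMap) : M.mirror.z = M.y * M.z⁻¹ * M.y⁻¹ := by
  change (M.x⁻¹ * M.y)⁻¹ = M.y * (M.x * M.y)⁻¹⁻¹ * M.y⁻¹
  rw [mul_inv_rev, inv_inv, inv_inv, y_inv]
  rw [mul_assoc, mul_assoc, y_mul_y, mul_one]

theorem minimalPeriod_conj {D : Type} (g h : Equiv.Perm D) (d : D) :
    Function.minimalPeriod (h * g * h⁻¹ : Equiv.Perm D) d = Function.minimalPeriod g (h⁻¹ d) := by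
  rw [Function.minimalPeriod_eq_minimalPeriod_iff]
  intro i
  simp only [Function.IsPeriodicPt, Function.IsFixedPt, Equiv.Perm.iterate_eq_pow, conj_pow]
  rw [Equiv.Perm.mul_apply, Equiv.Perm.mul_apply, ← Equiv.Perm.eq_inv_iff_eq]

theorem HasType.mirror {M : OMap} {n m : ℕ} (h : M.HasType n m) : M.mirror.HasType n m := by
  intro d
  constructor
  · rw [mirror_z]
    exact (minimalPeriod_conj _ _ _).trans ((mirror_minimalPeriod_inv _ _).trans (h _).1)
  · exact (mirror_minimalPeriod_inv _ _).trans (h _).2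

/-- A reflection of a map: it reverses `z` and commutes with `y`. -/
structure Reflection (M : OMap) where
  r : Equiv.Perm M.D
  map_z : ∀ d, r (M.z d) = M.z⁻¹ (r d)
  map_y : ∀ d, r (M.y d) = M.y (r d)

/-- By uniqueness the map is isomorphic to its mirror image, with any prescribed image of d.
Following the isomorphism by y turns inversion of x into inversion of z. -/
theorem exists_reflection {M : OMap} {n m : ℕ} (h : M.HasType n m) (hg : M.genus = 0) (d e : M.D) :
    ∃ s : Reflection M, s.r d = e := by
  obtain ⟨f, hf, hfd⟩ := exists_iso h hg h.mirror le_rfl d (M.y e)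
  let f' : M.D → M.D := f.toFun
  have hx : ∀ d, f' (M.x d) = M.x⁻¹ (f' d) := f.map_x
  have hy : ∀ d, f' (M.y d) = M.y (f' d) := f.map_y
  have hf' : Function.Bijective f' := hf
  refine ⟨⟨(Equiv.ofBijective f' hf').trans M.y, fun d => ?_, fun d => ?_⟩, ?_⟩
  · simp only [Equiv.trans_apply, Equiv.ofBijective_apply]
    have h1 : M.z d = M.y (M.x⁻¹ d) := by
      rw [← y_mul_z, Equiv.Perm.mul_apply, M.y_invol]
    have h2 : f' (M.x⁻¹ d) = M.x (f' d) := by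
      rw [← Equiv.Perm.inv_eq_iff_eq, ← hx, perm_apply_inv]
    rw [h1, hy, M.y_invol, h2, x_eq, Equiv.Perm.mul_apply]
  · simp only [Equiv.trans_apply, Equiv.ofBijective_apply, hy]
  · simp only [Equiv.trans_apply, Equiv.ofBijective_apply]
    change M.y (f.toFun d) = e
    rw [hfd, M.y_invol]

end

end OMap

end

/-! ### Voltages along words as cocycles. -/

section

namespace OMap

noncomputable section

variable {k : Type} [Field k] {M : OMap}

/-- The action of the free group on `M.D × k` in which `Y` adds the voltage `v`. -/
def volt (v : M.D → k) : FreeGroup Bool →* Equiv.Perm (M.D × k) :=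
  FreeGroup.lift fun b => cond b
    { toFun := fun q => (M.x q.1, q.2)
      invFun := fun q => (M.x⁻¹ q.1, q.2)
      left_inv := fun q => by simp
      right_inv := fun q => by simp }
    { toFun := fun q => (M.y q.1, q.2 + v q.1)
      invFun := fun q => (M.y⁻¹ q.1, q.2 - v (M.y⁻¹ q.1))
      left_inv := fun q => by simp
      right_inv := fun q => by simp }

/-- The total voltage of the path that starts at the dart `d` and follows the word `w`. -/
def tau (v : M.D → k) (w : FreeGroup Bool) (d : M.D) : k := (volt v w (d, 0)).2

theorem volt_apply (v : M.D → k) (w : FreeGroup Bool) (d : M.D) (a : k) :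
    volt v w (d, a) = (M.mon w d, a + tau v w d) := by
  have h : ∀ w : FreeGroup Bool, ∀ d, ∃ t, ∀ a, volt v w (d, a) = (M.mon w d, a + t) := by
    intro w
    induction w using FreeGroup.induction_on with
    | C1 => exact fun d => ⟨0, fun a => by simp⟩
    | of b =>
      intro d
      cases b
      · exact ⟨v d, fun a => by simp [volt]⟩
      · exact ⟨0, fun a => by simp [volt]⟩
    | inv_of b ih =>
      intro d
      obtain ⟨t, ht⟩ := ih (M.mon (FreeGroup.of b)⁻¹ d)
      refine ⟨-t, fun a => ?_⟩
      rw [map_inv (volt v), Equiv.Perm.inv_eq_iff_eq, ht]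
      simp
    | mul a b iha ihb =>
      intro d
      obtain ⟨t, ht⟩ := ihb d
      obtain ⟨t', ht'⟩ := iha (M.mon b d)
      exact ⟨t + t', fun a => by simp [ht, ht', add_assoc]⟩
  obtain ⟨t, ht⟩ := h w d
  rw [tau, ht, ht]
  simp

theorem tau_mul (v : M.D → k) (w w' : FreeGroup Bool) (d : M.D) :
    tau v (w * w') d = tau v w (M.mon w' d) + tau v w' d := by
  have h := volt_apply v (w * w') d 0
  rw [map_mul, Equiv.Perm.mul_apply, volt_apply, volt_apply] at h
  have := congrArg Prod.snd h
  simp only [zero_add] at this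
  rw [← this, add_comm]

@[simp] theorem tau_one (v : M.D → k) (d : M.D) : tau v 1 d = 0 := by simp [tau]
@[simp] theorem tau_X (v : M.D → k) (d : M.D) : tau v gX d = 0 := by simp [tau, volt]
@[simp] theorem tau_Y (v : M.D → k) (d : M.D) : tau v gY d = v d := by simp [tau, volt]

theorem tau_inv (v : M.D → k) (w : FreeGroup Bool) (d : M.D) :
    tau v w⁻¹ d = -tau v w (M.mon w⁻¹ d) := by
  have h := tau_mul v w w⁻¹ d
  rw [mul_inv_cancel, tau_one] at h
  linear_combination -h

/-- A cocycle is determined by its values at the generators. -/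
theorem eq_tau {v : M.D → k} {c : FreeGroup Bool → M.D → k}
    (hc : ∀ w w' d, c (w * w') d = c w (M.mon w' d) + c w' d) (hX : ∀ d, c gX d = 0)
    (hY : ∀ d, c gY d = v d) (w : FreeGroup Bool) (d : M.D) : c w d = tau v w d := by
  have h1 : ∀ d, c 1 d = 0 := by
    intro d
    have h := hc 1 1 d
    rw [one_mul, map_one, Equiv.Perm.one_apply] at h
    linear_combination -h
  induction w using FreeGroup.induction_on generalizing d with
  | C1 => rw [h1, tau_one]
  | of b => cases b <;> simp [hX, hY]
  | inv_of b ih =>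
    have h := hc (FreeGroup.of b) (FreeGroup.of b)⁻¹ d
    rw [mul_inv_cancel, h1, ih] at h
    rw [tau_inv]
    linear_combination -h
  | mul a b iha ihb => rw [hc, tau_mul, iha, ihb]

/-- Here, as for `tau_smul`, `tau_comp_aut` and `tau_coboundary`, the right-hand side is a cocycle
with the right values at the generators. -/
theorem tau_add (v v' : M.D → k) (w : FreeGroup Bool) (d : M.D) :
    tau (v + v') w d = tau v w d + tau v' w d :=
  (eq_tau (c := fun w d => tau v w d + tau v' w d)
    (fun w w' d => by simp only [tau_mul]; ring) (by simp) (by simp) w d).symm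

theorem tau_smul (a : k) (v : M.D → k) (w : FreeGroup Bool) (d : M.D) :
    tau (a • v) w d = a * tau v w d :=
  (eq_tau (c := fun w d => a * tau v w d)
    (fun w w' d => by simp only [tau_mul]; ring) (by simp) (by simp) w d).symm

/-- The total voltage as a linear functional. -/
def tauLin (w : FreeGroup Bool) (d : M.D) : (M.D → k) →ₗ[k] k where
  toFun v := tau v w d
  map_add' v v' := tau_add v v' w d
  map_smul' a v := by simp [tau_smul]

theorem tau_comp_aut {a : Equiv.Perm M.D} (ha : a ∈ M.aut) (v : M.D → k) (w : FreeGroup Bool)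
    (d : M.D) : tau (fun d => v (a d)) w d = tau v w (a d) :=
  (eq_tau (c := fun w d => tau v w (a d))
    (fun w w' d => by simp only [tau_mul, aut_mon ha]) (by simp) (by simp) w d).symm

theorem tau_coboundary {u : M.D → k} (hu : u ∈ fixSub k M.x) (w : FreeGroup Bool) (d : M.D) :
    tau (coboundary k M u) w d = u d - u (M.mon w d) :=
  (eq_tau (c := fun w d => u d - u (M.mon w d)) (fun w w' d => by simp)
    (fun d => by simp [hu d]) (fun d => by simp [coboundary]) w d).symm

theorem tau_Z (v : M.D → k) (d : M.D) : tau v gZ d = -v (M.z d) := by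
  rw [tau_inv, tau_mul, tau_X, tau_Y, mon_Z, zero_add]

theorem tau_Z_pow (v : M.D → k) (i : ℕ) (d : M.D) :
    tau v (gZ ^ i) d = -∑ j ∈ Finset.range i, v ((M.z ^ j) (M.z d)) := by
  induction i with
  | zero => simp
  | succ i ih =>
    rw [pow_succ', tau_mul, ih, tau_Z, map_pow, mon_Z, Finset.sum_range_succ,
      ← Equiv.Perm.mul_apply, ← Equiv.Perm.mul_apply, ← pow_succ', ← pow_succ]
    ring

/-- The word Z^n runs around a face; the sign comes from Z = (XY)⁻¹, in which Y is inverted. So face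
sums are voltages of elements of the kernel. -/
theorem tau_Z_pow_eq {n : ℕ} (hz : M.z ^ n = 1) (v : M.D → k) (d : M.D) :
    tau v (gZ ^ n) d = -faceSum k M n v d := by
  rw [tau_Z_pow, ← faceSum_mem_fixSub hz v d]; rfl

theorem tau_conj (v : M.D → k) {g : FreeGroup Bool} (hg : g ∈ M.mon.ker) (w : FreeGroup Bool)
    (d : M.D) : tau v (w * g * w⁻¹) d = tau v g (M.mon w⁻¹ d) := by
  have hg' : M.mon g = 1 := hg
  rw [tau_mul, tau_mul, tau_inv, map_inv, hg']
  simp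

/-! ### Homomorphisms from the kernel to `k` as voltage assignments -/

/-- This is the vanishing of the first cohomology of a cyclic group of order m when m is invertible.
In the weighted sum of the a(x^i d), replacing d by x d lowers every weight by one and leaves m a(d)
over. -/
theorem exists_primitive {m : ℕ} (hx : M.x ^ m = 1) (hm : (m : k) ≠ 0) (a : M.D → k)
    (ha : ∀ d, ∑ i ∈ Finset.range m, a ((M.x ^ i) d) = 0) :
    ∃ u : M.D → k, ∀ d, u (M.x d) - u d = a d := by
  refine ⟨fun d => (m : k)⁻¹ * ∑ i ∈ Finset.range m, (i : k) * a ((M.x ^ i) d), fun d => ?_⟩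
  have h1 : ∑ i ∈ Finset.range m, (i : k) * a ((M.x ^ i) (M.x d)) + ∑ i ∈ Finset.range m,
      a ((M.x ^ i) d) = ∑ i ∈ Finset.range m, (i : k) * a ((M.x ^ i) d) + m * a d := by
    have h2 : ∀ i, (M.x ^ i) (M.x d) = (M.x ^ (i + 1)) d := fun i => by
      rw [pow_succ, Equiv.Perm.mul_apply]
    simp_rw [h2]
    have h3 : ∑ i ∈ Finset.range m, a ((M.x ^ i) d) =
        ∑ i ∈ Finset.range m, a ((M.x ^ (i + 1)) d) := by
      have := Finset.sum_range_succ' (fun i => a ((M.x ^ i) d)) m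
      rw [Finset.sum_range_succ, hx] at this
      simpa using this
    rw [h3, ← Finset.sum_add_distrib]
    have h4 := Finset.sum_range_succ' (fun i => (i : k) * a ((M.x ^ i) d)) m
    rw [Finset.sum_range_succ, hx] at h4
    simp only [Nat.cast_zero, zero_mul, add_zero, Equiv.Perm.one_apply] at h4
    rw [h4]
    exact Finset.sum_congr rfl fun i _ => by push_cast; ring
  rw [ha, add_zero] at h1
  rw [← mul_sub, h1]
  field_simp
  ring

/-- Paths from d₀ turn h into a cocycle on all words. Vanishing on conjugates of X^m allows a
coboundary to be removed so that the cocycle vanishes at X; it is then given by its values at Y, and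
these are skew because h vanishes on conjugates of Y^2. -/
theorem exists_tau_eq (hM : M.OrientablyRegular) {n m : ℕ} (hT : M.HasType n m)
    (hm : (m : k) ≠ 0) (d₀ : M.D) (h : M.mon.ker → k) (hmul : ∀ a b, h (a * b) = h a + h b)
    (hX : ∀ g : M.mon.ker, (∃ w, g.1 = w⁻¹ * gX ^ m * w) → h g = 0)
    (hY : ∀ g : M.mon.ker, (∃ w, g.1 = w⁻¹ * gY ^ 2 * w) → h g = 0) :
    ∃ v ∈ skew k M, ∀ g : M.mon.ker, tau v g.1 d₀ = h g := by
  choose s hs using M.exists_mon d₀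
  have hmem : ∀ w d, (s (M.mon w d))⁻¹ * w * s d ∈ M.mon.ker := by
    intro w d
    apply hM.mem_ker (d := d₀)
    rw [map_mul, map_mul, Equiv.Perm.mul_apply, Equiv.Perm.mul_apply, hs, map_inv,
      Equiv.Perm.inv_eq_iff_eq, hs]
  -- The loop goes from d₀ to d along the chosen path, then along w, and back to d₀ along the path
  -- chosen for the end.
  let c : FreeGroup Bool → M.D → k := fun w d => h ⟨_, hmem w d⟩
  have hc : ∀ w w' d, c (w * w') d = c w (M.mon w' d) + c w' d := by
    intro w w' d
    simp only [c]
    rw [← hmul]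
    congr 1
    apply Subtype.ext
    simp only [map_mul, Equiv.Perm.mul_apply, Subgroup.coe_mul]
    group
  have hc1 : ∀ d, c 1 d = 0 := fun d => by
    have := hc 1 1 d
    rw [one_mul, map_one, Equiv.Perm.one_apply] at this
    linear_combination -this
  have hcpow : ∀ (w : FreeGroup Bool) (i : ℕ) d,
      c (w ^ i) d = ∑ j ∈ Finset.range i, c w ((M.mon w ^ j) d) := by
    intro w i d
    induction i with
    | zero => simp [hc1]
    | succ i ih => rw [pow_succ', hc, ih, Finset.sum_range_succ, map_pow, add_comm]
  obtain ⟨u, hu⟩ := exists_primitive hT.x_pow hm (c gX) (fun d => by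
    rw [← mon_X, ← hcpow]
    refine hX _ ⟨s d, ?_⟩
    simp only [map_pow, mon_X, hT.x_pow, Equiv.Perm.one_apply])
  -- The coboundary of the primitive of `c gX` is subtracted, so that `c'` vanishes at X.
  let c' : FreeGroup Bool → M.D → k := fun w d => c w d - u (M.mon w d) + u d
  have hc' : ∀ w d, c' w d = tau (c' gY) w d := by
    refine eq_tau (fun w w' d => ?_) (fun d => ?_) (fun d => rfl)
    · simp only [c', hc, map_mul, Equiv.Perm.mul_apply]; ring
    · simp only [c', mon_X]; rw [← hu]; ring
  refine ⟨c' gY, fun d => ?_, fun g => ?_⟩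
  · have h2 : c (gY ^ 2) d = 0 := by
      refine hY _ ⟨s d, ?_⟩
      simp only [map_mul, mon_Y, sq, y_mul_y, Equiv.Perm.one_apply]
    rw [sq, hc, mon_Y] at h2
    simp only [c', mon_Y, M.y_invol]
    linear_combination h2
  · have hg : M.mon g.1 = 1 := g.2
    have hs0 : s d₀ ∈ M.mon.ker := hM.mem_ker (hs d₀)
    rw [← hc']
    simp only [c', hg, Equiv.Perm.one_apply, sub_add_cancel]
    simp only [c]
    -- The chosen path `s d₀` need not be trivial, but it lies in the kernel, and conjugation by it
    -- is invisible to h since the target is commutative.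
    have h3 : (⟨_, hmem g.1 d₀⟩ : M.mon.ker) = ⟨s d₀, hs0⟩⁻¹ * g * ⟨s d₀, hs0⟩ := by
      apply Subtype.ext
      simp [hg]
    have h4 : h (⟨s d₀, hs0⟩⁻¹ * ⟨s d₀, hs0⟩) = 0 := by
      have := hmul 1 1
      rw [one_mul] at this
      rw [inv_mul_cancel]
      linear_combination -this
    rw [hmul] at h4
    rw [h3, hmul, hmul]
    linear_combination h4

end

end OMap

end

/-! ### Duality between the kernel and the functions on the faces. -/

section

namespace OMap

noncomputable section

/-- A Platonic map of type `{n, m}` and a prime `p` not dividing the number of darts. -/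
structure IsPlatonicCoprime (p : ℕ) (M : OMap) (n m : ℕ) : Prop where
  regular : M.OrientablyRegular
  type : M.HasType n m
  genus_eq : M.genus = 0
  card_ne : (Nat.card M.D : ZMod p) ≠ 0

/-- Invariance under the orientation-preserving automorphisms. -/
def Inv {k : Type} [Field k] {M : OMap} (W : Submodule k (M.D → k)) : Prop :=
  ∀ a ∈ M.aut, ∀ f ∈ W, (fun d => f (a d)) ∈ W

variable {k : Type} [Field k] {M : OMap}

/-- The words in the kernel along which the voltage assignments with face sums in `W` vanish. -/
def annKer (n : ℕ) (W : Submodule k (M.D → k)) : Subgroup (FreeGroup Bool) where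
  carrier := {g | g ∈ M.mon.ker ∧
    ∀ v ∈ skew k M, faceSum k M n v ∈ W → ∀ d, tau v g d = 0}
  mul_mem' := fun {a b} ha hb => ⟨mul_mem ha.1 hb.1, fun v hv hW d => by
    rw [tau_mul, ha.2 v hv hW, hb.2 v hv hW, add_zero]⟩
  one_mem' := ⟨one_mem _, fun v _ _ d => tau_one v d⟩
  inv_mem' := fun {a} ha => ⟨inv_mem ha.1, fun v hv hW d => by
    rw [tau_inv, ha.2 v hv hW, neg_zero]⟩

theorem annKer_le (n : ℕ) (W : Submodule k (M.D → k)) : annKer n W ≤ M.mon.ker := fun _ h => h.1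

instance annKer_normal (n : ℕ) (W : Submodule k (M.D → k)) : (annKer n W).Normal where
  conj_mem g hg w := ⟨(MonoidHom.normal_ker M.mon).conj_mem g hg.1 w, fun v hv hW d => by
    rw [tau_conj v hg.1, hg.2 v hv hW]⟩

/-- The voltage assignments which vanish along the words in `R`. -/
def vanishing (k : Type) [Field k] (M : OMap) (R : Subgroup (FreeGroup Bool)) :
    Submodule k (M.D → k) where
  carrier := {v | v ∈ skew k M ∧ ∀ g ∈ R, ∀ d, tau v g d = 0}
  add_mem' := fun ha hb => ⟨add_mem ha.1 hb.1, fun g hg d => by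
    rw [tau_add, ha.2 g hg, hb.2 g hg, add_zero]⟩
  zero_mem' := ⟨zero_mem _, fun g _ d => (tauLin g d).map_zero⟩
  smul_mem' := fun c v hv => ⟨Submodule.smul_mem _ _ hv.1, fun g hg d => by
    rw [tau_smul, hv.2 g hg, mul_zero]⟩

/-- The face sums of the voltage assignments which vanish along the words in `R`. -/
def annSpace (k : Type) [Field k] {M : OMap} (n : ℕ) (R : Subgroup (FreeGroup Bool)) :
    Submodule k (M.D → k) := (vanishing k M R).map (faceSum k M n)

theorem faceSum_comp_aut (n : ℕ) {a : Equiv.Perm M.D} (ha : a ∈ M.aut) (v : M.D → k) :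
    faceSum k M n (fun d => v (a d)) = fun d => faceSum k M n v (a d) := by
  funext d
  change ∑ i ∈ Finset.range n, v (a ((M.z ^ i) d)) = ∑ i ∈ Finset.range n, v ((M.z ^ i) (a d))
  refine Finset.sum_congr rfl fun i _ => ?_
  rw [← mon_Z, ← map_pow, aut_mon ha]

theorem skew_comp_aut {a : Equiv.Perm M.D} (ha : a ∈ M.aut) {v : M.D → k} (hv : v ∈ skew k M) :
    (fun d => v (a d)) ∈ skew k M := fun d => by
  change v (a (M.y d)) = -v (a d)
  rw [(mem_aut_iff.1 ha).2, hv]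

theorem annSpace_inv (n : ℕ) (R : Subgroup (FreeGroup Bool)) :
    Inv (annSpace k (M := M) n R) := by
  rintro a ha _ ⟨v, hv, rfl⟩
  exact ⟨fun d => v (a d), ⟨skew_comp_aut ha hv.1, fun g hg d => by
    rw [tau_comp_aut ha, hv.2 g hg]⟩, faceSum_comp_aut n ha v⟩

theorem annSpace_anti (n : ℕ) {R R' : Subgroup (FreeGroup Bool)} (h : R ≤ R') :
    annSpace k (M := M) n R' ≤ annSpace k n R := by
  rintro _ ⟨v, hv, rfl⟩
  exact ⟨v, ⟨hv.1, fun g hg => hv.2 g (h hg)⟩, rfl⟩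

theorem annKer_anti (n : ℕ) {W W' : Submodule k (M.D → k)} (h : W ≤ W') :
    annKer n W' ≤ annKer n W := fun _ hg => ⟨hg.1, fun v hv hW => hg.2 v hv (h hW)⟩

namespace IsPlatonicCoprime

variable {p n m : ℕ} [Fact p.Prime] (H : IsPlatonicCoprime p M n m)

local notation "𝕂" => ZMod p

include H

theorem two_ne : (2 : 𝕂) ≠ 0 := (H.type.natCast_ne_zero H.card_ne).1
theorem n_ne : (n : 𝕂) ≠ 0 := (H.type.natCast_ne_zero H.card_ne).2.1
theorem m_ne : (m : 𝕂) ≠ 0 := (H.type.natCast_ne_zero H.card_ne).2.2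

theorem annSpace_le (R : Subgroup (FreeGroup Bool)) :
    annSpace 𝕂 n R ≤ faceSpace 𝕂 M := by
  rintro _ ⟨v, hv, rfl⟩
  exact faceSum_skew_mem H.type.z_pow H.two_ne hv.1

theorem exists_skew {f : M.D → 𝕂} (hf : f ∈ faceSpace 𝕂 M) :
    ∃ v ∈ skew 𝕂 M, faceSum 𝕂 M n v = f := by
  rw [← map_faceSum_skew H.type.z_pow H.two_ne H.n_ne] at hf
  exact hf

/-- On the sphere the difference of the two assignments is a coboundary, whose total along a closed
path is zero. So voltages on the kernel depend only on the face sums. -/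
theorem tau_eq_of_faceSum_eq {v v' : M.D → 𝕂} (hv : v ∈ skew 𝕂 M) (hv' : v' ∈ skew 𝕂 M)
    (h : faceSum 𝕂 M n v = faceSum 𝕂 M n v') {g : FreeGroup Bool} (hg : g ∈ M.mon.ker) (d : M.D) :
    tau v g d = tau v' g d := by
  have h1 : v - v' ∈ skew 𝕂 M ⊓ LinearMap.ker (faceSum 𝕂 M n) :=
    ⟨sub_mem hv hv', by
      change faceSum 𝕂 M n _ = 0
      rw [map_sub, h, sub_self]⟩
  rw [H.type.skew_inf_ker H.genus_eq H.card_ne] at h1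
  obtain ⟨u, hu, hu'⟩ := h1
  have h2 := tau_coboundary hu g d
  have hg' : M.mon g = 1 := hg
  rw [hu', hg', Equiv.Perm.one_apply, sub_self] at h2
  have h3 := (tauLin g d).map_sub v v'
  change tau (v - v') g d = tau v g d - tau v' g d at h3
  rw [h2] at h3
  exact (sub_eq_zero.1 h3.symm)

theorem mem_annSpace_iff {R : Subgroup (FreeGroup Bool)} (hR : R ≤ M.mon.ker) {v : M.D → 𝕂}
    (hv : v ∈ skew 𝕂 M) :
    faceSum 𝕂 M n v ∈ annSpace 𝕂 n R ↔ ∀ g ∈ R, ∀ d, tau v g d = 0 := by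
  constructor
  · rintro ⟨v', hv', h⟩ g hg d
    rw [← H.tau_eq_of_faceSum_eq hv'.1 hv h (hR hg), hv'.2 g hg]
  · exact fun h => ⟨v, ⟨hv, h⟩, rfl⟩

/-- The antitone Galois connection behind the classification. R need not be normal: for joins it is
applied to cyclic groups generated by one word. -/
theorem le_annKer_iff {R : Subgroup (FreeGroup Bool)} (hR : R ≤ M.mon.ker)
    {W : Submodule 𝕂 (M.D → 𝕂)} (hW : W ≤ faceSpace 𝕂 M) :
    R ≤ annKer n W ↔ W ≤ annSpace 𝕂 n R := by
  constructor
  · intro h f hf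
    obtain ⟨v, hv, rfl⟩ := H.exists_skew (hW hf)
    exact (H.mem_annSpace_iff hR hv).2 fun g hg => (h hg).2 v hv hf
  · intro h g hg
    exact ⟨hR hg, fun v hv hvW => (H.mem_annSpace_iff hR hv).1 (h hvW) g hg⟩

/-- The pairing of the kernel with the functions on the faces. -/
theorem exists_pairing (d₀ : M.D) : ∃ θ : M.mon.ker → Module.Dual 𝕂 (faceSpace 𝕂 M),
    (∀ a b, θ (a * b) = θ a + θ b) ∧
    ∀ (g : M.mon.ker) (v : M.D → 𝕂) (hv : v ∈ skew 𝕂 M),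
      θ g ⟨_, faceSum_skew_mem H.type.z_pow H.two_ne hv⟩ = tau v g.1 d₀ := by
  have hsurj : LinearMap.range ((faceSum 𝕂 M n).restrict
      (fun v hv => faceSum_skew_mem H.type.z_pow H.two_ne hv :
        ∀ v ∈ skew 𝕂 M, faceSum 𝕂 M n v ∈ faceSpace 𝕂 M)) = ⊤ := by
    rw [LinearMap.range_eq_top]
    rintro ⟨f, hf⟩
    obtain ⟨v, hv, rfl⟩ := H.exists_skew hf
    exact ⟨⟨v, hv⟩, rfl⟩
  -- A linear section of the face sum; the resulting functional does not depend on it, by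
  -- `tau_eq_of_faceSum_eq`.
  obtain ⟨σ, hσ⟩ := LinearMap.exists_rightInverse_of_surjective _ hsurj
  refine ⟨fun g => (tauLin g.1 d₀).comp ((skew 𝕂 M).subtype.comp σ), fun a b => ?_,
    fun g v hv => ?_⟩
  · ext f
    have hb : M.mon b.1 = 1 := b.2
    change tau (σ f).1 (a.1 * b.1) d₀ = tau (σ f).1 a.1 d₀ + tau (σ f).1 b.1 d₀
    rw [tau_mul, hb, Equiv.Perm.one_apply]
  · refine H.tau_eq_of_faceSum_eq (σ _).2 hv ?_ g.2 d₀
    exact congrArg Subtype.val (LinearMap.congr_fun hσ ⟨_, faceSum_skew_mem H.type.z_pow H.two_ne hv⟩)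

/-- The image is an additive subgroup, hence a subspace over the prime field. A face function killed
by it is zero, since conjugates of Z^n read off each of its values. -/
theorem pairing_surjective {d₀ : M.D} {θ : M.mon.ker → Module.Dual 𝕂 (faceSpace 𝕂 M)}
    (hθ : ∀ a b, θ (a * b) = θ a + θ b)
    (hτ : ∀ (g : M.mon.ker) (v : M.D → 𝕂) (hv : v ∈ skew 𝕂 M),
      θ g ⟨_, faceSum_skew_mem H.type.z_pow H.two_ne hv⟩ = tau v g.1 d₀) :
    Function.Surjective θ := by
  have h1 : θ 1 = 0 := by simpa using hθ 1 1
  let A : AddSubgroup (Module.Dual 𝕂 (faceSpace 𝕂 M)) :=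
    { carrier := Set.range θ
      add_mem' := by rintro _ _ ⟨a, rfl⟩ ⟨b, rfl⟩; exact ⟨a * b, hθ a b⟩
      zero_mem' := ⟨1, h1⟩
      neg_mem' := by
        rintro _ ⟨a, rfl⟩
        refine ⟨a⁻¹, ?_⟩
        have := hθ a⁻¹ a
        rw [inv_mul_cancel, h1] at this
        exact eq_neg_of_add_eq_zero_left this.symm }
  let S : Submodule 𝕂 (Module.Dual 𝕂 (faceSpace 𝕂 M)) := AddSubgroup.toZModSubmodule p A
  have hS : S.dualCoannihilator = ⊥ := by
    rw [Submodule.eq_bot_iff]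
    rintro ⟨f, hf⟩ hf'
    rw [Submodule.mem_dualCoannihilator] at hf'
    obtain ⟨v, hv, rfl⟩ := H.exists_skew hf
    apply Subtype.ext
    funext d
    obtain ⟨w, rfl⟩ := M.exists_mon d₀ d
    have hZ : gZ ^ n ∈ M.mon.ker := by
      rw [MonoidHom.mem_ker, map_pow, mon_Z, H.type.z_pow]
    have hg : w⁻¹ * gZ ^ n * w⁻¹⁻¹ ∈ M.mon.ker := (MonoidHom.normal_ker M.mon).conj_mem _ hZ _
    have h2 := hf' (θ ⟨_, hg⟩) ⟨⟨_, hg⟩, rfl⟩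
    rw [hτ _ v hv, tau_conj v hZ, inv_inv, tau_Z_pow_eq H.type.z_pow] at h2
    exact neg_eq_zero.1 h2
  have hS' : S = ⊤ := by
    rw [← Subspace.dualCoannihilator_dualAnnihilator_eq (W := S), hS,
      Submodule.dualAnnihilator_bot]
  intro ψ
  have : ψ ∈ S := hS' ▸ Submodule.mem_top
  exact this

-- Automorphisms carry d₀ to any other dart and preserve W, so one base dart suffices.
omit H in
theorem mem_annKer_iff (H : IsPlatonicCoprime p M n m) {W : Submodule 𝕂 (M.D → 𝕂)} (hI : Inv W)
    (d₀ : M.D)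
    {g : FreeGroup Bool} (hg : g ∈ M.mon.ker) :
    g ∈ annKer n W ↔ ∀ v ∈ skew 𝕂 M, faceSum 𝕂 M n v ∈ W → tau v g d₀ = 0 := by
  refine ⟨fun h v hv hvW => h.2 v hv hvW d₀, fun h => ⟨hg, fun v hv hvW d => ?_⟩⟩
  obtain ⟨a, ha, rfl⟩ := H.regular d₀ d
  rw [← tau_comp_aut ha]
  refine h _ (skew_comp_aut ha hv) ?_
  rw [faceSum_comp_aut n ha]
  exact hI a ha _ hvW

/-- A face function outside W is separated from W by a functional. By `pairing_surjective` the
functional comes from a word of the kernel; that word lies in `annKer n W` but does not annihilate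
the function. -/
theorem annSpace_annKer {W : Submodule 𝕂 (M.D → 𝕂)} (hW : W ≤ faceSpace 𝕂 M) (hI : Inv W) :
    annSpace 𝕂 n (annKer n W) = W := by
  apply le_antisymm
  · rintro _ ⟨v, hv, rfl⟩
    by_contra hvW
    obtain ⟨d₀⟩ := M.nonempty
    obtain ⟨θ, hθ, hτ⟩ := H.exists_pairing d₀
    have h1 : (⟨_, faceSum_skew_mem H.type.z_pow H.two_ne hv.1⟩ : faceSpace 𝕂 M) ∉
        W.comap (faceSpace 𝕂 M).subtype := hvW
    obtain ⟨ψ, hψ, hψW⟩ := Submodule.exists_le_ker_of_notMem h1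
    obtain ⟨g, rfl⟩ := H.pairing_surjective hθ hτ ψ
    rw [hτ g v hv.1] at hψ
    refine hψ (hv.2 g.1 ((H.mem_annKer_iff hI d₀ g.2).2 fun v' hv' hW' => ?_) d₀)
    rw [← hτ g v' hv']
    exact hψW (show faceSum 𝕂 M n v' ∈ W from hW')
  · exact (H.le_annKer_iff (annKer_le n W) hW).1 le_rfl

/-- Restricting the pairing to W maps the kernel onto the dual of W, and the words that act as zero
are those in `annKer n W`. -/
theorem relIndex_annKer {W : Submodule 𝕂 (M.D → 𝕂)} (hW : W ≤ faceSpace 𝕂 M) (hI : Inv W) :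
    (annKer n W).relIndex M.mon.ker = p ^ Module.finrank 𝕂 W := by
  obtain ⟨d₀⟩ := M.nonempty
  obtain ⟨θ, hθ, hτ⟩ := H.exists_pairing d₀
  have hsurj := H.pairing_surjective hθ hτ
  let ι : W →ₗ[𝕂] faceSpace 𝕂 M := Submodule.inclusion hW
  let Θ : M.mon.ker →* Multiplicative (Module.Dual 𝕂 W) :=
    MonoidHom.mk' (fun g => Multiplicative.ofAdd ((θ g).comp ι)) fun a b => by
      rw [hθ, LinearMap.add_comp]; rfl
  have hker : Θ.ker = (annKer n W).subgroupOf M.mon.ker := by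
    ext g
    rw [MonoidHom.mem_ker, Subgroup.mem_subgroupOf, H.mem_annKer_iff hI d₀ g.2]
    change (θ g).comp ι = 0 ↔ _
    constructor
    · intro h v hv hvW
      rw [← hτ g v hv]
      exact LinearMap.congr_fun h ⟨_, hvW⟩
    · intro h
      ext ⟨f, hf⟩
      obtain ⟨v, hv, rfl⟩ := H.exists_skew (hW hf)
      exact (hτ g v hv).trans (h v hv hf)
  have hΘ : Function.Surjective Θ := by
    intro ψ
    obtain ⟨ψ', hψ'⟩ := LinearMap.exists_extend ψ.toAdd
    obtain ⟨g, hg⟩ := hsurj (ψ'.comp (faceSpace 𝕂 M).subtype)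
    refine ⟨g, ?_⟩
    change Multiplicative.ofAdd ((θ g).comp ι) = ψ
    rw [hg]
    exact hψ'
  rw [Subgroup.relIndex, ← hker, Subgroup.index_ker, MonoidHom.range_eq_top.2 hΘ, Subgroup.card_top,
    ← Subspace.dual_finrank_eq]
  have : Nat.card (Module.Dual 𝕂 W) = Nat.card 𝕂 ^ Module.finrank 𝕂 (Module.Dual 𝕂 W) :=
    Module.natCard_eq_pow_finrank
  rw [Nat.card_zmod] at this
  exact this

end IsPlatonicCoprime

end

end OMap

end

/-! ### Admissible subgroups and coverings. -/

section

namespace OMap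

noncomputable section

variable {M : OMap}

/-- The kernels of the coverings with elementary abelian covering group which are unbranched
outside the face-centres. -/
structure Admissible (p m : ℕ) (M : OMap) (R : Subgroup (FreeGroup Bool)) : Prop where
  normal : R.Normal
  le : R ≤ M.mon.ker
  X_pow : gX ^ m ∈ R
  Y_sq : gY ^ 2 ∈ R
  comm : ∀ a ∈ M.mon.ker, ∀ b ∈ M.mon.ker, a * b * a⁻¹ * b⁻¹ ∈ R
  exponent : ∀ a ∈ M.mon.ker, a ^ p ∈ R

theorem tau_pow_of_mem_ker {k : Type} [Field k] (v : M.D → k) {g : FreeGroup Bool}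
    (hg : g ∈ M.mon.ker) (i : ℕ) (d : M.D) : tau v (g ^ i) d = i * tau v g d := by
  have hg' : M.mon g = 1 := hg
  induction i with
  | zero => simp
  | succ i ih => rw [pow_succ, tau_mul, hg', Equiv.Perm.one_apply, ih]; push_cast; ring

theorem tau_X_pow {k : Type} [Field k] (v : M.D → k) (i : ℕ) (d : M.D) :
    tau v (gX ^ i) d = 0 := by
  induction i with
  | zero => simp
  | succ i ih => rw [pow_succ', tau_mul, ih, tau_X, add_zero]

theorem exists_linearMap_ne_zero {p : ℕ} [Fact p.Prime] {V : Type} [AddCommGroup V]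
    [Module (ZMod p) V] {g : V} (hg : g ≠ 0) : ∃ ψ : V →ₗ[ZMod p] ZMod p, ψ g ≠ 0 := by
  by_contra hcon
  push Not at hcon
  exact hg ((Module.forall_dual_apply_eq_zero_iff (ZMod p) g).1 hcon)

theorem exists_addMonoidHom_ne_zero {p : ℕ} [Fact p.Prime] {V : Type} [AddCommGroup V]
    (he : ∀ a : V, p • a = 0) {g : V} (hg : g ≠ 0) : ∃ ψ : V →+ ZMod p, ψ g ≠ 0 := by
  let _ : Module (ZMod p) V := AddCommGroup.zmodModule he
  obtain ⟨ψ, hψ⟩ := exists_linearMap_ne_zero (p := p) hg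
  exact ⟨ψ.toAddMonoidHom, hψ⟩

theorem exists_hom_ne_zero {p : ℕ} [Fact p.Prime] {Q : Type} [Group Q]
    (hc : ∀ a b : Q, a * b = b * a) (he : ∀ a : Q, a ^ p = 1) {g : Q} (hg : g ≠ 1) :
    ∃ ψ : Q → ZMod p, (∀ a b, ψ (a * b) = ψ a + ψ b) ∧ ψ g ≠ 0 := by
  let _ : CommGroup Q := { (inferInstance : Group Q) with mul_comm := hc }
  obtain ⟨ψ, hψ⟩ := exists_addMonoidHom_ne_zero (p := p) (V := Additive Q)
    (fun a => he a.toMul) (g := Additive.ofMul g) hg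
  exact ⟨fun a => ψ (Additive.ofMul a), fun a b => ψ.map_add _ _, hψ⟩

namespace IsPlatonicCoprime

variable {p n m : ℕ} [Fact p.Prime] (H : IsPlatonicCoprime p M n m)

local notation "𝕂" => ZMod p

include H

theorem admissible_annKer (W : Submodule 𝕂 (M.D → 𝕂)) : Admissible p m M (annKer n W) where
  normal := annKer_normal n W
  le := annKer_le n W
  X_pow := ⟨by rw [MonoidHom.mem_ker, map_pow, mon_X, H.type.x_pow],
    fun v _ _ d => tau_X_pow v m d⟩
  Y_sq := ⟨by rw [MonoidHom.mem_ker, map_pow, mon_Y, sq, y_mul_y], fun v hv _ d => by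
    rw [sq, tau_mul, mon_Y, tau_Y, tau_Y, hv d, neg_add_cancel]⟩
  comm := fun a ha b hb => ⟨mul_mem (mul_mem (mul_mem ha hb) (inv_mem ha)) (inv_mem hb),
    fun v _ _ d => by
      have ha' : M.mon a = 1 := ha
      have hb' : M.mon b = 1 := hb
      simp only [tau_mul, tau_inv, map_inv, ha', hb', inv_one, Equiv.Perm.one_apply]
      ring⟩
  exponent := fun a ha => ⟨pow_mem ha p, fun v _ _ d => by
    rw [tau_pow_of_mem_ker v ha, CharP.cast_eq_zero, zero_mul]⟩

omit H in
/-- A homomorphism to `𝔽_p` which separates an element of the kernel from `R`. -/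
theorem exists_separating {R : Subgroup (FreeGroup Bool)} (hR : Admissible p m M R)
    {g : FreeGroup Bool} (hg : g ∈ M.mon.ker) (hgR : g ∉ R) :
    ∃ h : M.mon.ker → 𝕂, (∀ a b, h (a * b) = h a + h b) ∧ (∀ a : M.mon.ker, a.1 ∈ R → h a = 0) ∧
      h ⟨g, hg⟩ ≠ 0 := by
  have := hR.normal
  let q : M.mon.ker →* M.mon.ker ⧸ R.subgroupOf M.mon.ker := QuotientGroup.mk' _
  have hq : ∀ a : M.mon.ker, q a = 1 ↔ a.1 ∈ R := fun a => by
    rw [← Subgroup.mem_subgroupOf (K := M.mon.ker), ← QuotientGroup.eq_one_iff]; rfl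
  obtain ⟨ψ, hψ, hne⟩ := exists_hom_ne_zero (p := p)
    (by
      intro a b
      obtain ⟨a, rfl⟩ := QuotientGroup.mk'_surjective _ a
      obtain ⟨b, rfl⟩ := QuotientGroup.mk'_surjective _ b
      have h1 := (hq (a * b * a⁻¹ * b⁻¹)).2 (hR.comm a.1 a.2 b.1 b.2)
      rwa [map_mul, map_mul, map_mul, map_inv, map_inv, mul_inv_eq_one,
        mul_inv_eq_iff_eq_mul] at h1)
    (by
      intro a
      obtain ⟨a, rfl⟩ := QuotientGroup.mk'_surjective _ a
      have h1 := (hq (a ^ p)).2 (hR.exponent a.1 a.2)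
      rwa [map_pow] at h1) (fun h => hgR ((hq ⟨g, hg⟩).1 h))
  refine ⟨fun a => ψ (q a), fun a b => ?_, fun a ha => ?_, hne⟩
  · simp only [map_mul, hψ]
  simp only [(hq a).2 ha]
  simpa using hψ 1 1

/-- An element of the kernel outside R is detected by a homomorphism to 𝔽_p trivial on R, since the
quotient is elementary abelian. By `exists_tau_eq` that homomorphism is a voltage assignment, and
its face sums lie in `annSpace`. -/
theorem annKer_annSpace {R : Subgroup (FreeGroup Bool)} (hR : Admissible p m M R) :
    annKer n (annSpace 𝕂 (M := M) n R) = R := by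
  apply le_antisymm
  · intro g hg
    by_contra hgR
    obtain ⟨h, hmul, hker, hne⟩ := exists_separating hR hg.1 hgR
    obtain ⟨d₀⟩ := M.nonempty
    obtain ⟨v, hv, hvh⟩ := exists_tau_eq H.regular H.type H.m_ne d₀ h hmul
      (by
        rintro ⟨a, ha⟩ ⟨w, rfl⟩
        apply hker
        simpa using hR.normal.conj_mem _ hR.X_pow w⁻¹)
      (by
        rintro ⟨a, ha⟩ ⟨w, rfl⟩
        apply hker
        simpa using hR.normal.conj_mem _ hR.Y_sq w⁻¹)
    apply hne
    rw [← hvh]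
    refine hg.2 v hv ((H.mem_annSpace_iff hR.le hv).2 fun g' hg' d => ?_) d₀
    obtain ⟨w, rfl⟩ := M.exists_mon d₀ d
    have h1 := tau_conj v (hR.le hg') w⁻¹ d₀
    rw [inv_inv] at h1
    have hm : w⁻¹ * g' * w ∈ R := by simpa using hR.normal.conj_mem _ hg' w⁻¹
    rw [← h1, hvh ⟨_, hR.le hm⟩, hker _ hm]
  · exact (H.le_annKer_iff hR.le (H.annSpace_le R)).2 le_rfl

theorem relIndex_eq {R : Subgroup (FreeGroup Bool)} (hR : Admissible p m M R) :
    R.relIndex M.mon.ker = p ^ Module.finrank 𝕂 (annSpace 𝕂 (M := M) n R) := by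
  rw [← H.relIndex_annKer (H.annSpace_le R) (annSpace_inv n R), H.annKer_annSpace hR]

end IsPlatonicCoprime

/-! ### Covering transformations -/

theorem Hom.ker_le {N M : OMap} (φ : Hom N M) : N.mon.ker ≤ M.mon.ker := by
  intro w hw
  have hw' : N.mon w = 1 := hw
  rw [MonoidHom.mem_ker]
  ext d
  obtain ⟨e, rfl⟩ := φ.surjective d
  rw [← φ.map_mon, hw']; rfl

def Hom.comp {X N M : OMap} (φ : Hom N M) (f : Hom X N) : Hom X M :=
  ⟨fun d => φ.toFun (f.toFun d), fun d => by rw [f.map_x, φ.map_x],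
    fun d => by rw [f.map_y, φ.map_y]⟩

theorem mem_deck_of_apply {N M : OMap} (φ : Hom N M) {a : N.aut} {d : N.D}
    (h : φ.toFun (a.1 d) = φ.toFun d) : a ∈ φ.deck := fun e =>
  Hom.ext_of_apply (f := φ.comp (autHom a.1 a.2)) (g := φ) h e

/-- The covering transformations as a quotient of the kernel. -/
theorem exists_deckHom {N M : OMap} (hN : N.OrientablyRegular) (hM : M.OrientablyRegular)
    (φ : Hom N M) (e₀ : N.D) : ∃ Ξ : M.mon.ker →* φ.deck, Function.Surjective Ξ ∧
      Ξ.ker = N.mon.ker.subgroupOf M.mon.ker ∧ ∀ g, (Ξ g).1.1 (N.mon g.1 e₀) = e₀ := by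
  have h1 : ∀ g : M.mon.ker, ∃ a : φ.deck, a.1.1 (N.mon g.1 e₀) = e₀ := by
    intro g
    obtain ⟨a, ha, hae⟩ := hN (N.mon g.1 e₀) e₀
    have hg : M.mon g.1 = 1 := g.2
    refine ⟨⟨⟨a, ha⟩, mem_deck_of_apply φ (d := N.mon g.1 e₀) ?_⟩, hae⟩
    rw [hae, φ.map_mon, hg]; rfl
  choose ξ hξ using h1
  have huniq : ∀ a b : φ.deck, ∀ e, a.1.1 e = b.1.1 e → a = b := fun a b e h =>
    Subtype.ext (Subtype.ext (aut_eq_of_apply_eq a.1.2 b.1.2 h))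
  -- The transformation attached to g carries the end of g back to `e₀`. Using the way back rather
  -- than the way out makes this a homomorphism and not an antihomomorphism.
  let Ξ : M.mon.ker →* φ.deck := MonoidHom.mk' ξ fun a b => by
    apply huniq _ _ (N.mon (a * b).1 e₀)
    rw [hξ]
    change e₀ = (ξ a).1.1 ((ξ b).1.1 (N.mon (a * b).1 e₀))
    rw [Subgroup.coe_mul, map_mul, Equiv.Perm.mul_apply, aut_mon (ξ b).1.2, hξ, hξ]
  refine ⟨Ξ, fun a => ?_, ?_, hξ⟩
  · obtain ⟨w, hw⟩ := N.exists_mon (a.1.1 e₀) e₀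
    have hwK : w ∈ M.mon.ker := by
      apply hM.mem_ker (d := φ.toFun e₀)
      have h2 := φ.map_mon w (a.1.1 e₀)
      rw [hw, a.2] at h2
      exact h2.symm
    refine ⟨⟨w, hwK⟩, huniq _ _ (N.mon w e₀) ?_⟩
    refine (hξ ⟨w, hwK⟩).trans ?_
    rw [aut_mon a.1.2, hw]
  · ext g
    rw [MonoidHom.mem_ker, Subgroup.mem_subgroupOf]
    constructor
    · intro h
      have h2 := hξ g
      change ξ g = 1 at h
      rw [h] at h2
      exact hN.mem_ker h2
    · intro h
      have h2 := hξ g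
      have h' : N.mon g.1 = 1 := h
      rw [h'] at h2
      exact huniq _ _ e₀ h2

theorem card_deck {N M : OMap} (hN : N.OrientablyRegular) (hM : M.OrientablyRegular)
    (φ : Hom N M) : Nat.card φ.deck = N.mon.ker.relIndex M.mon.ker := by
  obtain ⟨e₀⟩ := N.nonempty
  obtain ⟨Ξ, h1, h2, -⟩ := exists_deckHom hN hM φ e₀
  rw [Subgroup.relIndex, ← h2, Subgroup.index_ker, MonoidHom.range_eq_top.2 h1, Subgroup.card_top]

theorem regular_covering_of {N M : OMap} (hN : N.OrientablyRegular) (φ : Hom N M) (d e : N.D)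
    (h : φ.toFun d = φ.toFun e) : ∃ a ∈ φ.deck, a.1 d = e := by
  obtain ⟨a, ha, hae⟩ := hN d e
  exact ⟨⟨a, ha⟩, mem_deck_of_apply φ (d := d) (by rw [hae, h]), hae⟩

/-- Orientably regular maps from normal subgroups of finite index. -/
theorem exists_map_of_normal (R : Subgroup (FreeGroup Bool)) (hn : R.Normal)
    (hfin : R.index ≠ 0) (hY : gY ^ 2 ∈ R) (hY' : gY ∉ R) :
    ∃ N : OMap, N.OrientablyRegular ∧ N.mon.ker = R := by
  have : Finite (FreeGroup Bool ⧸ R) := by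
    have : R.FiniteIndex := ⟨hfin⟩
    infer_instance
  let ρ := MulAction.toPermHom (FreeGroup Bool) (FreeGroup Bool ⧸ R)
  have hρ : ∀ w v : FreeGroup Bool, ρ w (v : FreeGroup Bool ⧸ R) = ((w * v : FreeGroup Bool) :
    FreeGroup Bool ⧸ R) := fun w v => rfl
  have hmulρ : ∀ w q q', ρ w q * q' = ρ w (q * q') := by
    intro w q q'
    induction q using QuotientGroup.induction_on with | H a => ?_
    induction q' using QuotientGroup.induction_on with | H b => ?_
    rw [hρ, ← QuotientGroup.mk_mul, ← QuotientGroup.mk_mul, hρ, mul_assoc]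
  have h1 : ∀ q, ρ gY (ρ gY q) = q := by
    intro q
    induction q using QuotientGroup.induction_on with | H a => ?_
    rw [hρ, hρ, QuotientGroup.eq]
    have := hn.conj_mem _ (inv_mem hY) a⁻¹
    convert this using 1
    group
  have h2 : ∀ q, ρ gY q ≠ q := by
    intro q
    induction q using QuotientGroup.induction_on with | H a => ?_
    rw [hρ]
    intro h
    rw [QuotientGroup.eq] at h
    apply hY'
    have := inv_mem (hn.conj_mem _ h a)
    convert this using 1
    group
  have h3 : ∀ q q', ∃ w, ρ w q = q' := by
    intro q q'
    induction q using QuotientGroup.induction_on with | H a => ?_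
    induction q' using QuotientGroup.induction_on with | H b => ?_
    exact ⟨b * a⁻¹, by rw [hρ, inv_mul_cancel_right]⟩
  refine ⟨ofAction _ ρ h1 h2 h3, ?_, ?_⟩
  · intro q q'
    change FreeGroup Bool ⧸ R at q q'
    refine ⟨(Equiv.mulRight (q⁻¹ * q') : Equiv.Perm (FreeGroup Bool ⧸ R)), ?_, ?_⟩
    · refine mem_aut_iff.2 ⟨fun d => ?_, fun d => ?_⟩
      · change FreeGroup Bool ⧸ R at d
        change ρ gX d * (q⁻¹ * q') = ρ gX (d * (q⁻¹ * q'))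
        exact hmulρ _ _ _
      · change FreeGroup Bool ⧸ R at d
        change ρ gY d * (q⁻¹ * q') = ρ gY (d * (q⁻¹ * q'))
        exact hmulρ _ _ _
    · change q * (q⁻¹ * q') = q'
      group
  · rw [mon_ofAction]
    ext w
    change ρ w = 1 ↔ w ∈ R
    constructor
    · intro h
      have := congrArg (fun g => g ((1 : FreeGroup Bool) : FreeGroup Bool ⧸ R)) h
      simp only [hρ, mul_one, Equiv.Perm.one_apply] at this
      rw [QuotientGroup.mk_one] at this
      exact (QuotientGroup.eq_one_iff w).1 this
    · intro h
      ext q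
      induction q using QuotientGroup.induction_on with | H a => ?_
      rw [hρ, Equiv.Perm.one_apply, QuotientGroup.eq]
      have := hn.conj_mem _ (inv_mem h) a⁻¹
      convert this using 1
      group

theorem index_ker_ne_zero (M : OMap) : M.mon.ker.index ≠ 0 := by
  rw [Subgroup.index_ker]
  exact Nat.card_pos.ne'

theorem Y_notMem_ker (M : OMap) : gY ∉ M.mon.ker := by
  intro h
  have h' : M.mon gY = 1 := h
  rw [mon_Y] at h'
  obtain ⟨d⟩ := M.nonempty
  exact M.y_free d (by rw [h']; rfl)

namespace IsPlatonicCoprime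

variable {p n m : ℕ} [Fact p.Prime] (H : IsPlatonicCoprime p M n m)

local notation "𝕂" => ZMod p

include H

theorem exists_cover {R : Subgroup (FreeGroup Bool)} (hR : Admissible p m M R) :
    ∃ C : ElemAbCover M p, C.N.mon.ker = R := by
  have hp : p ≠ 0 := (Fact.out : p.Prime).ne_zero
  have hidx : R.index ≠ 0 := by
    rw [← Subgroup.relIndex_mul_index hR.le, H.relIndex_eq hR]
    exact mul_ne_zero (pow_ne_zero _ hp) M.index_ker_ne_zero
  obtain ⟨N, hN, hker⟩ := exists_map_of_normal R hR.normal hidx hR.Y_sq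
    fun h => M.Y_notMem_ker (hR.le h)
  obtain ⟨d₀⟩ := M.nonempty
  obtain ⟨e₀⟩ := N.nonempty
  obtain ⟨φ, -⟩ := exists_hom (X := N) (N := M) e₀ d₀ (by
    intro w hw
    have h1 := hN.mem_ker hw
    rw [hker] at h1
    have h2 : M.mon w = 1 := hR.le h1
    rw [h2]; rfl)
  obtain ⟨Ξ, hΞ, hΞk, -⟩ := exists_deckHom hN H.regular φ e₀
  have hmemΞ : ∀ g : M.mon.ker, g.1 ∈ R → Ξ g = 1 := by
    intro g hg
    rw [← MonoidHom.mem_ker, hΞk, Subgroup.mem_subgroupOf, hker]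
    exact hg
  refine ⟨⟨N, φ, _, hN, ?_, regular_covering_of hN φ, ?_, ?_,
    (card_deck hN H.regular φ).trans (hker ▸ H.relIndex_eq hR)⟩, hker⟩
  · intro d
    rw [(H.type _).2]
    have h1 : N.x ^ m = 1 := by
      have : gX ^ m ∈ N.mon.ker := hker ▸ hR.X_pow
      rw [MonoidHom.mem_ker, map_pow, mon_X] at this
      exact this
    apply Nat.dvd_antisymm
    · apply Function.IsPeriodicPt.minimalPeriod_dvd
      change N.x^[m] d = d
      rw [Equiv.Perm.iterate_eq_pow, h1]; rfl
    · rw [← (H.type (φ.toFun d)).2]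
      apply Function.IsPeriodicPt.minimalPeriod_dvd
      change M.x^[_] _ = _
      rw [Equiv.Perm.iterate_eq_pow, ← mon_X, ← map_pow, ← φ.map_mon, map_pow, mon_X,
        ← Equiv.Perm.iterate_eq_pow, Function.iterate_minimalPeriod]
  · intro a ha b hb
    obtain ⟨g, hg⟩ := hΞ ⟨a, ha⟩
    obtain ⟨g', hg'⟩ := hΞ ⟨b, hb⟩
    have h1 := hmemΞ (g * g' * g⁻¹ * g'⁻¹) (hR.comm _ g.2 _ g'.2)
    rw [map_mul, map_mul, map_mul, map_inv, map_inv, hg, hg'] at h1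
    have h2 : a * b * a⁻¹ * b⁻¹ = 1 := congrArg Subtype.val h1
    rw [mul_inv_eq_one, mul_inv_eq_iff_eq_mul] at h2
    exact h2
  · intro a ha
    obtain ⟨g, hg⟩ := hΞ ⟨a, ha⟩
    have h1 := hmemΞ (g ^ p) (hR.exponent _ g.2)
    rw [map_pow, hg] at h1
    exact congrArg Subtype.val h1

omit [Fact p.Prime] in
theorem admissible (C : ElemAbCover M p) : Admissible p m M C.N.mon.ker := by
  obtain ⟨e₀⟩ := C.N.nonempty
  obtain ⟨Ξ, hΞ, hΞk, -⟩ := exists_deckHom C.orientablyRegular H.regular C.φ e₀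
  have hmem : ∀ g : M.mon.ker, Ξ g = 1 → g.1 ∈ C.N.mon.ker := by
    intro g hg
    rwa [← MonoidHom.mem_ker, hΞk, Subgroup.mem_subgroupOf] at hg
  refine ⟨MonoidHom.normal_ker _, C.φ.ker_le, ?_, ?_, fun a ha b hb => ?_, fun a ha => ?_⟩
  · rw [MonoidHom.mem_ker, map_pow, mon_X]
    ext d
    rw [← Equiv.Perm.iterate_eq_pow]
    have h1 := C.unbranched_vertices d
    rw [(H.type _).2] at h1
    rw [← h1, Function.iterate_minimalPeriod]; rfl
  · rw [MonoidHom.mem_ker, map_pow, mon_Y, sq, y_mul_y]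
  · refine hmem (⟨a, ha⟩ * ⟨b, hb⟩ * ⟨a, ha⟩⁻¹ * ⟨b, hb⟩⁻¹) ?_
    rw [map_mul, map_mul, map_mul, map_inv, map_inv, mul_inv_eq_one, mul_inv_eq_iff_eq_mul]
    exact Subtype.ext (C.deck_comm _ (Ξ _).2 _ (Ξ _).2)
  · refine hmem (⟨a, ha⟩ ^ p) ?_
    rw [map_pow]
    exact Subtype.ext (C.deck_exponent _ (Ξ _).2)

end IsPlatonicCoprime

end

end OMap

end

/-! ### The dictionary between coverings and invariant subspaces. -/

section

namespace OMap

noncomputable section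

variable {M : OMap}

theorem Admissible.mono {p m : ℕ} {R R' : Subgroup (FreeGroup Bool)} (hR : Admissible p m M R)
    (h : R ≤ R') (hn : R'.Normal) (hle : R' ≤ M.mon.ker) : Admissible p m M R' :=
  ⟨hn, hle, h hR.X_pow, h hR.Y_sq, fun a ha b hb => h (hR.comm a ha b hb),
    fun a ha => h (hR.exponent a ha)⟩

/-- The functions on the faces of `M` which classify a covering. -/
def coverSpace {p : ℕ} [Fact p.Prime] (n : ℕ) (C : ElemAbCover M p) :
    Submodule (ZMod p) (M.D → ZMod p) := annSpace (ZMod p) n C.N.mon.ker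

theorem factorsThrough_of {p : ℕ} {X : OMap} (ψ : Hom X M) (C : ElemAbCover M p) (x₀ : X.D)
    (h : ∀ w, X.mon w x₀ = x₀ → w ∈ C.N.mon.ker) : FactorsThrough ψ C := by
  obtain ⟨e, he⟩ := C.φ.surjective (ψ.toFun x₀)
  obtain ⟨f, hf⟩ := exists_hom (X := X) (N := C.N) x₀ e (by
    intro w hw
    have h1 : C.N.mon w = 1 := h w hw
    rw [h1]; rfl)
  exact ⟨f, fun d => Hom.ext_of_apply (f := C.φ.comp f) (g := ψ) (d := x₀)
    (by rw [← he, ← hf]; rfl) d⟩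

theorem isQuotientOf_of_ker_le {p : ℕ} {C C' : ElemAbCover M p}
    (h : C'.N.mon.ker ≤ C.N.mon.ker) : C.IsQuotientOf C' := by
  obtain ⟨e⟩ := C'.N.nonempty
  exact factorsThrough_of _ C e fun w hw => h (C'.orientablyRegular.mem_ker hw)

theorem equivalent_of_ker_eq {p : ℕ} {C C' : ElemAbCover M p}
    (h : C.N.mon.ker = C'.N.mon.ker) : C.Equivalent C' := by
  obtain ⟨f, hf⟩ := isQuotientOf_of_ker_le (C := C') (C' := C) h.le
  obtain ⟨g, -⟩ := isQuotientOf_of_ker_le (C := C) (C' := C') h.ge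
  exact ⟨f, f.bijective_of_card_le (Nat.card_le_card_of_surjective _ g.surjective), hf⟩

theorem Iso.ker_eq {N N' : OMap} (h : N.Iso N') : N.mon.ker = N'.mon.ker := by
  obtain ⟨f, hf⟩ := h
  refine le_antisymm f.ker_le fun w hw => ?_
  have hw' : N'.mon w = 1 := hw
  rw [MonoidHom.mem_ker]
  ext d
  apply hf.1
  rw [f.map_mon, hw']; rfl

/-! ### Reversing the orientation -/

/-- The automorphism of the free group which inverts `X` and fixes `Y`. -/
def flip : FreeGroup Bool →* FreeGroup Bool := FreeGroup.lift fun b => cond b gX⁻¹ gY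

theorem mon_mirror (N : OMap) (w : FreeGroup Bool) (d : N.D) :
    N.mirror.mon w d = N.mon (flip w) d := by
  have h : N.mirror.mon = (show FreeGroup Bool →* Equiv.Perm N.D from N.mon.comp flip) := by
    refine FreeGroup.ext_hom _ _ fun b => ?_
    cases b
    · change N.mirror.mon gY = N.mon (flip gY)
      rw [mon_Y]; simp only [flip, FreeGroup.lift_apply_of, cond_false, mon_Y]; rfl
    · change N.mirror.mon gX = N.mon (flip gX)
      rw [mon_X]; simp only [flip, FreeGroup.lift_apply_of, cond_true, map_inv, mon_X]; rfl
  rw [h]; rfl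

/-- The monodromy of the mirror image is that of N composed with `flip`, and an orientably regular
map is determined by its kernel. -/
theorem regular_iff_ker (N : OMap) (hN : N.OrientablyRegular) :
    N.Regular ↔ ∀ w ∈ N.mon.ker, flip w ∈ N.mon.ker := by
  constructor
  · intro h w hw
    have h2 : w ∈ N.mirror.mon.ker := Iso.ker_eq h ▸ hw
    have h2' : N.mirror.mon w = 1 := h2
    rw [MonoidHom.mem_ker]
    ext d
    rw [← mon_mirror, h2']; rfl
  · intro h
    obtain ⟨d⟩ := N.nonempty
    obtain ⟨f, -⟩ := exists_hom (X := N) (N := N.mirror) d d (by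
      intro w hw
      have h1 : N.mon (flip w) = 1 := h w (hN.mem_ker hw)
      rw [mon_mirror, h1]; rfl)
    exact ⟨f, f.bijective_of_card_le le_rfl⟩

/-- A reflection as an isomorphism to the mirror image. -/
def Reflection.toHom (s : Reflection M) : Hom M M.mirror where
  toFun d := M.y (s.r d)
  map_x d := by
    change M.y (s.r (M.x d)) = M.x⁻¹ (M.y (s.r d))
    have h1 : s.r (M.x d) = M.z (s.r (M.y d)) := by
      have h2 := s.map_z (M.z⁻¹ (M.y d))
      rw [perm_apply_inv] at h2
      rw [h2, perm_apply_inv, x_eq]; rfl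
    rw [h1, s.map_y, ← y_mul_z]; rfl
  map_y d := by
    change M.y (s.r (M.y d)) = M.y (M.y (s.r d))
    rw [s.map_y]

/-- A reflection runs around the faces backwards, which does not affect the sum; the sign comes from
y and skewness. -/
theorem faceSum_comp_reflection {k : Type} [Field k] {n : ℕ} (hz : M.z ^ n = 1) (s : Reflection M)
    {v : M.D → k} (hv : v ∈ skew k M) :
    faceSum k M n (fun d => v (M.y (s.r d))) = -fun d => faceSum k M n v (s.r d) := by
  have h1 : ∀ i d, s.r ((M.z ^ i) d) = (M.z⁻¹ ^ i) (s.r d) := by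
    intro i d
    induction i generalizing d with
    | zero => simp
    | succ i ih =>
      rw [pow_succ, Equiv.Perm.mul_apply, ih, s.map_z, pow_succ, Equiv.Perm.mul_apply]
  funext d
  change ∑ i ∈ Finset.range n, v (M.y (s.r ((M.z ^ i) d))) = -faceSum k M n v (s.r d)
  rw [← faceSum_mem_fixSub hz v (s.r d)]
  change _ = -∑ i ∈ Finset.range n, v ((M.z ^ i) (M.z (s.r d)))
  rw [← Finset.sum_neg_distrib, ← Finset.sum_range_reflect]
  refine Finset.sum_congr rfl fun i hi => ?_
  rw [hv, h1]
  congr 2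
  rw [← Equiv.Perm.mul_apply (M.z ^ i) M.z, ← pow_succ]
  congr 1
  rw [Finset.mem_range] at hi
  rw [inv_pow, inv_eq_iff_mul_eq_one, ← pow_add, ← hz]
  congr 1
  omega

theorem tau_comp_reflection {k : Type} [Field k] (s : Reflection M) (v : M.D → k)
    (w : FreeGroup Bool) (d : M.D) :
    tau (fun d => v (M.y (s.r d))) w d = tau v (flip w) (M.y (s.r d)) := by
  have h1 : ∀ w d, M.y (s.r (M.mon w d)) = M.mon (flip w) (M.y (s.r d)) := by
    intro w d
    rw [← mon_mirror]
    exact s.toHom.map_mon w d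
  refine (eq_tau (c := fun w d => tau v (flip w) (M.y (s.r d))) (fun w w' d => ?_) (fun d => ?_)
    (fun d => ?_) w d).symm
  · simp only [map_mul, tau_mul, h1]
  · simp [flip, tau_inv]
  · simp [flip]

namespace IsPlatonicCoprime

variable {p n m : ℕ} [Fact p.Prime] (H : IsPlatonicCoprime p M n m)

local notation "𝕂" => ZMod p

include H

theorem coverSpace_le (C : ElemAbCover M p) : coverSpace n C ≤ faceSpace 𝕂 M := H.annSpace_le _

omit H in
theorem coverSpace_inv (C : ElemAbCover M p) : Inv (coverSpace n C) := annSpace_inv n _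

theorem annKer_coverSpace (C : ElemAbCover M p) : annKer n (coverSpace n C) = C.N.mon.ker :=
  H.annKer_annSpace (H.admissible C)

theorem finrank_coverSpace (C : ElemAbCover M p) : Module.finrank 𝕂 (coverSpace n C) = C.c := by
  have h1 := H.relIndex_eq (H.admissible C)
  rw [← card_deck C.orientablyRegular H.regular C.φ, C.deck_card] at h1
  exact (Nat.pow_right_injective (Fact.out : p.Prime).two_le h1).symm

theorem exists_coverSpace_eq {W : Submodule 𝕂 (M.D → 𝕂)} (hW : W ≤ faceSpace 𝕂 M) (hI : Inv W) :
    ∃ C : ElemAbCover M p, coverSpace n C = W := by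
  obtain ⟨C, hC⟩ := H.exists_cover (H.admissible_annKer W)
  exact ⟨C, by rw [coverSpace, hC, H.annSpace_annKer hW hI]⟩

theorem ker_le_of_coverSpace_le {C C' : ElemAbCover M p} (h : coverSpace n C ≤ coverSpace n C') :
    C'.N.mon.ker ≤ C.N.mon.ker := by
  rw [← H.annKer_coverSpace C, ← H.annKer_coverSpace C']
  exact annKer_anti n h

theorem isQuotientOf_of_le {C C' : ElemAbCover M p} (h : coverSpace n C ≤ coverSpace n C') :
    C.IsQuotientOf C' := isQuotientOf_of_ker_le (H.ker_le_of_coverSpace_le h)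

theorem equivalent_of_eq {C C' : ElemAbCover M p} (h : coverSpace n C = coverSpace n C') :
    C.Equivalent C' :=
  equivalent_of_ker_eq (le_antisymm (H.ker_le_of_coverSpace_le h.ge) (H.ker_le_of_coverSpace_le h.le))

omit H in
theorem coverSpace_eq_of_iso {C C' : ElemAbCover M p} (h : C.N.Iso C'.N) :
    coverSpace n C = coverSpace n C' := by rw [coverSpace, coverSpace, Iso.ker_eq h]

/-- The correspondence reverses inclusions, so sums of subspaces match intersections of kernels. The
covering X in the definition of a join is arbitrary, perhaps not orientably regular, so its dart
stabiliser is tested one word at a time. -/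
theorem isJoin_of_eq {ι : Type} {C : ElemAbCover M p} {I : ι → ElemAbCover M p} {S : Finset ι}
    (h : coverSpace n C = ⨆ i ∈ S, coverSpace n (I i)) : C.IsJoin I S := by
  refine ⟨fun i hi => H.isQuotientOf_of_le ?_, fun X ψ hψ => ?_⟩
  · rw [h]
    exact le_biSup (fun i => coverSpace n (I i)) hi
  · obtain ⟨x₀⟩ := X.nonempty
    refine factorsThrough_of ψ C x₀ fun w hw => ?_
    have hK : w ∈ M.mon.ker := by
      apply H.regular.mem_ker (d := ψ.toFun x₀)
      rw [← ψ.map_mon, hw]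
    have hz : Subgroup.zpowers w ≤ M.mon.ker := by rwa [Subgroup.zpowers_le]
    rw [← H.annKer_coverSpace C, ← Subgroup.zpowers_le,
      H.le_annKer_iff hz (H.coverSpace_le C), h]
    refine iSup₂_le fun i hi => ?_
    rw [← H.le_annKer_iff hz (H.coverSpace_le _), H.annKer_coverSpace, Subgroup.zpowers_le]
    obtain ⟨f, -⟩ := hψ i hi
    apply (I i).orientablyRegular.mem_ker (d := f.toFun x₀)
    rw [← f.map_mon, hw]

theorem ker_le_annKer_bot : M.mon.ker ≤ annKer n (⊥ : Submodule 𝕂 (M.D → 𝕂)) := by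
  intro g hg
  refine ⟨hg, fun v hv h d => ?_⟩
  rw [Submodule.mem_bot] at h
  rw [H.tau_eq_of_faceSum_eq hv (zero_mem _) (by rw [h, map_zero]) hg]
  exact (tauLin g d).map_zero

/-- A normal subgroup of Aut⁺ N inside the covering group corresponds to an admissible subgroup
between the kernels of N and M, and hence to an invariant subspace of the space of the covering. -/
theorem irreducible_of {C : ElemAbCover M p} (hne : coverSpace n C ≠ ⊥)
    (hs : ∀ W ≤ coverSpace n C, Inv W → W = ⊥ ∨ W = coverSpace n C) : C.Irreducible := by
  refine ⟨?_, fun G hG hGd => ?_⟩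
  · rw [← H.finrank_coverSpace C, Nat.one_le_iff_ne_zero]
    exact fun h => hne (Submodule.finrank_eq_zero.1 h)
  · obtain ⟨e₀⟩ := C.N.nonempty
    -- The words which move the base dart in the same way as some element of G does.
    let R : Subgroup (FreeGroup Bool) :=
      { carrier := {w | ∃ a ∈ G, C.N.mon w e₀ = a.1 e₀}
        mul_mem' := by
          rintro v w ⟨a, ha, hva⟩ ⟨b, hb, hwb⟩
          refine ⟨b * a, mul_mem hb ha, ?_⟩
          rw [map_mul, Equiv.Perm.mul_apply, hwb, ← aut_mon b.2, hva]; rfl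
        one_mem' := ⟨1, one_mem _, by simp⟩
        inv_mem' := by
          rintro v ⟨a, ha, hva⟩
          refine ⟨a⁻¹, inv_mem ha, ?_⟩
          rw [map_inv, Equiv.Perm.inv_eq_iff_eq, ← aut_mon a⁻¹.2, hva]
          exact (perm_inv_apply a.1 e₀).symm }
    have hRn : R.Normal := by
      refine ⟨?_⟩
      rintro w ⟨a, ha, hwa⟩ u
      obtain ⟨b, hb, hbe⟩ := C.orientablyRegular e₀ (C.N.mon u⁻¹ e₀)
      refine ⟨⟨b, hb⟩ * a * ⟨b, hb⟩⁻¹, hG.conj_mem a ha _, ?_⟩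
      have h1 : b⁻¹ e₀ = C.N.mon u e₀ := by
        rw [Equiv.Perm.inv_eq_iff_eq, aut_mon hb, hbe, map_inv, perm_apply_inv]
      rw [map_mul, map_mul, Equiv.Perm.mul_apply, Equiv.Perm.mul_apply, ← hbe, ← aut_mon hb,
        ← aut_mon hb, hwa, ← aut_mon a.2, ← h1]
      rfl
    have hle : C.N.mon.ker ≤ R := fun w hw => ⟨1, one_mem _, by
      have h1 : C.N.mon w = 1 := hw
      rw [h1]; rfl⟩
    have hRK : R ≤ M.mon.ker := by
      rintro w ⟨a, ha, hwa⟩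
      apply H.regular.mem_ker (d := C.φ.toFun e₀)
      rw [← C.φ.map_mon, hwa]
      exact hGd ha e₀
    have hadm := (H.admissible C).mono hle hRn hRK
    have hker := H.annKer_annSpace hadm
    rcases hs (annSpace 𝕂 n R) (annSpace_anti n hle) (annSpace_inv n R) with h | h
    · right
      refine le_antisymm hGd fun a ha => ?_
      obtain ⟨w, hw⟩ := C.N.exists_mon e₀ (a.1 e₀)
      have hwK : w ∈ M.mon.ker := by
        apply H.regular.mem_ker (d := C.φ.toFun e₀)
        rw [← C.φ.map_mon, hw]
        exact ha e₀
      rw [h] at hker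
      have hwR : w ∈ R := hker ▸ H.ker_le_annKer_bot hwK
      obtain ⟨b, hb, hwb⟩ := hwR
      have : a = b := Subtype.ext (aut_eq_of_apply_eq a.2 b.2 (hw.symm.trans hwb))
      exact this ▸ hb
    · left
      rw [h, H.annKer_coverSpace C] at hker
      rw [Subgroup.eq_bot_iff_forall]
      intro a ha
      obtain ⟨w, hw⟩ := C.N.exists_mon e₀ (a.1 e₀)
      have hwR : w ∈ R := ⟨a, ha, hw⟩
      rw [← hker] at hwR
      have h1 : C.N.mon w = 1 := hwR
      rw [h1] at hw
      exact Subtype.ext (aut_eq_of_apply_eq a.2 (one_mem _) hw.symm)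

/-- Composition with the reflection translates stability of the kernel under `flip` into stability
of the face functions; the sign in `faceSum_comp_reflection` does not matter for a subspace. -/
theorem regular_iff (s : Reflection M) (C : ElemAbCover M p) :
    C.N.Regular ↔ ∀ f ∈ coverSpace n C, (fun d => f (s.r d)) ∈ coverSpace n C := by
  rw [regular_iff_ker _ C.orientablyRegular]
  have hskew : ∀ v ∈ skew 𝕂 M, (fun d => v (M.y (s.r d))) ∈ skew 𝕂 M := fun v hv d => by
    change v (M.y (s.r (M.y d))) = -v (M.y (s.r d))
    rw [s.map_y, hv]
  constructor
  · rintro h _ ⟨v, hv, rfl⟩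
    rw [← neg_mem_iff]
    refine ⟨fun d => v (M.y (s.r d)), ⟨hskew v hv.1, fun g hg d => ?_⟩,
      faceSum_comp_reflection H.type.z_pow s hv.1⟩
    rw [tau_comp_reflection, hv.2 _ (h g hg)]
  · intro h g hg
    have hgM : M.mon g = 1 := C.φ.ker_le hg
    have hsurj : ∀ d, ∃ d', M.y (s.r d') = d := fun d =>
      ⟨s.r.symm (M.y d), by rw [Equiv.apply_symm_apply, M.y_invol]⟩
    rw [← H.annKer_coverSpace C] at hg ⊢
    refine ⟨?_, fun v hv hvW d => ?_⟩
    · rw [MonoidHom.mem_ker]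
      ext d
      obtain ⟨d', rfl⟩ := hsurj d
      rw [← mon_mirror]
      have h1 := s.toHom.map_mon g d'
      rw [hgM] at h1
      exact h1.symm
    · obtain ⟨d', rfl⟩ := hsurj d
      rw [← tau_comp_reflection]
      refine hg.2 _ (hskew v hv) ?_ d'
      rw [faceSum_comp_reflection H.type.z_pow s hv, neg_mem_iff]
      exact h _ hvW

/-- The face length is a multiple of n dividing n p. If it were n for one dart, Z^n would lie in the
kernel of the covering, all face sums in its space would vanish, and the rank would be 0. -/
theorem hasType_cover (C : ElemAbCover M p) (hc : 1 ≤ C.c) : C.N.HasType (n * p) m := by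
  intro d
  refine ⟨?_, by rw [C.unbranched_vertices, (H.type _).2]⟩
  have hK : gZ ^ n ∈ M.mon.ker := by rw [MonoidHom.mem_ker, map_pow, mon_Z, H.type.z_pow]
  have h1 : Function.minimalPeriod C.N.z d ∣ n * p := by
    apply Function.IsPeriodicPt.minimalPeriod_dvd
    change C.N.z^[n * p] d = d
    have h2 : C.N.mon ((gZ ^ n) ^ p) = 1 := (H.admissible C).exponent _ hK
    rw [Equiv.Perm.iterate_eq_pow, ← mon_Z, ← map_pow, pow_mul, h2]; rfl
  have h2 : n ∣ Function.minimalPeriod C.N.z d := by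
    rw [← (H.type (C.φ.toFun d)).1]
    apply Function.IsPeriodicPt.minimalPeriod_dvd
    change M.z^[_] _ = _
    rw [Equiv.Perm.iterate_eq_pow, ← mon_Z, ← map_pow, ← C.φ.map_mon, map_pow, mon_Z,
        ← Equiv.Perm.iterate_eq_pow, Function.iterate_minimalPeriod]
  obtain ⟨j, hj⟩ := h2
  rw [hj] at h1 ⊢
  have h3 := Nat.dvd_of_mul_dvd_mul_left H.type.n_pos h1
  rcases (Nat.dvd_prime Fact.out).1 h3 with rfl | rfl
  · exfalso
    have h4 : gZ ^ n ∈ C.N.mon.ker := by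
      apply C.orientablyRegular.mem_ker (d := d)
      rw [map_pow, mon_Z, ← Equiv.Perm.iterate_eq_pow]
      rw [mul_one] at hj
      rw [← hj, Function.iterate_minimalPeriod]
    have h5 : coverSpace n C = ⊥ := by
      rw [Submodule.eq_bot_iff]
      rintro _ ⟨v, hv, rfl⟩
      funext e
      have := hv.2 _ h4 e
      rw [tau_Z_pow_eq H.type.z_pow] at this
      exact neg_eq_zero.1 this
    have h6 := H.finrank_coverSpace C
    rw [h5, finrank_bot] at h6
    omega
  · rfl

omit [Fact p.Prime] in
theorem card_cover (C : ElemAbCover M p) : Nat.card C.N.D = Nat.card M.D * p ^ C.c := by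
  have h1 : ∀ N : OMap, N.OrientablyRegular → N.mon.ker.index = Nat.card N.D := by
    intro N hN
    rw [Subgroup.index_ker]
    obtain ⟨d⟩ := N.nonempty
    refine Nat.card_congr (Equiv.ofBijective (fun g : N.mon.range => g.1 d) ⟨?_, ?_⟩)
    · rintro ⟨_, v, rfl⟩ ⟨_, w, rfl⟩ h
      exact Subtype.ext (hN.mon_eq h)
    · intro e
      obtain ⟨w, hw⟩ := N.exists_mon d e
      exact ⟨⟨_, w, rfl⟩, hw⟩
  rw [← h1 _ C.orientablyRegular, ← h1 _ H.regular,
    ← Subgroup.relIndex_mul_index C.φ.ker_le, ← card_deck C.orientablyRegular H.regular C.φ,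
    C.deck_card, mul_comm]

theorem genus_cover (C : ElemAbCover M p) (hc : 1 ≤ C.c) :
    C.N.genus = ((M.numFaces : ℚ) / 2 - 1) * (p : ℚ) ^ C.c
        - (M.numFaces : ℚ) / 2 * (p : ℚ) ^ (C.c - 1) + 1 := by
  have h1 := (H.hasType_cover C hc).euler_char
  have h2 := H.type.card_eq H.genus_eq
  have h3 := H.type.numFaces_mul
  have hn : (n : ℚ) ≠ 0 := by exact_mod_cast H.type.n_pos.ne'
  have hm : (m : ℚ) ≠ 0 := by exact_mod_cast H.type.m_pos.ne'
  have hp : (p : ℚ) ≠ 0 := by exact_mod_cast (Fact.out : p.Prime).ne_zero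
  rw [genus, h1, H.card_cover C]
  -- The subtraction in the exponent is that of natural numbers, so positivity of the rank matters
  -- here.
  obtain ⟨c, hc'⟩ : ∃ c, C.c = c + 1 := ⟨C.c - 1, by omega⟩
  rw [hc', Nat.add_sub_cancel]
  have h4 : (Nat.card M.D : ℚ) = M.numFaces * n := by exact_mod_cast h3.symm
  rw [h4] at h2
  push_cast
  rw [h4, pow_succ]
  have h5 : (M.numFaces : ℚ) * n * (1 / m - 1 / 2) = 2 - M.numFaces := by
    have : (M.numFaces : ℚ) * n * (1 / n) = M.numFaces := by field_simp
    linear_combination h2 - this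
  have h6 : (M.numFaces : ℚ) * n * (p ^ c * p) * (1 / (n * p)) = M.numFaces * p ^ c := by
    field_simp
  linear_combination (-(p : ℚ) ^ c * p / 2) * h5 - h6 / 2

/-- The classification of the coverings by invariant subspaces. -/
theorem exists_classification {ι : Type} (W : ι → Submodule 𝕂 (M.D → 𝕂))
    (hle : ∀ i, W i ≤ faceSpace 𝕂 M) (hI : ∀ i, Inv (W i)) (hne : ∀ i, W i ≠ ⊥)
    (hinj : Function.Injective W)
    (hall : ∀ V ≤ faceSpace 𝕂 M, Inv V → V ≠ ⊥ → ∃ i, V = W i) :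
    ∃ L : ι → ElemAbCover M p, IsClassification L ∧ (∀ i, coverSpace n (L i) = W i) ∧
      ∀ i, (L i).c = Module.finrank 𝕂 (W i) := by
  choose L hL using fun i => H.exists_coverSpace_eq (hle i) (hI i)
  have hc : ∀ i, (L i).c = Module.finrank 𝕂 (W i) := fun i => by
    rw [← H.finrank_coverSpace, hL]
  refine ⟨L, ⟨fun i => ?_, fun i j h => ?_, fun C hC => ?_⟩, hL, hc⟩
  · rw [hc, Nat.one_le_iff_ne_zero]
    exact fun h => hne i (Submodule.finrank_eq_zero.1 h)
  · apply hinj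
    rw [← hL, ← hL, coverSpace_eq_of_iso h]
  · obtain ⟨i, hi⟩ := hall (coverSpace n C) (H.coverSpace_le C) (coverSpace_inv C) (fun h => by
      have := H.finrank_coverSpace C
      rw [h, finrank_bot] at this
      omega)
    exact ⟨i, H.equivalent_of_eq (hi.trans (hL i).symm)⟩

theorem exists_universal : ∃ C₀ : ElemAbCover M p, C₀.c + 1 = M.numFaces ∧
    ∀ C : ElemAbCover M p, C.IsQuotientOf C₀ := by
  obtain ⟨C₀, h⟩ := H.exists_coverSpace_eq (W := faceSpace 𝕂 M) le_rfl (by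
    rintro a ha f ⟨hf, hf'⟩
    refine ⟨fun d => ?_, ?_⟩
    · change f (a (M.z d)) = f (a d)
      rw [aut_z ha, hf]
    · exact (total_comp a f).trans hf')
  refine ⟨C₀, ?_, fun C => H.isQuotientOf_of_le (by rw [h]; exact H.coverSpace_le C)⟩
  rw [← H.finrank_coverSpace, h, finrank_faceSpace H.card_ne]

end IsPlatonicCoprime

end

end OMap

end

section

open Polynomial

namespace OMap

noncomputable section

variable {k : Type} [Field k] {M : OMap}

/-! ### Hecke operators on the functions on the faces -/

/-- `f ↦ ∑ s < n, f (g (z ^ s d))`. -/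
def hecke (k : Type) [Field k] {M : OMap} (n : ℕ) (g : Equiv.Perm M.D) :
    (M.D → k) →ₗ[k] (M.D → k) where
  toFun f d := ∑ s ∈ Finset.range n, f (g ((M.z ^ s) d))
  map_add' f f' := by funext d; simp [Finset.sum_add_distrib]
  map_smul' c f := by funext d; simp [Finset.mul_sum]

theorem hecke_apply (n : ℕ) (g : Equiv.Perm M.D) (f : M.D → k) (d : M.D) :
    hecke k n g f d = ∑ s ∈ Finset.range n, f (g ((M.z ^ s) d)) := rfl

theorem hecke_eq_faceSum (n : ℕ) (g : Equiv.Perm M.D) (f : M.D → k) :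
    hecke k n g f = faceSum k M n (fun d => f (g d)) := rfl

theorem hecke_hecke (n : ℕ) (v w : Equiv.Perm M.D) (f : M.D → k) :
    hecke k n v (hecke k n w f) = ∑ t ∈ Finset.range n, hecke k n (w * M.z ^ t * v) f := by
  funext d
  rw [Finset.sum_apply, hecke_apply]
  simp only [hecke_apply, Equiv.Perm.mul_apply]
  exact Finset.sum_comm

/-- Together with `hecke_zpow_mul`: on functions on the faces the operator depends only on the
double coset of g for the face rotations. -/
theorem hecke_mul_zpow {n : ℕ} (hz : M.z ^ n = 1) (g : Equiv.Perm M.D) (i : ℤ) (f : M.D → k) :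
    hecke k n (g * M.z ^ i) f = hecke k n g f := by
  funext d
  rw [hecke_eq_faceSum, hecke_eq_faceSum]
  have h := fixSub_zpow k (faceSum_mem_fixSub hz (fun d => f (g d))) i d
  rw [← h]
  change ∑ s ∈ Finset.range n, f (g ((M.z ^ i) ((M.z ^ s) d))) =
    ∑ s ∈ Finset.range n, f (g ((M.z ^ s) ((M.z ^ i) d)))
  refine Finset.sum_congr rfl fun s _ => ?_
  rw [← Equiv.Perm.mul_apply (M.z ^ i), ← Equiv.Perm.mul_apply (M.z ^ s), ← zpow_natCast,
    zpow_mul_comm]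

theorem hecke_zpow_mul (n : ℕ) (g : Equiv.Perm M.D) (i : ℤ) {f : M.D → k}
    (hf : f ∈ fixSub k M.z) : hecke k n (M.z ^ i * g) f = hecke k n g f := by
  funext d
  simp only [hecke_apply, Equiv.Perm.mul_apply, fixSub_zpow k hf]

theorem hecke_one (n : ℕ) {f : M.D → k} (hf : f ∈ fixSub k M.z) :
    hecke k n 1 f = (n : k) • f := faceSum_of_mem_fixSub n hf

theorem hecke_mem_faceSpace {n : ℕ} (hz : M.z ^ n = 1) (g : Equiv.Perm M.D) {f : M.D → k}
    (hf : f ∈ faceSpace k M) : hecke k n g f ∈ faceSpace k M := by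
  refine ⟨faceSum_mem_fixSub hz fun d => f (g d), ?_⟩
  change total k M _ = 0
  rw [hecke_eq_faceSum, total_faceSum, total_comp]
  have : total k M f = 0 := hf.2
  rw [this, mul_zero]

theorem hecke_comp_aut (n : ℕ) {a : Equiv.Perm M.D} (ha : a ∈ M.aut) (w : FreeGroup Bool)
    (f : M.D → k) :
    hecke k n (M.mon w) (fun d => f (a d)) = fun d => hecke k n (M.mon w) f (a d) := by
  funext d
  simp only [hecke_apply, ← mon_Z, ← map_pow, aut_mon ha]

theorem Reflection.map_z_pow (s : Reflection M) (i : ℕ) (d : M.D) :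
    s.r ((M.z ^ i) d) = (M.z⁻¹ ^ i) (s.r d) := by
  induction i generalizing d with
  | zero => simp
  | succ i ih =>
    rw [pow_succ, Equiv.Perm.mul_apply, ih, s.map_z, pow_succ, Equiv.Perm.mul_apply]

theorem hecke_comp_reflection {n : ℕ} (hz : M.z ^ n = 1) (s : Reflection M) {g g' : Equiv.Perm M.D}
    (hg : ∀ d, s.r (g d) = g' (s.r d)) (f : M.D → k) :
    hecke k n g (fun d => f (s.r d)) = fun d => hecke k n g' f (s.r d) := by
  funext d
  rw [← hecke_mul_zpow hz g' 1 f, hecke_apply, hecke_apply, ← Finset.sum_range_reflect]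
  refine Finset.sum_congr rfl fun i hi => ?_
  rw [hg, s.map_z_pow, zpow_one, Equiv.Perm.mul_apply, ← Equiv.Perm.mul_apply M.z, ← pow_succ']
  congr 3
  rw [Finset.mem_range] at hi
  rw [inv_pow, inv_eq_iff_mul_eq_one, ← pow_add, ← hz]
  congr 1
  omega

/-- Maschke's theorem, with the equivariant projection written in Hecke operators. -/
theorem exists_projection (hM : M.OrientablyRegular) {n : ℕ} (hn : (n : k) ≠ 0)
    (hD : (Nat.card M.D : k) ≠ 0) {W : Submodule k (M.D → k)} (hW : W ≤ fixSub k M.z)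
    (hI : Inv W) : ∃ (β : M.D → k) (w : M.D → FreeGroup Bool),
      (∀ f, ∑ e, β e • hecke k n (M.mon (w e)) f ∈ W) ∧
      ∀ f ∈ W, ∑ e, β e • hecke k n (M.mon (w e)) f = f := by
  have : Fintype M.aut := Fintype.ofFinite _
  have hcard : (Fintype.card M.aut : k) ≠ 0 := by
    rwa [← Nat.card_eq_fintype_card, card_aut hM]
  obtain ⟨π₀, hπ₀⟩ := LinearMap.exists_leftInverse_of_injective W.subtype (Submodule.ker_subtype W)
  let act (a : M.aut) : (M.D → k) →ₗ[k] (M.D → k) := LinearMap.funLeft k k a.1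
  -- The average of an arbitrary linear projection over the automorphisms, whose number is that of
  -- the darts and so invertible.
  let π : (M.D → k) →ₗ[k] (M.D → k) :=
    (Fintype.card M.aut : k)⁻¹ • ∑ a : M.aut, (act a⁻¹).comp ((W.subtype.comp π₀).comp (act a))
  have hπ : ∀ f, π f = (Fintype.card M.aut : k)⁻¹ • ∑ a : M.aut, act a⁻¹ (π₀ (act a f)).1 := by
    intro f
    simp [π, LinearMap.sum_apply]
  have hmem : ∀ f, π f ∈ W := fun f => by
    rw [hπ]
    exact Submodule.smul_mem _ _ (Submodule.sum_mem _ fun a _ => hI _ (a⁻¹).2 _ (π₀ (act a f)).2)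
  have hid : ∀ f ∈ W, π f = f := fun f hf => by
    have h1 : ∀ a : M.aut, act a⁻¹ (π₀ (act a f)).1 = f := by
      intro a
      have h2 : (π₀ (act a f)).1 = act a f :=
        congrArg Subtype.val (LinearMap.congr_fun hπ₀ ⟨act a f, hI a.1 a.2 f hf⟩)
      rw [h2]
      funext d
      exact congrArg f (perm_apply_inv a.1 d)
    rw [hπ, Finset.sum_congr rfl fun a _ => h1 a]
    rw [Finset.sum_const, Finset.card_univ, ← Nat.cast_smul_eq_nsmul k, smul_smul,
      inv_mul_cancel₀ hcard, one_smul]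
  have hequiv : ∀ (b : M.aut) f, π (act b f) = act b (π f) := by
    intro b f
    rw [hπ, hπ, map_smul, map_sum]
    congr 1
    refine Fintype.sum_equiv (Equiv.mulLeft b) _ _ fun a => ?_
    funext d
    change (π₀ (act a (act b f))).1 (a⁻¹.1 d) = (π₀ (act (b * a) f)).1 ((b * a)⁻¹.1 (b.1 d))
    have h1 : act a (act b f) = act (b * a) f := rfl
    rw [h1]
    refine congrArg (π₀ (act (b * a) f)).1 ?_
    change a.1⁻¹ d = (b.1 * a.1)⁻¹ (b.1 d)
    rw [mul_inv_rev, Equiv.Perm.mul_apply, perm_inv_apply]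
  obtain ⟨d₀⟩ := M.nonempty
  choose w hw using M.exists_mon d₀
  -- An equivariant operator is determined by its matrix row at `d₀`; automorphisms transport the
  -- row to every other dart, where it is a combination of monodromy translates.
  have hsum : ∀ f d, π f d = ∑ e, π (Pi.single e 1) d₀ * f (M.mon (w e) d) := by
    intro f d
    obtain ⟨a, ha, rfl⟩ := hM d₀ d
    have h1 : π f (a d₀) = π (act ⟨a, ha⟩ f) d₀ := (congrFun (hequiv ⟨a, ha⟩ f) d₀).symm
    have h2 : act ⟨a, ha⟩ f = ∑ e, f (a e) • (Pi.single e (1 : k) : M.D → k) := by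
      funext e; simp [act, Finset.sum_apply, Pi.single_apply, LinearMap.funLeft_apply]
    rw [h1, h2, map_sum, Finset.sum_apply]
    refine Finset.sum_congr rfl fun e _ => ?_
    rw [map_smul, Pi.smul_apply, smul_eq_mul, mul_comm, ← aut_mon ha, hw]
  -- The image of π already consists of functions on the faces, so averaging over the n rotations of
  -- a face changes nothing and produces Hecke operators.
  have hB : ∀ f, ∑ e, ((n : k)⁻¹ * π (Pi.single e 1) d₀) • hecke k n (M.mon (w e)) f = π f := by
    intro f
    have h1 := faceSum_of_mem_fixSub n (hW (hmem f))
    have h2 : π f = (n : k)⁻¹ • faceSum k M n (π f) := by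
      rw [h1, smul_smul, inv_mul_cancel₀ hn, one_smul]
    rw [h2]
    funext d
    rw [Finset.sum_apply]
    change _ = (n : k)⁻¹ * ∑ s ∈ Finset.range n, π f ((M.z ^ s) d)
    simp_rw [hsum f]
    rw [Finset.sum_comm, Finset.mul_sum]
    refine Finset.sum_congr rfl fun e _ => ?_
    rw [← Finset.mul_sum, ← mul_assoc]
    rfl
  exact ⟨fun e => (n : k)⁻¹ * π (Pi.single e 1) d₀, w, fun f => by rw [hB]; exact hmem f,
    fun f hf => by rw [hB]; exact hid f hf⟩

/-! ### Polynomials in an endomorphism -/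

section poly

variable {V : Type} [AddCommGroup V] [Module k V]

theorem aeval_apply_comm {T A : V →ₗ[k] V} (h : ∀ f, A (T f) = T (A f)) (q : k[X]) (f : V) :
    A (aeval T q f) = aeval T q (A f) := by
  have h1 : Commute A T := LinearMap.ext h
  have h2 : Commute A (aeval T q) := by
    rw [aeval_eq_sum_range]
    exact Commute.sum_right _ _ _ fun i _ => (h1.pow_right i).smul_right _
  exact LinearMap.congr_fun h2 f

theorem aeval_mem {T : V →ₗ[k] V} {P : Submodule k V} (hP : ∀ f ∈ P, T f ∈ P) (q : k[X]) {f : V}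
    (hf : f ∈ P) : aeval T q f ∈ P := by
  have h1 : ∀ i : ℕ, (T ^ i) f ∈ P := by
    intro i
    induction i with
    | zero => simpa
    | succ i ih => rw [pow_succ']; exact hP _ ih
  rw [aeval_eq_sum_range, LinearMap.sum_apply]
  exact Submodule.sum_mem _ fun i _ => Submodule.smul_mem _ _ (h1 i)

/-- The kernel of `q (T)` in an invariant subspace. -/
def kerIn (T : V →ₗ[k] V) (P : Submodule k V) (q : k[X]) : Submodule k V :=
  LinearMap.ker (aeval T q) ⊓ P

theorem mem_kerIn {T : V →ₗ[k] V} {P : Submodule k V} {q : k[X]} {f : V} :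
    f ∈ kerIn T P q ↔ aeval T q f = 0 ∧ f ∈ P := Iff.rfl

theorem aeval_mul_apply (T : V →ₗ[k] V) (q r : k[X]) (f : V) :
    aeval T (q * r) f = aeval T q (aeval T r f) := by rw [map_mul]; rfl

/-- Any element of `P` is a sum of images under the primary idempotents. -/
theorem exists_idempotents {ι : Type} [Fintype ι] [DecidableEq ι] {μ : ι → k[X]}
    (hcop : Pairwise fun i j => IsCoprime (μ i) (μ j)) {T : V →ₗ[k] V} [Nonempty ι] :
    ∃ e : ι → k[X], (∀ f : V, f = ∑ j, aeval T (e j) f) ∧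
      (∀ j, ∏ i, μ i ∣ μ j * e j) ∧ ∀ i j, i ≠ j → μ i ∣ e j := by
  obtain ⟨c, hc⟩ := exists_sum_eq_one_iff_pairwise_coprime'.2 hcop
  refine ⟨fun j => c j * ∏ i ∈ {j}ᶜ, μ i, fun f => ?_, fun j => ?_,
    fun i j hij => ?_⟩
  · rw [← LinearMap.sum_apply, ← map_sum, hc]; simp
  · refine ⟨c j, ?_⟩
    beta_reduce
    rw [← Finset.mul_prod_erase Finset.univ μ (Finset.mem_univ j), Finset.compl_eq_univ_sdiff,
      Finset.erase_eq]
    ring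
  · refine Dvd.dvd.mul_left (Finset.dvd_prod_of_mem μ ?_) _
    simpa using hij

/-- On the kernel of μ(T) the algebra of polynomials in T acts through the field k[X]/(μ). The
element q fixes a non-zero vector, so it is not 0 there; it is therefore invertible, and its image
is the whole component. -/
theorem kerIn_le_of_projection {T : V →ₗ[k] V} {P W : Submodule k V} (hP : ∀ f ∈ P, T f ∈ P)
    {μ q : k[X]} (hμ : Irreducible μ) (h1 : ∀ f ∈ kerIn T P μ, aeval T q f ∈ W)
    (h2 : ∀ f ∈ W, f ∈ kerIn T P μ → aeval T q f = f) {f : V} (hfW : f ∈ W)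
    (hf : f ∈ kerIn T P μ) (hne : f ≠ 0) : kerIn T P μ ≤ W := by
  have hnd : ¬ μ ∣ q := by
    rintro ⟨r, rfl⟩
    have h3 := h2 f hfW hf
    rw [mul_comm, aeval_mul_apply, hf.1, map_zero] at h3
    exact hne h3.symm
  obtain ⟨a, b, hab⟩ := (hμ.coprime_iff_not_dvd.2 hnd)
  intro g hg
  have h4 : aeval T q (aeval T b g) = g := by
    have h5 : aeval T (a * μ + b * q) g = g := by rw [hab]; simp
    rw [map_add, LinearMap.add_apply, aeval_mul_apply, mem_kerIn.1 hg |>.1, map_zero, zero_add,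
      mul_comm, aeval_mul_apply] at h5
    exact h5
  rw [← h4]
  refine h1 _ ⟨?_, aeval_mem hP _ hg.2⟩
  change aeval T μ (aeval T b g) = 0
  rw [← aeval_mul_apply, mul_comm, aeval_mul_apply, mem_kerIn.1 hg |>.1, map_zero]

/-- The subspaces which are images of projections in `k[T]` are sums of primary components. -/
theorem eq_iSup_kerIn {ι : Type} [Fintype ι] {T : V →ₗ[k] V} {P : Submodule k V}
    (hP : ∀ f ∈ P, T f ∈ P) {μ : ι → k[X]} (hirr : ∀ j, Irreducible (μ j))
    (hcop : Pairwise fun i j => IsCoprime (μ i) (μ j)) (hkill : ∀ f ∈ P, aeval T (∏ j, μ j) f = 0)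
    {W : Submodule k V} (hW : W ≤ P) {q : k[X]} (h1 : ∀ f ∈ P, aeval T q f ∈ W)
    (h2 : ∀ f ∈ W, aeval T q f = f) :
    W = ⨆ j ∈ {j | kerIn T P (μ j) ≤ W}, kerIn T P (μ j) := by
  classical
  apply le_antisymm
  · intro f hf
    rcases isEmpty_or_nonempty ι with hι | hι
    · have := hkill f (hW hf)
      simp only [Finset.univ_eq_empty, Finset.prod_empty, map_one, Module.End.one_apply] at this
      rw [this]; exact zero_mem _
    obtain ⟨e, he, hdvd, -⟩ := exists_idempotents (T := T) hcop
    rw [he f]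
    refine Submodule.sum_mem _ fun j _ => ?_
    by_cases hz : aeval T (e j) f = 0
    · rw [hz]; exact zero_mem _
    have hk : aeval T (e j) f ∈ kerIn T P (μ j) := by
      refine ⟨?_, aeval_mem hP _ (hW hf)⟩
      change aeval T (μ j) (aeval T (e j) f) = 0
      obtain ⟨r, hr⟩ := hdvd j
      rw [← aeval_mul_apply, hr, mul_comm, aeval_mul_apply, hkill f (hW hf), map_zero]
    -- The projection q(T) fixes f and commutes with the idempotent, so it fixes the component of f.
    have hw : aeval T (e j) f ∈ W := by
      rw [← h2 f hf, ← aeval_mul_apply, mul_comm, aeval_mul_apply]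
      exact h1 _ (aeval_mem hP _ (hW hf))
    have hle : kerIn T P (μ j) ≤ W := kerIn_le_of_projection hP (hirr j)
      (fun g hg => h1 g hg.2) (fun g hg _ => h2 g hg) hw hk hz
    exact Submodule.mem_iSup_of_mem j (Submodule.mem_iSup_of_mem hle hk)
  · exact iSup₂_le fun j hj => hj

theorem kerIn_disjoint {ι : Type} {T : V →ₗ[k] V} {P : Submodule k V} {μ : ι → k[X]}
    (hcop : Pairwise fun i j => IsCoprime (μ i) (μ j)) (S : Finset ι) {j : ι} (hj : j ∉ S) :
    Disjoint (kerIn T P (μ j)) (⨆ i ∈ S, kerIn T P (μ i)) := by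
  rw [Submodule.disjoint_def]
  intro f hf hfS
  have h1 : ⨆ i ∈ S, kerIn T P (μ i) ≤ LinearMap.ker (aeval T (∏ i ∈ S, μ i)) := by
    refine iSup₂_le fun i hi f hf => ?_
    obtain ⟨r, hr⟩ := Finset.dvd_prod_of_mem μ hi
    rw [LinearMap.mem_ker, hr, mul_comm, aeval_mul_apply, (mem_kerIn.1 hf).1, map_zero]
  have h2 : aeval T (∏ i ∈ S, μ i) f = 0 := h1 hfS
  have h3 : IsCoprime (μ j) (∏ i ∈ S, μ i) :=
    IsCoprime.prod_right fun i hi => hcop fun h => hj (h ▸ hi)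
  obtain ⟨a, b, hab⟩ := h3
  have h5 : aeval T (a * μ j + b * ∏ i ∈ S, μ i) f = f := by rw [hab]; simp
  rw [map_add, LinearMap.add_apply, aeval_mul_apply, (mem_kerIn.1 hf).1, aeval_mul_apply, h2] at h5
  simpa using h5.symm

theorem kerIn_le_iff {ι : Type} {T : V →ₗ[k] V} {P : Submodule k V} {μ : ι → k[X]}
    (hcop : Pairwise fun i j => IsCoprime (μ i) (μ j)) (hne : ∀ j, kerIn T P (μ j) ≠ ⊥)
    (S : Finset ι) (j : ι) : kerIn T P (μ j) ≤ ⨆ i ∈ S, kerIn T P (μ i) ↔ j ∈ S := by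
  constructor
  · intro h
    by_contra hj
    exact hne j ((kerIn_disjoint hcop S hj).eq_bot_of_le h)
  · exact fun h => le_biSup (fun i => kerIn T P (μ i)) h

theorem finrank_iSup_kerIn [FiniteDimensional k V] {ι : Type} {T : V →ₗ[k] V}
    {P : Submodule k V} {μ : ι → k[X]} (hcop : Pairwise fun i j => IsCoprime (μ i) (μ j))
    (S : Finset ι) : Module.finrank k ↥(⨆ i ∈ S, kerIn T P (μ i)) =
      ∑ i ∈ S, Module.finrank k (kerIn T P (μ i)) := by
  classical
  induction S using Finset.induction_on with
  | empty => simp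
  | insert j S hj ih =>
    have h1 := Submodule.finrank_sup_add_finrank_inf_eq (kerIn T P (μ j))
      (⨆ i ∈ S, kerIn T P (μ i))
    rw [(kerIn_disjoint hcop S hj).eq_bot, finrank_bot, add_zero, ih] at h1
    rw [Finset.iSup_insert, h1, Finset.sum_insert hj]

end poly

end

end OMap

end

/-! ### Multiplicity-free modules of face functions. -/

section

open Polynomial

namespace OMap

noncomputable section

variable {M : OMap}

theorem inv_iSup {k : Type} [Field k] {ι : Type} {W : ι → Submodule k (M.D → k)}
    (h : ∀ i, Inv (W i)) (S : Set ι) : Inv (⨆ i ∈ S, W i) := by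
  intro a ha f hf
  have h1 : ⨆ i ∈ S, W i ≤ (⨆ i ∈ S, W i).comap (LinearMap.funLeft k k a) :=
    iSup₂_le fun i hi g hg =>
      (le_biSup W hi : W i ≤ ⨆ i ∈ S, W i) (h i a ha g hg)
  exact h1 hf

theorem hecke_y_comp_aut {k : Type} [Field k] (n : ℕ) {a : Equiv.Perm M.D} (ha : a ∈ M.aut)
    (f : M.D → k) : hecke k n M.y (fun d => f (a d)) = fun d => hecke k n M.y f (a d) := by
  have := hecke_comp_aut n ha gY f
  rwa [mon_Y] at this

theorem faceSpace_comp_aut {k : Type} [Field k] : Inv (faceSpace k M) := by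
  rintro a ha f ⟨hf, hf'⟩
  refine ⟨fun d => ?_, ?_⟩
  · change f (a (M.z d)) = f (a d)
    rw [aut_z ha, hf]
  · exact (total_comp a f).trans hf'

theorem faceSpace_comp_reflection {k : Type} [Field k] (s : Reflection M) {f : M.D → k}
    (hf : f ∈ faceSpace k M) : (fun d => f (s.r d)) ∈ faceSpace k M := by
  refine ⟨fun d => ?_, (total_comp s.r f).trans hf.2⟩
  change f (s.r (M.z d)) = f (s.r d)
  have h := hf.1 (M.z⁻¹ (s.r d))
  rw [perm_apply_inv] at h
  rw [s.map_z, h]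

theorem kerIn_inv {k : Type} [Field k] (n : ℕ) (q : k[X]) :
    Inv (kerIn (hecke k n M.y) (faceSpace k M) q) := by
  intro a ha f hf
  refine ⟨?_, faceSpace_comp_aut a ha f hf.2⟩
  have h := aeval_apply_comm (T := hecke k n M.y) (A := LinearMap.funLeft k k a)
    (fun f => (hecke_y_comp_aut n ha f).symm) q f
  rw [(mem_kerIn.1 hf).1, map_zero] at h
  exact h.symm

theorem kerIn_comp_reflection {k : Type} [Field k] {n : ℕ} (hz : M.z ^ n = 1) (s : Reflection M)
    (q : k[X]) {f : M.D → k} (hf : f ∈ kerIn (hecke k n M.y) (faceSpace k M) q) :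
    (fun d => f (s.r d)) ∈ kerIn (hecke k n M.y) (faceSpace k M) q := by
  refine ⟨?_, faceSpace_comp_reflection s hf.2⟩
  have h := aeval_apply_comm (T := hecke k n M.y) (A := LinearMap.funLeft k k s.r)
    (fun f => (hecke_comp_reflection hz s s.map_y f).symm) q f
  rw [(mem_kerIn.1 hf).1, map_zero] at h
  exact h.symm

theorem iSup_comp_reflection {k : Type} [Field k] (s : Reflection M) {ι : Type}
    {W : ι → Submodule k (M.D → k)} (h : ∀ i, ∀ f ∈ W i, (fun d => f (s.r d)) ∈ W i) (S : Set ι)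
    {f : M.D → k} (hf : f ∈ ⨆ i ∈ S, W i) : (fun d => f (s.r d)) ∈ ⨆ i ∈ S, W i := by
  have h1 : ⨆ i ∈ S, W i ≤ (⨆ i ∈ S, W i).comap (LinearMap.funLeft k k s.r) :=
    iSup₂_le fun i hi g hg => (le_biSup W hi : W i ≤ ⨆ i ∈ S, W i) (h i g hg)
  exact h1 hf

/-- The functions on the faces of sum zero form a multiplicity-free module, whose irreducible
constituents are the kernels of the `μ j (T)`, where `T` is the adjacency operator. -/
structure MultFree (p n : ℕ) [Fact p.Prime] (M : OMap) {ν : ℕ} (μ : Fin ν → (ZMod p)[X]) :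
    Prop where
  comm : ∀ w, ∃ q : (ZMod p)[X], ∀ f ∈ faceSpace (ZMod p) M,
    hecke (ZMod p) n (M.mon w) f = aeval (hecke (ZMod p) n M.y) q f
  irr : ∀ j, Irreducible (μ j)
  cop : Pairwise fun i j => IsCoprime (μ i) (μ j)
  kill : ∀ f ∈ faceSpace (ZMod p) M, aeval (hecke (ZMod p) n M.y) (∏ j, μ j) f = 0
  ne : ∀ j, kerIn (hecke (ZMod p) n M.y) (faceSpace (ZMod p) M) (μ j) ≠ ⊥

namespace MultFree

variable {p n m : ℕ} [Fact p.Prime] {ν : ℕ} {μ : Fin ν → (ZMod p)[X]}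
  (h : MultFree p n M μ) (H : IsPlatonicCoprime p M n m)

local notation "𝕂" => ZMod p

/-- The sum of the irreducible constituents with indices in `S`. -/
def comp (p n : ℕ) [Fact p.Prime] (M : OMap) {ν : ℕ} (μ : Fin ν → (ZMod p)[X])
    (S : Finset (Fin ν)) : Submodule (ZMod p) (M.D → ZMod p) :=
  ⨆ j ∈ S, kerIn (hecke (ZMod p) n M.y) (faceSpace (ZMod p) M) (μ j)

omit h in
theorem comp_le (S : Finset (Fin ν)) : comp p n M μ S ≤ faceSpace 𝕂 M :=
  iSup₂_le fun _ _ => inf_le_right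

omit h in
theorem comp_inv (S : Finset (Fin ν)) : Inv (comp p n M μ S) :=
  inv_iSup (fun j => kerIn_inv n (μ j)) (S : Set (Fin ν))

include h

theorem comp_injective : Function.Injective (comp p n M μ) := by
  intro S S' hS
  ext j
  rw [← kerIn_le_iff h.cop h.ne S j, ← kerIn_le_iff h.cop h.ne S' j]
  change _ ≤ comp p n M μ S ↔ _ ≤ comp p n M μ S'
  rw [hS]

theorem comp_ne_bot {S : Finset (Fin ν)} (hS : S.Nonempty) : comp p n M μ S ≠ ⊥ := by
  intro h0
  have h1 : comp p n M μ S = comp p n M μ ∅ := by rw [h0]; simp [comp]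
  rw [h.comp_injective h1] at hS
  simp at hS

include H

/-- Maschke's projection onto W is a combination of Hecke operators, hence here a polynomial in T,
and `eq_iSup_kerIn` applies. -/
theorem exists_eq_comp {W : Submodule 𝕂 (M.D → 𝕂)} (hW : W ≤ faceSpace 𝕂 M) (hI : Inv W) :
    ∃ S, W = comp p n M μ S := by
  classical
  obtain ⟨β, w, h1, h2⟩ := exists_projection H.regular H.n_ne H.card_ne
    (hW.trans inf_le_left) hI
  choose q hq using fun e => h.comm (w e)
  have hB : ∀ f ∈ faceSpace 𝕂 M, aeval (hecke 𝕂 n M.y) (∑ e, C (β e) * q e) f =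
      ∑ e, β e • hecke 𝕂 n (M.mon (w e)) f := by
    intro f hf
    rw [map_sum, LinearMap.sum_apply]
    refine Finset.sum_congr rfl fun e _ => ?_
    rw [hq e f hf, map_mul, aeval_C]
    rfl
  have key := eq_iSup_kerIn (T := hecke 𝕂 n M.y) (P := faceSpace 𝕂 M)
    (fun f hf => hecke_mem_faceSpace H.type.z_pow _ hf) h.irr h.cop h.kill hW
    (q := ∑ e, C (β e) * q e)
    (fun f hf => by rw [hB f hf]; exact h1 f) (fun f hf => by rw [hB f (hW hf)]; exact h2 f hf)
  refine ⟨Finset.univ.filter fun j =>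
    kerIn (hecke 𝕂 n M.y) (faceSpace 𝕂 M) (μ j) ≤ W, ?_⟩
  rw [comp]
  simpa using key

theorem classify {ι : Type} (e : ι → Finset (Fin ν)) (hinj : Function.Injective e)
    (hne : ∀ i, (e i).Nonempty) (hsurj : ∀ S, S.Nonempty → ∃ i, e i = S) :
    ∃ L : ι → ElemAbCover M p, IsClassification L ∧
      (∀ i, coverSpace n (L i) = comp p n M μ (e i)) ∧
      (∀ i, (L i).c = ∑ j ∈ e i,
        Module.finrank 𝕂 (kerIn (hecke 𝕂 n M.y) (faceSpace 𝕂 M) (μ j))) ∧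
      ∀ i, (L i).N.Regular := by
  obtain ⟨L, hL, hsp, hc⟩ := H.exists_classification (fun i => comp p n M μ (e i))
    (fun i => comp_le _) (fun i => comp_inv _) (fun i => h.comp_ne_bot (hne i))
    (h.comp_injective.comp hinj) (fun V hV hI hV0 => by
      obtain ⟨S, rfl⟩ := h.exists_eq_comp H hV hI
      obtain ⟨i, hi⟩ := hsurj S (Finset.nonempty_iff_ne_empty.2 fun h0 => hV0 (by simp [h0, comp]))
      exact ⟨i, by rw [hi]⟩)
  refine ⟨L, hL, hsp, fun i => ?_, fun i => ?_⟩
  · rw [hc, comp, finrank_iSup_kerIn h.cop]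
  -- A reflection commutes with T, so it preserves every constituent; this is why no chiral covering
  -- arises.
  · obtain ⟨d⟩ := M.nonempty
    obtain ⟨s, -⟩ := exists_reflection H.type H.genus_eq d d
    rw [H.regular_iff s, hsp]
    intro f hf
    exact iSup_comp_reflection s (W := fun j => kerIn (hecke 𝕂 n M.y) (faceSpace 𝕂 M) (μ j))
      (fun j f hf => kerIn_comp_reflection H.type.z_pow s (μ j) hf) (e i : Set (Fin ν)) hf

theorem hasRegularCoverings {l : ℕ} {c : Fin l → ℕ} (e : Fin l → Finset (Fin ν))
    (hinj : Function.Injective e) (hne : ∀ i, (e i).Nonempty)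
    (hsurj : ∀ S, S.Nonempty → ∃ i, e i = S)
    (hc : ∀ i, ∑ j ∈ e i,
        Module.finrank 𝕂 (kerIn (hecke 𝕂 n M.y) (faceSpace 𝕂 M) (μ j)) = c i) :
    HasRegularCoverings M p c := by
  obtain ⟨L, h1, -, h2, h3⟩ := h.classify H e hinj hne hsurj
  exact ⟨L, h1, fun i => (h2 i).trans (hc i), h3⟩

theorem coveringsAreJoins : CoveringsAreJoins M p ν := by
  obtain ⟨L, hL, hsp, -, -⟩ := h.classify H
    (fun S : {S : Finset (Fin ν) // S.Nonempty} => S.1) Subtype.val_injective (fun S => S.2)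
    (fun S hS => ⟨⟨S, hS⟩, rfl⟩)
  have hsing : ∀ j, coverSpace n (L ⟨{j}, Finset.singleton_nonempty j⟩) =
      kerIn (hecke 𝕂 n M.y) (faceSpace 𝕂 M) (μ j) := fun j => by rw [hsp]; simp [comp]
  refine ⟨fun j => L ⟨{j}, Finset.singleton_nonempty j⟩, L, fun j => ?_, hL, fun S => ?_⟩
  · apply H.irreducible_of
    · rw [hsing]; exact h.ne j
    · intro W hW hI
      rw [hsing] at hW ⊢
      obtain ⟨S, rfl⟩ := h.exists_eq_comp H (hW.trans inf_le_right) hI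
      rcases S.eq_empty_or_nonempty with rfl | ⟨i, hi⟩
      · left; simp [comp]
      · right
        refine le_antisymm hW ?_
        have h1 : kerIn (hecke 𝕂 n M.y) (faceSpace 𝕂 M) (μ i) ≤ comp p n M μ {j} := by
          refine ((kerIn_le_iff h.cop h.ne S i).2 hi).trans (hW.trans ?_)
          simp [comp]
        have h2 := (kerIn_le_iff h.cop h.ne {j} i).1 h1
        rw [Finset.mem_singleton] at h2
        subst h2
        exact (kerIn_le_iff h.cop h.ne S i).2 hi
  · apply H.isJoin_of_eq
    rw [hsp, comp]
    simp_rw [hsing]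

end MultFree

/-- The case of a one-dimensional module. -/
theorem IsPlatonicCoprime.multFree_of_finrank_eq_one {p n m : ℕ} [Fact p.Prime]
    (H : IsPlatonicCoprime p M n m) (h1 : Module.finrank (ZMod p) (faceSpace (ZMod p) M) = 1) :
    ∃ l : ZMod p, MultFree p n M (fun _ : Fin 1 => X - C l) ∧
      kerIn (hecke (ZMod p) n M.y) (faceSpace (ZMod p) M) (X - C l) = faceSpace (ZMod p) M := by
  obtain ⟨⟨f₀, hf₀⟩, hne, hspan⟩ := finrank_eq_one_iff'.1 h1
  have hs : ∀ g : Equiv.Perm M.D, ∃ l : ZMod p, ∀ f ∈ faceSpace (ZMod p) M,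
      hecke (ZMod p) n g f = l • f := by
    intro g
    obtain ⟨l, hl⟩ := hspan ⟨_, hecke_mem_faceSpace H.type.z_pow g hf₀⟩
    refine ⟨l, fun f hf => ?_⟩
    obtain ⟨c, hc⟩ := hspan ⟨f, hf⟩
    have hc' : c • f₀ = f := congrArg Subtype.val hc
    have hl' : l • f₀ = hecke (ZMod p) n g f₀ := congrArg Subtype.val hl
    rw [← hc', map_smul, ← hl', smul_comm]
  obtain ⟨l, hl⟩ := hs M.y
  have hz : ∀ f ∈ faceSpace (ZMod p) M, aeval (hecke (ZMod p) n M.y) (X - C l) f = 0 := by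
    intro f hf
    rw [map_sub, aeval_X, aeval_C, LinearMap.sub_apply, hl f hf]
    exact sub_self _
  have hk : kerIn (hecke (ZMod p) n M.y) (faceSpace (ZMod p) M) (X - C l) =
      faceSpace (ZMod p) M := le_antisymm inf_le_right fun f hf => ⟨hz f hf, hf⟩
  refine ⟨l, ⟨fun w => ?_, fun _ => irreducible_X_sub_C l, fun i j hij => ?_, ?_, fun _ => ?_⟩, hk⟩
  · obtain ⟨c, hc⟩ := hs (M.mon w)
    exact ⟨C c, fun f hf => by rw [hc f hf, aeval_C]; rfl⟩
  · exact absurd (Subsingleton.elim i j) hij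
  · simpa using hz
  · rw [hk]
    intro h0
    rw [h0, finrank_bot] at h1
    omega

end

end OMap

end

section

open Polynomial

namespace OMap

noncomputable section

/-! ### Orbits of roots of unity -/

section roots

variable {p : ℕ} [Fact p.Prime]

local notation "𝔽" => ZMod p
local notation "𝕃" => AlgebraicClosure (ZMod p)

theorem orbit_induction {q : 𝕃 → Prop} (hF : ∀ η, q η ↔ q (η ^ p)) (hI : ∀ η, q η ↔ q η⁻¹)
    {ω ω' : 𝕃} (h : ω' ∈ MulAction.orbit (frobInvGroup p) ω) (hω : q ω) : q ω' := by
  obtain ⟨⟨g, hg⟩, rfl⟩ := h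
  have key : ∀ η, q η ↔ q (g η) := by
    induction hg using Subgroup.closure_induction with
    | mem g hg =>
      rcases hg with rfl | rfl
      · intro η; rw [hF]; rfl
      · intro η; rw [hI]; rfl
    | one => intro η; rfl
    | mul g g' _ _ ih ih' => intro η; rw [ih' η, ih (g' η)]; rfl
    | inv g _ ih => intro η; rw [ih (g⁻¹ η), perm_apply_inv]
  exact (key ω).1 hω

theorem pow_mem_orbit (ω : 𝕃) (s : ℕ) : ω ^ p ^ s ∈ MulAction.orbit (frobInvGroup p) ω := by
  induction s with
  | zero => simp
  | succ s ih =>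
    have h1 : (ω ^ p ^ s) ^ p ∈ MulAction.orbit (frobInvGroup p) (ω ^ p ^ s) :=
      ⟨⟨_, Subgroup.subset_closure (Set.mem_insert _ _)⟩, rfl⟩
    rw [MulAction.orbit_eq_iff.2 ih, ← pow_mul, ← pow_succ] at h1
    exact h1

theorem inv_mem_orbit (ω : 𝕃) : ω⁻¹ ∈ MulAction.orbit (frobInvGroup p) ω :=
  ⟨⟨_, Subgroup.subset_closure (Set.mem_insert_of_mem _ rfl)⟩, rfl⟩

theorem orbit_one : MulAction.orbit (frobInvGroup p) (1 : 𝕃) = {1} := by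
  apply Set.eq_singleton_iff_unique_mem.2
  refine ⟨MulAction.mem_orbit_self _, fun η hη => ?_⟩
  refine orbit_induction (q := fun η => η = 1) (fun η => ?_) (fun η => ?_) hη rfl
  · constructor
    · rintro rfl
      exact one_pow p
    · intro h
      exact frobenius_inj 𝕃 p (by rw [frobenius_def, h, map_one])
  · rw [inv_eq_one]

/-- Conjugates over the prime field are related by a power of the Frobenius automorphism. -/
theorem exists_eq_pow_of_aeval_minpoly {l l' : 𝕃} {r : ℕ} (hr : 0 < r) (hl : l ^ p ^ r = l)
    (h : aeval l' (minpoly 𝔽 l) = 0) : ∃ s, l' = l ^ p ^ s := by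
  -- The product over the Frobenius conjugates of l. Frobenius permutes its factors, so its
  -- coefficients lie in the prime field and the minimal polynomial of l divides it.
  let f : 𝕃[X] := ∏ s ∈ Finset.range r, (X - C (l ^ p ^ s))
  have hf : f.map (frobenius 𝕃 p) = f := by
    simp only [f, Polynomial.map_prod, Polynomial.map_sub, map_X, map_C, frobenius_def, ← pow_mul,
      ← pow_succ]
    have h1 := Finset.prod_range_succ (fun s => X - C (l ^ p ^ s)) r
    rw [Finset.prod_range_succ', hl] at h1
    simp only [pow_zero, pow_one] at h1
    exact mul_right_cancel₀ (X_sub_C_ne_zero l) h1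
  have hlift : f ∈ lifts (algebraMap 𝔽 𝕃) := by
    rw [lifts_iff_coeff_lifts]
    intro i
    have h1 : (f.coeff i) ^ p = f.coeff i := by
      conv_rhs => rw [← hf]
      rw [coeff_map, frobenius_def]
    rw [← Subfield.mem_bot_iff_pow_eq_self 𝕃 p, mem_bot_iff_intCast p 𝕃] at h1
    obtain ⟨a, ha⟩ := h1
    exact ⟨(a : 𝔽), by rw [map_intCast, ha]⟩
  obtain ⟨g, hg⟩ := (mem_lifts f).1 hlift
  have hgl : aeval l g = 0 := by
    rw [aeval_def, ← eval_map, hg, eval_prod]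
    exact Finset.prod_eq_zero (Finset.mem_range.2 hr) (by simp)
  obtain ⟨c, hc⟩ := minpoly.dvd 𝔽 l hgl
  have hgl' : aeval l' g = 0 := by rw [hc, map_mul, h, zero_mul]
  rw [aeval_def, ← eval_map, hg, eval_prod, Finset.prod_eq_zero_iff] at hgl'
  obtain ⟨s, -, hs⟩ := hgl'
  refine ⟨s, ?_⟩
  rwa [eval_sub, eval_X, eval_C, sub_eq_zero] at hs

theorem add_inv_pow (ω : 𝕃) (s : ℕ) : (ω + ω⁻¹) ^ p ^ s = ω ^ p ^ s + (ω ^ p ^ s)⁻¹ := by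
  rw [add_pow_char_pow, inv_pow]

theorem eq_or_eq_inv_of_add_inv_eq {ω η : 𝕃} (hω : ω ≠ 0) (hη : η ≠ 0)
    (h : ω + ω⁻¹ = η + η⁻¹) : ω = η ∨ ω = η⁻¹ := by
  have h1 : (ω - η) * (ω * η - 1) = 0 := by
    field_simp at h
    linear_combination h
  rcases mul_eq_zero.1 h1 with h2 | h2
  · exact Or.inl (sub_eq_zero.1 h2)
  · exact Or.inr (eq_inv_of_mul_eq_one_left (sub_eq_zero.1 h2))

theorem ne_zero_of_pow_eq_one {m : ℕ} (hm : m ≠ 0) {ω : 𝕃} (h : ω ^ m = 1) : ω ≠ 0 := by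
  rintro rfl
  rw [zero_pow hm] at h
  exact zero_ne_one h

/-- Euler's theorem: p to the power φ(m) is 1 modulo m, so that power of Frobenius fixes the mth
roots of 1. -/
theorem exists_pow_prime_pow_eq {m : ℕ} (hm : (m : 𝔽) ≠ 0) {ω : 𝕃} (h : ω ^ m = 1) :
    ∃ r, 0 < r ∧ ω ^ p ^ r = ω := by
  have hm0 : m ≠ 0 := by rintro rfl; simp at hm
  have hcop : Nat.Coprime p m := by
    rw [Nat.Prime.coprime_iff_not_dvd Fact.out, ← ZMod.natCast_eq_zero_iff]
    exact hm
  refine ⟨m.totient, Nat.totient_pos.2 (Nat.pos_of_ne_zero hm0), ?_⟩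
  have h1 := Nat.ModEq.pow_totient hcop
  have h2 := pow_eq_pow_of_modEq h1 h
  rwa [pow_one] at h2

/-- The minimal polynomials of the `ω + ω⁻¹`, one for each orbit. -/
theorem exists_orbit_polynomials {m : ℕ} (hm : (m : 𝔽) ≠ 0) :
    ∃ ω : Fin (numRootOrbits p m) → 𝕃,
      (∀ j, ω j ^ m = 1 ∧ ω j ≠ 1) ∧
      (Pairwise fun i j => IsCoprime (minpoly 𝔽 (ω i + (ω i)⁻¹)) (minpoly 𝔽 (ω j + (ω j)⁻¹))) ∧
      ∀ η : 𝕃, η ^ m = 1 → η ≠ 1 → ∃ j, aeval (η + η⁻¹) (minpoly 𝔽 (ω j + (ω j)⁻¹)) = 0 := by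
  have hm0 : m ≠ 0 := by rintro rfl; simp at hm
  let O : Set (Set 𝕃) := {Δ : Set 𝕃 |
    (∃ ω, ω ^ m = 1 ∧ Δ = MulAction.orbit (frobInvGroup p) ω) ∧ Δ ≠ {1}}
  have hfin : O.Finite := by
    have h1 : {ω : 𝕃 | ω ^ m = 1}.Finite := by
      refine Set.Finite.subset (nthRootsFinset m (1 : 𝕃)).finite_toSet fun ω hω => ?_
      exact (mem_nthRootsFinset (Nat.pos_of_ne_zero hm0) 1).2 hω
    refine (h1.image fun ω => MulAction.orbit (frobInvGroup p) ω).subset ?_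
    rintro _ ⟨⟨ω, hω, rfl⟩, -⟩
    exact ⟨ω, hω, rfl⟩
  have : Finite O := hfin
  let E : O ≃ Fin (numRootOrbits p m) := Finite.equivFinOfCardEq rfl
  choose ω hω using fun j => (E.symm j).2.1
  have hω1 : ∀ j, ω j ≠ 1 := by
    intro j h
    apply (E.symm j).2.2
    rw [(hω j).2, h, orbit_one]
  have hint : ∀ l : 𝕃, IsIntegral 𝔽 l := fun l => Algebra.IsIntegral.isIntegral l
  refine ⟨ω, fun j => ⟨(hω j).1, hω1 j⟩, fun i j hij => ?_, fun η hη hη1 => ?_⟩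
  · by_contra hcop
    -- If the minimal polynomials are not coprime, then `ω i + (ω i)⁻¹` is a Frobenius conjugate of
    -- `ω j + (ω j)⁻¹`. Hence `ω i` is such a conjugate of `ω j` or the inverse of one, and the
    -- orbits coincide.
    have hdvd := (minpoly.irreducible (hint (ω i + (ω i)⁻¹))).coprime_iff_not_dvd.not.1 hcop
    rw [not_not] at hdvd
    have hroot : aeval (ω i + (ω i)⁻¹) (minpoly 𝔽 (ω j + (ω j)⁻¹)) = 0 := by
      obtain ⟨c, hc⟩ := hdvd
      rw [hc, map_mul, minpoly.aeval, zero_mul]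
    obtain ⟨r, hr, hr'⟩ := exists_pow_prime_pow_eq hm (hω j).1
    obtain ⟨s, hs⟩ := exists_eq_pow_of_aeval_minpoly hr
      (by rw [add_inv_pow, hr']) hroot
    rw [add_inv_pow] at hs
    have h0 : ∀ j, ω j ≠ 0 := fun j => ne_zero_of_pow_eq_one hm0 (hω j).1
    have hmem : ω i ∈ MulAction.orbit (frobInvGroup p) (ω j) := by
      rcases eq_or_eq_inv_of_add_inv_eq (h0 i) (pow_ne_zero _ (h0 j)) hs with h | h
      · rw [h]; exact pow_mem_orbit _ _
      · rw [h, ← MulAction.orbit_eq_iff.2 (pow_mem_orbit (ω j) s)]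
        exact inv_mem_orbit _
    have h2 : E.symm i = E.symm j := by
      apply Subtype.ext
      rw [(hω i).2, (hω j).2, MulAction.orbit_eq_iff.2 hmem]
    exact hij (E.symm.injective h2)
  · have hO : MulAction.orbit (frobInvGroup p) η ∈ O := by
      refine ⟨⟨η, hη, rfl⟩, fun h => hη1 ?_⟩
      have : η ∈ MulAction.orbit (frobInvGroup p) η := MulAction.mem_orbit_self η
      rw [h] at this
      exact this
    refine ⟨E ⟨_, hO⟩, ?_⟩
    have h2 := (hω (E ⟨_, hO⟩)).2
    rw [Equiv.symm_apply_apply] at h2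
    have h3 : η ∈ MulAction.orbit (frobInvGroup p) (ω (E ⟨_, hO⟩)) := by
      rw [← h2]; exact MulAction.mem_orbit_self η
    refine orbit_induction (q := fun η => aeval (η + η⁻¹)
      (minpoly 𝔽 (ω (E ⟨_, hO⟩) + (ω (E ⟨_, hO⟩))⁻¹)) = 0) (fun η => ?_) (fun η => ?_) h3
      (minpoly.aeval _ _)
    · have h4 : η ^ p + (η ^ p)⁻¹ = frobenius 𝕃 p (η + η⁻¹) := by
        rw [map_add, frobenius_def, frobenius_def, inv_pow]
      have h5 : ∀ (l : 𝕃) (g : 𝔽[X]), aeval (frobenius 𝕃 p l) g = frobenius 𝕃 p (aeval l g) := by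
        intro l g
        let F : 𝕃 →ₐ[𝔽] 𝕃 := { frobenius 𝕃 p with
          commutes' := fun c => by
            change (algebraMap 𝔽 𝕃 c) ^ p = _
            rw [← map_pow, ZMod.pow_card] }
        exact aeval_algHom_apply F l g
      rw [h4, h5]
      exact (map_eq_zero (frobenius 𝕃 p)).symm
    · rw [inv_inv, add_comm]

/-- Every factor of `X ^ m - 1` other than `X - 1` divides the product of these polynomials at
`X + X ^ (m - 1)`. -/
theorem X_pow_sub_one_dvd {m : ℕ} (hm : (m : 𝔽) ≠ 0) {ν : ℕ} {μ : Fin ν → 𝔽[X]}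
    (h : ∀ η : 𝕃, η ^ m = 1 → η ≠ 1 → ∃ j, aeval (η + η⁻¹) (μ j) = 0) :
    (X ^ m - 1 : 𝔽[X]) ∣ (X - 1) * (∏ j, μ j).comp (X + X ^ (m - 1)) := by
  have hm0 : m ≠ 0 := by rintro rfl; simp at hm
  have hm𝕃 : (m : 𝕃) ≠ 0 := by
    rw [← map_natCast (algebraMap 𝔽 𝕃)]
    exact fun h0 => hm ((map_eq_zero _).1 h0)
  have : NeZero (m : 𝕃) := ⟨hm𝕃⟩
  obtain ⟨ζ, hζ⟩ := HasEnoughRootsOfUnity.exists_primitiveRoot 𝕃 m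
  rw [← map_dvd_map' (algebraMap 𝔽 𝕃)]
  rw [Polynomial.map_sub, Polynomial.map_pow, map_X, Polynomial.map_one,
    X_pow_sub_one_eq_prod (Nat.pos_of_ne_zero hm0) hζ]
  -- The roots of X^m - 1 are distinct, so they may be tested singly; at a root η the polynomial X +
  -- X^(m-1) takes the value η + η⁻¹.
  refine Finset.prod_dvd_of_coprime
    (fun a _ b _ hab => pairwise_coprime_X_sub_C Function.injective_id hab) fun η hη => ?_
  rw [mem_nthRootsFinset (Nat.pos_of_ne_zero hm0)] at hη
  rw [dvd_iff_isRoot, IsRoot, eval_map, ← aeval_def, map_mul]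
  by_cases hη1 : η = 1
  · simp [hη1]
  · obtain ⟨j, hj⟩ := h η hη hη1
    have h1 : η ^ (m - 1) = η⁻¹ := by
      apply eq_inv_of_mul_eq_one_left
      rw [← pow_succ, Nat.sub_add_cancel (Nat.pos_of_ne_zero hm0), hη]
    rw [aeval_comp, map_add, map_pow, aeval_X, h1, map_prod,
      Finset.prod_eq_zero (Finset.mem_univ j) hj, mul_zero]

end roots

end

end OMap

end

section

open Polynomial

namespace OMap

noncomputable section

variable {M : OMap}

/-! ### Hosohedra -/

section hosohedron

/-- With z² = 1 and (z x)² = y² = 1 the monodromy group is dihedral. -/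
theorem x_zpow_mul_z (hz : M.z ^ 2 = 1) (i : ℤ) : M.x ^ i * M.z = M.z * M.x ^ (-i) := by
  have h1 : M.z * M.z = 1 := by rw [← pow_two, hz]
  have h2 : SemiconjBy M.z M.x⁻¹ M.x := by
    have h3 : M.z * M.x * (M.z * M.x) = 1 := by rw [z_mul_x, y_mul_y]
    change M.z * M.x⁻¹ = M.x * M.z
    calc M.z * M.x⁻¹ = M.z * (M.z * M.x * (M.z * M.x)) * M.x⁻¹ := by rw [h3, mul_one]
      _ = M.z * M.z * (M.x * M.z) * (M.x * M.x⁻¹) := by simp only [mul_assoc]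
      _ = M.x * M.z := by rw [h1, one_mul, mul_inv_cancel, mul_one]
  have h4 := h2.zpow_right i
  rw [inv_zpow'] at h4
  exact h4.symm

theorem x_zpow_z (hz : M.z ^ 2 = 1) (i : ℤ) (d : M.D) :
    (M.x ^ i) (M.z d) = M.z ((M.x ^ (-i)) d) :=
  Equiv.Perm.congr_fun (x_zpow_mul_z hz i) d

theorem mon_eq_of_z_sq (hz : M.z ^ 2 = 1) (w : FreeGroup Bool) :
    ∃ j : ℤ, M.mon w = M.x ^ j ∨ M.mon w = M.z * M.x ^ j := by
  have h1 : M.z * M.z = 1 := by rw [← pow_two, hz]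
  have hgen : ∀ b, ∃ j : ℤ, M.mon (FreeGroup.of b) = M.x ^ j ∨
      M.mon (FreeGroup.of b) = M.z * M.x ^ j := by
    rintro (_ | _)
    · exact ⟨1, Or.inr (by rw [zpow_one, z_mul_x]; exact mon_Y M)⟩
    · exact ⟨1, Or.inl ((mon_X M).trans (zpow_one _).symm)⟩
  induction w using FreeGroup.induction_on with
  | C1 => exact ⟨0, Or.inl (by simp)⟩
  | of b => exact hgen b
  | inv_of b ih =>
    obtain ⟨j, hj | hj⟩ := hgen b
    · exact ⟨-j, Or.inl (by rw [map_inv, hj, zpow_neg])⟩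
    · refine ⟨j, Or.inr ?_⟩
      rw [map_inv, hj, mul_inv_rev, ← zpow_neg, inv_eq_of_mul_eq_one_left h1, x_zpow_mul_z hz,
        neg_neg]
  | mul a b iha ihb =>
    obtain ⟨i, hi | hi⟩ := iha <;> obtain ⟨j, hj | hj⟩ := ihb <;> rw [map_mul, hi, hj]
    · exact ⟨i + j, Or.inl (zpow_add _ _ _).symm⟩
    · exact ⟨-i + j, Or.inr (by rw [← mul_assoc, x_zpow_mul_z hz, mul_assoc, ← zpow_add])⟩
    · exact ⟨i + j, Or.inr (by rw [mul_assoc, zpow_add])⟩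
    · exact ⟨-i + j, Or.inl (by
        rw [mul_assoc, ← mul_assoc (M.x ^ i), x_zpow_mul_z hz, mul_assoc, ← mul_assoc, h1, one_mul,
          zpow_add])⟩

variable {k : Type} [Field k]

theorem hecke_x_zpow (hz : M.z ^ 2 = 1) {f : M.D → k} (hf : f ∈ fixSub k M.z) (j : ℤ) (d : M.D) :
    hecke k 2 (M.x ^ j) f d = f ((M.x ^ j) d) + f ((M.x ^ (-j)) d) := by
  rw [hecke_apply, Finset.sum_range_succ, Finset.sum_range_one, pow_zero, pow_one,
    Equiv.Perm.one_apply, x_zpow_z hz, hf]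

theorem hecke_y_of_z_sq (hz : M.z ^ 2 = 1) {f : M.D → k} (hf : f ∈ fixSub k M.z) (d : M.D) :
    hecke k 2 M.y f d = f (M.x d) + f (M.x⁻¹ d) := by
  have h := hecke_x_zpow hz hf 1 d
  rw [zpow_one, zpow_neg_one, ← hecke_zpow_mul 2 M.x 1 hf, zpow_one, z_mul_x] at h
  exact h

/-- The Chebyshev recursion: T applied to the operator of x^(i+1) is the sum of those of x^(i+2) and
x^i. It starts with 2 and T, and the operators of x^j and x^(-j) agree on face functions. -/
theorem exists_hecke_x_zpow (hz : M.z ^ 2 = 1) (j : ℤ) :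
    ∃ q : k[X], ∀ f ∈ faceSpace k M, hecke k 2 (M.x ^ j) f = aeval (hecke k 2 M.y) q f := by
  have key : ∀ i : ℕ, (∃ q : k[X], ∀ f ∈ faceSpace k M,
      hecke k 2 (M.x ^ (i : ℤ)) f = aeval (hecke k 2 M.y) q f) ∧
      ∃ q : k[X], ∀ f ∈ faceSpace k M,
      hecke k 2 (M.x ^ ((i + 1 : ℕ) : ℤ)) f = aeval (hecke k 2 M.y) q f := by
    intro i
    induction i with
    | zero =>
      refine ⟨⟨C 2, fun f hf => ?_⟩, X, fun f hf => ?_⟩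
      · rw [Nat.cast_zero, zpow_zero, hecke_one 2 hf.1, aeval_C]
        rfl
      · funext d
        rw [aeval_X, hecke_y_of_z_sq hz hf.1, hecke_x_zpow hz hf.1]
        simp
    | succ i ih =>
      obtain ⟨⟨q, hq⟩, q', hq'⟩ := ih
      refine ⟨⟨q', hq'⟩, X * q' - q, fun f hf => ?_⟩
      rw [map_sub, LinearMap.sub_apply, aeval_mul_apply, aeval_X, ← hq f hf, ← hq' f hf]
      funext d
      rw [Pi.sub_apply, hecke_y_of_z_sq hz (hecke_mem_faceSpace hz _ hf).1,
        hecke_x_zpow hz hf.1, hecke_x_zpow hz hf.1, hecke_x_zpow hz hf.1, hecke_x_zpow hz hf.1]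
      have e1 : ∀ j : ℤ, (M.x ^ j) (M.x d) = (M.x ^ (j + 1)) d := fun j => by
        rw [zpow_add_one]; rfl
      have e2 : ∀ j : ℤ, (M.x ^ j) (M.x⁻¹ d) = (M.x ^ (j - 1)) d := fun j => by
        rw [zpow_sub_one]; rfl
      rw [e1, e1, e2, e2]
      push_cast
      rw [show -((i : ℤ) + 1) + 1 = -i by ring, show (i : ℤ) + 1 - 1 = i by ring,
        show -((i : ℤ) + 1) - 1 = -(i + 1 + 1) by ring]
      ring
  obtain ⟨i, rfl | rfl⟩ := j.eq_nat_or_neg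
  · exact (key i).1
  · obtain ⟨q, hq⟩ := (key i).1
    refine ⟨q, fun f hf => ?_⟩
    rw [← hq f hf]
    funext d
    rw [hecke_x_zpow hz hf.1, hecke_x_zpow hz hf.1, neg_neg, add_comm]

/-- Twisted sums over the orbits of a permutation. -/
theorem mul_sum_twist {K D : Type} [Field K] {g : Equiv.Perm D} {m : ℕ} (hg : g ^ m = 1) {ω : K}
    (hω : ω ^ m = 1) (δ : D → K) (d : D) :
    ω * ∑ i ∈ Finset.range m, ω ^ i * δ ((g ^ i) (g d)) =
      ∑ i ∈ Finset.range m, ω ^ i * δ ((g ^ i) d) := by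
  have h1 := Finset.sum_range_succ (fun i => ω ^ i * δ ((g ^ i) d)) m
  rw [Finset.sum_range_succ', hg, hω, pow_zero, pow_zero] at h1
  rw [← add_right_cancel h1, Finset.mul_sum]
  refine Finset.sum_congr rfl fun i _ => ?_
  rw [pow_succ' ω, pow_succ g, mul_assoc]
  rfl

/-- The sum over a vertex rotation is invariant under x, and under z because z inverts x; so it is
constant. Its total vanishes and the number of darts is invertible. -/
theorem sum_x_pow_eq_zero {m : ℕ} (hz : M.z ^ 2 = 1) (hx : M.x ^ m = 1)
    (hD : (Nat.card M.D : k) ≠ 0) {f : M.D → k} (hf : f ∈ faceSpace k M) (d : M.D) :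
    ∑ i ∈ Finset.range m, f ((M.x ^ i) d) = 0 := by
  set g : M.D → k := fun d => ∑ i ∈ Finset.range m, f ((M.x ^ i) d) with hg
  have hgx : g ∈ fixSub k M.x := fun d => by
    have := mul_sum_twist hx (one_pow m) f d
    simpa [hg] using this
  have hgz : g ∈ fixSub k M.z := fun d => by
    rw [← fixSub_zpow k hgx (1 - m) d]
    simp only [hg]
    rw [← Finset.sum_range_reflect]
    refine Finset.sum_congr rfl fun i hi => ?_
    rw [← zpow_natCast, x_zpow_z hz, hf.1, ← zpow_natCast, ← Equiv.Perm.mul_apply, ← zpow_add]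
    congr 3
    have := Finset.mem_range.1 hi
    omega
  have hgy : g ∈ fixSub k M.y := fun d => by
    rw [← z_mul_x, Equiv.Perm.mul_apply, hgz, hgx]
  have h1 : total k M g = 0 := by
    change ∑ d, ∑ i ∈ Finset.range m, f ((M.x ^ i) d) = 0
    rw [Finset.sum_comm]
    refine Finset.sum_eq_zero fun i _ => ?_
    exact (total_comp (M.x ^ i) f).trans hf.2
  have h2 : total k M g = Nat.card M.D * g d := by
    change ∑ e, g e = _
    rw [Finset.sum_congr rfl fun e _ => fixSub_const hgy hgz e d]
    simp [Nat.card_eq_fintype_card]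
  rw [h1] at h2
  exact (mul_eq_zero.1 h2.symm).resolve_left hD

/-- On face functions T is translation by x plus its inverse, the inverse being the (m-1)st power.
The single translations need not preserve the face functions, so the comparison takes place among
all functions on darts. -/
theorem aeval_hecke_of_z_sq {m : ℕ} (hm : 0 < m) (hz : M.z ^ 2 = 1) (hx : M.x ^ m = 1) (q : k[X])
    {f : M.D → k} (hf : f ∈ faceSpace k M) :
    aeval (hecke k 2 M.y) q f =
      aeval (LinearMap.funLeft k k M.x) (q.comp (X + X ^ (m - 1))) f := by
  have hpow : ∀ (i : ℕ) (f : M.D → k),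
      ((LinearMap.funLeft k k M.x) ^ i) f = fun d => f ((M.x ^ i) d) := by
    intro i
    induction i with
    | zero => intro f; rfl
    | succ i ih =>
      intro f
      rw [pow_succ, Module.End.mul_apply, ih]
      funext d
      change f (M.x ((M.x ^ i) d)) = _
      rw [pow_succ']; rfl
  have hT : ∀ f ∈ faceSpace k M, hecke k 2 M.y f =
      aeval (LinearMap.funLeft k k M.x) (X + X ^ (m - 1) : k[X]) f := by
    intro f hf
    funext d
    rw [hecke_y_of_z_sq hz hf.1, map_add, map_pow, aeval_X, LinearMap.add_apply, hpow]
    have : M.x⁻¹ = M.x ^ (m - 1) := by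
      apply inv_eq_of_mul_eq_one_left
      rw [← pow_succ, Nat.sub_add_cancel hm, hx]
    rw [this]
    rfl
  rw [aeval_comp]
  induction q using Polynomial.induction_on' with
  | add q r hq hr => rw [map_add, map_add, LinearMap.add_apply, LinearMap.add_apply, hq, hr]
  | monomial i c =>
    rw [aeval_monomial, aeval_monomial, Module.End.mul_apply, Module.End.mul_apply]
    congr 1
    induction i with
    | zero => rfl
    | succ i ih =>
      rw [pow_succ', pow_succ', Module.End.mul_apply, Module.End.mul_apply, ← ih]
      apply hT
      have := aeval_mem (T := hecke k 2 M.y) (fun f hf => hecke_mem_faceSpace hz M.y hf) (X ^ i) hf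
      rwa [map_pow, aeval_X] at this

theorem aeval_sum_X_pow (m : ℕ) (f : M.D → k) (d : M.D) :
    aeval (LinearMap.funLeft k k M.x) (∑ i ∈ Finset.range m, X ^ i : k[X]) f d =
      ∑ i ∈ Finset.range m, f ((M.x ^ i) d) := by
  rw [map_sum, LinearMap.sum_apply, Finset.sum_apply]
  refine Finset.sum_congr rfl fun i hi => ?_
  clear hi
  rw [map_pow, aeval_X]
  induction i generalizing d with
  | zero => rfl
  | succ i ih =>
    rw [pow_succ', Module.End.mul_apply, pow_succ]
    exact ih (M.x d)

theorem HasType.card_hosohedron {m : ℕ} (h : M.HasType 2 m) (hg : M.genus = 0) :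
    Nat.card M.D = 2 * m := by
  have h1 := h.card_eq hg
  obtain ⟨d⟩ := M.nonempty
  have hm : (m : ℚ) ≠ 0 := by exact_mod_cast h.m_pos.ne'
  field_simp at h1
  have h2 : (Nat.card M.D : ℚ) = 2 * m := by push_cast at h1; linarith
  exact_mod_cast h2

/-- Otherwise z would be a power of x, and the m powers of x would be transitive on the 2m darts. -/
theorem x_zpow_ne_z {m : ℕ} (hM : M.OrientablyRegular) (h : M.HasType 2 m) (hg : M.genus = 0)
    (j : ℤ) (d : M.D) : (M.x ^ j) d ≠ M.z d := by
  intro hj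
  have hjz : M.x ^ j = M.z := by
    have := hM.mon_eq (v := gX ^ j) (w := gZ) (d := d) (by rw [map_zpow, mon_X, mon_Z, hj])
    rwa [map_zpow, mon_X, mon_Z] at this
  have hsurj : Function.Surjective fun i : Fin m => (M.x ^ (i : ℕ)) d := by
    have hxm : ∀ i : ℤ, ∃ l : Fin m, (M.x ^ (l : ℕ)) d = (M.x ^ i) d := by
      intro i
      have hm : (0 : ℤ) < m := by exact_mod_cast h.m_pos
      have h1 := Int.emod_nonneg i hm.ne'
      have h2 := Int.emod_lt_of_pos i hm
      refine ⟨⟨(i % m).toNat, by omega⟩, ?_⟩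
      have h3 : M.x ^ i = M.x ^ (i % m) := by
        conv_lhs => rw [← Int.emod_add_mul_ediv i m]
        rw [zpow_add, zpow_mul, zpow_natCast, h.x_pow, one_zpow, mul_one]
      rw [h3, ← zpow_natCast, Int.toNat_of_nonneg h1]
    intro e
    obtain ⟨w, rfl⟩ := M.exists_mon d e
    obtain ⟨i, hi | hi⟩ := mon_eq_of_z_sq h.z_pow w
    · rw [hi]; exact hxm i
    · rw [hi, ← hjz, ← zpow_add]; exact hxm _
  have h1 := Nat.card_le_card_of_surjective _ hsurj
  rw [Nat.card_fin, h.card_hosohedron hg] at h1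
  have := h.m_pos
  omega

variable {p : ℕ} [Fact p.Prime]

/-- The indicator of one face is projected to eigenfunctions of x and of x⁻¹; z interchanges the
two, so their sum is a function on the faces. -/
theorem exists_eigenfunction {m : ℕ} (H : IsPlatonicCoprime p M 2 m) {ω : AlgebraicClosure (ZMod p)}
    (hω : ω ^ m = 1) (hω1 : ω ≠ 1) :
    ∃ F : M.D → AlgebraicClosure (ZMod p), (∀ d, F (M.z d) = F d) ∧
      (∀ d, F (M.x d) + F (M.x⁻¹ d) = (ω + ω⁻¹) * F d) ∧ ∑ d, F d = 0 ∧ ∃ d, F d ≠ 0 := by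
  classical
  have hz := H.type.z_pow
  have hz1 : ∀ d, M.z (M.z d) = d := fun d => by
    rw [← Equiv.Perm.mul_apply, ← pow_two, hz]; rfl
  have hx := H.type.x_pow
  have hx' : M.x⁻¹ ^ m = 1 := by rw [inv_pow, hx, inv_one]
  have hm := H.type.m_pos
  have hω0 : ω ≠ 0 := ne_zero_of_pow_eq_one hm.ne' hω
  obtain ⟨d₀⟩ := M.nonempty
  let δ : M.D → AlgebraicClosure (ZMod p) := fun d => if d = d₀ ∨ d = M.z d₀ then 1 else 0
  have hδ : ∀ d, δ (M.z d) = δ d := by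
    intro d
    have : (M.z d = d₀ ∨ M.z d = M.z d₀) ↔ (d = d₀ ∨ d = M.z d₀) := by
      rw [M.z.injective.eq_iff, or_comm, ← M.z.injective.eq_iff (a := d) (b := M.z d₀), hz1]
    simp only [δ, this]
  -- The unnormalised projection of δ to the functions which g multiplies by ω⁻¹.
  let A : Equiv.Perm M.D → M.D → AlgebraicClosure (ZMod p) := fun g d =>
    ∑ i ∈ Finset.range m, ω ^ i * δ ((g ^ i) d)
  have hA : ∀ g : Equiv.Perm M.D, g ^ m = 1 → ∀ d, ω * A g (g d) = A g d :=
    fun g hg d => mul_sum_twist hg hω δ d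
  have hAz : ∀ d, A M.x (M.z d) = A M.x⁻¹ d := by
    intro d
    refine Finset.sum_congr rfl fun i _ => ?_
    rw [← zpow_natCast M.x, x_zpow_z hz, hδ, inv_pow, zpow_neg, zpow_natCast]
  have h1 : ∀ d, A M.x (M.x d) = ω⁻¹ * A M.x d := fun d => by
    rw [← hA _ hx d, inv_mul_cancel_left₀ hω0]
  have h2 : ∀ d, A M.x (M.x⁻¹ d) = ω * A M.x d := fun d => by
    have := hA _ hx (M.x⁻¹ d)
    rw [perm_apply_inv] at this
    exact this.symm
  have h3 : ∀ d, A M.x⁻¹ (M.x⁻¹ d) = ω⁻¹ * A M.x⁻¹ d := fun d => by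
    rw [← hA _ hx' d, inv_mul_cancel_left₀ hω0]
  have h4 : ∀ d, A M.x⁻¹ (M.x d) = ω * A M.x⁻¹ d := fun d => by
    have := hA _ hx' (M.x d)
    rw [perm_inv_apply] at this
    exact this.symm
  have hF : ∀ d, (A M.x (M.x d) + A M.x⁻¹ (M.x d)) + (A M.x (M.x⁻¹ d) + A M.x⁻¹ (M.x⁻¹ d)) =
      (ω + ω⁻¹) * (A M.x d + A M.x⁻¹ d) := fun d => by rw [h1, h2, h3, h4]; ring
  refine ⟨fun d => A M.x d + A M.x⁻¹ d, fun d => ?_, hF, ?_, d₀, ?_⟩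
  · change A M.x (M.z d) + A M.x⁻¹ (M.z d) = A M.x d + A M.x⁻¹ d
    rw [hAz, ← hAz (M.z d), hz1, add_comm]
  · have h5 := Finset.sum_congr (rfl : (Finset.univ : Finset M.D) = _) fun d _ => hF d
    rw [Finset.sum_add_distrib, ← Finset.mul_sum,
      Equiv.sum_comp M.x (fun d => A M.x d + A M.x⁻¹ d),
      Equiv.sum_comp M.x⁻¹ (fun d => A M.x d + A M.x⁻¹ d)] at h5
    -- Summing the eigenvalue relation over the darts gives (ω + ω⁻¹) S = 2 S, and ω ≠ 1.
    have h6 : (ω - 1) ^ 2 * ∑ d, (A M.x d + A M.x⁻¹ d) = 0 := by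
      have h7 : ω⁻¹ * ω = 1 := inv_mul_cancel₀ hω0
      linear_combination (-ω) * h5 - (∑ d, (A M.x d + A M.x⁻¹ d)) * h7
    exact (mul_eq_zero.1 h6).resolve_left (pow_ne_zero _ (sub_ne_zero.2 hω1))
  -- At `d₀` only the term i = 0 survives, since no other rotation about the vertex leads back to
  -- the base face. Thus the value there is 1 + 1, which is not 0.
  · have hval : ∀ g : Equiv.Perm M.D, (g = M.x ∨ g = M.x⁻¹) → A g d₀ = 1 := by
      intro g hg
      have hper : ∀ i : ℕ, i < m → 0 < i → (g ^ i) d₀ ≠ d₀ ∧ (g ^ i) d₀ ≠ M.z d₀ := by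
        intro i him hi
        have hxi : (M.x ^ i) d₀ ≠ d₀ := by
          intro h
          have h8 : Function.IsPeriodicPt M.x i d₀ := by
            rw [Function.IsPeriodicPt, Function.IsFixedPt, Equiv.Perm.iterate_eq_pow]; exact h
          have := h8.minimalPeriod_le hi
          rw [(H.type d₀).2] at this
          omega
        rcases hg with rfl | rfl
        · exact ⟨hxi, by
            rw [← zpow_natCast]; exact x_zpow_ne_z H.regular H.type H.genus_eq _ _⟩
        · refine ⟨fun h => hxi ?_, by
            rw [inv_pow, ← zpow_natCast, ← zpow_neg]
            exact x_zpow_ne_z H.regular H.type H.genus_eq _ _⟩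
          rw [inv_pow] at h
          conv_lhs => rw [← h]
          rw [perm_apply_inv]
      change ∑ i ∈ Finset.range m, ω ^ i * δ ((g ^ i) d₀) = 1
      rw [Finset.sum_eq_single_of_mem 0 (Finset.mem_range.2 hm)]
      · simp [δ]
      · intro i hi hi0
        have := hper i (Finset.mem_range.1 hi) (Nat.pos_of_ne_zero hi0)
        simp [δ, this.1, this.2]
    change A M.x d₀ + A M.x⁻¹ d₀ ≠ 0
    rw [hval _ (Or.inl rfl), hval _ (Or.inr rfl), one_add_one_eq_two]
    intro h9
    apply H.two_ne
    rw [← map_ofNat (algebraMap (ZMod p) (AlgebraicClosure (ZMod p))), map_eq_zero] at h9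
    exact h9

/-- The eigenfunction has values in the algebraic closure. An 𝔽_p-linear functional carries it to a
function over 𝔽_p, on which q(T) acts as multiplication by q(ω + ω⁻¹) inside the functional; the
minimal polynomial kills this. -/
theorem kerIn_minpoly_ne_bot {m : ℕ} (H : IsPlatonicCoprime p M 2 m)
    {ω : AlgebraicClosure (ZMod p)} (hω : ω ^ m = 1) (hω1 : ω ≠ 1) :
    kerIn (hecke (ZMod p) 2 M.y) (faceSpace (ZMod p) M) (minpoly (ZMod p) (ω + ω⁻¹)) ≠ ⊥ := by
  obtain ⟨F, hFz, hF, hF0, d, hd⟩ := exists_eigenfunction H hω hω1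
  obtain ⟨ψ, hψ⟩ := exists_linearMap_ne_zero (p := p) hd
  have hz := H.type.z_pow
  have hT : ∀ c, hecke (ZMod p) 2 M.y (fun d => ψ (c * F d)) =
      fun d => ψ ((ω + ω⁻¹) * c * F d) := by
    intro c
    funext d
    rw [hecke_y_of_z_sq hz (fun d => by rw [hFz]), ← map_add, ← mul_add, hF]
    congr 1
    ring
  have key : ∀ (q : (ZMod p)[X]) c, aeval (hecke (ZMod p) 2 M.y) q (fun d => ψ (c * F d)) =
      fun d => ψ (aeval (ω + ω⁻¹) q * c * F d) := by
    intro q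
    induction q using Polynomial.induction_on' with
    | add q r hq hr =>
      intro c
      funext d
      rw [map_add, map_add, LinearMap.add_apply, hq, hr, Pi.add_apply, ← map_add]
      congr 1
      ring
    | monomial i a =>
      intro c
      have hpow : (hecke (ZMod p) 2 M.y ^ i) (fun d => ψ (c * F d)) =
          fun d => ψ ((ω + ω⁻¹) ^ i * c * F d) := by
        induction i with
        | zero => simp
        | succ i ih =>
          rw [pow_succ', Module.End.mul_apply, ih, hT, pow_succ']
          simp only [mul_assoc]
      rw [aeval_monomial, aeval_monomial, Module.End.mul_apply, hpow]
      funext d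
      change a * ψ _ = _
      rw [← smul_eq_mul, ← map_smul, Algebra.smul_def]
      congr 1
      ring
  intro h0
  have hmem : (fun d => ψ (F d)) ∈ kerIn (hecke (ZMod p) 2 M.y) (faceSpace (ZMod p) M)
      (minpoly (ZMod p) (ω + ω⁻¹)) := by
    refine ⟨?_, fun d => congrArg ψ (hFz d), ?_⟩
    · have := key (minpoly (ZMod p) (ω + ω⁻¹)) 1
      simp only [one_mul, minpoly.aeval, zero_mul, map_zero] at this
      exact this
    · change ∑ d, ψ (F d) = 0
      rw [← map_sum, hF0, map_zero]
  rw [h0] at hmem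
  exact hψ (congrFun ((Submodule.mem_bot _).1 hmem) d)

theorem IsPlatonicCoprime.multFree_hosohedron {m : ℕ} (H : IsPlatonicCoprime p M 2 m) :
    ∃ μ : Fin (numRootOrbits p m) → (ZMod p)[X], MultFree p 2 M μ := by
  obtain ⟨ω, hω, hcop, hall⟩ := exists_orbit_polynomials H.m_ne
  have hz := H.type.z_pow
  refine ⟨fun j => minpoly (ZMod p) (ω j + (ω j)⁻¹), fun w => ?_,
    fun j => minpoly.irreducible (Algebra.IsIntegral.isIntegral _), hcop, fun f hf => ?_,
    fun j => kerIn_minpoly_ne_bot H (hω j).1 (hω j).2⟩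
  · obtain ⟨j, hj | hj⟩ := mon_eq_of_z_sq hz w
    · rw [hj]; exact exists_hecke_x_zpow hz j
    · obtain ⟨q, hq⟩ := exists_hecke_x_zpow (k := ZMod p) hz j
      refine ⟨q, fun f hf => ?_⟩
      rw [hj, ← hq f hf, ← hecke_zpow_mul 2 (M.x ^ j) 1 hf.1, zpow_one]
  · rw [aeval_hecke_of_z_sq H.type.m_pos hz H.type.x_pow _ hf]
    -- After cancelling X - 1, the geometric sum of length m divides the product evaluated at X +
    -- X^(m-1). In translation by x this sum is zero on face functions of sum zero.
    have h1 := X_pow_sub_one_dvd H.m_ne hall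
    rw [← geom_sum_mul, mul_comm] at h1
    have hX : (X - 1 : (ZMod p)[X]) ≠ 0 := by simpa using X_sub_C_ne_zero (1 : ZMod p)
    obtain ⟨r, hr⟩ := (mul_dvd_mul_iff_left hX).1 h1
    rw [hr, mul_comm, aeval_mul_apply]
    have h2 : aeval (LinearMap.funLeft (ZMod p) (ZMod p) M.x)
        (∑ i ∈ Finset.range m, X ^ i : (ZMod p)[X]) f = 0 := by
      funext d
      rw [aeval_sum_X_pow, sum_x_pow_eq_zero hz H.type.x_pow H.card_ne hf]
      rfl
    rw [h2, map_zero]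

theorem MultFree.exists_hasRegularCoverings {n m ν : ℕ} {μ : Fin ν → (ZMod p)[X]}
    (h : MultFree p n M μ) (H : IsPlatonicCoprime p M n m) :
    ∃ c : Fin (2 ^ ν - 1) → ℕ, HasRegularCoverings M p c := by
  have hcard : Nat.card {S : Finset (Fin ν) // S.Nonempty} = 2 ^ ν - 1 := by
    rw [Nat.card_eq_fintype_card, Fintype.card_subtype]
    have : (Finset.univ.filter fun S : Finset (Fin ν) => S.Nonempty) = Finset.univ.erase ∅ := by
      ext S; simp [Finset.nonempty_iff_ne_empty]
    rw [this, Finset.card_erase_of_mem (Finset.mem_univ _), Finset.card_univ, Fintype.card_finset,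
      Fintype.card_fin]
  let E := (Finite.equivFinOfCardEq hcard).symm
  exact ⟨_, h.hasRegularCoverings H (fun i => (E i).1)
    (Subtype.val_injective.comp E.injective) (fun i => (E i).2)
    (fun S hS => ⟨E.symm ⟨S, hS⟩, by simp⟩) fun i => rfl⟩

end hosohedron

/-! ### Dihedra -/

theorem IsPlatonicCoprime.multFree_dihedron {p n : ℕ} [Fact p.Prime]
    (H : IsPlatonicCoprime p M n 2) :
    HasRegularCoverings M p ![1] ∧ CoveringsAreJoins M p 1 := by
  have h1 : M.numFaces = 2 := by
    have h2 := H.type.card_eq H.genus_eq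
    rw [← H.type.numFaces_mul] at h2
    have hn : (n : ℚ) ≠ 0 := by exact_mod_cast H.type.n_pos.ne'
    push_cast at h2
    field_simp at h2
    have h3 : (M.numFaces : ℚ) = 2 := by linarith
    exact_mod_cast h3
  have h2 : Module.finrank (ZMod p) (faceSpace (ZMod p) M) = 1 := by
    have := finrank_faceSpace (k := ZMod p) (M := M) H.card_ne
    omega
  obtain ⟨l, hl, hk⟩ := H.multFree_of_finrank_eq_one h2
  refine ⟨hl.hasRegularCoverings H (fun _ => Finset.univ) (fun i j _ => Subsingleton.elim i j)
    (fun _ => Finset.univ_nonempty) (fun S hS => ⟨0, ?_⟩) (fun i => ?_), hl.coveringsAreJoins H⟩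
  · obtain ⟨i, hi⟩ := hS
    ext j
    rw [Subsingleton.elim j i]
    exact iff_of_true (Finset.mem_univ _) hi
  · rw [Finset.univ_unique, Finset.sum_singleton, hk, h2]
    fin_cases i
    rfl

end

end OMap

end

section

open Polynomial

namespace OMap

noncomputable section

variable {M : OMap}

/-! ### Maps given by tables -/

/-- An orientably regular map with `N` darts and `n`-gonal faces, given by tables: `rho` is the
automorphism which rotates the face of the dart `0`, `cls` numbers its orbits on the faces, and
`word` lists elements of the monodromy group which take the dart `0` to a dart in each of these
orbits (`true` and `false` stand for `y` and `z`). -/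
structure FaceTable (n N r : ℕ) where
  z : Fin N → Fin N
  y : Fin N → Fin N
  rho : Fin N → Fin N
  cls : Fin N → Fin r
  word : Fin r → List Bool

namespace FaceTable

variable {n N r : ℕ} [NeZero N] [NeZero r] (Δ : FaceTable n N r)

/-- The action of words. -/
def act (w : List Bool) (a : Fin N) : Fin N :=
  w.foldr (fun b c => bif b then Δ.y c else Δ.z c) a

def rep (j : Fin r) : Fin N := Δ.act (Δ.word j) 0

/-- All of this is decidable. `descent` gives connectedness by strong induction on labels, with z⁻¹
written as the power n - 1. As `rho` commutes with z and y and agrees with z at 0, `cls_eq`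
identifies the class of a dart with a double coset; `rep_ne` says that the other representatives lie
off the base face. -/
structure IsValid (Δ : FaceTable n N r) : Prop where
  pos : 0 < n
  z_iterate : ∀ a, Δ.z^[n] a = a
  y_y : ∀ a, Δ.y (Δ.y a) = a
  y_ne : ∀ a, Δ.y a ≠ a
  descent : ∀ a, a ≠ 0 → Δ.z^[n - 1] a < a ∨ Δ.y a < a
  rho_z : ∀ a, Δ.rho (Δ.z a) = Δ.z (Δ.rho a)
  rho_y : ∀ a, Δ.rho (Δ.y a) = Δ.y (Δ.rho a)
  rho_zero : Δ.rho 0 = Δ.z 0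
  cls_eq : ∀ a, ∃ i j : Fin n, a = Δ.z^[i] (Δ.rho^[j] (Δ.rep (Δ.cls a)))
  word_zero : Δ.word 0 = []
  rep_ne : ∀ j, j ≠ 0 → ∀ i : Fin n, Δ.z^[i] (Δ.rep j) ≠ 0

variable {Δ}

section toMap

variable (hΔ : Δ.IsValid)

/-- The face rotation as a permutation. -/
def zPerm : Equiv.Perm (Fin N) where
  toFun := Δ.z
  invFun := Δ.z^[n - 1]
  left_inv a := by
    rw [← Function.iterate_succ_apply, Nat.succ_eq_add_one, Nat.sub_add_cancel hΔ.pos,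
      hΔ.z_iterate]
  right_inv a := by
    rw [← Function.iterate_succ_apply' Δ.z, Nat.succ_eq_add_one, Nat.sub_add_cancel hΔ.pos,
      hΔ.z_iterate]

/-- The reversal of the darts as a permutation. -/
def yPerm : Equiv.Perm (Fin N) where
  toFun := Δ.y
  invFun := Δ.y
  left_inv := hΔ.y_y
  right_inv := hΔ.y_y

theorem yPerm_mul_yPerm : yPerm hΔ * yPerm hΔ = 1 := Equiv.ext hΔ.y_y

theorem exists_closure_zero (a : Fin N) :
    ∃ g ∈ Subgroup.closure ({(zPerm hΔ)⁻¹ * yPerm hΔ, yPerm hΔ} : Set (Equiv.Perm (Fin N))),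
      g a = 0 := by
  have hy : yPerm hΔ ∈ Subgroup.closure
      ({(zPerm hΔ)⁻¹ * yPerm hΔ, yPerm hΔ} : Set (Equiv.Perm (Fin N))) :=
    Subgroup.subset_closure (by simp)
  have hz : (zPerm hΔ)⁻¹ ∈ Subgroup.closure
      ({(zPerm hΔ)⁻¹ * yPerm hΔ, yPerm hΔ} : Set (Equiv.Perm (Fin N))) := by
    have h1 : (zPerm hΔ)⁻¹ * yPerm hΔ ∈ Subgroup.closure
        ({(zPerm hΔ)⁻¹ * yPerm hΔ, yPerm hΔ} : Set (Equiv.Perm (Fin N))) :=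
      Subgroup.subset_closure (by simp)
    have h2 := mul_mem h1 hy
    rwa [mul_assoc, yPerm_mul_yPerm, mul_one] at h2
  induction a using WellFoundedLT.induction with
  | ind a ih =>
    by_cases ha : a = 0
    · exact ⟨1, one_mem _, ha⟩
    · rcases hΔ.descent a ha with h | h
      · obtain ⟨g, hg, h1⟩ := ih _ h
        exact ⟨g * (zPerm hΔ)⁻¹, mul_mem hg hz, h1⟩
      · obtain ⟨g, hg, h1⟩ := ih _ h
        exact ⟨g * yPerm hΔ, mul_mem hg hy, h1⟩

/-- The map described by a table. -/
def toMap : OMap where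
  D := Fin N
  finite := inferInstance
  nonempty := ⟨0⟩
  x := (zPerm hΔ)⁻¹ * yPerm hΔ
  y := yPerm hΔ
  y_invol := hΔ.y_y
  y_free := hΔ.y_ne
  connected a b := by
    obtain ⟨g, hg, ha⟩ := exists_closure_zero hΔ a
    obtain ⟨g', hg', hb⟩ := exists_closure_zero hΔ b
    exact ⟨g'⁻¹ * g, mul_mem (inv_mem hg') hg, by
      rw [Equiv.Perm.mul_apply, ha, ← hb, perm_inv_apply]⟩

theorem toMap_z : (toMap hΔ).z = zPerm hΔ := by
  change ((zPerm hΔ)⁻¹ * yPerm hΔ * yPerm hΔ)⁻¹ = _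
  rw [mul_assoc, yPerm_mul_yPerm, mul_one, inv_inv]

/-- The face lengths and valencies of the five solids are prime powers, so an exact period is
certified by one power being the identity and one being without fixed points. -/
theorem hasType_toMap {q s q' s' : ℕ} [Fact q.Prime] [Fact q'.Prime] (hn : n = q ^ (s + 1))
    (h1 : ∀ a, Δ.z^[q ^ s] a ≠ a)
    (h2 : ∀ a, (fun b => Δ.z^[n - 1] (Δ.y b))^[q' ^ (s' + 1)] a = a)
    (h3 : ∀ a, (fun b => Δ.z^[n - 1] (Δ.y b))^[q' ^ s'] a ≠ a) :
    (toMap hΔ).HasType n (q' ^ (s' + 1)) := by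
  intro a
  rw [toMap_z]
  refine ⟨?_, Function.minimalPeriod_eq_prime_pow (h3 a) (h2 a)⟩
  have h4 := Function.minimalPeriod_eq_prime_pow (f := Δ.z) (p := q) (k := s) (h1 a)
    (by rw [← hn]; exact hΔ.z_iterate a)
  rw [← hn] at h4
  exact h4

end toMap

theorem IsValid.rho_iterate_act (hΔ : Δ.IsValid) (w : List Bool) (i : ℕ)
    (a : Fin N) : Δ.rho^[i] (Δ.act w a) = Δ.act w (Δ.rho^[i] a) := by
  induction w with
  | nil => rfl
  | cons b w ih =>
    cases b
    · change Δ.rho^[i] (Δ.z (Δ.act w a)) = Δ.z (Δ.act w (Δ.rho^[i] a))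
      rw [← ih, (Function.Commute.iterate_left hΔ.rho_z i).eq]
    · change Δ.rho^[i] (Δ.y (Δ.act w a)) = Δ.y (Δ.act w (Δ.rho^[i] a))
      rw [← ih, (Function.Commute.iterate_left hΔ.rho_y i).eq]

theorem IsValid.rho_iterate_zero (hΔ : Δ.IsValid) (i : ℕ) :
    Δ.rho^[i] 0 = Δ.z^[i] 0 := by
  induction i with
  | zero => rfl
  | succ i ih =>
    rw [Function.iterate_succ_apply, hΔ.rho_zero, (Function.Commute.iterate_left hΔ.rho_z i).eq, ih,
      Function.iterate_succ_apply']

/-- A numbering of the darts of `M` according to a table. -/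
structure Labelling (Δ : FaceTable n N r) (M : OMap) where
  e : Fin N ≃ M.D
  map_z : ∀ a, M.z (e a) = e (Δ.z a)
  map_y : ∀ a, M.y (e a) = e (Δ.y a)

/-- The spherical map M is unique for its type and number of darts, so the genus of the map given by
the table need not be computed. -/
theorem exists_labelling (hΔ : Δ.IsValid) {m : ℕ} (ht : (toMap hΔ).HasType n m)
    (h : M.HasType n m) (hg : M.genus = 0) (hN : Nat.card M.D = N) : Nonempty (Δ.Labelling M) := by
  obtain ⟨d⟩ := M.nonempty
  obtain ⟨φ, hφ, -⟩ := exists_iso h hg ht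
    (hN.le.trans (Nat.card_fin N).ge) d (0 : Fin N)
  let e : M.D ≃ Fin N := Equiv.ofBijective φ.toFun hφ
  have hz : ∀ d, e (M.z d) = Δ.z (e d) := fun d => by
    have := φ.map_mon gZ d
    rw [mon_Z, mon_Z, toMap_z] at this
    exact this
  have hy : ∀ d, e (M.y d) = Δ.y (e d) := φ.map_y
  refine ⟨⟨e.symm, fun a => ?_, fun a => ?_⟩⟩
  · rw [← e.symm_apply_apply (M.z _), hz, e.apply_symm_apply]
  · rw [← e.symm_apply_apply (M.y _), hy, e.apply_symm_apply]

namespace Labelling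

variable (L : Δ.Labelling M)

omit [NeZero N] [NeZero r] in
theorem map_z_pow (i : ℕ) (a : Fin N) : (M.z ^ i) (L.e a) = L.e (Δ.z^[i] a) := by
  induction i generalizing a with
  | zero => rfl
  | succ i ih =>
    rw [pow_succ, Equiv.Perm.mul_apply, L.map_z, ih, Function.iterate_succ_apply]

/-- The element of the free group given by a word. -/
def _root_.OMap.wordElt (w : List Bool) : FreeGroup Bool :=
  (w.map fun b => bif b then gY else gZ).prod

omit [NeZero N] [NeZero r] in
theorem mon_wordElt (w : List Bool) (a : Fin N) :
    M.mon (wordElt w) (L.e a) = L.e (Δ.act w a) := by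
  induction w with
  | nil => simp [wordElt, act]
  | cons b w ih =>
    have h1 : wordElt (b :: w) = (bif b then gY else gZ) * wordElt w := by simp [wordElt]
    rw [h1, map_mul, Equiv.Perm.mul_apply, ih]
    cases b
    · rw [cond_false, mon_Z, L.map_z]; rfl
    · rw [cond_true, mon_Y, L.map_y]; rfl

variable (k : Type) [Field k]

/-- The Hecke operator of a double coset. -/
def op (_ : Δ.Labelling M) (k : Type) [Field k] (j : Fin r) : (M.D → k) →ₗ[k] (M.D → k) :=
  hecke k n (M.mon (wordElt (Δ.word j)))

variable {k} (hΔ : Δ.IsValid) (hM : M.OrientablyRegular)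

include hΔ hM

/-- A monodromy element is determined by the image of the dart 0. Since `rho` and z agree at 0, a
dart z^i rho^j of a representative is the image of 0 under z^i · word · z^j, which lies in the
double coset of the word. -/
theorem hecke_eq_op (hz : M.z ^ n = 1) {w : FreeGroup Bool} {a : Fin N}
    (h : M.mon w (L.e 0) = L.e a) {f : M.D → k} (hf : f ∈ fixSub k M.z) :
    hecke k n (M.mon w) f = L.op k (Δ.cls a) f := by
  obtain ⟨i, j, ha⟩ := hΔ.cls_eq a
  have h1 : M.mon w = M.mon (gZ ^ (i : ℕ) * (wordElt (Δ.word (Δ.cls a)) * gZ ^ (j : ℕ))) := by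
    refine hM.mon_eq (d := L.e 0) ?_
    rw [h, map_mul, map_mul, map_pow, map_pow, mon_Z, Equiv.Perm.mul_apply, Equiv.Perm.mul_apply,
      L.map_z_pow, mon_wordElt, L.map_z_pow, ← hΔ.rho_iterate_zero, ← hΔ.rho_iterate_act]
    exact congrArg L.e ha
  rw [h1, map_mul, map_mul, map_pow, map_pow, mon_Z, ← zpow_natCast, ← zpow_natCast,
    hecke_zpow_mul n _ _ hf, hecke_mul_zpow hz]
  rfl

theorem exists_hecke_eq_op (hz : M.z ^ n = 1) (w : FreeGroup Bool) :
    ∃ j, ∀ f ∈ fixSub k M.z, hecke k n (M.mon w) f = L.op k j f :=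
  ⟨_, fun _ hf => hecke_eq_op L hΔ hM hz (L.e.apply_symm_apply (M.mon w (L.e 0))).symm hf⟩

theorem op_op (hz : M.z ^ n = 1) (i j : Fin r) {f : M.D → k} (hf : f ∈ fixSub k M.z) :
    L.op k i (L.op k j f) =
      ∑ t : Fin n, L.op k (Δ.cls (Δ.act (Δ.word j) (Δ.z^[t] (Δ.rep i)))) f := by
  rw [op, op, hecke_hecke, ← Fin.sum_univ_eq_sum_range (fun t => hecke k n
    (M.mon (wordElt (Δ.word j)) * M.z ^ t * M.mon (wordElt (Δ.word i))) f)]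
  refine Finset.sum_congr rfl fun t _ => ?_
  rw [← mon_Z, ← map_pow, ← map_mul, ← map_mul]
  refine hecke_eq_op L hΔ hM hz ?_ hf
  rw [map_mul, map_mul, map_pow, mon_Z, Equiv.Perm.mul_apply, Equiv.Perm.mul_apply, mon_wordElt,
    L.map_z_pow, mon_wordElt]
  rfl

/-- Words leading from 0 to all darts lead from any dart to all darts, so each inner sum is the
total of f. -/
theorem sum_op_eq_zero (hz : M.z ^ n = 1) {f : M.D → k} (hf : f ∈ faceSpace k M) :
    ∑ a, L.op k (Δ.cls a) f = 0 := by
  choose u hu using fun a => M.exists_mon (L.e 0) (L.e a)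
  rw [Finset.sum_congr rfl fun a _ => (hecke_eq_op L hΔ hM hz (hu a) hf.1).symm]
  funext d
  rw [Finset.sum_apply]
  simp only [hecke_apply]
  rw [Finset.sum_comm]
  refine Finset.sum_eq_zero fun s _ => ?_
  obtain ⟨α, hα, h1⟩ := hM (L.e 0) ((M.z ^ s) d)
  rw [← h1, Finset.sum_congr rfl fun a _ => by rw [← aut_mon hα, hu]]
  exact (Equiv.sum_comp (L.e.trans α) f).trans hf.2

omit hM

theorem op_zero {f : M.D → k} (hf : f ∈ fixSub k M.z) : L.op k 0 f = (n : k) • f := by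
  rw [op, hΔ.word_zero, ← hecke_one n hf]
  simp [wordElt]

omit hΔ [NeZero N] [NeZero r] in
theorem op_mem (hz : M.z ^ n = 1) (j : Fin r) {f : M.D → k} (hf : f ∈ faceSpace k M) :
    L.op k j f ∈ faceSpace k M := hecke_mem_faceSpace hz _ hf

/-! ### Traces -/

include hM

/-- The monodromy group acts regularly, so a diagonal entry counts the s with word · z^s = 1. This
occurs only for the trivial double coset, once for each dart. -/
theorem trace_op {m : ℕ} (ht : M.HasType n m) (j : Fin r) :
    LinearMap.trace k _ (L.op k j) = if j = 0 then (Nat.card M.D : k) else 0 := by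
  classical
  have h0 : LinearMap.trace k _ (L.op k j) = ∑ d : M.D, ∑ s ∈ Finset.range n,
      if M.mon (wordElt (Δ.word j)) ((M.z ^ s) d) = d then (1 : k) else 0 := by
    rw [LinearMap.trace_eq_matrix_trace k (Pi.basisFun k M.D), Matrix.trace]
    refine Finset.sum_congr rfl fun d _ => ?_
    rw [Matrix.diag_apply, LinearMap.toMatrix_apply, Pi.basisFun_apply, Pi.basisFun_repr, op,
      hecke_apply]
    refine Finset.sum_congr rfl fun s _ => ?_
    rw [Pi.single_apply]
  rw [h0]
  split_ifs with hj
  · subst hj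
    have h1 : ∀ d : M.D, ∑ s ∈ Finset.range n,
        (if M.mon (wordElt (Δ.word 0)) ((M.z ^ s) d) = d then (1 : k) else 0) = 1 := by
      intro d
      rw [hΔ.word_zero]
      rw [Finset.sum_eq_single_of_mem 0 (Finset.mem_range.2 hΔ.pos)]
      · simp [wordElt]
      · intro s hs hs0
        rw [if_neg]
        intro h2
        have h3 : Function.IsPeriodicPt M.z s d := by
          rw [Function.IsPeriodicPt, Function.IsFixedPt, Equiv.Perm.iterate_eq_pow]
          simpa [wordElt] using h2
        have := h3.minimalPeriod_le (Nat.pos_of_ne_zero hs0)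
        rw [(ht d).1] at this
        have := Finset.mem_range.1 hs
        omega
    rw [Finset.sum_congr rfl fun d _ => h1 d]
    simp [Nat.card_eq_fintype_card]
  · refine Finset.sum_eq_zero fun d _ => Finset.sum_eq_zero fun s hs => if_neg fun h => ?_
    have h2 : M.mon (gZ ^ s * wordElt (Δ.word j)) = 1 := by
      have h1 : M.mon (wordElt (Δ.word j) * gZ ^ s) = 1 := by
        rw [hM.mon_eq (v := wordElt (Δ.word j) * gZ ^ s) (w := 1) (d := d), map_one]
        rw [map_mul, map_pow, mon_Z, map_one]
        exact h
      rw [map_mul] at h1 ⊢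
      exact mul_eq_one_comm.1 h1
    have h3 := Equiv.Perm.congr_fun h2 (L.e 0)
    rw [map_mul, map_pow, mon_Z, Equiv.Perm.mul_apply, mon_wordElt, L.map_z_pow] at h3
    exact hΔ.rep_ne j hj ⟨s, Finset.mem_range.1 hs⟩ (L.e.injective h3)

/-- The dimension of a module of functions on the faces, modulo the characteristic. -/
theorem finrank_eq_of_projection {m : ℕ} (ht : M.HasType n m) (hD : (Nat.card M.D : k) ≠ 0)
    {W : Submodule k (M.D → k)} (hW : W ≤ faceSpace k M) (γ : Fin r → k)
    (h1 : ∀ f ∈ faceSpace k M, ∑ j, γ j • L.op k j f ∈ W)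
    (h2 : ∀ f ∈ W, ∑ j, γ j • L.op k j f = f) :
    (Module.finrank k W : k) = Nat.card M.D * γ 0 - n * ∑ j, γ j := by
  classical
  have hn : (n : k) ≠ 0 := (ht.natCast_ne_zero hD).2.1
  have hz := ht.z_pow
  -- J projects onto the constants, and E below projects all functions on darts onto `faceSpace`:
  -- average over the face, then subtract the mean.
  let J : (M.D → k) →ₗ[k] (M.D → k) := (total k M).smulRight fun _ => (Nat.card M.D : k)⁻¹
  let E : (M.D → k) →ₗ[k] (M.D → k) := (n : k)⁻¹ • faceSum k M n - J
  have hJ : ∀ f : M.D → k, total k M f = 0 → J f = 0 := fun f hf => by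
    change total k M f • (fun _ : M.D => (Nat.card M.D : k)⁻¹) = _
    rw [hf, zero_smul]
  have hEmem : ∀ f, E f ∈ faceSpace k M := by
    intro f
    refine ⟨sub_mem (Submodule.smul_mem _ _ (faceSum_mem_fixSub hz f)) fun d => rfl, ?_⟩
    change total k M ((n : k)⁻¹ • faceSum k M n f - J f) = 0
    rw [map_sub, map_smul, total_faceSum, smul_eq_mul, inv_mul_cancel_left₀ hn, sub_eq_zero]
    change _ = ∑ d : M.D, total k M f * (Nat.card M.D : k)⁻¹
    rw [Finset.sum_const, Finset.card_univ, ← Nat.card_eq_fintype_card, nsmul_eq_mul,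
      mul_left_comm, mul_inv_cancel₀ hD, mul_one]
  have hEid : ∀ f ∈ faceSpace k M, E f = f := by
    intro f hf
    change (n : k)⁻¹ • faceSum k M n f - J f = f
    rw [faceSum_of_mem_fixSub n hf.1, hJ f hf.2, sub_zero, inv_smul_smul₀ hn]
  have hproj : LinearMap.IsProj W (∑ j, γ j • (L.op k j * E)) := by
    refine ⟨fun f => ?_, fun f hf => ?_⟩
    · have := h1 (E f) (hEmem f)
      simpa [LinearMap.sum_apply] using this
    · have := h2 f hf
      rw [← hEid f (hW hf)] at this
      simp only [LinearMap.sum_apply, LinearMap.smul_apply, Module.End.mul_apply]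
      rw [this, hEid f (hW hf)]
  -- E composed with the operator is the operator minus n J, and J has trace 1.
  have htr : ∀ j, LinearMap.trace k _ (L.op k j * E) =
      (if j = 0 then (Nat.card M.D : k) else 0) - n := by
    intro j
    rw [LinearMap.trace_mul_comm, ← L.trace_op hΔ hM ht j]
    have h3 : E * L.op k j = L.op k j - (n : k) • J := by
      refine LinearMap.ext fun f => _root_.funext fun d => ?_
      change ((n : k)⁻¹ • faceSum k M n (L.op k j f) - J (L.op k j f)) d = _
      have h4 : L.op k j f ∈ fixSub k M.z := by
        rw [op, hecke_eq_faceSum]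
        exact faceSum_mem_fixSub hz _
      rw [faceSum_of_mem_fixSub n h4, inv_smul_smul₀ hn]
      change _ - total k M (hecke k n _ f) * _ = _ - n * (total k M f * _)
      rw [hecke_eq_faceSum, total_faceSum, total_comp, mul_assoc]
    rw [h3, map_sub, map_smul]
    have h4 : LinearMap.trace k _ J = 1 := by
      rw [LinearMap.trace_eq_matrix_trace k (Pi.basisFun k M.D), Matrix.trace]
      have h5 : ∀ d : M.D, (LinearMap.toMatrix (Pi.basisFun k M.D) (Pi.basisFun k M.D) J).diag d =
          (Nat.card M.D : k)⁻¹ := by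
        intro d
        rw [Matrix.diag_apply, LinearMap.toMatrix_apply, Pi.basisFun_apply, Pi.basisFun_repr]
        change total k M (Pi.single d 1) * _ = _
        have : total k M (Pi.single d 1) = 1 := by
          change ∑ e, (Pi.single d 1 : M.D → k) e = 1
          rw [Finset.sum_pi_single']
          simp
        rw [this, one_mul]
      rw [Finset.sum_congr rfl fun d _ => h5 d, Finset.sum_const, Finset.card_univ,
        ← Nat.card_eq_fintype_card, nsmul_eq_mul, mul_inv_cancel₀ hD]
    rw [h4, smul_eq_mul, mul_one]
  rw [← hproj.trace, map_sum]
  simp only [map_smul, htr, smul_eq_mul, mul_sub, Finset.sum_sub_distrib, mul_ite, mul_zero]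
  rw [Finset.sum_ite_eq' Finset.univ 0, if_pos (Finset.mem_univ _), Finset.mul_sum, mul_comm]
  simp only [mul_comm]

end Labelling

end FaceTable

end

end OMap

end

section

open Polynomial

namespace OMap

/-! ### Tables of the Platonic solids -/

def tetrahedronTable : FaceTable 3 12 2 where
  z a := Fin.ofNat 12 (a / 3 * 3 + (a + 1) % 3)
  y a :=
    Fin.ofNat 12 ([3, 6, 9, 0, 11, 7, 1, 5, 10, 2, 8, 4].getD a 0)
  rho a :=
    Fin.ofNat 12 ([1, 2, 0, 6, 7, 8, 9, 10, 11, 3, 4, 5].getD a 0)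
  cls a :=
    Fin.ofNat 2 ([0, 0, 0, 1, 1, 1, 1, 1, 1, 1, 1, 1].getD a 0)
  word :=
    ![[], [true]]

theorem tetrahedronTable_isValid : tetrahedronTable.IsValid where
  pos := by decide
  z_iterate := by decide +kernel
  y_y := by decide +kernel
  y_ne := by decide +kernel
  descent := by decide +kernel
  rho_z := by decide +kernel
  rho_y := by decide +kernel
  rho_zero := by decide +kernel
  cls_eq := by decide +kernel
  word_zero := rfl
  rep_ne := by decide +kernel

theorem tetrahedronTable_hasType : (FaceTable.toMap tetrahedronTable_isValid).HasType 3 3 :=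
  FaceTable.hasType_toMap tetrahedronTable_isValid (q := 3) (s := 0)
    (q' := 3) (s' := 0) rfl (by decide +kernel) (by decide +kernel) (by decide +kernel)

def cubeTable : FaceTable 4 24 3 where
  z a := Fin.ofNat 24 (a / 4 * 4 + (a + 1) % 4)
  y a :=
    Fin.ofNat 24 ([4, 8, 12, 16, 0, 19, 20, 9, 1, 7, 23, 13, 2, 11, 22, 17, 3, 15, 21, 5, 6, 18,
      14, 10].getD a 0)
  rho a :=
    Fin.ofNat 24 ([1, 2, 3, 0, 8, 9, 10, 11, 12, 13, 14, 15, 16, 17, 18, 19, 4, 5, 6, 7, 23, 20,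
      21, 22].getD a 0)
  cls a :=
    Fin.ofNat 3 ([0, 0, 0, 0, 1, 1, 1, 1, 1, 1, 1, 1, 1, 1, 1, 1, 1, 1, 1, 1, 2, 2, 2, 2].getD a
      0)
  word :=
    ![[], [true], [true, false, false, true]]

theorem cubeTable_isValid : cubeTable.IsValid where
  pos := by decide
  z_iterate := by decide +kernel
  y_y := by decide +kernel
  y_ne := by decide +kernel
  descent := by decide +kernel
  rho_z := by decide +kernel
  rho_y := by decide +kernel
  rho_zero := by decide +kernel
  cls_eq := by decide +kernel
  word_zero := rfl
  rep_ne := by decide +kernel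

theorem cubeTable_hasType : (FaceTable.toMap cubeTable_isValid).HasType 4 3 :=
  FaceTable.hasType_toMap cubeTable_isValid (q := 2) (s := 1)
    (q' := 3) (s' := 0) rfl (by decide +kernel) (by decide +kernel) (by decide +kernel)

def octahedronTable : FaceTable 3 24 4 where
  z a := Fin.ofNat 24 (a / 3 * 3 + (a + 1) % 3)
  y a :=
    Fin.ofNat 24 ([3, 6, 9, 0, 12, 15, 1, 17, 18, 2, 20, 13, 4, 11, 21, 5, 23, 7, 8, 22, 10, 14,
      19, 16].getD a 0)
  rho a :=
    Fin.ofNat 24 ([1, 2, 0, 6, 7, 8, 9, 10, 11, 3, 4, 5, 17, 15, 16, 18, 19, 20, 13, 14, 12, 23,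
      21, 22].getD a 0)
  cls a :=
    Fin.ofNat 4 ([0, 0, 0, 1, 1, 1, 1, 1, 1, 1, 1, 1, 2, 2, 2, 2, 2, 2, 2, 2, 2, 3, 3, 3].getD a
      0)
  word :=
    ![[], [true], [true, false, true], [true, false, true, false, false, true]]

theorem octahedronTable_isValid : octahedronTable.IsValid where
  pos := by decide
  z_iterate := by decide +kernel
  y_y := by decide +kernel
  y_ne := by decide +kernel
  descent := by decide +kernel
  rho_z := by decide +kernel
  rho_y := by decide +kernel
  rho_zero := by decide +kernel
  cls_eq := by decide +kernel
  word_zero := rfl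
  rep_ne := by decide +kernel

theorem octahedronTable_hasType : (FaceTable.toMap octahedronTable_isValid).HasType 3 4 :=
  FaceTable.hasType_toMap octahedronTable_isValid (q := 3) (s := 0)
    (q' := 2) (s' := 1) rfl (by decide +kernel) (by decide +kernel) (by decide +kernel)

def dodecahedronTable : FaceTable 5 60 4 where
  z a := Fin.ofNat 60 (a / 5 * 5 + (a + 1) % 5)
  y a :=
    Fin.ofNat 60 ([5, 10, 15, 20, 25, 0, 29, 30, 35, 11, 1, 9, 39, 40, 16, 2, 14, 44, 45, 21, 3,
      19, 49, 50, 26, 4, 24, 54, 31, 6, 7, 28, 53, 55, 36, 8, 34, 59, 41, 12, 13, 38, 58, 46,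
      17, 18, 43, 57, 51, 22, 23, 48, 56, 32, 27, 33, 52, 47, 42, 37].getD a 0)
  rho a :=
    Fin.ofNat 60 ([1, 2, 3, 4, 0, 10, 11, 12, 13, 14, 15, 16, 17, 18, 19, 20, 21, 22, 23, 24,
      25, 26, 27, 28, 29, 5, 6, 7, 8, 9, 39, 35, 36, 37, 38, 40, 41, 42, 43, 44, 45, 46, 47, 48,
      49, 50, 51, 52, 53, 54, 31, 32, 33, 34, 30, 59, 55, 56, 57, 58].getD a 0)
  cls a :=
    Fin.ofNat 4 ([0, 0, 0, 0, 0, 1, 1, 1, 1, 1, 1, 1, 1, 1, 1, 1, 1, 1, 1, 1, 1, 1, 1, 1, 1, 1,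
      1, 1, 1, 1, 2, 2, 2, 2, 2, 2, 2, 2, 2, 2, 2, 2, 2, 2, 2, 2, 2, 2, 2, 2, 2, 2, 2, 2, 2, 3,
      3, 3, 3, 3].getD a 0)
  word :=
    ![[], [true], [true, false, false, true], [true, false, false, true, false, false, false,
      true]]

theorem dodecahedronTable_isValid : dodecahedronTable.IsValid where
  pos := by decide
  z_iterate := by decide +kernel
  y_y := by decide +kernel
  y_ne := by decide +kernel
  descent := by decide +kernel
  rho_z := by decide +kernel
  rho_y := by decide +kernel
  rho_zero := by decide +kernel
  cls_eq := by decide +kernel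
  word_zero := rfl
  rep_ne := by decide +kernel

theorem dodecahedronTable_hasType : (FaceTable.toMap dodecahedronTable_isValid).HasType 5 3 :=
  have : Fact (Nat.Prime 5) := ⟨by norm_num⟩
  FaceTable.hasType_toMap dodecahedronTable_isValid (q := 5) (s := 0)
    (q' := 3) (s' := 0) rfl (by decide +kernel) (by decide +kernel) (by decide +kernel)

def icosahedronTable : FaceTable 3 60 8 where
  z a := Fin.ofNat 60 (a / 3 * 3 + (a + 1) % 3)
  y a :=
    Fin.ofNat 60 ([3, 6, 9, 0, 12, 15, 1, 18, 21, 2, 24, 27, 4, 29, 30, 5, 33, 19, 7, 17, 36, 8,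
      39, 25, 10, 23, 42, 11, 45, 13, 14, 48, 34, 16, 32, 51, 20, 53, 40, 22, 38, 54, 26, 56,
      46, 28, 44, 49, 31, 47, 57, 35, 59, 37, 41, 58, 43, 50, 55, 52].getD a 0)
  rho a :=
    Fin.ofNat 60 ([1, 2, 0, 6, 7, 8, 9, 10, 11, 3, 4, 5, 18, 19, 20, 21, 22, 23, 24, 25, 26, 27,
      28, 29, 12, 13, 14, 15, 16, 17, 36, 37, 38, 39, 40, 41, 42, 43, 44, 45, 46, 47, 30, 31,
      32, 33, 34, 35, 53, 51, 52, 54, 55, 56, 49, 50, 48, 59, 57, 58].getD a 0)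
  cls a :=
    Fin.ofNat 8 ([0, 0, 0, 1, 1, 1, 1, 1, 1, 1, 1, 1, 2, 2, 2, 3, 3, 3, 2, 2, 2, 3, 3, 3, 2, 2,
      2, 3, 3, 3, 5, 5, 5, 4, 4, 4, 5, 5, 5, 4, 4, 4, 5, 5, 5, 4, 4, 4, 6, 6, 6, 6, 6, 6, 6, 6,
      6, 7, 7, 7].getD a 0)
  word :=
    ![[], [true], [true, false, true], [true, false, false, true], [true, false, true, false,
      false, true], [true, false, false, true, false, true], [true, false, true, false, false,
      true, false, true], [true, false, true, false, false, true, false, true, false, false,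
      true]]

theorem icosahedronTable_isValid : icosahedronTable.IsValid where
  pos := by decide
  z_iterate := by decide +kernel
  y_y := by decide +kernel
  y_ne := by decide +kernel
  descent := by decide +kernel
  rho_z := by decide +kernel
  rho_y := by decide +kernel
  rho_zero := by decide +kernel
  cls_eq := by decide +kernel
  word_zero := rfl
  rep_ne := by decide +kernel

theorem icosahedronTable_hasType : (FaceTable.toMap icosahedronTable_isValid).HasType 3 5 :=
  have : Fact (Nat.Prime 5) := ⟨by norm_num⟩
  FaceTable.hasType_toMap icosahedronTable_isValid (q := 3) (s := 0)
    (q' := 5) (s' := 0) rfl (by decide +kernel) (by decide +kernel) (by decide +kernel)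


end OMap

end

section

open Polynomial

namespace OMap

noncomputable section

variable {M : OMap}

/-! ### Eigenspaces of the adjacency operator -/

theorem aeval_X_sub_C_apply {k V : Type} [Field k] [AddCommGroup V] [Module k V] (T : V →ₗ[k] V)
    (l : k) (f : V) : aeval T (X - C l) f = T f - l • f := by
  rw [map_sub, aeval_X, aeval_C]
  rfl

theorem aeval_apply_of_eigen {k V : Type} [Field k] [AddCommGroup V] [Module k V] {T : V →ₗ[k] V}
    {l : k} {f : V} (h : T f = l • f) (q : k[X]) : aeval T q f = q.eval l • f := by
  induction q using Polynomial.induction_on' with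
  | add q r hq hr => rw [map_add, LinearMap.add_apply, hq, hr, eval_add, add_smul]
  | monomial i c =>
    have h1 : (T ^ i) f = l ^ i • f := by
      induction i with
      | zero => simp
      | succ i ih => rw [pow_succ', Module.End.mul_apply, ih, map_smul, h, smul_smul, pow_succ]
    rw [aeval_monomial, Module.End.mul_apply, eval_monomial, mul_smul, h1]
    rfl

theorem sum_finrank_kerIn {k V : Type} [Field k] [AddCommGroup V] [Module k V]
    [FiniteDimensional k V] {ν : ℕ} {T : V →ₗ[k] V} {P : Submodule k V} (hP : ∀ f ∈ P, T f ∈ P)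
    {μ : Fin ν → k[X]} (hirr : ∀ j, Irreducible (μ j))
    (hcop : Pairwise fun i j => IsCoprime (μ i) (μ j))
    (hkill : ∀ f ∈ P, aeval T (∏ j, μ j) f = 0) :
    ∑ j, Module.finrank k (kerIn T P (μ j)) = Module.finrank k P := by
  rw [← finrank_iSup_kerIn hcop]
  have h1 := eq_iSup_kerIn hP hirr hcop hkill (le_refl P) (q := 1) (fun f hf => by simpa)
    (fun f hf => by simp)
  have h2 : {j | kerIn T P (μ j) ≤ P} = Set.univ := 
    Set.eq_univ_of_forall fun j => (inf_le_right : kerIn T P (μ j) ≤ P)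
  rw [h2] at h1
  have h3 : ⨆ j ∈ (Finset.univ : Finset (Fin ν)), kerIn T P (μ j) = P := by simpa using h1.symm
  rw [h3]

/-- Traces give dimensions only modulo p. As each d' j is a least residue, d' ≤ d termwise, and
equal totals force equality. The congruence at one index follows from the total, so it may be left
out. -/
theorem eq_of_natCast_eq_of_sum_eq {p ν : ℕ} [Fact p.Prime] {d d' : Fin ν → ℕ} (j₀ : Fin ν)
    (hlt : ∀ j, d' j < p) (hs : ∑ j, d j = ∑ j, d' j)
    (hc : ∀ j, j ≠ j₀ → (d j : ZMod p) = d' j) (j : Fin ν) : d j = d' j := by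
  have hc' : ∀ j, (d j : ZMod p) = d' j := by
    intro j
    by_cases hj : j = j₀
    · subst hj
      have h1 := congrArg (Nat.cast : ℕ → ZMod p) hs
      rw [Nat.cast_sum, Nat.cast_sum, ← Finset.add_sum_erase _ _ (Finset.mem_univ j),
        ← Finset.add_sum_erase _ (fun i => (d' i : ZMod p)) (Finset.mem_univ j),
        Finset.sum_congr rfl fun i hi => hc i (Finset.ne_of_mem_erase hi)] at h1
      exact add_right_cancel h1
    · exact hc j hj
  have hle : ∀ j ∈ Finset.univ, d' j ≤ d j := by
    intro j _
    have h1 := (ZMod.natCast_eq_natCast_iff' _ _ _).1 (hc' j)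
    rw [Nat.mod_eq_of_lt (hlt j)] at h1
    rw [← h1]
    exact Nat.mod_le _ _
  exact ((Finset.sum_eq_sum_iff_of_le hle).1 hs.symm j (Finset.mem_univ j)).symm

theorem prime_ne_of_natCast_ne_zero {p c : ℕ} (h : (c : ZMod p) ≠ 0) : p ≠ c := by
  rintro rfl
  exact h (ZMod.natCast_self p)

theorem five_le_of_ne_zero {p : ℕ} [Fact p.Prime] (h2 : (2 : ZMod p) ≠ 0)
    (h3 : (3 : ZMod p) ≠ 0) : 5 ≤ p := by
  have q2 := prime_ne_of_natCast_ne_zero (c := 2) (by exact_mod_cast h2)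
  have q3 := prime_ne_of_natCast_ne_zero (c := 3) (by exact_mod_cast h3)
  have hp : p.Prime := Fact.out
  have := hp.two_le
  by_contra hlt
  interval_cases p <;> first | omega | norm_num at hp

theorem seven_le_of_ne_zero {p : ℕ} [Fact p.Prime] (h2 : (2 : ZMod p) ≠ 0)
    (h3 : (3 : ZMod p) ≠ 0) (h5 : (5 : ZMod p) ≠ 0) : 7 ≤ p := by
  have q5 := prime_ne_of_natCast_ne_zero (c := 5) (by exact_mod_cast h5)
  have := five_le_of_ne_zero h2 h3
  have hp : p.Prime := Fact.out
  by_contra hlt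
  interval_cases p <;> first | omega | norm_num at hp

theorem HasType.card_eq_of {n m N : ℕ} (h : M.HasType n m) (hg : M.genus = 0)
    (hN : (N : ℚ) * (1 / m - 1 / 2 + 1 / n) = 2) : Nat.card M.D = N := by
  have h1 := h.card_eq hg
  have h2 : ((1 : ℚ) / m - 1 / 2 + 1 / n) ≠ 0 := fun h0 => by rw [h0, mul_zero] at hN; norm_num at hN
  exact_mod_cast mul_right_cancel₀ h2 (h1.trans hN.symm)

namespace FaceTable.Labelling

variable {n N r : ℕ} [NeZero N] [NeZero r] {Δ : FaceTable n N r} (L : Δ.Labelling M)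
  (hΔ : Δ.IsValid) {k : Type} [Field k]

include hΔ

theorem op_op_eq (hM : M.OrientablyRegular) (hz : M.z ^ n = 1) {i j : Fin r} (v : Fin n → Fin r)
    (hv : ∀ t : Fin n, Δ.cls (Δ.act (Δ.word j) (Δ.z^[t] (Δ.rep i))) = v t) {f : M.D → k}
    (hf : f ∈ fixSub k M.z) : L.op k i (L.op k j f) = ∑ t, L.op k (v t) f := by
  rw [L.op_op hΔ hM hz i j hf]
  exact Finset.sum_congr rfl fun t _ => by rw [hv]

/-- `v j` is the number of faces in the jth class; the common factor n, for the darts of each face,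
is cancelled. -/
theorem sum_smul_op_eq_zero (hM : M.OrientablyRegular) (hz : M.z ^ n = 1) (v : Fin r → ℕ)
    (hv : ∀ j, (Finset.univ.filter fun a => Δ.cls a = j).card = n * v j) (hn : (n : k) ≠ 0)
    {f : M.D → k} (hf : f ∈ faceSpace k M) : ∑ j, (v j : k) • L.op k j f = 0 := by
  refine (smul_eq_zero_iff_right hn).1 ?_
  rw [← L.sum_op_eq_zero hΔ hM hz hf, ← Finset.sum_fiberwise Finset.univ Δ.cls, Finset.smul_sum]
  refine Finset.sum_congr rfl fun j _ => ?_
  rw [smul_smul, ← Nat.cast_mul, ← hv j,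
    Finset.sum_congr rfl (g := fun _ => L.op k j f) fun a ha => by
    rw [(Finset.mem_filter.1 ha).2], Finset.sum_const, Nat.cast_smul_eq_nsmul]

omit hΔ [NeZero N] [NeZero r] in
theorem op_of_word_eq {j : Fin r} (h : Δ.word j = [true]) : L.op k j = hecke k n M.y := by
  rw [op, h]
  simp [wordElt]

/-- c q(T) is the Lagrange projection onto the eigenspace, and γ lists its coefficients on the
double coset operators, whose traces are known. -/
theorem finrank_eigenspace (hM : M.OrientablyRegular) {m : ℕ} (ht : M.HasType n m)
    (hD : (Nat.card M.D : k) ≠ 0) {l : k} (c : k) (q : k[X]) (γ : Fin r → k)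
    (hγ : ∀ f ∈ faceSpace k M, ∑ j, γ j • L.op k j f = c • aeval (hecke k n M.y) q f)
    (hk : ∀ f ∈ faceSpace k M, aeval (hecke k n M.y) ((X - C l) * q) f = 0)
    (hq : c * q.eval l = 1) :
    (Module.finrank k (kerIn (hecke k n M.y) (faceSpace k M) (X - C l)) : k) =
      Nat.card M.D * γ 0 - n * ∑ j, γ j := by
  refine L.finrank_eq_of_projection hΔ hM ht hD inf_le_right γ (fun f hf => ?_) (fun f hf => ?_)
  · rw [hγ f hf]
    refine Submodule.smul_mem _ _ ⟨?_, aeval_mem (fun f hf => hecke_mem_faceSpace ht.z_pow _ hf) _ hf⟩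
    change aeval (hecke k n M.y) (X - C l) (aeval (hecke k n M.y) q f) = 0
    rw [← aeval_mul_apply, hk f hf]
  · have h1 := (mem_kerIn.1 hf).1
    rw [aeval_X_sub_C_apply, sub_eq_zero] at h1
    rw [hγ f hf.2, aeval_apply_of_eigen h1, smul_smul, hq, one_smul]

end FaceTable.Labelling

section assemble

variable {p n m ν : ℕ} [Fact p.Prime] {μ : Fin ν → (ZMod p)[X]}

theorem finrank_kerIn_eq (H : IsPlatonicCoprime p M n m) (hirr : ∀ j, Irreducible (μ j))
    (hcop : Pairwise fun i j => IsCoprime (μ i) (μ j))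
    (hkill : ∀ f ∈ faceSpace (ZMod p) M, aeval (hecke (ZMod p) n M.y) (∏ j, μ j) f = 0)
    (d : Fin ν → ℕ) (j₀ : Fin ν) (hlt : ∀ j, d j < p)
    (hs : (∑ j, d j + 1) * n = Nat.card M.D)
    (hc : ∀ j, j ≠ j₀ → (Module.finrank (ZMod p)
      (kerIn (hecke (ZMod p) n M.y) (faceSpace (ZMod p) M) (μ j)) : ZMod p) = d j) (j : Fin ν) :
    Module.finrank (ZMod p) (kerIn (hecke (ZMod p) n M.y) (faceSpace (ZMod p) M) (μ j)) = d j := by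
  refine eq_of_natCast_eq_of_sum_eq (d := fun j => Module.finrank (ZMod p)
    (kerIn (hecke (ZMod p) n M.y) (faceSpace (ZMod p) M) (μ j))) j₀ hlt ?_ hc j
  rw [sum_finrank_kerIn (fun f hf => hecke_mem_faceSpace H.type.z_pow _ hf) hirr hcop hkill]
  have h1 := finrank_faceSpace (k := ZMod p) (M := M) H.card_ne
  rw [← H.type.numFaces_mul, ← h1] at hs
  have := Nat.eq_of_mul_eq_mul_right H.type.n_pos hs
  omega

theorem multFree_of_finrank (hirr : ∀ j, Irreducible (μ j))
    (hcop : Pairwise fun i j => IsCoprime (μ i) (μ j))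
    (hkill : ∀ f ∈ faceSpace (ZMod p) M, aeval (hecke (ZMod p) n M.y) (∏ j, μ j) f = 0)
    (hcomm : ∀ w, ∃ q : (ZMod p)[X], ∀ f ∈ faceSpace (ZMod p) M,
      hecke (ZMod p) n (M.mon w) f = aeval (hecke (ZMod p) n M.y) q f) {d : Fin ν → ℕ}
    (hd : ∀ j, Module.finrank (ZMod p)
      (kerIn (hecke (ZMod p) n M.y) (faceSpace (ZMod p) M) (μ j)) = d j) (hpos : ∀ j, d j ≠ 0) :
    MultFree p n M μ := by
  refine ⟨hcomm, hirr, hcop, hkill, fun j h0 => hpos j ?_⟩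
  rw [← hd j, h0, finrank_bot]

theorem multFree_of_eigenvalues (H : IsPlatonicCoprime p M n m) {l : Fin ν → ZMod p}
    (hl : Function.Injective l) (hkill : ∀ f ∈ faceSpace (ZMod p) M,
      aeval (hecke (ZMod p) n M.y) (∏ j, (X - C (l j))) f = 0)
    (hcomm : ∀ w, ∃ q : (ZMod p)[X], ∀ f ∈ faceSpace (ZMod p) M,
      hecke (ZMod p) n (M.mon w) f = aeval (hecke (ZMod p) n M.y) q f)
    (d : Fin ν → ℕ) (j₀ : Fin ν) (hlt : ∀ j, d j < p) (hpos : ∀ j, d j ≠ 0)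
    (hs : (∑ j, d j + 1) * n = Nat.card M.D)
    (hc : ∀ j, j ≠ j₀ → (Module.finrank (ZMod p) (kerIn (hecke (ZMod p) n M.y)
      (faceSpace (ZMod p) M) (X - C (l j))) : ZMod p) = d j) :
    MultFree p n M (fun j => X - C (l j)) ∧ ∀ j, Module.finrank (ZMod p)
      (kerIn (hecke (ZMod p) n M.y) (faceSpace (ZMod p) M) (X - C (l j))) = d j := by
  have hirr : ∀ j, Irreducible (X - C (l j)) := fun j => irreducible_X_sub_C (l j)
  have hcop : Pairwise fun i j => IsCoprime (X - C (l i)) (X - C (l j)) :=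
    pairwise_coprime_X_sub_C hl
  have hd := finrank_kerIn_eq H hirr hcop hkill d j₀ hlt hs hc
  exact ⟨multFree_of_finrank hirr hcop hkill hcomm hd hpos, hd⟩

theorem MultFree.hasRegularCoverings_one {μ : Fin 1 → (ZMod p)[X]} (h : MultFree p n M μ)
    (H : IsPlatonicCoprime p M n m) {a : ℕ} (hd : ∀ j, Module.finrank (ZMod p)
      (kerIn (hecke (ZMod p) n M.y) (faceSpace (ZMod p) M) (μ j)) = ![a] j) :
    HasRegularCoverings M p ![a] :=
  h.hasRegularCoverings H ![Finset.univ] (by decide) (by decide) (by decide) (by simp [hd])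

theorem MultFree.hasRegularCoverings_two {μ : Fin 2 → (ZMod p)[X]} (h : MultFree p n M μ)
    (H : IsPlatonicCoprime p M n m) {a b : ℕ} (hd : ∀ j, Module.finrank (ZMod p)
      (kerIn (hecke (ZMod p) n M.y) (faceSpace (ZMod p) M) (μ j)) = ![a, b] j) :
    HasRegularCoverings M p ![a, b, a + b] :=
  h.hasRegularCoverings H ![{0}, {1}, {0, 1}] (by decide) (by decide) (by decide) (by
    simp_rw [hd]
    intro i
    fin_cases i <;> simp)

theorem MultFree.hasRegularCoverings_three {μ : Fin 3 → (ZMod p)[X]} (h : MultFree p n M μ)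
    (H : IsPlatonicCoprime p M n m) {a b c : ℕ} (hd : ∀ j, Module.finrank (ZMod p)
      (kerIn (hecke (ZMod p) n M.y) (faceSpace (ZMod p) M) (μ j)) = ![a, b, c] j) :
    HasRegularCoverings M p ![a, b, c, a + b, a + c, b + c, a + b + c] :=
  h.hasRegularCoverings H ![{0}, {1}, {2}, {0, 1}, {0, 2}, {1, 2}, {0, 1, 2}] (by decide)
    (by decide) (by decide) (by
    simp_rw [hd]
    intro i
    fin_cases i <;> simp [add_assoc])

end assemble

end

end OMap

end

section

open Polynomial

namespace OMap

noncomputable section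

variable {M : OMap} {p : ℕ} [Fact p.Prime]

/-! ### Platonic solids -/

theorem injective_vec_two {k : Type} {a b : k} (hab : a ≠ b) : Function.Injective ![a, b] := by
  intro i j hij
  fin_cases i <;> fin_cases j <;> simp_all

theorem injective_vec_three {k : Type} {a b c : k} (hab : a ≠ b) (hac : a ≠ c) (hbc : b ≠ c) :
    Function.Injective ![a, b, c] := by
  intro i j hij
  fin_cases i <;> fin_cases j <;> simp_all

theorem aeval_X_sq_sub_C_apply {k V : Type} [Field k] [AddCommGroup V] [Module k V]
    (T : V →ₗ[k] V) (l : k) (f : V) : aeval T (X ^ 2 - C l) f = T (T f) - l • f := by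
  rw [map_sub, map_pow, aeval_X, aeval_C, pow_two]
  rfl

theorem aeval_mul_two {k V : Type} [Field k] [AddCommGroup V] [Module k V] (T : V →ₗ[k] V)
    (a b : k) (f : V) :
    aeval T ((X - C a) * (X - C b)) f = T (T f) - (a + b) • T f + (a * b) • f := by
  rw [aeval_mul_apply, aeval_X_sub_C_apply, aeval_X_sub_C_apply, map_sub, map_smul]
  module

theorem aeval_mul_three {k V : Type} [Field k] [AddCommGroup V] [Module k V] (T : V →ₗ[k] V)
    (a b c : k) (f : V) :
    aeval T ((X - C a) * ((X - C b) * (X - C c))) f = T (T (T f)) - (a + b + c) • T (T f) +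
      (a * b + a * c + b * c) • T f - (a * b * c) • f := by
  rw [aeval_mul_apply, aeval_mul_two, aeval_X_sub_C_apply, map_add, map_sub, map_smul, map_smul]
  module

/-- Any two of the four faces are adjacent, so T acts as -1 on functions of sum zero and there is
one constituent. -/
theorem IsPlatonicCoprime.tetrahedron (H : IsPlatonicCoprime p M 3 3) :
    HasRegularCoverings M p ![3] ∧ CoveringsAreJoins M p 1 := by
  have hN : Nat.card M.D = 12 := H.type.card_eq_of H.genus_eq (by norm_num)
  obtain ⟨L⟩ := FaceTable.exists_labelling tetrahedronTable_isValid tetrahedronTable_hasType H.type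
    H.genus_eq hN
  have hz := H.type.z_pow
  have h2 : (2 : ZMod p) ≠ 0 := H.two_ne
  have h3 : (3 : ZMod p) ≠ 0 := H.n_ne
  have hp := five_le_of_ne_zero h2 h3
  have e1 : L.op (ZMod p) 1 = hecke (ZMod p) 3 M.y := L.op_of_word_eq rfl
  set T := hecke (ZMod p) 3 M.y
  have e0 : ∀ f ∈ faceSpace (ZMod p) M, L.op (ZMod p) 0 f = (3 : ZMod p) • f := fun f hf => by
    simpa using L.op_zero tetrahedronTable_isValid hf.1
  have es : ∀ f ∈ faceSpace (ZMod p) M, L.op (ZMod p) 0 f + (3 : ZMod p) • T f = 0 := fun f hf => by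
    have := L.sum_smul_op_eq_zero tetrahedronTable_isValid H.regular hz ![1, 3]
      (by decide +kernel) H.n_ne hf
    rw [Fin.sum_univ_two, e1] at this
    simpa using this
  have hk : ∀ f ∈ faceSpace (ZMod p) M, T f + f = 0 := fun f hf =>
    (smul_eq_zero_iff_right h3).1 (by linear_combination (norm := module) es f hf - e0 f hf)
  have hkill : ∀ f ∈ faceSpace (ZMod p) M,
      aeval T (∏ j, (X - C ((![-1] : Fin 1 → ZMod p) j))) f = 0 := fun f hf => by
    rw [Fin.prod_univ_one, aeval_X_sub_C_apply]
    change T f - (-1 : ZMod p) • f = 0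
    linear_combination (norm := module) hk f hf
  have hcomm : ∀ w, ∃ q : (ZMod p)[X], ∀ f ∈ faceSpace (ZMod p) M,
      hecke (ZMod p) 3 (M.mon w) f = aeval T q f := fun w => by
    obtain ⟨j, hj⟩ := L.exists_hecke_eq_op (k := ZMod p) tetrahedronTable_isValid H.regular hz w
    fin_cases j
    · exact ⟨C 3, fun f hf => by
        rw [hj f hf.1, aeval_C, Module.algebraMap_end_apply]; exact e0 f hf⟩
    · exact ⟨X, fun f hf => by
        rw [hj f hf.1, aeval_X]; exact LinearMap.congr_fun e1 f⟩
  obtain ⟨h, hd⟩ := multFree_of_eigenvalues H (Function.injective_of_subsingleton _) hkill hcomm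
    ![3] 0 (by simp; omega) (by simp) (by rw [hN]; rfl)
    (fun j hj => absurd (Subsingleton.elim j 0) hj)
  exact ⟨h.hasRegularCoverings_one H hd, h.coveringsAreJoins H⟩

/-- The faces are adjacent as the vertices of a cube, so on functions of sum zero T satisfies (T +
3)(T - 1)(T + 1) = 0, with dimensions 1, 3, 3. -/
theorem IsPlatonicCoprime.octahedron (H : IsPlatonicCoprime p M 3 4) :
    HasRegularCoverings M p ![1, 3, 3, 4, 4, 6, 7] ∧ CoveringsAreJoins M p 3 := by
  have hN : Nat.card M.D = 24 := H.type.card_eq_of H.genus_eq (by norm_num)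
  obtain ⟨L⟩ := FaceTable.exists_labelling octahedronTable_isValid octahedronTable_hasType H.type
    H.genus_eq hN
  have hz := H.type.z_pow
  have h2 : (2 : ZMod p) ≠ 0 := H.two_ne
  have h3 : (3 : ZMod p) ≠ 0 := H.n_ne
  have hp := five_le_of_ne_zero h2 h3
  obtain ⟨u, hu⟩ : ∃ u : ZMod p, 2 * u = 1 := ⟨_, mul_inv_cancel₀ h2⟩
  obtain ⟨v, hv⟩ : ∃ v : ZMod p, 3 * v = 1 := ⟨_, mul_inv_cancel₀ h3⟩
  have e1 : L.op (ZMod p) 1 = hecke (ZMod p) 3 M.y := L.op_of_word_eq rfl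
  set T := hecke (ZMod p) 3 M.y
  have hTP : ∀ f ∈ faceSpace (ZMod p) M, T f ∈ faceSpace (ZMod p) M := fun f hf =>
    hecke_mem_faceSpace hz _ hf
  have e0 : ∀ f ∈ faceSpace (ZMod p) M, L.op (ZMod p) 0 f = (3 : ZMod p) • f := fun f hf => by
    simpa using L.op_zero octahedronTable_isValid hf.1
  have e2 : ∀ f ∈ faceSpace (ZMod p) M,
      T (T f) = L.op (ZMod p) 0 f + (2 : ZMod p) • L.op (ZMod p) 2 f := fun f hf => by
    have := L.op_op_eq octahedronTable_isValid H.regular hz (i := 1) (j := 1) ![0, 2, 2]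
      (by decide +kernel) hf.1
    rw [Fin.sum_univ_three, e1] at this
    rw [this, two_smul, ← add_assoc]
    rfl
  have e3 : ∀ f ∈ faceSpace (ZMod p) M, L.op (ZMod p) 2 (T f) =
      (2 : ZMod p) • T f + L.op (ZMod p) 3 f := fun f hf => by
    have := L.op_op_eq octahedronTable_isValid H.regular hz (i := 2) (j := 1) ![1, 1, 3]
      (by decide +kernel) hf.1
    rw [Fin.sum_univ_three, e1] at this
    rw [this, two_smul, ← e1]
    rfl
  have es : ∀ f ∈ faceSpace (ZMod p) M, L.op (ZMod p) 0 f + (3 : ZMod p) • T f +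
      (3 : ZMod p) • L.op (ZMod p) 2 f + L.op (ZMod p) 3 f = 0 := fun f hf => by
    have := L.sum_smul_op_eq_zero octahedronTable_isValid H.regular hz ![1, 3, 3, 1]
      (by decide +kernel) H.n_ne hf
    rw [Fin.sum_univ_four, e1] at this
    simpa using this
  have hk : ∀ f ∈ faceSpace (ZMod p) M,
      T (T (T f)) + (3 : ZMod p) • T (T f) - T f - (3 : ZMod p) • f = 0 := fun f hf => by
    linear_combination (norm := module) e2 (T f) (hTP f hf) + e0 (T f) (hTP f hf) + (2 : ZMod p) • e3 f hf +
      (3 : ZMod p) • e2 f hf + e0 f hf + (2 : ZMod p) • es f hf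
  have hinj : Function.Injective ![(-3 : ZMod p), 1, -1] := by
    refine injective_vec_three (fun h => ?_) (fun h => ?_) (fun h => ?_)
    · exact mul_ne_zero h2 h2 (by linear_combination -h)
    · exact h2 (by linear_combination -h)
    · exact h2 (by linear_combination h)
  have hkill : ∀ f ∈ faceSpace (ZMod p) M,
      aeval T (∏ j, (X - C (![(-3 : ZMod p), 1, -1] j))) f = 0 := fun f hf => by
    rw [Fin.prod_univ_three, mul_assoc]
    refine (aeval_mul_three T (-3) 1 (-1) f).trans ?_
    linear_combination (norm := module) hk f hf
  have hcomm : ∀ w, ∃ q : (ZMod p)[X], ∀ f ∈ faceSpace (ZMod p) M,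
      hecke (ZMod p) 3 (M.mon w) f = aeval T q f := fun w => by
    obtain ⟨j, hj⟩ := L.exists_hecke_eq_op (k := ZMod p) octahedronTable_isValid H.regular hz w
    fin_cases j
    · exact ⟨C 3, fun f hf => by
        rw [hj f hf.1, aeval_C, Module.algebraMap_end_apply]; exact e0 f hf⟩
    · exact ⟨X, fun f hf => by
        rw [hj f hf.1, aeval_X]; exact LinearMap.congr_fun e1 f⟩
    · refine ⟨C u * (X * X - C 3), fun f hf => ?_⟩
      rw [hj f hf.1]
      simp only [map_mul, map_sub, aeval_X, aeval_C, Module.End.mul_apply, LinearMap.sub_apply,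
        Module.algebraMap_end_apply]
      change L.op (ZMod p) 2 f = _
      linear_combination (norm := module) (-u) • e2 f hf - u • e0 f hf - hu • L.op (ZMod p) 2 f
    · refine ⟨C u * (X * (X * X) - C 7 * X), fun f hf => ?_⟩
      rw [hj f hf.1]
      simp only [map_mul, map_sub, aeval_X, aeval_C, Module.End.mul_apply, LinearMap.sub_apply,
        Module.algebraMap_end_apply]
      change L.op (ZMod p) 3 f = _
      linear_combination (norm := module) (-u) • e2 (T f) (hTP f hf) - u • e0 (T f) (hTP f hf) -
        (2 * u) • e3 f hf - hu • L.op (ZMod p) 3 f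
  have hdim : ∀ j, j ≠ 2 → (Module.finrank (ZMod p) (kerIn T (faceSpace (ZMod p) M)
      (X - C (![(-3 : ZMod p), 1, -1] j))) : ZMod p) = (![1, 3, 3] : Fin 3 → ℕ) j := fun j hj => by
    -- Both Lagrange denominators are 8, namely (-3 - 1)(-3 + 1) and (1 + 3)(1 + 1).
    obtain ⟨c, hc⟩ : ∃ c : ZMod p, 8 * c = 1 :=
      ⟨u * u * u, by linear_combination (4 * u * u + 2 * u + 1) * hu⟩
    fin_cases j
    · refine (L.finrank_eigenspace octahedronTable_isValid H.regular H.type H.card_ne c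
        ((X - C 1) * (X - C (-1))) ![c * (1 - v), 0, c * 2, 0]
        (fun f hf => ?_) (fun f hf => ?_) ?_).trans ?_
      · rw [aeval_mul_two, Fin.sum_univ_four]
        change (c * (1 - v)) • L.op (ZMod p) 0 f + (0 : ZMod p) • L.op (ZMod p) 1 f +
          (c * 2) • L.op (ZMod p) 2 f + (0 : ZMod p) • L.op (ZMod p) 3 f = _
        linear_combination (norm := module) (-c) • e2 f hf - (c * v) • e0 f hf - (c • hv) • f
      · refine (aeval_mul_three T (-3) 1 (-1) f).trans ?_
        linear_combination (norm := module) hk f hf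
      · simp
        linear_combination hc
      · rw [hN, Fin.sum_univ_four]
        simp
        linear_combination hc - 7 * c * hv
    · refine (L.finrank_eigenspace octahedronTable_isValid H.regular H.type H.card_ne c
        ((X - C (-3)) * (X - C (-1))) ![c * 2, c * 4, c * 2, 0]
        (fun f hf => ?_) (fun f hf => ?_) ?_).trans ?_
      · rw [aeval_mul_two, Fin.sum_univ_four, e1]
        change (c * 2) • L.op (ZMod p) 0 f + (c * 4) • T f +
          (c * 2) • L.op (ZMod p) 2 f + (0 : ZMod p) • L.op (ZMod p) 3 f = _
        linear_combination (norm := module) (-c) • e2 f hf + c • e0 f hf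
      · refine (aeval_mul_three T 1 (-3) (-1) f).trans ?_
        linear_combination (norm := module) hk f hf
      · simp
        linear_combination hc
      · rw [hN, Fin.sum_univ_four]
        simp
        linear_combination 3 * hc
    · exact absurd rfl hj
  obtain ⟨h, hd⟩ := multFree_of_eigenvalues H hinj hkill hcomm ![1, 3, 3] 2
    (fun j => by fin_cases j <;> simp <;> omega) (fun j => by fin_cases j <;> simp)
    (by rw [hN]; rfl) hdim
  exact ⟨h.hasRegularCoverings_three H hd, h.coveringsAreJoins H⟩

/-- Each face is adjacent to all others but its opposite, so T (T + 2) = 0 on functions of sum zero,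
with dimension 2 for -2 and 3 for 0. -/
theorem IsPlatonicCoprime.cube (H : IsPlatonicCoprime p M 4 3) :
    HasRegularCoverings M p ![2, 3, 5] ∧ CoveringsAreJoins M p 2 := by
  have hN : Nat.card M.D = 24 := H.type.card_eq_of H.genus_eq (by norm_num)
  obtain ⟨L⟩ := FaceTable.exists_labelling cubeTable_isValid cubeTable_hasType H.type
    H.genus_eq hN
  have hz := H.type.z_pow
  have h2 : (2 : ZMod p) ≠ 0 := H.two_ne
  have h3 : (3 : ZMod p) ≠ 0 := H.m_ne
  have hp := five_le_of_ne_zero h2 h3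
  obtain ⟨u, hu⟩ : ∃ u : ZMod p, 2 * u = 1 := ⟨_, mul_inv_cancel₀ h2⟩
  have e1 : L.op (ZMod p) 1 = hecke (ZMod p) 4 M.y := L.op_of_word_eq rfl
  set T := hecke (ZMod p) 4 M.y
  have e0 : ∀ f ∈ faceSpace (ZMod p) M, L.op (ZMod p) 0 f = (4 : ZMod p) • f := fun f hf => by
    simpa using L.op_zero cubeTable_isValid hf.1
  have e2 : ∀ f ∈ faceSpace (ZMod p) M, T (T f) =
      L.op (ZMod p) 0 f + T f + L.op (ZMod p) 2 f + T f := fun f hf => by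
    have := L.op_op_eq cubeTable_isValid H.regular hz (i := 1) (j := 1) ![0, 1, 2, 1]
      (by decide +kernel) hf.1
    rw [Fin.sum_univ_four, e1] at this
    rw [this, ← e1]
    rfl
  have es : ∀ f ∈ faceSpace (ZMod p) M, L.op (ZMod p) 0 f + (4 : ZMod p) • T f +
      L.op (ZMod p) 2 f = 0 := fun f hf => by
    have := L.sum_smul_op_eq_zero cubeTable_isValid H.regular hz ![1, 4, 1]
      (by decide +kernel) H.n_ne hf
    rw [Fin.sum_univ_three, e1] at this
    simpa using this
  have hk : ∀ f ∈ faceSpace (ZMod p) M, T (T f) + (2 : ZMod p) • T f = 0 := fun f hf => by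
    linear_combination (norm := module) e2 f hf + es f hf
  have hinj : Function.Injective ![(-2 : ZMod p), 0] :=
    injective_vec_two (neg_ne_zero.2 h2)
  have hkill : ∀ f ∈ faceSpace (ZMod p) M,
      aeval T (∏ j, (X - C (![(-2 : ZMod p), 0] j))) f = 0 := fun f hf => by
    rw [Fin.prod_univ_two]
    refine (aeval_mul_two T (-2) 0 f).trans ?_
    linear_combination (norm := module) hk f hf
  have hcomm : ∀ w, ∃ q : (ZMod p)[X], ∀ f ∈ faceSpace (ZMod p) M,
      hecke (ZMod p) 4 (M.mon w) f = aeval T q f := fun w => by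
    obtain ⟨j, hj⟩ := L.exists_hecke_eq_op (k := ZMod p) cubeTable_isValid H.regular hz w
    fin_cases j
    · exact ⟨C 4, fun f hf => by
        rw [hj f hf.1, aeval_C, Module.algebraMap_end_apply]; exact e0 f hf⟩
    · exact ⟨X, fun f hf => by
        rw [hj f hf.1, aeval_X]; exact LinearMap.congr_fun e1 f⟩
    · refine ⟨C (-4) * X - C 4, fun f hf => ?_⟩
      rw [hj f hf.1]
      simp only [map_mul, map_sub, aeval_X, aeval_C, Module.End.mul_apply, LinearMap.sub_apply,
        Module.algebraMap_end_apply]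
      change L.op (ZMod p) 2 f = _
      linear_combination (norm := module) es f hf - e0 f hf
  have hdim : ∀ j, j ≠ 1 → (Module.finrank (ZMod p) (kerIn T (faceSpace (ZMod p) M)
      (X - C (![(-2 : ZMod p), 0] j))) : ZMod p) = (![2, 3] : Fin 2 → ℕ) j := fun j hj => by
    fin_cases j
    · refine (L.finrank_eigenspace cubeTable_isValid H.regular H.type H.card_ne (-u)
        (X - C 0) ![0, -u, 0] (fun f hf => ?_) (fun f hf => ?_) ?_).trans ?_
      · rw [aeval_X_sub_C_apply, Fin.sum_univ_three, e1]
        change (0 : ZMod p) • L.op (ZMod p) 0 f + (-u) • T f + (0 : ZMod p) • L.op (ZMod p) 2 f = _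
        module
      · refine (aeval_mul_two T (-2) 0 f).trans ?_
        linear_combination (norm := module) hk f hf
      · simp
        linear_combination hu
      · rw [hN, Fin.sum_univ_three]
        simp
        linear_combination 2 * hu
    · exact absurd rfl hj
  obtain ⟨h, hd⟩ := multFree_of_eigenvalues H hinj hkill hcomm ![2, 3] 1
    (fun j => by fin_cases j <;> simp <;> omega) (fun j => by fin_cases j <;> simp)
    (by rw [hN]; rfl) hdim
  exact ⟨h.hasRegularCoverings_two H hd, h.coveringsAreJoins H⟩

theorem isSquare_natCast_zmod_five_iff {a : ℕ} (hlt : a < 5) (hne : a ≠ 0) :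
    IsSquare (a : ZMod 5) ↔ a = 1 ∨ a = 4 := by
  interval_cases a
  · exact absurd rfl hne
  all_goals decide

/-- Quadratic reciprocity, as 5 is 1 modulo 4. -/
theorem isSquare_five_iff (hp : 7 ≤ p) :
    IsSquare (5 : ZMod p) ↔ p % 5 = 1 ∨ p % 5 = 4 := by
  have : Fact (Nat.Prime 5) := ⟨by norm_num⟩
  have h1 := ZMod.exists_sq_eq_prime_iff_of_mod_four_eq_one (p := 5) (q := p) (by norm_num)
    (by omega)
  have hne : p % 5 ≠ 0 := fun h0 => by
    have := (Nat.prime_dvd_prime_iff_eq (p := 5) (by norm_num) (Fact.out : p.Prime)).1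
      (Nat.dvd_of_mod_eq_zero h0)
    omega
  have h2 : IsSquare (p : ZMod 5) ↔ p % 5 = 1 ∨ p % 5 = 4 := by
    rw [← ZMod.natCast_mod p 5]
    have hlt : p % 5 < 5 := Nat.mod_lt _ (by norm_num)
    generalize p % 5 = a at hlt hne
    exact isSquare_natCast_zmod_five_iff hlt hne
  rw [← h2, h1]
  norm_num

theorem irreducible_X_sq_sub_C {k : Type} [Field k] {a : k} (h : ¬ IsSquare a) :
    Irreducible (X ^ 2 - C a) := by
  refine (X_pow_sub_C_irreducible_iff_of_prime Nat.prime_two).2 fun b hb => h ⟨b, ?_⟩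
  rw [← hb, pow_two]

/-- The faces are adjacent as the vertices of an icosahedron, and (T + 1)(T² - 5) = 0 on functions
of sum zero. The quadratic factor gives 3 + 3 if 5 is a square modulo p, and one irreducible
constituent of dimension 6 otherwise. -/
theorem IsPlatonicCoprime.dodecahedron (H : IsPlatonicCoprime p M 5 3) :
    ((p % 5 = 1 ∨ p % 5 = 4 → HasRegularCoverings M p ![3, 3, 5, 6, 8, 8, 11]) ∧
      (p % 5 = 2 ∨ p % 5 = 3 → HasRegularCoverings M p ![5, 6, 11])) ∧
    ∃ ν, CoveringsAreJoins M p ν := by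
  have hN : Nat.card M.D = 60 := H.type.card_eq_of H.genus_eq (by norm_num)
  obtain ⟨L⟩ := FaceTable.exists_labelling dodecahedronTable_isValid dodecahedronTable_hasType
    H.type H.genus_eq hN
  have hz := H.type.z_pow
  have h2 : (2 : ZMod p) ≠ 0 := H.two_ne
  have h3 : (3 : ZMod p) ≠ 0 := H.m_ne
  have h5 : (5 : ZMod p) ≠ 0 := H.n_ne
  have hp := seven_le_of_ne_zero h2 h3 h5
  obtain ⟨u, hu⟩ : ∃ u : ZMod p, 2 * u = 1 := ⟨_, mul_inv_cancel₀ h2⟩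
  obtain ⟨v, hv⟩ : ∃ v : ZMod p, 5 * v = 1 := ⟨_, mul_inv_cancel₀ h5⟩
  have e1 : L.op (ZMod p) 1 = hecke (ZMod p) 5 M.y := L.op_of_word_eq rfl
  set T := hecke (ZMod p) 5 M.y
  have hTP : ∀ f ∈ faceSpace (ZMod p) M, T f ∈ faceSpace (ZMod p) M := fun f hf =>
    hecke_mem_faceSpace hz _ hf
  have e0 : ∀ f ∈ faceSpace (ZMod p) M, L.op (ZMod p) 0 f = (5 : ZMod p) • f := fun f hf => by
    simpa using L.op_zero dodecahedronTable_isValid hf.1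
  have e2 : ∀ f ∈ faceSpace (ZMod p) M, T (T f) = L.op (ZMod p) 0 f + T f +
      L.op (ZMod p) 2 f + L.op (ZMod p) 2 f + T f := fun f hf => by
    have := L.op_op_eq dodecahedronTable_isValid H.regular hz (i := 1) (j := 1) ![0, 1, 2, 2, 1]
      (by decide +kernel) hf.1
    rw [Fin.sum_univ_five, e1] at this
    rw [this, ← e1]
    rfl
  have e3 : ∀ f ∈ faceSpace (ZMod p) M, L.op (ZMod p) 2 (T f) = T f + T f + L.op (ZMod p) 2 f +
      L.op (ZMod p) 3 f + L.op (ZMod p) 2 f := fun f hf => by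
    have := L.op_op_eq dodecahedronTable_isValid H.regular hz (i := 2) (j := 1) ![1, 1, 2, 3, 2]
      (by decide +kernel) hf.1
    rw [Fin.sum_univ_five, e1] at this
    rw [this, ← e1]
    rfl
  have es : ∀ f ∈ faceSpace (ZMod p) M, L.op (ZMod p) 0 f + (5 : ZMod p) • T f +
      (5 : ZMod p) • L.op (ZMod p) 2 f + L.op (ZMod p) 3 f = 0 := fun f hf => by
    have := L.sum_smul_op_eq_zero dodecahedronTable_isValid H.regular hz ![1, 5, 5, 1]
      (by decide +kernel) H.n_ne hf
    rw [Fin.sum_univ_four, e1] at this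
    simpa using this
  have hk : ∀ f ∈ faceSpace (ZMod p) M,
      T (T (T f)) + T (T f) - (5 : ZMod p) • T f - (5 : ZMod p) • f = 0 := fun f hf => by
    linear_combination (norm := module) e2 (T f) (hTP f hf) + e0 (T f) (hTP f hf) +
      (2 : ZMod p) • e3 f hf + (3 : ZMod p) • e2 f hf + e0 f hf + (2 : ZMod p) • es f hf
  have hcomm : ∀ w, ∃ q : (ZMod p)[X], ∀ f ∈ faceSpace (ZMod p) M,
      hecke (ZMod p) 5 (M.mon w) f = aeval T q f := fun w => by
    obtain ⟨j, hj⟩ := L.exists_hecke_eq_op (k := ZMod p) dodecahedronTable_isValid H.regular hz w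
    fin_cases j
    · exact ⟨C 5, fun f hf => by
        rw [hj f hf.1, aeval_C, Module.algebraMap_end_apply]; exact e0 f hf⟩
    · exact ⟨X, fun f hf => by
        rw [hj f hf.1, aeval_X]; exact LinearMap.congr_fun e1 f⟩
    · refine ⟨C u * (X * X - C 2 * X - C 5), fun f hf => ?_⟩
      rw [hj f hf.1]
      simp only [map_mul, map_sub, aeval_X, aeval_C, Module.End.mul_apply, LinearMap.sub_apply,
        Module.algebraMap_end_apply]
      change L.op (ZMod p) 2 f = _
      linear_combination (norm := module) (-u) • e2 f hf - u • e0 f hf - hu • L.op (ZMod p) 2 f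
    · refine ⟨C (-5 * u) * (X * X - C 2 * X - C 5) - C 5 * X - C 5, fun f hf => ?_⟩
      rw [hj f hf.1]
      simp only [map_mul, map_sub, aeval_X, aeval_C, Module.End.mul_apply, LinearMap.sub_apply,
        Module.algebraMap_end_apply]
      change L.op (ZMod p) 3 f = _
      linear_combination (norm := module) es f hf - e0 f hf + (5 * u) • e2 f hf +
        (5 * u) • e0 f hf + ((5 : ZMod p) • hu) • L.op (ZMod p) 2 f
  by_cases hsq : IsSquare (5 : ZMod p)
  · obtain ⟨s, hs⟩ := hsq
    have hs0 : s ≠ 0 := fun h0 => h5 (by rw [hs, h0, mul_zero])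
    have hne : ∀ s : ZMod p, 5 = s * s → s + 1 ≠ 0 := fun s hs h0 =>
      mul_ne_zero h2 h2 (by linear_combination hs + (s - 1) * h0)
    have hinj : Function.Injective ![s, -s, -1] := by
      refine injective_vec_three (fun h => ?_) (fun h => ?_) (fun h => ?_)
      · exact mul_ne_zero h2 hs0 (by linear_combination h)
      · exact hne s hs (by linear_combination h)
      · exact hne (-s) (by linear_combination hs) (by linear_combination h)
    have hkill : ∀ f ∈ faceSpace (ZMod p) M,
        aeval T (∏ j, (X - C (![s, -s, -1] j))) f = 0 := fun f hf => by
      rw [Fin.prod_univ_three, mul_assoc]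
      refine (aeval_mul_three T s (-s) (-1) f).trans ?_
      linear_combination (norm := module) hk f hf + hs • T f + hs • f
    have hdim' : ∀ s : ZMod p, 5 = s * s → (Module.finrank (ZMod p)
        (kerIn T (faceSpace (ZMod p) M) (X - C s)) : ZMod p) = (3 : ℕ) := fun s hs => by
      have hs0 : s ≠ 0 := fun h0 => h5 (by rw [hs, h0, mul_zero])
      -- The Lagrange denominator (s - (-s))(s - (-1)).
      obtain ⟨c, hc⟩ : ∃ c : ZMod p, 2 * s * (s + 1) * c = 1 :=
        ⟨_, mul_inv_cancel₀ (mul_ne_zero (mul_ne_zero h2 hs0) (hne s hs))⟩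
      refine (L.finrank_eigenspace dodecahedronTable_isValid H.regular H.type H.card_ne c
        ((X - C (-s)) * (X - C (-1))) ![c * (1 + s * v), c * (s + 3), c * 2, 0]
        (fun f hf => ?_) (fun f hf => ?_) ?_).trans ?_
      · rw [aeval_mul_two, Fin.sum_univ_four, e1]
        change (c * (1 + s * v)) • L.op (ZMod p) 0 f + (c * (s + 3)) • T f +
          (c * 2) • L.op (ZMod p) 2 f + (0 : ZMod p) • L.op (ZMod p) 3 f = _
        linear_combination (norm := module) (-c) • e2 f hf + (c * s * v) • e0 f hf +
          ((c * s) • hv) • f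
      · refine (aeval_mul_three T s (-s) (-1) f).trans ?_
        linear_combination (norm := module) hk f hf + hs • T f + hs • f
      · simp
        linear_combination hc
      · rw [hN, Fin.sum_univ_four]
        simp
        linear_combination 3 * hc + 6 * c * hs + 11 * c * s * hv
    have hdim : ∀ j, j ≠ 2 → (Module.finrank (ZMod p) (kerIn T (faceSpace (ZMod p) M)
        (X - C (![s, -s, -1] j))) : ZMod p) = (![3, 3, 5] : Fin 3 → ℕ) j := fun j hj => by
      fin_cases j
      · exact hdim' s hs
      · exact hdim' (-s) (by linear_combination hs)
      · exact absurd rfl hj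
    obtain ⟨h, hd⟩ := multFree_of_eigenvalues H hinj hkill hcomm ![3, 3, 5] 2
      (fun j => by fin_cases j <;> simp <;> omega) (fun j => by fin_cases j <;> simp)
      (by rw [hN]; rfl) hdim
    have hmod := (isSquare_five_iff hp).1 ⟨s, hs⟩
    exact ⟨⟨fun _ => h.hasRegularCoverings_three H hd, fun h' => by omega⟩, _,
      h.coveringsAreJoins H⟩
  -- At -1 the factor X² - 5 takes the value -4, so -c normalises the projection.
  · obtain ⟨c, hc⟩ : ∃ c : ZMod p, 4 * c = 1 := ⟨u * u, by linear_combination (2 * u + 1) * hu⟩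
    have hirr : ∀ j, Irreducible ((![X - C (-1), X ^ 2 - C 5] : Fin 2 → (ZMod p)[X]) j) := by
      intro j
      fin_cases j
      · exact irreducible_X_sub_C _
      · exact irreducible_X_sq_sub_C hsq
    have hcop1 : IsCoprime (X - C (-1) : (ZMod p)[X]) (X ^ 2 - C 5) := by
      refine ⟨C c * (X - 1), -C c, ?_⟩
      have : (C 4 * C c : (ZMod p)[X]) = 1 := by rw [← C_mul, hc, C_1]
      rw [C_neg, C_1]
      have h5' : (C 5 : (ZMod p)[X]) = C 4 + 1 := by rw [← C_1, ← C_add]; norm_num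
      rw [h5']
      linear_combination this
    have hcop : Pairwise fun i j => IsCoprime ((![X - C (-1), X ^ 2 - C 5] : Fin 2 → (ZMod p)[X]) i)
        ((![X - C (-1), X ^ 2 - C 5] : Fin 2 → (ZMod p)[X]) j) := by
      intro i j hij
      fin_cases i <;> fin_cases j
      · exact absurd rfl hij
      · exact hcop1
      · exact hcop1.symm
      · exact absurd rfl hij
    have hkp : ∀ f ∈ faceSpace (ZMod p) M, 
        aeval T ((X - C (-1)) * (X ^ 2 - C 5) : (ZMod p)[X]) f = 0 := by
      intro f hf
      rw [aeval_mul_apply, aeval_X_sub_C_apply, aeval_X_sq_sub_C_apply, map_sub, map_smul]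
      linear_combination (norm := module) hk f hf
    have hkill : ∀ f ∈ faceSpace (ZMod p) M,
        aeval T (∏ j, (![X - C (-1), X ^ 2 - C 5] : Fin 2 → (ZMod p)[X]) j) f = 0 := fun f hf => by
      rw [Fin.prod_univ_two]
      exact hkp f hf
    have hdim : ∀ j, j ≠ 1 → (Module.finrank (ZMod p) (kerIn T (faceSpace (ZMod p) M)
        ((![X - C (-1), X ^ 2 - C 5] : Fin 2 → (ZMod p)[X]) j)) : ZMod p) =
        (![5, 6] : Fin 2 → ℕ) j := fun j hj => by
      fin_cases j
      · refine (L.finrank_eigenspace dodecahedronTable_isValid H.regular H.type H.card_ne (-c)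
          (X ^ 2 - C 5) ![0, -c * 2, -c * 2, 0] (fun f hf => ?_) hkp ?_).trans ?_
        · rw [aeval_X_sq_sub_C_apply, Fin.sum_univ_four, e1]
          change (0 : ZMod p) • L.op (ZMod p) 0 f + (-c * 2) • T f + (-c * 2) • L.op (ZMod p) 2 f +
            (0 : ZMod p) • L.op (ZMod p) 3 f = _
          linear_combination (norm := module) c • e2 f hf + c • e0 f hf
        · simp
          linear_combination hc
        · rw [hN, Fin.sum_univ_four]
          simp
          linear_combination 5 * hc
      · exact absurd rfl hj
    have hd := finrank_kerIn_eq H hirr hcop hkill ![5, 6] 1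
      (fun j => by fin_cases j <;> simp <;> omega) (by rw [hN]; rfl) hdim
    have h := multFree_of_finrank hirr hcop hkill hcomm hd (fun j => by fin_cases j <;> simp)
    have hmod := (isSquare_five_iff hp).not.1 hsq
    exact ⟨⟨fun h' => absurd h' hmod, fun _ => h.hasRegularCoverings_two H hd⟩, _,
      h.coveringsAreJoins H⟩

end

end OMap

end

section

open Polynomial

namespace OMap

noncomputable section

/-! ### Two anticommuting constituents -/

/-- An isotypic component `Q = ker T (T + 2)` of multiplicity two, with the operator `U` which
exchanges the kernels of `T` and `T + 2` and vanishes on the other components. -/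
structure Exchange {k V : Type} [Field k] [AddCommGroup V] [Module k V] (T U : V →ₗ[k] V)
    (P : Submodule k V) (κ : k) : Prop where
  two_ne : (2 : k) ≠ 0
  κ_ne : κ ≠ 0
  T_mem : ∀ f ∈ P, T f ∈ P
  U_mem : ∀ f ∈ P, U f ∈ P
  anti : ∀ f ∈ P, T (U f) + U (T f) = (-2 : k) • U f
  T_T_U : ∀ f ∈ P, T (T (U f)) = (-2 : k) • T (U f)
  U_U : ∀ f ∈ P, T (T f) = (-2 : k) • T f → U (U f) = κ • f

namespace Exchange

variable {k V : Type} [Field k] [AddCommGroup V] [Module k V] {T U : V →ₗ[k] V}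
  {P : Submodule k V} {κ : k}

/-- The submodules `{a g + b U g | T g = 0}`. -/
def line (T U : V →ₗ[k] V) (P : Submodule k V) (a b : k) : Submodule k V :=
  (kerIn T P X).map (a • LinearMap.id + b • U)

/-- The isotypic component of multiplicity two. -/
def double (T : V →ₗ[k] V) (P : Submodule k V) : Submodule k V := kerIn T P (X ^ 2 + C 2 * X)

theorem mem_kerIn_X {f : V} : f ∈ kerIn T P X ↔ T f = 0 ∧ f ∈ P := by
  rw [mem_kerIn, aeval_X]

theorem aeval_double (f : V) : aeval T (X ^ 2 + C 2 * X : k[X]) f = T (T f) + (2 : k) • T f := by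
  rw [map_add, map_mul, map_pow, aeval_X, aeval_C, pow_two]
  rfl

theorem mem_double {f : V} : f ∈ double T P ↔ T (T f) = (-2 : k) • T f ∧ f ∈ P := by
  rw [double, mem_kerIn, aeval_double]
  constructor
  · rintro ⟨h, hf⟩
    exact ⟨by linear_combination (norm := module) h, hf⟩
  · rintro ⟨h, hf⟩
    exact ⟨by linear_combination (norm := module) h, hf⟩

theorem mem_line {a b : k} {f : V} :
    f ∈ line T U P a b ↔ ∃ g, (T g = 0 ∧ g ∈ P) ∧ a • g + b • U g = f := by
  rw [line, Submodule.mem_map]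
  simp only [mem_kerIn_X]
  rfl

/-- The submodules of the double component which are stable under the automorphisms. -/
def part (T U : V →ₗ[k] V) (P : Submodule k V) : Fin 3 ⊕ k → Submodule k V
  | .inl i => ![⊥, line T U P 0 1, double T P] i
  | .inr t => line T U P 1 t

theorem line_smul_le {a b : k} (c : k) : line T U P (c * a) (c * b) ≤ line T U P a b := by
  rintro f hf
  obtain ⟨g, ⟨hg, hgP⟩, rfl⟩ := mem_line.1 hf
  refine mem_line.2 ⟨c • g, ⟨by rw [map_smul, hg, smul_zero], P.smul_mem _ hgP⟩, ?_⟩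
  rw [map_smul]
  module

theorem line_zero : line T U P 0 0 = ⊥ := by
  rw [line, zero_smul, zero_smul, add_zero, Submodule.map_zero]

theorem line_eq_smul {a b c : k} (hc : c ≠ 0) : line T U P (c * a) (c * b) = line T U P a b := by
  refine le_antisymm (line_smul_le c) ?_
  have := line_smul_le (T := T) (U := U) (P := P) (a := c * a) (b := c * b) c⁻¹
  rwa [inv_mul_cancel_left₀ hc, inv_mul_cancel_left₀ hc] at this

theorem exists_part_eq_line (a b : k) : ∃ τ, line T U P a b = part T U P τ := by
  by_cases ha : a = 0
  · by_cases hb : b = 0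
    · exact ⟨.inl 0, by rw [ha, hb, line_zero]; rfl⟩
    · refine ⟨.inl 1, ?_⟩
      have := line_eq_smul (T := T) (U := U) (P := P) (a := 0) (b := 1) hb
      rw [mul_zero, mul_one] at this
      rw [ha, this]
      rfl
  · refine ⟨.inr (a⁻¹ * b), ?_⟩
    have := line_eq_smul (T := T) (U := U) (P := P) (a := 1) (b := a⁻¹ * b) ha
    rw [mul_one, mul_inv_cancel_left₀ ha] at this
    rw [this]
    rfl

variable (E : Exchange T U P κ)

include E

theorem T_U {g : V} (hg : T g = 0) (hP : g ∈ P) : T (U g) = (-2 : k) • U g := by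
  rw [← E.anti g hP, hg, map_zero, add_zero]

theorem U_U_of_mem {g : V} (hg : T g = 0) (hP : g ∈ P) : U (U g) = κ • g :=
  E.U_U g hP (by rw [hg, map_zero, smul_zero])

theorem U_mem_double {f : V} (hf : f ∈ P) : U f ∈ double T P :=
  mem_double.2 ⟨E.T_T_U f hf, E.U_mem f hf⟩

/-- With `U_mem_double`: U takes its values in the double component and vanishes on the image of T²
+ 2T. -/
theorem U_double {f : V} (hf : f ∈ P) : U (aeval T (X ^ 2 + C 2 * X : k[X]) f) = 0 := by
  have h1 := congrArg T (E.anti f hf)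
  rw [map_add, map_smul, E.T_T_U f hf] at h1
  have h2 := E.anti (T f) (E.T_mem f hf)
  rw [aeval_double, map_add, map_smul]
  linear_combination (norm := module) h2 - h1

omit E in
theorem kerIn_X_le_double : kerIn T P X ≤ double T P := fun f hf => by
  obtain ⟨h1, h2⟩ := mem_kerIn_X.1 hf
  exact mem_double.2 ⟨by rw [h1, map_zero, smul_zero], h2⟩

theorem line_le_double (a b : k) : line T U P a b ≤ double T P := by
  intro f hf
  obtain ⟨g, hg, rfl⟩ := mem_line.1 hf
  exact add_mem (Submodule.smul_mem _ _ (kerIn_X_le_double (mem_kerIn_X.2 hg)))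
    (Submodule.smul_mem _ _ (E.U_mem_double hg.2))

theorem part_le_double (τ : Fin 3 ⊕ k) : part T U P τ ≤ double T P := by
  rcases τ with i | t
  · fin_cases i
    · exact bot_le
    · exact E.line_le_double 0 1
    · exact le_rfl
  · exact E.line_le_double 1 t

/-- The double component is ker T plus its image under U. The parts of f are f + T f/2 in ker T and
-T f/2 in ker (T + 2), and the latter is U of something because U² = κ is invertible. -/
theorem exists_eq_add {f : V} (hf : f ∈ double T P) :
    ∃ g h, (T g = 0 ∧ g ∈ P) ∧ (T h = 0 ∧ h ∈ P) ∧ f = g + U h := by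
  obtain ⟨h1, h2⟩ := mem_double.1 hf
  obtain ⟨u, hu⟩ : ∃ u : k, 2 * u = 1 := ⟨_, mul_inv_cancel₀ E.two_ne⟩
  have hTf := E.T_mem f h2
  have hUTf := E.U_mem _ hTf
  have hUU : U (U (T f)) = κ • T f := E.U_U _ hTf (by rw [h1, map_smul, h1])
  have hTU : T (U (T f)) = 0 := by
    have h3 := E.anti _ hTf
    rw [h1, map_smul] at h3
    exact add_eq_right.1 h3
  refine ⟨f + u • T f, (-(u * κ⁻¹)) • U (T f), ⟨?_, add_mem h2 (P.smul_mem _ hTf)⟩,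
    ⟨by rw [map_smul, hTU, smul_zero], P.smul_mem _ hUTf⟩, ?_⟩
  · rw [map_add, map_smul, h1]
    linear_combination (norm := module) -(hu • T f)
  · rw [map_smul, hUU, smul_smul, neg_mul, mul_assoc, inv_mul_cancel₀ E.κ_ne]
    module

theorem line_sup_line_eq_double {a b a' b' : k} (h : a * b' - b * a' ≠ 0) :
    line T U P a b ⊔ line T U P a' b' = double T P := by
  refine le_antisymm (sup_le (E.line_le_double _ _) (E.line_le_double _ _)) fun f hf => ?_
  obtain ⟨g, g', ⟨hg, hgP⟩, ⟨hg', hgP'⟩, rfl⟩ := E.exists_eq_add hf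
  obtain ⟨c, hc⟩ : ∃ c : k, (a * b' - b * a') * c = 1 := ⟨_, mul_inv_cancel₀ h⟩
  -- Cramer's rule for the matrix with rows (a, b) and (a', b').
  refine Submodule.mem_sup.2 ⟨a • (c • (b' • g - a' • g')) + b • U (c • (b' • g - a' • g')),
    mem_line.2 ⟨_, ⟨?_, ?_⟩, rfl⟩, a' • (c • (a • g' - b • g)) + b' • U (c • (a • g' - b • g)),
    mem_line.2 ⟨_, ⟨?_, ?_⟩, rfl⟩, ?_⟩
  · simp only [map_smul, map_sub, hg, hg', smul_zero, sub_zero]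
  · exact P.smul_mem _ (sub_mem (P.smul_mem _ hgP) (P.smul_mem _ hgP'))
  · simp only [map_smul, map_sub, hg, hg', smul_zero, sub_zero]
  · exact P.smul_mem _ (sub_mem (P.smul_mem _ hgP') (P.smul_mem _ hgP))
  · simp only [map_smul, map_sub]
    linear_combination (norm := module) hc • g + hc • U g'

theorem exists_part_eq_sup (a b a' b' : k) :
    ∃ τ, line T U P a b ⊔ line T U P a' b' = part T U P τ := by
  by_cases h : a * b' - b * a' = 0
  · by_cases ha : a = 0 ∧ b = 0
    · rw [ha.1, ha.2, line_zero, bot_sup_eq]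
      exact exists_part_eq_line a' b'
    · have hle : line T U P a' b' ≤ line T U P a b := by
        by_cases ha0 : a = 0
        · have hb : b ≠ 0 := fun hb => ha ⟨ha0, hb⟩
          subst ha0
          have h1 : a' = 0 := by
            rw [zero_mul, zero_sub, neg_eq_zero] at h
            exact (mul_eq_zero.1 h).resolve_left hb
          have := line_smul_le (T := T) (U := U) (P := P) (a := 0) (b := b) (b' * b⁻¹)
          rwa [mul_zero, inv_mul_cancel_right₀ hb, ← congrArg (fun c => line T U P c b') h1] at this
        · have h1 : a' * a⁻¹ * b = b' := by
            field_simp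
            linear_combination -h
          have := line_smul_le (T := T) (U := U) (P := P) (a := a) (b := b) (a' * a⁻¹)
          rwa [inv_mul_cancel_right₀ ha0, h1] at this
      rw [sup_eq_left.2 hle]
      exact exists_part_eq_line a b
  · exact ⟨.inl 2, E.line_sup_line_eq_double h⟩

/-- The images of the equivariant projections of the double component. -/
theorem exists_part_eq {W : Submodule k V} (hW : W ≤ double T P) {q : k[X]} {a b : k}
    (h1 : ∀ f ∈ double T P, aeval T q f + a • U f + b • T (U f) ∈ W)
    (h2 : ∀ f ∈ W, aeval T q f + a • U f + b • T (U f) = f) : ∃ τ, W = part T U P τ := by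
  have hB1 : ∀ g, T g = 0 → g ∈ P → aeval T q g + a • U g + b • T (U g) =
      q.eval 0 • g + (a - 2 * b) • U g := fun g hg hP => by
    rw [aeval_apply_of_eigen (l := 0) (by rw [hg, zero_smul]), E.T_U hg hP]
    module
  have hB2 : ∀ g, T g = 0 → g ∈ P →
      aeval T q (U g) + a • U (U g) + b • T (U (U g)) = (a * κ) • g + q.eval (-2) • U g := by
    intro g hg hP
    rw [aeval_apply_of_eigen (E.T_U hg hP), E.U_U_of_mem hg hP, map_smul, hg]
    module
  -- In the coordinates g and U g the projection is a 2 × 2 matrix. These are the images of the two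
  -- basis vectors, and the image of the projection is the sum of the corresponding lines.
  obtain ⟨τ, hτ⟩ := E.exists_part_eq_sup (q.eval 0) (a - 2 * b) (a * κ) (q.eval (-2))
  refine ⟨τ, hτ ▸ le_antisymm (fun f hf => ?_) (sup_le (fun f hf => ?_) fun f hf => ?_)⟩
  · obtain ⟨g, g', ⟨hg, hgP⟩, ⟨hg', hgP'⟩, rfl⟩ := E.exists_eq_add (hW hf)
    rw [← h2 _ hf]
    refine Submodule.mem_sup.2 ⟨_, mem_line.2 ⟨g, ⟨hg, hgP⟩, rfl⟩, _,
      mem_line.2 ⟨g', ⟨hg', hgP'⟩, rfl⟩, ?_⟩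
    rw [← hB1 g hg hgP, ← hB2 g' hg' hgP']
    simp only [map_add]
    module
  · obtain ⟨g, ⟨hg, hgP⟩, rfl⟩ := mem_line.1 hf
    rw [← hB1 g hg hgP]
    exact h1 _ (kerIn_X_le_double (mem_kerIn_X.2 ⟨hg, hgP⟩))
  · obtain ⟨g, ⟨hg, hgP⟩, rfl⟩ := mem_line.1 hf
    rw [← hB2 g hg hgP]
    exact h1 _ (E.U_mem_double hgP)

theorem eq_zero_of_add_eq_zero {g h : V} (hg : T g = 0 ∧ g ∈ P) (hh : T h = 0 ∧ h ∈ P)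
    (hs : g + U h = 0) : g = 0 ∧ h = 0 := by
  have h1 := congrArg T hs
  rw [map_add, hg.1, zero_add, E.T_U hh.1 hh.2, map_zero,
    smul_eq_zero_iff_right (neg_ne_zero.2 E.two_ne)] at h1
  refine ⟨by rw [h1, add_zero] at hs; exact hs, ?_⟩
  have h2 := E.U_U_of_mem hh.1 hh.2
  rw [h1, map_zero] at h2
  exact (smul_eq_zero_iff_right E.κ_ne).1 h2.symm

theorem mem_line_iff {a b x y : k} {g : V} (hg : T g = 0 ∧ g ∈ P) :
    x • g + y • U g ∈ line T U P a b ↔ ∃ h, (T h = 0 ∧ h ∈ P) ∧ x • g = a • h ∧ y • g = b • h := by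
  rw [mem_line]
  constructor
  · rintro ⟨h, hh, h1⟩
    have h2 : (x • g - a • h) + U (y • g - b • h) = 0 := by
      rw [map_sub, map_smul, map_smul]
      linear_combination (norm := module) -h1
    have h3 : ∀ c d : k, T (c • g - d • h) = 0 ∧ c • g - d • h ∈ P := fun c d =>
      ⟨by rw [map_sub, map_smul, map_smul, hg.1, hh.1, smul_zero, smul_zero, sub_zero],
        sub_mem (P.smul_mem _ hg.2) (P.smul_mem _ hh.2)⟩
    obtain ⟨h4, h5⟩ := E.eq_zero_of_add_eq_zero (h3 x a) (h3 y b) h2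
    exact ⟨h, hh, sub_eq_zero.1 h4, sub_eq_zero.1 h5⟩
  · rintro ⟨h, hh, h1, h2⟩
    exact ⟨h, hh, by rw [h1, ← map_smul, ← map_smul, h2]⟩

/-- The slopes `(x, y)` contained in the parts. -/
theorem mem_part_inr {t x y : k} {g : V} (hg : T g = 0 ∧ g ∈ P) (hne : g ≠ 0) :
    x • g + y • U g ∈ part T U P (.inr t) ↔ y = t * x := by
  change _ ∈ line T U P 1 t ↔ _
  rw [E.mem_line_iff hg]
  constructor
  · rintro ⟨h, -, h1, h2⟩
    rw [one_smul] at h1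
    rw [← h1, smul_smul] at h2
    exact smul_left_injective k hne h2
  · rintro rfl
    exact ⟨x • g, ⟨by rw [map_smul, hg.1, smul_zero], P.smul_mem _ hg.2⟩, (one_smul _ _).symm,
      mul_smul _ _ _⟩

theorem mem_part_one {x y : k} {g : V} (hg : T g = 0 ∧ g ∈ P) (hne : g ≠ 0) :
    x • g + y • U g ∈ part T U P (.inl 1) ↔ x = 0 := by
  change _ ∈ line T U P 0 1 ↔ _
  rw [E.mem_line_iff hg]
  constructor
  · rintro ⟨h, -, h1, -⟩
    rw [zero_smul] at h1
    exact (smul_eq_zero.1 h1).resolve_right hne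
  · rintro rfl
    exact ⟨y • g, ⟨by rw [map_smul, hg.1, smul_zero], P.smul_mem _ hg.2⟩, by simp, by simp⟩

theorem mem_part_zero {x y : k} {g : V} (hg : T g = 0 ∧ g ∈ P) (hne : g ≠ 0) :
    x • g + y • U g ∈ part T U P (.inl 0) ↔ x = 0 ∧ y = 0 := by
  change _ ∈ (⊥ : Submodule k V) ↔ _
  rw [← line_zero (T := T) (U := U) (P := P), E.mem_line_iff hg]
  constructor
  · rintro ⟨h, -, h1, h2⟩
    rw [zero_smul] at h1 h2
    exact ⟨(smul_eq_zero.1 h1).resolve_right hne, (smul_eq_zero.1 h2).resolve_right hne⟩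
  · rintro ⟨rfl, rfl⟩
    exact ⟨0, ⟨map_zero _, zero_mem _⟩, by simp, by simp⟩

theorem mem_part_two {x y : k} {g : V} (hg : T g = 0 ∧ g ∈ P) :
    x • g + y • U g ∈ part T U P (.inl 2) :=
  add_mem (Submodule.smul_mem _ _ (kerIn_X_le_double (mem_kerIn_X.2 hg)))
    (Submodule.smul_mem _ _ (E.U_mem_double hg.2))

/-- For one non-zero g in ker T, the pairs (x, y) with x g + y U g in a part form the origin, the
line x = 0, the plane, or the line y = t x, and so determine the part. -/
theorem part_injective (hne : kerIn T P X ≠ ⊥) : Function.Injective (part T U P) := by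
  obtain ⟨g, hg, hg0⟩ := (Submodule.ne_bot_iff _).1 hne
  rw [mem_kerIn_X] at hg
  let slope : Fin 3 ⊕ k → k → k → Prop := fun τ x y =>
    τ.elim (fun i => ![x = 0 ∧ y = 0, x = 0, True] i) fun t => y = t * x
  have hs : ∀ τ x y, x • g + y • U g ∈ part T U P τ ↔ slope τ x y := by
    rintro (i | t) x y
    · fin_cases i
      · exact E.mem_part_zero hg hg0
      · exact E.mem_part_one hg hg0
      · exact iff_true_intro (E.mem_part_two hg)
    · exact E.mem_part_inr hg hg0
  intro τ τ' h
  have key : ∀ x y, slope τ x y ↔ slope τ' x y := fun x y => by rw [← hs, ← hs, h]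
  clear h hs hg0 hg hne
  -- The pairs (0, 1) and (1, 0), and where needed (1, t), distinguish all parts.
  have k2 := key 0 1
  have k3 := key 1 0
  rcases τ with i | t <;> rcases τ' with j | t'
  · clear key
    fin_cases i <;> fin_cases j <;> simp_all [slope]
  · have k4 := key 1 t'
    clear key
    fin_cases i <;> simp_all [slope]
  · have k4 := key 1 t
    clear key
    fin_cases j <;> simp_all [slope]
  · have k4 := key 1 t
    clear key
    simp_all [slope]

omit E in
/-- Transport of the parts by an operator which commutes with `T`, and with `U` up to sign. -/
theorem map_line {A : V →ₗ[k] V} {ε : k} (hA : ∀ f ∈ P, A f ∈ P) (hT : ∀ f, A (T f) = T (A f))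
    (hU : ∀ f ∈ P, U (A f) = ε • A (U f)) (hε : ε * ε = 1) {a b : k} {f : V}
    (hf : f ∈ line T U P a b) : A f ∈ line T U P a (ε * b) := by
  obtain ⟨g, ⟨hg, hgP⟩, rfl⟩ := mem_line.1 hf
  refine mem_line.2 ⟨A g, ⟨by rw [← hT, hg, map_zero], hA g hgP⟩, ?_⟩
  rw [hU g hgP, map_add, map_smul, map_smul]
  linear_combination (norm := module) (b • hε) • A (U g)

omit E in
theorem map_double {A : V →ₗ[k] V} (hA : ∀ f ∈ P, A f ∈ P) (hT : ∀ f, A (T f) = T (A f)) {f : V}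
    (hf : f ∈ double T P) : A f ∈ double T P := by
  obtain ⟨h1, h2⟩ := mem_double.1 hf
  exact mem_double.2 ⟨by rw [← hT, ← hT, h1, map_smul], hA f h2⟩

/-! ### Dimensions -/

theorem finrank_line [FiniteDimensional k V] {a b : k} (h : a ≠ 0 ∨ b ≠ 0) :
    Module.finrank k (line T U P a b) = Module.finrank k (kerIn T P X) := by
  rw [line, ← LinearMap.range_domRestrict]
  refine LinearMap.finrank_range_of_inj ((injective_iff_map_eq_zero _).2 fun g hg => ?_)
  have hgK := mem_kerIn_X.1 g.2
  have h1 : a • g.1 + U (b • g.1) = 0 := by rw [map_smul]; exact hg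
  have h2 : ∀ c : k, T (c • g.1) = 0 ∧ c • g.1 ∈ P := fun c =>
    ⟨by rw [map_smul, hgK.1, smul_zero], P.smul_mem _ hgK.2⟩
  obtain ⟨h3, h4⟩ := E.eq_zero_of_add_eq_zero (h2 a) (h2 b) h1
  apply Subtype.ext
  rcases h with h | h
  · exact (smul_eq_zero_iff_right h).1 h3
  · exact (smul_eq_zero_iff_right h).1 h4

theorem finrank_double [FiniteDimensional k V] :
    Module.finrank k (double T P) = 2 * Module.finrank k (kerIn T P X) := by
  have h1 := Submodule.finrank_sup_add_finrank_inf_eq (line T U P 1 0) (line T U P 0 1)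
  have h2 : line T U P 1 0 ⊓ line T U P 0 1 = ⊥ := by
    rw [Submodule.eq_bot_iff]
    rintro f ⟨hf, hf'⟩
    obtain ⟨g, hg, rfl⟩ := mem_line.1 hf
    rw [SetLike.mem_coe, E.mem_line_iff hg] at hf'
    obtain ⟨h, -, h3, -⟩ := hf'
    rw [one_smul, zero_smul] at h3
    rw [h3]
    simp
  rw [h2, finrank_bot, add_zero, E.line_sup_line_eq_double (by simp),
    E.finrank_line (Or.inl one_ne_zero), E.finrank_line (Or.inr one_ne_zero)] at h1
  rw [h1, two_mul]

/-- The multiplicities of the parts. -/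
def mult : Fin 3 ⊕ k → ℕ
  | .inl i => i
  | .inr _ => 1

theorem finrank_part [FiniteDimensional k V] (τ : Fin 3 ⊕ k) :
    Module.finrank k (part T U P τ) = mult τ * Module.finrank k (kerIn T P X) := by
  rcases τ with i | t
  · fin_cases i
    · change Module.finrank k (⊥ : Submodule k V) = 0 * _
      rw [finrank_bot, zero_mul]
    · change Module.finrank k (line T U P 0 1) = 1 * _
      rw [E.finrank_line (Or.inr one_ne_zero), one_mul]
    · exact E.finrank_double
  · change Module.finrank k (line T U P 1 t) = 1 * _
    rw [E.finrank_line (Or.inl one_ne_zero), one_mul]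

end Exchange

end

end OMap

end

/-! ### Submodules when one component is double. -/

section

open Polynomial

namespace OMap

noncomputable section

namespace Exchange

variable {k V : Type} [Field k] [AddCommGroup V] [Module k V] {T U : V →ₗ[k] V}
  {P : Submodule k V} {κ : k} {ν : ℕ} {μ : Fin ν → k[X]}

/-- The sum of the primary components with indices in `S` and of a part of the double one. -/
def space (T U : V →ₗ[k] V) (P : Submodule k V) (μ : Fin ν → k[X])
    (q : Finset (Fin ν) × (Fin 3 ⊕ k)) : Submodule k V :=
  (⨆ j ∈ q.1, kerIn T P (μ j)) ⊔ part T U P q.2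

theorem eq_zero_of_coprime {q r : k[X]} (h : IsCoprime q r) {f : V} (hq : aeval T q f = 0)
    (hr : aeval T r f = 0) : f = 0 := by
  obtain ⟨a, b, hab⟩ := h
  have h1 : aeval T (a * q + b * r) f = f := by rw [hab]; simp
  rw [map_add, LinearMap.add_apply, aeval_mul_apply, hq, aeval_mul_apply, hr] at h1
  simpa using h1.symm

theorem disjoint_double (hd : ∀ j, IsCoprime (μ j) (X ^ 2 + C 2 * X)) (S : Finset (Fin ν)) :
    Disjoint (⨆ j ∈ S, kerIn T P (μ j)) (double T P) := by
  rw [Submodule.disjoint_def]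
  intro f hf hf'
  have h1 : ⨆ i ∈ S, kerIn T P (μ i) ≤ LinearMap.ker (aeval T (∏ i ∈ S, μ i)) := by
    refine iSup₂_le fun i hi f hf => ?_
    obtain ⟨r, hr⟩ := Finset.dvd_prod_of_mem μ hi
    rw [LinearMap.mem_ker, hr, mul_comm, aeval_mul_apply, (mem_kerIn.1 hf).1, map_zero]
  exact eq_zero_of_coprime (IsCoprime.prod_left fun i _ => hd i) (h1 hf) hf'.1

variable (E : Exchange T U P κ) (hcop : Pairwise fun i j => IsCoprime (μ i) (μ j))
  (hd : ∀ j, IsCoprime (μ j) (X ^ 2 + C 2 * X))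

include E hd

theorem space_inf_double (q : Finset (Fin ν) × (Fin 3 ⊕ k)) :
    space T U P μ q ⊓ double T P = part T U P q.2 := by
  refine le_antisymm ?_ (le_inf le_sup_right (E.part_le_double _))
  rintro f ⟨hf, hf'⟩
  obtain ⟨c, hc, g, hg, rfl⟩ := Submodule.mem_sup.1 hf
  have h1 : c ∈ double T P := by
    have := sub_mem hf' (E.part_le_double _ hg)
    rwa [add_sub_cancel_right] at this
  rw [Submodule.disjoint_def.1 (disjoint_double hd q.1) c hc h1, zero_add]
  exact hg

theorem finrank_space [FiniteDimensional k V] (hcop : Pairwise fun i j => IsCoprime (μ i) (μ j))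
    (q : Finset (Fin ν) × (Fin 3 ⊕ k)) :
    Module.finrank k (space T U P μ q) = ∑ j ∈ q.1, Module.finrank k (kerIn T P (μ j)) +
      mult q.2 * Module.finrank k (kerIn T P X) := by
  have h1 := Submodule.finrank_sup_add_finrank_inf_eq (⨆ j ∈ q.1, kerIn T P (μ j))
    (part T U P q.2)
  rw [((disjoint_double hd q.1).mono_right (E.part_le_double q.2)).eq_bot, finrank_bot, add_zero,
    E.finrank_part, finrank_iSup_kerIn hcop] at h1
  exact h1

include hcop

theorem kerIn_le_space_iff (hne : ∀ j, kerIn T P (μ j) ≠ ⊥) (q : Finset (Fin ν) × (Fin 3 ⊕ k))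
    (j : Fin ν) : kerIn T P (μ j) ≤ space T U P μ q ↔ j ∈ q.1 := by
  rw [← kerIn_le_iff hcop hne]
  refine ⟨fun h f hf => ?_, fun h => h.trans le_sup_left⟩
  obtain ⟨c, hc, g, hg, rfl⟩ := Submodule.mem_sup.1 (h hf)
  have h1 : g ∈ ⨆ i ∈ insert j q.1, kerIn T P (μ i) := by
    have h2 : ⨆ i ∈ q.1, kerIn T P (μ i) ≤ ⨆ i ∈ insert j q.1, kerIn T P (μ i) :=
      biSup_mono fun i hi => Finset.mem_insert_of_mem hi
    have h3 : kerIn T P (μ j) ≤ ⨆ i ∈ insert j q.1, kerIn T P (μ i) :=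
      le_biSup (fun i => kerIn T P (μ i)) (Finset.mem_insert_self j q.1)
    have := sub_mem (h3 hf) (h2 hc)
    rwa [add_sub_cancel_left] at this
  rw [Submodule.disjoint_def.1 (disjoint_double hd _) g h1 (E.part_le_double _ hg), add_zero]
  exact hc

theorem space_injective (hne : ∀ j, kerIn T P (μ j) ≠ ⊥) (hX : kerIn T P X ≠ ⊥) :
    Function.Injective (space T U P μ) := by
  intro q q' h
  refine Prod.ext ?_ (E.part_injective hX ?_)
  · ext j
    rw [← E.kerIn_le_space_iff hcop hd hne q, h, E.kerIn_le_space_iff hcop hd hne q']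
  · rw [← E.space_inf_double hd q, h, E.space_inf_double hd q']

/-- The images of the equivariant projections. -/
theorem exists_eq_space (hirr : ∀ j, Irreducible (μ j))
    (hkill : ∀ f ∈ P, aeval T ((∏ j, μ j) * (X ^ 2 + C 2 * X)) f = 0) {W : Submodule k V}
    (hW : W ≤ P) {q : k[X]} {a b : k} (h1 : ∀ f ∈ P, aeval T q f + a • U f + b • T (U f) ∈ W)
    (h2 : ∀ f ∈ W, aeval T q f + a • U f + b • T (U f) = f) : ∃ s, W = space T U P μ s := by
  -- The Bézout relation splits the identity: the α term projects away from the double component,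
  -- the β term onto it.
  obtain ⟨α, β, hαβ⟩ : IsCoprime (X ^ 2 + C 2 * X) (∏ j, μ j) :=
    IsCoprime.prod_right fun j _ => (hd j).symm
  have hPT : ∀ (r : k[X]) {f : V}, f ∈ P → aeval T r f ∈ P := fun r f hf => aeval_mem E.T_mem r hf
  have hU0 : ∀ f ∈ P, aeval T (X ^ 2 + C 2 * X : k[X]) (U f) = 0 := fun f hf =>
    (E.U_mem_double hf).1
  have hsum : ∀ f, f = aeval T (α * (X ^ 2 + C 2 * X)) f + aeval T (β * ∏ j, μ j) f := fun f => by
    rw [← LinearMap.add_apply, ← map_add, hαβ]; simp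
  have hUα : ∀ f ∈ P, U (aeval T (α * (X ^ 2 + C 2 * X)) f) = 0 := fun f hf => by
    rw [mul_comm, aeval_mul_apply]
    exact E.U_double (hPT α hf)
  have hαU : ∀ f ∈ P, aeval T (α * (X ^ 2 + C 2 * X)) (U f) = 0 := fun f hf => by
    rw [aeval_mul_apply, hU0 f hf, map_zero]
  have hcommT : ∀ (r : k[X]) f, T (aeval T r f) = aeval T r (T f) := fun r f =>
    aeval_apply_comm (fun _ => rfl) r f
  have hcommq : ∀ (r s : k[X]) f, aeval T r (aeval T s f) = aeval T s (aeval T r f) :=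
    fun r s f => by rw [← aeval_mul_apply, mul_comm, aeval_mul_apply]
  -- The terms in U vanish both before and after the α idempotent e. Hence the equivariant
  -- projection sends e f to e of its value at f, that is, to e f, which therefore lies in W.
  have hsplit : ∀ f ∈ W, aeval T (α * (X ^ 2 + C 2 * X)) f ∈ W := by
    intro f hf
    have hfP := hW hf
    have h3 := h1 _ (hPT (α * (X ^ 2 + C 2 * X)) hfP)
    rw [hUα f hfP, map_zero, smul_zero, smul_zero, add_zero, add_zero] at h3
    have h4 := congrArg (aeval T (α * (X ^ 2 + C 2 * X))) (h2 f hf)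
    rw [map_add, map_add, map_smul, map_smul, hαU f hfP, ← hcommT, hαU f hfP, map_zero, smul_zero,
      smul_zero, add_zero, add_zero] at h4
    rw [← h4, hcommq]
    exact h3
  set P₁ := kerIn T P (∏ j, μ j) with hP₁
  have hker : ∀ j, kerIn T P₁ (μ j) = kerIn T P (μ j) := by
    intro j
    ext f
    refine ⟨fun hf => ⟨hf.1, hf.2.2⟩, fun hf => ⟨hf.1, ?_, hf.2⟩⟩
    obtain ⟨r, hr⟩ := Finset.dvd_prod_of_mem μ (Finset.mem_univ j)
    change aeval T (∏ j, μ j) f = 0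
    rw [hr, mul_comm, aeval_mul_apply, (mem_kerIn.1 hf).1, map_zero]
  -- On the complement of the double component U is zero, so the projection is a polynomial in T
  -- there and the multiplicity-free argument applies.
  have hα₁ : ∀ f ∈ P₁, U f = 0 := by
    intro f hf
    have h3 := hsum f
    rw [aeval_mul_apply _ β, (mem_kerIn.1 hf).1, map_zero, add_zero] at h3
    rw [h3, hUα f hf.2]
  have hB₁ : ∀ f ∈ P₁, aeval T q f = aeval T q f + a • U f + b • T (U f) := fun f hf => by
    rw [hα₁ f hf, map_zero, smul_zero, smul_zero, add_zero, add_zero]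
  have hTP₁ : ∀ f ∈ P₁, T f ∈ P₁ := fun f hf => by
    refine ⟨?_, E.T_mem f hf.2⟩
    change aeval T (∏ j, μ j) (T f) = 0
    rw [← hcommT, (mem_kerIn.1 hf).1, map_zero]
  have hW₁ := eq_iSup_kerIn (T := T) (P := P₁) hTP₁ hirr hcop (fun f hf => (mem_kerIn.1 hf).1)
    (W := W ⊓ P₁) inf_le_right (q := q)
    (fun f hf => ⟨by rw [hB₁ f hf]; exact h1 f hf.2, aeval_mem hTP₁ q hf⟩)
    (fun f hf => by rw [hB₁ f hf.2]; exact h2 f hf.1)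
  have hTd : ∀ f ∈ double T P, T f ∈ double T P := fun f hf => map_double E.T_mem (fun _ => rfl) hf
  obtain ⟨τ, hτ⟩ := E.exists_part_eq (W := W ⊓ double T P) inf_le_right (q := q) (a := a) (b := b)
    (fun f hf => ⟨h1 f hf.2, add_mem (add_mem (aeval_mem hTd q hf)
      (Submodule.smul_mem _ _ (E.U_mem_double hf.2)))
      (Submodule.smul_mem _ _ (hTd _ (E.U_mem_double hf.2)))⟩)
    (fun f hf => h2 f hf.1)
  classical
  refine ⟨(Finset.univ.filter fun j => kerIn T P₁ (μ j) ≤ W ⊓ P₁, τ), ?_⟩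
  have hcomp : ⨆ j ∈ Finset.univ.filter fun j => kerIn T P₁ (μ j) ≤ W ⊓ P₁, kerIn T P (μ j) =
      W ⊓ P₁ := by
    simp_rw [← hker]
    refine Eq.trans ?_ hW₁.symm
    simp only [Finset.mem_filter, Finset.mem_univ, true_and, Set.mem_ofPred_eq]
  rw [space]
  dsimp only
  rw [hcomp, ← hτ]
  refine le_antisymm (fun f hf => ?_) (sup_le inf_le_left inf_le_left)
  rw [hsum f]
  refine add_mem (Submodule.mem_sup_left ⟨hsplit f hf, ?_, hPT _ (hW hf)⟩)
    (Submodule.mem_sup_right ⟨?_, ?_, hPT _ (hW hf)⟩)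
  · change aeval T (∏ j, μ j) (aeval T (α * (X ^ 2 + C 2 * X)) f) = 0
    rw [← aeval_mul_apply, mul_left_comm, aeval_mul_apply, hkill f (hW hf), map_zero]
  · have := sub_mem hf (hsplit f hf)
    nth_rewrite 1 [hsum f] at this
    rwa [add_sub_cancel_left] at this
  · change aeval T (X ^ 2 + C 2 * X) (aeval T (β * ∏ j, μ j) f) = 0
    rw [← aeval_mul_apply, mul_left_comm, mul_comm (X ^ 2 + C 2 * X), aeval_mul_apply,
      hkill f (hW hf), map_zero]

omit E hcop hd in
theorem space_le (E : Exchange T U P κ) (q : Finset (Fin ν) × (Fin 3 ⊕ k)) :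
    space T U P μ q ≤ P :=
  sup_le (iSup₂_le fun _ _ => inf_le_right) ((E.part_le_double _).trans inf_le_right)

omit E hcop hd in
/-- Transport of the submodules by an operator which commutes with `T` and `U`, or only preserves
the part of the double component. -/
theorem map_space {A : V →ₗ[k] V} (hA : ∀ f ∈ P, A f ∈ P) (hT : ∀ f, A (T f) = T (A f))
    {q : Finset (Fin ν) × (Fin 3 ⊕ k)} (hq : ∀ f ∈ part T U P q.2, A f ∈ part T U P q.2) {f : V}
    (hf : f ∈ space T U P μ q) : A f ∈ space T U P μ q := by
  have h1 : space T U P μ q ≤ (space T U P μ q).comap A := by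
    refine sup_le (iSup₂_le fun j hj g hg => ?_) fun g hg => ?_
    · have h2 : A g ∈ kerIn T P (μ j) := by
        refine ⟨?_, hA g hg.2⟩
        change aeval T (μ j) (A g) = 0
        rw [← aeval_apply_comm hT, (mem_kerIn.1 hg).1, map_zero]
      exact (le_biSup (fun j => kerIn T P (μ j)) hj).trans le_sup_left h2
    · exact Submodule.mem_sup_right (hq g hg)
  exact h1 hf

-- Commuting with U up to the sign ε multiplies slopes by ε. For ε = 1 every part is kept; for any
-- other ε it is enough that the slope be 0, or that the part be zero, the line spanned by U, or the
-- whole.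
omit E hcop hd in
theorem map_part {A : V →ₗ[k] V} (hA : ∀ f ∈ P, A f ∈ P) (hT : ∀ f, A (T f) = T (A f)) {ε : k}
    (hU : ∀ f ∈ P, U (A f) = ε • A (U f)) (hε : ε * ε = 1) {τ : Fin 3 ⊕ k}
    (hτ : ε = 1 ∨ ∀ t, τ = .inr t → t = 0) {f : V} (hf : f ∈ part T U P τ) :
    A f ∈ part T U P τ := by
  rcases τ with i | t
  · fin_cases i
    · have h0 : f = 0 := hf
      rw [h0, map_zero]
      exact zero_mem _
    · have h1 := map_line hA hT hU hε (a := 0) (b := 1) hf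
      have hε0 : ε ≠ 0 := fun h0 => by rw [h0, zero_mul] at hε; exact zero_ne_one hε
      have h2 := line_eq_smul (T := T) (U := U) (P := P) (a := 0) (b := 1) hε0
      rw [mul_zero] at h2
      rw [h2] at h1
      exact h1
    · exact map_double hA hT hf
  · have h1 := map_line hA hT hU hε (a := 1) (b := t) hf
    have h2 : ε * t = t := by
      rcases hτ with h | h
      · rw [h, one_mul]
      · rw [h t rfl, mul_zero]
    rwa [h2] at h1

omit hcop in
/-- An operator which anticommutes with `U` does not preserve the other parts. -/
theorem eq_zero_of_map_space {A : V →ₗ[k] V} (hA : ∀ f ∈ P, A f ∈ P) (hinj : Function.Injective A)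
    (hT : ∀ f, A (T f) = T (A f)) (hU : ∀ f ∈ P, U (A f) = -A (U f)) (hX : kerIn T P X ≠ ⊥)
    {S : Finset (Fin ν)} {t : k}
    (h : ∀ f ∈ space T U P μ (S, .inr t), A f ∈ space T U P μ (S, .inr t)) : t = 0 := by
  obtain ⟨g, hg, hg0⟩ := (Submodule.ne_bot_iff _).1 hX
  rw [mem_kerIn_X] at hg
  have h1 : (1 : k) • g + t • U g ∈ part T U P (.inr t) :=
    (E.mem_part_inr hg hg0).2 (mul_one t).symm
  have h2 := h _ (Submodule.mem_sup_right h1)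
  have hAg : T (A g) = 0 ∧ A g ∈ P := ⟨by rw [← hT, hg.1, map_zero], hA g hg.2⟩
  have hAg0 : A g ≠ 0 := fun h0 => hg0 (hinj (by rw [h0, map_zero]))
  -- The slope changes from t to -t; as the part is preserved, 2 t = 0.
  have h3 : A ((1 : k) • g + t • U g) = (1 : k) • A g + (-t) • U (A g) := by
    rw [map_add, map_smul, map_smul, hU g hg.2]
    module
  have h4 : A ((1 : k) • g + t • U g) ∈ part T U P (.inr t) := by
    rw [← E.space_inf_double hd (S, .inr t)]
    exact ⟨h2, map_double hA hT (E.part_le_double _ h1)⟩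
  rw [h3, E.mem_part_inr hAg hAg0, mul_one] at h4
  have h5 : 2 * t = 0 := by linear_combination -h4
  exact (mul_eq_zero.1 h5).resolve_left E.two_ne

end Exchange

end

end OMap

end

section

open Polynomial

namespace OMap

noncomputable section

variable {M : OMap}

/-! ### Coverings with a double component -/

theorem _root_.ElemAbCover.IsClassification.comp_equiv {p : ℕ} {ι κ : Type}
    {L : ι → ElemAbCover M p} (h : IsClassification L) (e : κ ≃ ι) :
    IsClassification fun i => L (e i) :=
  ⟨fun i => h.1 (e i), fun i j hij => e.injective (h.2.1 _ _ hij), fun C hC => by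
    obtain ⟨i, hi⟩ := h.2.2 C hC
    exact ⟨e.symm i, by simpa using hi⟩⟩

theorem hasCoverings_of_classification {p k r : ℕ} {ι : Type} [Finite ι] {L : ι → ElemAbCover M p}
    (h : IsClassification L) (hk : Nat.card ι = k)
    (hr : Nat.card {i // (L i).N.Chiral} = r) :
    HasCoverings M p k (k - r) r (Set.range fun i => (L i).c) := by
  let e : Fin k ≃ ι := (Finite.equivFinOfCardEq hk).symm
  have h1 : ∀ P : ι → Prop, Nat.card {i // P (e i)} = Nat.card {i // P i} := fun P =>
    Nat.card_congr (e.subtypeEquiv fun _ => Iff.rfl)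
  refine ⟨fun i => L (e i), h.comp_equiv e, ?_, (h1 fun i => (L i).N.Chiral).trans hr,
    e.surjective.range_comp fun i => (L i).c⟩
  rw [h1 fun i => (L i).N.Regular, ← hk, ← hr]
  have : Fintype ι := Fintype.ofFinite ι
  classical
  have h2 := Fintype.card_subtype_compl fun i => (L i).N.Regular
  have h3 := Fintype.card_subtype_le fun i => (L i).N.Regular
  simp only [Nat.card_eq_fintype_card, Chiral]
  omega

theorem card_subtype_ne {α : Type} [Fintype α] [DecidableEq α] (a : α) :
    Fintype.card {x // x ≠ a} = Fintype.card α - 1 := by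
  rw [Fintype.card_subtype_compl, Fintype.card_subtype_eq]

/-- The indices of the non-zero submodules. -/
abbrev ExchangeIndex (k : Type) [Field k] (ν : ℕ) : Type :=
  {q : Finset (Fin ν) × (Fin 3 ⊕ k) // q ≠ (∅, .inl 0)}

/-- The factor p + 3 counts zero, the whole double component and its p + 1 lines; the zero submodule
is removed. -/
theorem card_exchangeIndex (p ν : ℕ) [Fact p.Prime] :
    Nat.card (ExchangeIndex (ZMod p) ν) = 2 ^ ν * (p + 3) - 1 := by
  classical
  rw [Nat.card_eq_fintype_card, card_subtype_ne]
  simp [ZMod.card, add_comm]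

theorem card_exchangeIndex_inr (p ν : ℕ) [Fact p.Prime] :
    Nat.card {q : ExchangeIndex (ZMod p) ν // ¬ ∀ t, q.1.2 = .inr t → t = 0} =
      2 ^ ν * (p - 1) := by
  classical
  let e : Finset (Fin ν) × {t : ZMod p // t ≠ 0} ≃
      {q : ExchangeIndex (ZMod p) ν // ¬ ∀ t, q.1.2 = .inr t → t = 0} :=
    Equiv.ofBijective (fun x => ⟨⟨(x.1, .inr x.2.1), by simp⟩, fun h => x.2.2 (h _ rfl)⟩)
      ⟨fun x y h => by
        simp only [Subtype.mk.injEq, Prod.mk.injEq, Sum.inr.injEq] at h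
        exact Prod.ext h.1 (Subtype.ext h.2),
      fun ⟨⟨⟨S, τ⟩, h1⟩, h2⟩ => by
        push Not at h2
        obtain ⟨t, ht, ht0⟩ := h2
        dsimp only at ht
        subst ht
        exact ⟨(S, ⟨t, ht0⟩), rfl⟩⟩
  rw [← Nat.card_congr e, Nat.card_prod, Nat.card_eq_fintype_card, Nat.card_eq_fintype_card,
    card_subtype_ne]
  simp [ZMod.card]

-- Automorphisms commute with T and U and so preserve every listed subspace. A reflection commutes
-- with T but changes the sign of U, so precisely the subspaces with a finite non-zero slope are
-- moved, and these are the chiral coverings.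
open Exchange in
theorem IsPlatonicCoprime.hasCoverings_of_exchange {p n m ν : ℕ} [Fact p.Prime]
    (H : IsPlatonicCoprime p M n m) {U : (M.D → ZMod p) →ₗ[ZMod p] (M.D → ZMod p)} {κ : ZMod p}
    (E : Exchange (hecke (ZMod p) n M.y) U (faceSpace (ZMod p) M) κ)
    {μ : Fin ν → (ZMod p)[X]} (hirr : ∀ j, Irreducible (μ j))
    (hcop : Pairwise fun i j => IsCoprime (μ i) (μ j))
    (hd : ∀ j, IsCoprime (μ j) (X ^ 2 + C 2 * X))
    (hkill : ∀ f ∈ faceSpace (ZMod p) M,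
      aeval (hecke (ZMod p) n M.y) ((∏ j, μ j) * (X ^ 2 + C 2 * X)) f = 0)
    (hcomm : ∀ w, ∃ (q : (ZMod p)[X]) (a b : ZMod p), ∀ f ∈ faceSpace (ZMod p) M,
      hecke (ZMod p) n (M.mon w) f =
        aeval (hecke (ZMod p) n M.y) q f + a • U f + b • hecke (ZMod p) n M.y (U f))
    (haut : ∀ a ∈ M.aut, ∀ f : M.D → ZMod p, U (fun d => f (a d)) = fun d => U f (a d))
    (s : Reflection M)
    (hrefl : ∀ f ∈ faceSpace (ZMod p) M, U (fun d => f (s.r d)) = -fun d => U f (s.r d))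
    {δ : Fin ν → ℕ} {ε : ℕ}
    (hδ : ∀ j, Module.finrank (ZMod p)
      (kerIn (hecke (ZMod p) n M.y) (faceSpace (ZMod p) M) (μ j)) = δ j) (hδ0 : ∀ j, δ j ≠ 0)
    (hε : Module.finrank (ZMod p)
      (kerIn (hecke (ZMod p) n M.y) (faceSpace (ZMod p) M) X) = ε) (hε0 : ε ≠ 0) :
    HasCoverings M p (2 ^ ν * (p + 3) - 1) (2 ^ ν * 4 - 1) (2 ^ ν * (p - 1))
      {c | ∃ (S : Finset (Fin ν)) (i : Fin 3), (S, i) ≠ (∅, 0) ∧ ∑ j ∈ S, δ j + i * ε = c} := by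
  classical
  set P := faceSpace (ZMod p) M
  set T := hecke (ZMod p) n M.y
  have hne : ∀ j, kerIn T P (μ j) ≠ ⊥ := fun j h0 => hδ0 j (by rw [← hδ j, h0, finrank_bot])
  have hX : kerIn T P X ≠ ⊥ := fun h0 => hε0 (by rw [← hε, h0, finrank_bot])
  have hinj := E.space_injective hcop hd hne hX
  have hbot : space T U P μ (∅, .inl 0) = ⊥ := by
    rw [space]
    simp [part]
  obtain ⟨L, hL, hsp, hc⟩ := H.exists_classification
    (fun q : ExchangeIndex (ZMod p) ν => space T U P μ q.1) (fun q => space_le E q.1)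
    (fun q a ha f hf => map_space (A := LinearMap.funLeft (ZMod p) (ZMod p) a)
      (faceSpace_comp_aut a ha) (fun f => (hecke_y_comp_aut n ha f).symm)
      (fun f hf => map_part (ε := 1) (faceSpace_comp_aut a ha)
        (fun f => (hecke_y_comp_aut n ha f).symm)
        (fun f _ => by rw [one_smul]; exact haut a ha f) (one_mul 1) (Or.inl rfl) hf) hf)
    (fun q h0 => q.2 (hinj (h0.trans hbot.symm)))
    (fun q q' h => Subtype.ext (hinj h))
    (fun V hV hI hV0 => by
      obtain ⟨β, w, h1, h2⟩ := exists_projection H.regular H.n_ne H.card_ne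
        (hV.trans inf_le_left) hI
      -- Every Hecke operator is a polynomial in T plus a combination of U and T U, so Maschke's
      -- projection also has this form.
      choose q a b hq using fun e => hcomm (w e)
      have hB : ∀ f ∈ P, aeval T (∑ e, C (β e) * q e) f + (∑ e, β e * a e) • U f +
          (∑ e, β e * b e) • T (U f) = ∑ e, β e • hecke (ZMod p) n (M.mon (w e)) f := by
        intro f hf
        rw [map_sum, LinearMap.sum_apply, Finset.sum_smul, Finset.sum_smul,
          ← Finset.sum_add_distrib, ← Finset.sum_add_distrib]
        refine Finset.sum_congr rfl fun e _ => ?_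
        rw [hq e f hf, map_mul, aeval_C, Module.End.mul_apply, Module.algebraMap_end_apply]
        module
      obtain ⟨σ, hσ⟩ := E.exists_eq_space hcop hd hirr hkill hV (q := ∑ e, C (β e) * q e)
        (a := ∑ e, β e * a e) (b := ∑ e, β e * b e)
        (fun f hf => by rw [hB f hf]; exact h1 f)
        (fun f hf => by rw [hB f (hV hf)]; exact h2 f hf)
      exact ⟨⟨σ, fun h0 => hV0 (by rw [hσ, h0, hbot])⟩, hσ⟩)
  have hreg : ∀ q, (L q).N.Regular ↔ ∀ t, q.1.2 = .inr t → t = 0 := by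
    intro q
    have hT : ∀ f, LinearMap.funLeft (ZMod p) (ZMod p) s.r (T f) =
        T (LinearMap.funLeft (ZMod p) (ZMod p) s.r f) := fun f =>
      (hecke_comp_reflection H.type.z_pow s s.map_y f).symm
    rw [H.regular_iff s, hsp]
    constructor
    · intro h t ht
      obtain ⟨⟨S, τ⟩, h0⟩ := q
      dsimp only at ht
      subst ht
      exact E.eq_zero_of_map_space hd (A := LinearMap.funLeft (ZMod p) (ZMod p) s.r)
        (fun f => faceSpace_comp_reflection s)
        (LinearMap.funLeft_injective_of_surjective _ _ _ s.r.surjective) hT hrefl hX h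
    · exact fun h f hf => map_space (A := LinearMap.funLeft (ZMod p) (ZMod p) s.r)
        (fun f => faceSpace_comp_reflection s) hT
        (fun f hf => map_part (ε := -1) (fun f => faceSpace_comp_reflection s) hT
          (fun f hf => by rw [neg_one_smul]; exact hrefl f hf) (by ring) (Or.inr h) hf) hf
  have key := hasCoverings_of_classification hL (card_exchangeIndex p ν)
    (r := 2 ^ ν * (p - 1)) (by
      rw [← card_exchangeIndex_inr]
      exact Nat.card_congr (Equiv.subtypeEquivRight fun q => (hreg q).not))
  have h1 : 2 ^ ν * (p + 3) - 1 - 2 ^ ν * (p - 1) = 2 ^ ν * 4 - 1 := by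
    obtain ⟨r, rfl⟩ : ∃ r, p = r + 1 := ⟨p - 1, by have := (Fact.out : p.Prime).pos; omega⟩
    rw [Nat.add_sub_cancel, show r + 1 + 3 = r + 4 from rfl, mul_add]
    omega
  have h2 : (Set.range fun q => (L q).c) =
      {c | ∃ (S : Finset (Fin ν)) (i : Fin 3), (S, i) ≠ (∅, 0) ∧ ∑ j ∈ S, δ j + i * ε = c} := by
    have hc' : ∀ q, (L q).c = ∑ j ∈ q.1.1, δ j + mult q.1.2 * ε := fun q => by
      rw [hc, E.finrank_space hd hcop, hε, Finset.sum_congr rfl fun j _ => hδ j]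
    ext c
    constructor
    · rintro ⟨⟨⟨S, i | t⟩, h0⟩, rfl⟩
      · exact ⟨S, i, fun h => h0 (by rw [Prod.mk.injEq] at h; rw [h.1, h.2]), (hc' ⟨(S, .inl i), h0⟩).symm⟩
      · exact ⟨S, 1, by simp, (hc' ⟨(S, .inr t), h0⟩).symm⟩
    · rintro ⟨S, i, h0, rfl⟩
      exact ⟨⟨(S, .inl i), fun h => h0 (by
        rw [Prod.mk.injEq, Sum.inl.injEq] at h; rw [h.1, h.2])⟩, hc' _⟩
  rw [h1, h2] at key
  exact key

end

end OMap

end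

section

open Polynomial

namespace OMap

noncomputable section

variable {M : OMap} {p : ℕ} [Fact p.Prime]

/-! ### The icosahedron -/

namespace IcosahedronLabelling

variable (H : IsPlatonicCoprime p M 3 5) (L : icosahedronTable.Labelling M)

local notation "𝕂" => ZMod p
local notation "P" => faceSpace (ZMod p) M
local notation "T" => hecke (ZMod p) 3 M.y
local notation "A" => FaceTable.Labelling.op L (ZMod p)

theorem op_one : A 1 = T := L.op_of_word_eq rfl

include H

/-- The 20 faces fall into eight orbits of sizes 1, 3, 3, 3, 3, 3, 3, 1 under the rotations of one
face. Reflections interchange the classes 2 and 3, and also 4 and 5; this motivates the symmetric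
and antisymmetric combinations below. -/
theorem op_op {i j : Fin 8} (v : Fin 3 → Fin 8)
    (hv : ∀ t : Fin 3, icosahedronTable.cls (icosahedronTable.act (icosahedronTable.word j)
      (icosahedronTable.z^[t] (icosahedronTable.rep i))) = v t) {f : M.D → 𝕂} (hf : f ∈ P) :
    A i (A j f) = A (v 0) f + A (v 1) f + A (v 2) f := by
  rw [L.op_op_eq icosahedronTable_isValid H.regular H.type.z_pow v hv hf.1, Fin.sum_univ_three]

omit H in
theorem op_zero {f : M.D → 𝕂} (hf : f ∈ P) : A 0 f = (3 : 𝕂) • f := by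
  simpa using L.op_zero icosahedronTable_isValid hf.1

theorem T_mem {f : M.D → 𝕂} (hf : f ∈ P) : T f ∈ P := hecke_mem_faceSpace H.type.z_pow _ hf

theorem T_T {f : M.D → 𝕂} (hf : f ∈ P) : T (T f) = A 0 f + A 2 f + A 3 f := by
  rw [← op_one L]; exact op_op H L (i := 1) (j := 1) ![0, 2, 3] (by decide +kernel) hf

theorem op_two_T {f : M.D → 𝕂} (hf : f ∈ P) : A 2 (T f) = T f + A 3 f + A 5 f := by
  rw [← op_one L]; exact op_op H L (i := 2) (j := 1) ![1, 3, 5] (by decide +kernel) hf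

theorem op_three_T {f : M.D → 𝕂} (hf : f ∈ P) : A 3 (T f) = T f + A 4 f + A 2 f := by
  rw [← op_one L]; exact op_op H L (i := 3) (j := 1) ![1, 4, 2] (by decide +kernel) hf

theorem op_four_T {f : M.D → 𝕂} (hf : f ∈ P) : A 4 (T f) = A 3 f + A 5 f + A 6 f := by
  rw [← op_one L]; exact op_op H L (i := 4) (j := 1) ![3, 5, 6] (by decide +kernel) hf

theorem op_five_T {f : M.D → 𝕂} (hf : f ∈ P) : A 5 (T f) = A 2 f + A 6 f + A 4 f := by
  rw [← op_one L]; exact op_op H L (i := 5) (j := 1) ![2, 6, 4] (by decide +kernel) hf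

theorem op_six_T {f : M.D → 𝕂} (hf : f ∈ P) : A 6 (T f) = A 5 f + A 4 f + A 7 f := by
  rw [← op_one L]; exact op_op H L (i := 6) (j := 1) ![5, 4, 7] (by decide +kernel) hf

theorem T_op_two {f : M.D → 𝕂} (hf : f ∈ P) : T (A 2 f) = T f + A 3 f + A 4 f := by
  rw [← op_one L]; exact op_op H L (i := 1) (j := 2) ![1, 3, 4] (by decide +kernel) hf

theorem T_op_three {f : M.D → 𝕂} (hf : f ∈ P) : T (A 3 f) = T f + A 5 f + A 2 f := by
  rw [← op_one L]; exact op_op H L (i := 1) (j := 3) ![1, 5, 2] (by decide +kernel) hf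

theorem op_two_op_two {f : M.D → 𝕂} (hf : f ∈ P) : A 2 (A 2 f) = A 3 f + T f + A 6 f := by
  rw [← op_one L]; exact op_op H L (i := 2) (j := 2) ![3, 1, 6] (by decide +kernel) hf

theorem op_two_op_three {f : M.D → 𝕂} (hf : f ∈ P) : A 2 (A 3 f) = A 0 f + A 4 f + A 4 f :=
  op_op H L (i := 2) (j := 3) ![0, 4, 4] (by decide +kernel) hf

theorem op_three_op_two {f : M.D → 𝕂} (hf : f ∈ P) : A 3 (A 2 f) = A 0 f + A 5 f + A 5 f :=
  op_op H L (i := 3) (j := 2) ![0, 5, 5] (by decide +kernel) hf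

theorem op_three_op_three {f : M.D → 𝕂} (hf : f ∈ P) : A 3 (A 3 f) = A 2 f + A 6 f + T f := by
  rw [← op_one L]; exact op_op H L (i := 3) (j := 3) ![2, 6, 1] (by decide +kernel) hf

theorem sum_op {f : M.D → 𝕂} (hf : f ∈ P) : A 0 f + (3 : 𝕂) • T f + (3 : 𝕂) • A 2 f +
    (3 : 𝕂) • A 3 f + (3 : 𝕂) • A 4 f + (3 : 𝕂) • A 5 f + (3 : 𝕂) • A 6 f + A 7 f = 0 := by
  have := L.sum_smul_op_eq_zero icosahedronTable_isValid H.regular H.type.z_pow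
    ![1, 3, 3, 3, 3, 3, 3, 1] (by decide +kernel) H.n_ne hf
  rw [Fin.sum_univ_eight, op_one L] at this
  simpa using this

/-! Symmetric combinations of the operators, as polynomials in the adjacency operator. -/

theorem op_two_add_op_three {f : M.D → 𝕂} (hf : f ∈ P) :
    A 2 f + A 3 f = T (T f) - (3 : 𝕂) • f := by
  linear_combination (norm := module) -T_T H L hf - op_zero L hf

theorem op_four_add_op_five {f : M.D → 𝕂} (hf : f ∈ P) :
    A 4 f + A 5 f = T (T (T f)) - T (T f) - (5 : 𝕂) • T f + (3 : 𝕂) • f := by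
  linear_combination (norm := module) op_two_add_op_three H L (T_mem H hf) - op_two_T H L hf -
    op_three_T H L hf - op_two_add_op_three H L hf

theorem two_smul_op_six {f : M.D → 𝕂} (hf : f ∈ P) : (2 : 𝕂) • A 6 f =
    T (T (T (T f))) - (2 : 𝕂) • T (T (T f)) - (5 : 𝕂) • T (T f) + (8 : 𝕂) • T f := by
  linear_combination (norm := module) op_four_add_op_five H L (T_mem H hf) - op_four_T H L hf -
    op_five_T H L hf - op_two_add_op_three H L hf - op_four_add_op_five H L hf

theorem two_smul_op_seven {f : M.D → 𝕂} (hf : f ∈ P) : (2 : 𝕂) • A 7 f =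
    T (T (T (T (T f)))) - (2 : 𝕂) • T (T (T (T f))) - (7 : 𝕂) • T (T (T f)) +
      (10 : 𝕂) • T (T f) + (10 : 𝕂) • T f - (6 : 𝕂) • f := by
  linear_combination (norm := module) two_smul_op_six H L (T_mem H hf) -
    (2 : 𝕂) • op_six_T H L hf - (2 : 𝕂) • op_four_add_op_five H L hf

-- The vanishing total, written in powers of T, is the quintic T (T - 1)(T + 2)(T² - 5).
include L in
theorem kill {f : M.D → 𝕂} (hf : f ∈ P) : T (T (T (T (T f)))) + T (T (T (T f))) -
    (7 : 𝕂) • T (T (T f)) - (5 : 𝕂) • T (T f) + (10 : 𝕂) • T f = 0 := by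
  linear_combination (norm := module) (2 : 𝕂) • sum_op H L hf - (2 : 𝕂) • op_zero L hf -
    (6 : 𝕂) • op_two_add_op_three H L hf - (6 : 𝕂) • op_four_add_op_five H L hf -
    (3 : 𝕂) • two_smul_op_six H L hf - two_smul_op_seven H L hf

/-! Antisymmetric combinations. -/

/-- The operator is antisymmetric under reflection. Multiplication by T on either side gives, up to
sign, its class and that of A 4 - A 5, whence the anticommutation relation. -/
theorem exchange : Exchange T (A 2 - A 3) P (-15) := by
  have hU : ∀ f ∈ P, (A 2 - A 3) (T f) = -(A 2 f - A 3 f) - (A 4 f - A 5 f) := fun f hf => by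
    rw [LinearMap.sub_apply]
    linear_combination (norm := module) op_two_T H L hf - op_three_T H L hf
  have hTU : ∀ f ∈ P, T ((A 2 - A 3) f) = -(A 2 f - A 3 f) + (A 4 f - A 5 f) := fun f hf => by
    rw [LinearMap.sub_apply, map_sub]
    linear_combination (norm := module) T_op_two H L hf - T_op_three H L hf
  refine ⟨H.two_ne, ?_, fun f hf => T_mem H hf, fun f hf => ?_, fun f hf => ?_, fun f hf => ?_,
    fun f hf h => ?_⟩
  · have h3 : (3 : 𝕂) ≠ 0 := H.n_ne
    have h5 : (5 : 𝕂) ≠ 0 := H.m_ne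
    intro h0
    exact mul_ne_zero h3 h5 (by linear_combination -h0)
  · exact sub_mem (L.op_mem H.type.z_pow 2 hf) (L.op_mem H.type.z_pow 3 hf)
  · rw [hU f hf, hTU f hf, LinearMap.sub_apply]
    module
  · have h1 := hTU (T f) (T_mem H hf)
    rw [hU f hf] at h1
    have h2 := congrArg T (hTU f hf)
    simp only [LinearMap.sub_apply, map_add, map_sub, map_neg] at h1 h2 ⊢
    linear_combination (norm := module) h2 - h1 + op_two_T H L hf - op_three_T H L hf -
      op_four_T H L hf + op_five_T H L hf
  -- The square of A 2 - A 3 is symmetric, hence the polynomial T⁴ - 4T³ - 2T² + 20T - 15; where T²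
  -- = -2T it reduces to -15.
  · have h1 := congrArg T h
    have h2 := congrArg T h1
    rw [map_smul] at h1 h2
    rw [map_smul] at h2
    simp only [LinearMap.sub_apply, map_sub]
    linear_combination (norm := module) op_two_op_two H L hf - op_two_op_three H L hf -
      op_three_op_two H L hf + op_three_op_three H L hf - (2 : 𝕂) • op_zero L hf +
      op_two_add_op_three H L hf - (2 : 𝕂) • op_four_add_op_five H L hf + two_smul_op_six H L hf +
      h2 - (6 : 𝕂) • h1 + (10 : 𝕂) • h

/-- Each operator is half the sum of its symmetric part, a polynomial in T, and its antisymmetric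
part, a combination of U and T U. -/
theorem exists_polynomial (w : FreeGroup Bool) : ∃ (q : 𝕂[X]) (a b : 𝕂), ∀ f ∈ P,
    hecke 𝕂 3 (M.mon w) f = aeval T q f + a • (A 2 - A 3) f + b • T ((A 2 - A 3) f) := by
  obtain ⟨u, hu⟩ : ∃ u : 𝕂, 2 * u = 1 := ⟨_, mul_inv_cancel₀ H.two_ne⟩
  have hTU : ∀ f ∈ P, T (A 2 f) - T (A 3 f) = -(A 2 f - A 3 f) + (A 4 f - A 5 f) := fun f hf => by
    linear_combination (norm := module) T_op_two H L hf - T_op_three H L hf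
  obtain ⟨j, hj⟩ := L.exists_hecke_eq_op (k := 𝕂) icosahedronTable_isValid H.regular
    H.type.z_pow w
  suffices h : ∃ (q : 𝕂[X]) (a b : 𝕂), ∀ f ∈ P,
      A j f = aeval T q f + a • (A 2 f - A 3 f) + b • (T (A 2 f) - T (A 3 f)) by
    obtain ⟨q, a, b, h⟩ := h
    exact ⟨q, a, b, fun f hf => by rw [hj f hf.1, h f hf, LinearMap.sub_apply, map_sub]⟩
  clear hj
  fin_cases j
  · refine ⟨C 3, 0, 0, fun f hf => ?_⟩
    simp only [aeval_C, Module.algebraMap_end_apply]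
    change A 0 f = _
    linear_combination (norm := module) op_zero L hf
  · refine ⟨X, 0, 0, fun f hf => ?_⟩
    rw [aeval_X]
    change A 1 f = _
    rw [op_one L]
    module
  · refine ⟨C u * (X * X - C 3), u, 0, fun f hf => ?_⟩
    simp only [map_mul, map_sub, aeval_X, aeval_C, Module.End.mul_apply, LinearMap.sub_apply,
        Module.algebraMap_end_apply]
    change A 2 f = _
    linear_combination (norm := module) u • op_two_add_op_three H L hf - hu • A 2 f
  · refine ⟨C u * (X * X - C 3), -u, 0, fun f hf => ?_⟩
    simp only [map_mul, map_sub, aeval_X, aeval_C, Module.End.mul_apply, LinearMap.sub_apply,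
        Module.algebraMap_end_apply]
    change A 3 f = _
    linear_combination (norm := module) u • op_two_add_op_three H L hf - hu • A 3 f
  · refine ⟨C u * (X * (X * X) - X * X - C 5 * X + C 3), u, u, fun f hf => ?_⟩
    simp only [map_mul, map_sub, map_add, aeval_X, aeval_C, Module.End.mul_apply,
      LinearMap.sub_apply, LinearMap.add_apply, Module.algebraMap_end_apply]
    change A 4 f = _
    linear_combination (norm := module) u • op_four_add_op_five H L hf - u • hTU f hf - hu • A 4 f
  · refine ⟨C u * (X * (X * X) - X * X - C 5 * X + C 3), -u, -u, fun f hf => ?_⟩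
    simp only [map_mul, map_sub, map_add, aeval_X, aeval_C, Module.End.mul_apply,
      LinearMap.sub_apply, LinearMap.add_apply, Module.algebraMap_end_apply]
    change A 5 f = _
    linear_combination (norm := module) u • op_four_add_op_five H L hf + u • hTU f hf - hu • A 5 f
  · refine ⟨C u * (X * (X * (X * X)) - C 2 * (X * (X * X)) - C 5 * (X * X) + C 8 * X), 0, 0,
      fun f hf => ?_⟩
    simp only [map_mul, map_sub, map_add, aeval_X, aeval_C, Module.End.mul_apply,
      LinearMap.sub_apply, LinearMap.add_apply, Module.algebraMap_end_apply]
    change A 6 f = _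
    linear_combination (norm := module) u • two_smul_op_six H L hf - hu • A 6 f
  · refine ⟨C u * (X * (X * (X * (X * X))) - C 2 * (X * (X * (X * X))) - C 7 * (X * (X * X)) +
      C 10 * (X * X) + C 10 * X - C 6), 0, 0, fun f hf => ?_⟩
    simp only [map_mul, map_sub, map_add, aeval_X, aeval_C, Module.End.mul_apply,
      LinearMap.sub_apply, LinearMap.add_apply, Module.algebraMap_end_apply]
    change A 7 f = _
    linear_combination (norm := module) u • two_smul_op_seven H L hf - hu • A 7 f

omit H in
theorem sub_comp_aut {a : Equiv.Perm M.D} (ha : a ∈ M.aut) (f : M.D → 𝕂) :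
    (A 2 - A 3) (fun d => f (a d)) = fun d => (A 2 - A 3) f (a d) := by
  rw [LinearMap.sub_apply, LinearMap.sub_apply]
  exact congrArg₂ (· - ·) (hecke_comp_aut 3 ha _ f) (hecke_comp_aut 3 ha _ f)

/-- A reflection inverts z and commutes with y, so it interchanges y z y and y z² y, the words of
the classes 2 and 3. -/
theorem sub_comp_reflection (s : Reflection M) (f : M.D → 𝕂) :
    (A 2 - A 3) (fun d => f (s.r d)) = -fun d => (A 2 - A 3) f (s.r d) := by
  have hz := H.type.z_pow
  have hi : M.z⁻¹ = M.z ^ 2 := inv_eq_of_mul_eq_one_right (by rw [← pow_succ', hz])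
  have hi' : M.z⁻¹ ^ 2 = M.z := by rw [inv_pow, ← hi, inv_inv]
  have g2 : M.mon (wordElt (icosahedronTable.word 2)) = M.y * M.z * M.y := by
    simp [icosahedronTable, wordElt, ← y_mul_z, mul_assoc]
  have g3 : M.mon (wordElt (icosahedronTable.word 3)) = M.y * M.z ^ 2 * M.y := by
    simp [icosahedronTable, wordElt, ← y_mul_z, mul_assoc, pow_two]
  have h2 : A 2 (fun d => f (s.r d)) = fun d => A 3 f (s.r d) := by
    refine hecke_comp_reflection hz s (fun d => ?_) f
    rw [g2, g3, ← hi]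
    simp only [Equiv.Perm.mul_apply, s.map_y, s.map_z]
  have h3 : A 3 (fun d => f (s.r d)) = fun d => A 2 f (s.r d) := by
    refine hecke_comp_reflection hz s (fun d => ?_) f
    rw [g2, g3]
    simp only [Equiv.Perm.mul_apply, s.map_y, s.map_z_pow, hi']
  rw [LinearMap.sub_apply, LinearMap.sub_apply, h2, h3]
  funext d
  simp

/-! Dimensions. -/

omit H in
theorem aeval_quartic {V : Type} [AddCommGroup V] [Module 𝕂 V] (S : V →ₗ[𝕂] V) (a b c d : 𝕂)
    (f : V) : aeval S (X * (X * (X * X)) + C a * (X * (X * X)) + C b * (X * X) + C c * X + C d) f =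
      S (S (S (S f))) + a • S (S (S f)) + b • S (S f) + c • S f + d • f := by
  simp only [map_mul, map_add, aeval_X, aeval_C, Module.End.mul_apply, LinearMap.add_apply,
    Module.algebraMap_end_apply]

-- The quartic with coefficients a, b, c, d is the quotient of the annihilating quintic by X - l,
-- and the first five hypotheses are its synthetic division. The last one is the trace formula,
-- multiplied by the value of the quartic at l.
include L in
theorem finrank_kerIn {l a b c d : 𝕂} (ha : a - l = 1) (hb : b - l * a = -7) (hc : c - l * b = -5)
    (hd : d - l * c = 10) (hl : l * d = 0) {e : ℕ}
    (hne : l * (l * (l * l)) + a * (l * (l * l)) + b * (l * l) + c * l + d ≠ 0)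
    (he : 219 - 27 * a + 51 * b - 3 * c + 19 * d =
      (l * (l * (l * l)) + a * (l * (l * l)) + b * (l * l) + c * l + d) * e) :
    (Module.finrank 𝕂 (kerIn T P (X - C l)) : 𝕂) = e := by
  have hN : Nat.card M.D = 60 := H.type.card_eq_of H.genus_eq (by norm_num)
  obtain ⟨v, hv⟩ : ∃ v : 𝕂, 3 * v = 1 := ⟨_, mul_inv_cancel₀ H.n_ne⟩
  obtain ⟨γ, hγ⟩ : ∃ γ, γ * (l * (l * (l * l)) + a * (l * (l * l)) + b * (l * l) + c * l + d) = 1 :=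
    ⟨_, inv_mul_cancel₀ hne⟩
  refine (L.finrank_eigenspace icosahedronTable_isValid H.regular H.type H.card_ne γ
    (X * (X * (X * X)) + C a * (X * (X * X)) + C b * (X * X) + C c * X + C d)
    ![γ * (d * v + b + 5), γ * (c + 5 * a + 2), γ * (b + a + 7), γ * (b + a + 7), γ * (a + 2),
      γ * (a + 2), γ * 2, 0] (fun f hf => ?_) (fun f hf => ?_) ?_).trans ?_
  · rw [Fin.sum_univ_eight, op_one L, aeval_quartic]
    change (γ * (d * v + b + 5)) • A 0 f + (γ * (c + 5 * a + 2)) • T f +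
      (γ * (b + a + 7)) • A 2 f + (γ * (b + a + 7)) • A 3 f + (γ * (a + 2)) • A 4 f +
      (γ * (a + 2)) • A 5 f + (γ * 2) • A 6 f + (0 : 𝕂) • A 7 f = _
    linear_combination (norm := module) (γ * (d * v + b + 5)) • op_zero L hf +
      (γ * (b + a + 7)) • op_two_add_op_three H L hf +
      (γ * (a + 2)) • op_four_add_op_five H L hf + γ • two_smul_op_six H L hf +
      ((γ * d) • hv) • f
  · rw [aeval_mul_apply, aeval_quartic, aeval_X_sub_C_apply]
    simp only [map_add, map_smul]
    linear_combination (norm := module) kill H L hf + ha • T (T (T (T f))) + hb • T (T (T f)) +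
      hc • T (T f) + hd • T f - hl • f
  · simp only [eval_add, eval_mul, eval_X, eval_C]
    exact hγ
  · rw [hN, Fin.sum_univ_eight]
    simp
    linear_combination γ * he + e * hγ + 19 * γ * d * hv

end IcosahedronLabelling

end

end OMap

end

/-! ### Coverings of the icosahedron, according as 5 is a square or not. -/

section

open Polynomial

namespace OMap

noncomputable section

variable {M : OMap} {p : ℕ} [Fact p.Prime]

namespace IcosahedronLabelling

variable (H : IsPlatonicCoprime p M 3 5) (L : icosahedronTable.Labelling M)

include H L

omit L in
theorem ten_ne : (10 : ZMod p) ≠ 0 := by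
  have h5 : (5 : ZMod p) ≠ 0 := H.m_ne
  exact fun h => mul_ne_zero H.two_ne h5 (by linear_combination h)

theorem finrank_one : (Module.finrank (ZMod p)
    (kerIn (hecke (ZMod p) 3 M.y) (faceSpace (ZMod p) M) (X - C 1)) : ZMod p) = (5 : ℕ) := by
  have h2 : (2 : ZMod p) ≠ 0 := H.two_ne
  have h3 : (3 : ZMod p) ≠ 0 := H.n_ne
  refine finrank_kerIn H L (a := 2) (b := -5) (c := -10) (d := 0) (by norm_num) (by norm_num)
    (by norm_num) (by norm_num) (by norm_num) (fun h => ?_) (by norm_num)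
  exact mul_ne_zero (mul_ne_zero h2 h2) h3 (by linear_combination -h)

theorem finrank_zero : (Module.finrank (ZMod p)
    (kerIn (hecke (ZMod p) 3 M.y) (faceSpace (ZMod p) M) (X - C 0)) : ZMod p) = (4 : ℕ) := by
  refine finrank_kerIn H L (a := 1) (b := -7) (c := -5) (d := 10) (by norm_num) (by norm_num)
    (by norm_num) (by norm_num) (by norm_num) (fun h => ?_) (by norm_num)
  exact ten_ne H (by linear_combination h)

theorem finrank_neg_two : (Module.finrank (ZMod p)
    (kerIn (hecke (ZMod p) 3 M.y) (faceSpace (ZMod p) M) (X - C (-2))) : ZMod p) = (4 : ℕ) := by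
  have h2 : (2 : ZMod p) ≠ 0 := H.two_ne
  have h3 : (3 : ZMod p) ≠ 0 := H.n_ne
  refine finrank_kerIn H L (a := -1) (b := -5) (c := 5) (d := 0) (by norm_num) (by norm_num)
    (by norm_num) (by norm_num) (by norm_num) (fun h => ?_) (by norm_num)
  exact mul_ne_zero h2 h3 (by linear_combination -h)

omit L in
theorem add_three_ne {s : ZMod p} (hs : s * s = 5) : s + 3 ≠ 0 := fun h =>
  mul_ne_zero H.two_ne H.two_ne (by linear_combination (3 - s) * h + hs)

theorem finrank_sqrt {s : ZMod p} (hs : s * s = 5) : (Module.finrank (ZMod p)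
    (kerIn (hecke (ZMod p) 3 M.y) (faceSpace (ZMod p) M) (X - C s)) : ZMod p) = (3 : ℕ) := by
  -- The value at s of the quotient of the quintic by X - s, reduced with s² = 5.
  have hq : s * (s * (s * s)) + (s + 1) * (s * (s * s)) + (s - 2) * (s * s) + -2 * s * s + 0 =
      10 * (s + 3) := by
    linear_combination (2 * s * s + 2 * s + 6) * hs
  refine finrank_kerIn H L (a := s + 1) (b := s - 2) (c := -2 * s) (d := 0)
    (by ring) (by linear_combination -hs) (by linear_combination -hs)
    (by linear_combination 2 * hs) (mul_zero s) ?_ ?_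
  · rw [hq]
    exact mul_ne_zero (ten_ne H) (add_three_ne H hs)
  · rw [hq]
    push_cast
    ring

theorem aeval_kill {f : M.D → ZMod p} (hf : f ∈ faceSpace (ZMod p) M) :
    aeval (hecke (ZMod p) 3 M.y) (X * (X - 1) * (X + 2) * (X ^ 2 - 5) : (ZMod p)[X]) f = 0 := by
  have h1 : (X * (X - 1) * (X + 2) * (X ^ 2 - 5) : (ZMod p)[X]) =
      X * (X * (X * (X * X)) + C 1 * (X * (X * X)) + C (-7) * (X * X) + C (-5) * X + C 10) := by
    simp only [map_neg, map_ofNat, map_one]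
    ring
  rw [h1, aeval_mul_apply, aeval_quartic, aeval_X]
  simp only [map_add, map_smul]
  linear_combination (norm := module) kill H L hf

/-- The factors μ belong to the simple components; the remaining factor X (X + 2) of the quintic
cuts out the double one. -/
theorem hasCoverings {ν : ℕ} {μ : Fin ν → (ZMod p)[X]} (hirr : ∀ j, Irreducible (μ j))
    (hcop : Pairwise fun i j => IsCoprime (μ i) (μ j))
    (hX : ∀ j, IsCoprime (μ j) (X - C 0)) (hX2 : ∀ j, IsCoprime (μ j) (X - C (-2)))
    (hμ : (∏ j, μ j) = (X - 1) * (X ^ 2 - 5)) {δ : Fin ν → ℕ}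
    (hδ : ∀ j, Module.finrank (ZMod p)
      (kerIn (hecke (ZMod p) 3 M.y) (faceSpace (ZMod p) M) (μ j)) = δ j) (hδ0 : ∀ j, δ j ≠ 0)
    (hε : Module.finrank (ZMod p)
      (kerIn (hecke (ZMod p) 3 M.y) (faceSpace (ZMod p) M) (X - C 0)) = 4) :
    HasCoverings M p (2 ^ ν * (p + 3) - 1) (2 ^ ν * 4 - 1) (2 ^ ν * (p - 1))
      {c | ∃ (S : Finset (Fin ν)) (i : Fin 3), (S, i) ≠ (∅, 0) ∧ ∑ j ∈ S, δ j + i * 4 = c} := by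
  have hX' : (X ^ 2 + C 2 * X : (ZMod p)[X]) = (X - C 0) * (X - C (-2)) := by
    rw [C_0, C_neg]
    ring
  obtain ⟨d⟩ := M.nonempty
  obtain ⟨s, -⟩ := exists_reflection H.type H.genus_eq d d
  refine H.hasCoverings_of_exchange (exchange H L) hirr hcop
    (fun j => hX' ▸ (hX j).mul_right (hX2 j)) (fun f hf => ?_) (exists_polynomial H L)
    (fun a ha f => sub_comp_aut L ha f) s (fun f _ => sub_comp_reflection H L s f) hδ hδ0
    (by rwa [C_0, sub_zero] at hε) (by norm_num)
  have h1 : ((∏ j, μ j) * (X ^ 2 + C 2 * X) : (ZMod p)[X]) =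
      X * (X - 1) * (X + 2) * (X ^ 2 - 5) := by
    rw [hμ, map_ofNat]
    ring
  rw [h1]
  exact aeval_kill H L hf

end IcosahedronLabelling

theorem injective_vec_five {k : Type} {a b c d e : k} (hab : a ≠ b) (hac : a ≠ c) (had : a ≠ d)
    (hae : a ≠ e) (hbc : b ≠ c) (hbd : b ≠ d) (hbe : b ≠ e) (hcd : c ≠ d) (hce : c ≠ e)
    (hde : d ≠ e) : Function.Injective ![a, b, c, d, e] := by
  intro i j hij
  fin_cases i <;> fin_cases j <;> first | rfl | exact absurd hij ‹_› | exact absurd hij.symm ‹_›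

open IcosahedronLabelling in
theorem IsPlatonicCoprime.icosahedron_split (H : IsPlatonicCoprime p M 3 5) {s : ZMod p}
    (hs : s * s = 5) :
    HasCoverings M p (8 * p + 23) 31 (8 * (p - 1)) (Set.Icc 3 16 ∪ {19}) := by
  have hN : Nat.card M.D = 60 := H.type.card_eq_of H.genus_eq (by norm_num)
  obtain ⟨L⟩ := FaceTable.exists_labelling icosahedronTable_isValid icosahedronTable_hasType
    H.type H.genus_eq hN
  have h2 : (2 : ZMod p) ≠ 0 := H.two_ne
  have h3 : (3 : ZMod p) ≠ 0 := H.n_ne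
  have h5 : (5 : ZMod p) ≠ 0 := H.m_ne
  have hp := seven_le_of_ne_zero h2 h3 h5
  have hs' : -s * -s = 5 := by linear_combination hs
  have hs0 : s ≠ 0 := fun h0 => h5 (by rw [← hs, h0, mul_zero])
  have hs1 : ∀ s : ZMod p, s * s = 5 → 1 ≠ s := fun s hs h =>
    mul_ne_zero h2 h2 (by linear_combination -hs - (s + 1) * h)
  have hs2 : ∀ s : ZMod p, s * s = 5 → s ≠ -2 := fun s hs h =>
    one_ne_zero (α := ZMod p) (by linear_combination -hs + (s - 2) * h)
  have hinj : Function.Injective ![1, s, -s, 0, -2] :=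
    injective_vec_five (hs1 s hs) (hs1 _ hs') one_ne_zero
      (fun h => h3 (by linear_combination h))
      (fun h => mul_ne_zero h2 hs0 (by linear_combination h)) hs0 (hs2 s hs)
      (neg_ne_zero.2 hs0) (hs2 _ hs') (fun h => h2 (by linear_combination h))
  have hcop := pairwise_coprime_X_sub_C hinj
  have hC : (C s * C s : (ZMod p)[X]) = 5 := by rw [← C_mul, hs, map_ofNat]
  have hkill : ∀ f ∈ faceSpace (ZMod p) M, aeval (hecke (ZMod p) 3 M.y)
      (∏ j, (X - C (![1, s, -s, 0, -2] j))) f = 0 := fun f hf => by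
    have h1 : (∏ j, (X - C (![1, s, -s, 0, -2] j)) : (ZMod p)[X]) =
        X * (X - 1) * (X + 2) * (X ^ 2 - 5) := by
      rw [Fin.prod_univ_five]
      change (X - C 1) * (X - C s) * (X - C (-s)) * (X - C 0) * (X - C (-2)) = _
      simp only [map_neg, map_ofNat, map_one, map_zero]
      linear_combination -(X * (X - 1) * (X + 2)) * hC
    rw [h1]
    exact aeval_kill H L hf
  -- The last eigenvalue, -2, is left out: its dimension follows from the total 19.
  have hd := finrank_kerIn_eq H (fun j => irreducible_X_sub_C (![1, s, -s, 0, -2] j)) hcop hkill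
    ![5, 3, 3, 4, 4] 4 (fun j => by fin_cases j <;> simp <;> omega) (by rw [hN]; rfl)
    (fun j hj => by
      fin_cases j
      · exact finrank_one H L
      · exact finrank_sqrt H L hs
      · exact finrank_sqrt H L hs'
      · exact finrank_zero H L
      · exact absurd rfl hj)
  -- The first three eigenvalues give the simple components; 0 and -2 together make up the double
  -- one.
  let ι : Fin 3 → Fin 5 := Fin.castLE (by norm_num)
  have hι : Function.Injective ι := Fin.castLE_injective _
  have key := hasCoverings H L (μ := fun j => X - C (![1, s, -s, 0, -2] (ι j)))
    (fun j => irreducible_X_sub_C _) (fun i j hij => hcop (hι.ne hij))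
    (fun j => hcop (j := 3) (by fin_cases j <;> decide))
    (fun j => hcop (j := 4) (by fin_cases j <;> decide))
    (by
      rw [Fin.prod_univ_three]
      change (X - C 1) * (X - C s) * (X - C (-s)) = _
      simp only [map_neg, map_one]
      linear_combination -(X - 1) * hC)
    (δ := fun j => ![5, 3, 3, 4, 4] (ι j)) (fun j => hd (ι j)) (by decide) (hd 3)
  have e1 : 2 ^ 3 * (p + 3) - 1 = 8 * p + 23 := by omega
  have hR : {c | ∃ (S : Finset (Fin 3)) (i : Fin 3), (S, i) ≠ (∅, 0) ∧
      ∑ j ∈ S, (fun j => ![5, 3, 3, 4, 4] (ι j)) j + (i : ℕ) * 4 = c} =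
      Set.Icc 3 16 ∪ {19} := by
    ext c
    constructor
    · rintro ⟨S, i, h, rfl⟩
      revert S i
      decide
    · rintro (⟨h, h'⟩ | rfl)
      · interval_cases c <;> decide
      · decide
  rw [hR, e1] at key
  exact key

open IcosahedronLabelling in
theorem IsPlatonicCoprime.icosahedron_nonsplit (H : IsPlatonicCoprime p M 3 5)
    (hsq : ¬ IsSquare (5 : ZMod p)) :
    HasCoverings M p (4 * p + 11) 15 (4 * (p - 1)) {4, 5, 6, 8, 9, 10, 11, 13, 14, 15, 19} := by
  have hN : Nat.card M.D = 60 := H.type.card_eq_of H.genus_eq (by norm_num)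
  obtain ⟨L⟩ := FaceTable.exists_labelling icosahedronTable_isValid icosahedronTable_hasType
    H.type H.genus_eq hN
  have h2 : (2 : ZMod p) ≠ 0 := H.two_ne
  have h3 : (3 : ZMod p) ≠ 0 := H.n_ne
  have h5 : (5 : ZMod p) ≠ 0 := H.m_ne
  have hp := seven_le_of_ne_zero h2 h3 h5
  have hlin : ∀ a b : ZMod p, a ≠ b → IsCoprime (X - C a) (X - C b) := fun a b hab =>
    isCoprime_X_sub_C_of_isUnit_sub (isUnit_iff_ne_zero.2 (sub_ne_zero.2 hab))
  have hirr2 : Irreducible (X ^ 2 - C 5 : (ZMod p)[X]) := irreducible_X_sq_sub_C hsq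
  have hquad : ∀ a : ZMod p, IsCoprime (X - C a) (X ^ 2 - C 5) := fun a => by
    rw [(irreducible_X_sub_C a).coprime_iff_not_dvd, dvd_iff_isRoot]
    intro h
    refine hsq ⟨a, ?_⟩
    have h' : a ^ 2 - 5 = 0 := by simpa using h
    linear_combination -h'
  have n1 : (1 : ZMod p) ≠ -2 := fun h => h3 (by linear_combination h)
  have n2 : (0 : ZMod p) ≠ -2 := fun h => h2 (by linear_combination h)
  let μ : Fin 4 → (ZMod p)[X] := ![X - C 1, X ^ 2 - C 5, X - C 0, X - C (-2)]
  have hirr : ∀ j, Irreducible (μ j) := fun j => by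
    fin_cases j
    · exact irreducible_X_sub_C _
    · exact hirr2
    · exact irreducible_X_sub_C _
    · exact irreducible_X_sub_C _
  have hcop : Pairwise fun i j => IsCoprime (μ i) (μ j) := by
    intro i j hij
    fin_cases i <;> fin_cases j
    · exact absurd rfl hij
    · exact hquad 1
    · exact hlin 1 0 one_ne_zero
    · exact hlin 1 (-2) n1
    · exact (hquad 1).symm
    · exact absurd rfl hij
    · exact (hquad 0).symm
    · exact (hquad (-2)).symm
    · exact hlin 0 1 zero_ne_one
    · exact hquad 0
    · exact absurd rfl hij
    · exact hlin 0 (-2) n2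
    · exact hlin (-2) 1 n1.symm
    · exact hquad (-2)
    · exact hlin (-2) 0 n2.symm
    · exact absurd rfl hij
  have hkill : ∀ f ∈ faceSpace (ZMod p) M,
      aeval (hecke (ZMod p) 3 M.y) (∏ j, μ j) f = 0 := fun f hf => by
    have h1 : ∏ j, μ j = X * (X - 1) * (X + 2) * (X ^ 2 - 5) := by
      rw [Fin.prod_univ_four]
      change (X - C 1) * (X ^ 2 - C 5) * (X - C 0) * (X - C (-2)) = _
      simp only [map_neg, map_ofNat, map_one, map_zero]
      ring
    rw [h1]
    exact aeval_kill H L hf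
  -- The trace formula is for eigenvalues only, so the dimension 6 of the quadratic factor is
  -- obtained from the total 19.
  have hd := finrank_kerIn_eq H hirr hcop hkill
    ![5, 6, 4, 4] 1 (fun j => by fin_cases j <;> simp <;> omega) (by rw [hN]; rfl)
    (fun j hj => by
      fin_cases j
      · exact finrank_one H L
      · exact absurd rfl hj
      · exact finrank_zero H L
      · exact finrank_neg_two H L)
  let ι : Fin 2 → Fin 4 := Fin.castLE (by norm_num)
  have hι : Function.Injective ι := Fin.castLE_injective _
  have key := hasCoverings H L (μ := fun j => μ (ι j))
    (fun j => hirr _) (fun i j hij => hcop (hι.ne hij))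
    (fun j => hcop (j := 2) (by fin_cases j <;> decide))
    (fun j => hcop (j := 3) (by fin_cases j <;> decide))
    (by
      rw [Fin.prod_univ_two]
      change (X - C 1) * (X ^ 2 - C 5) = _
      simp only [map_ofNat, map_one])
    (δ := fun j => ![5, 6, 4, 4] (ι j)) (fun j => hd (ι j)) (by decide) (hd 2)
  have e1 : 2 ^ 2 * (p + 3) - 1 = 4 * p + 11 := by omega
  have hR : {c | ∃ (S : Finset (Fin 2)) (i : Fin 3), (S, i) ≠ (∅, 0) ∧
      ∑ j ∈ S, (fun j => ![5, 6, 4, 4] (ι j)) j + (i : ℕ) * 4 = c} =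
      {4, 5, 6, 8, 9, 10, 11, 13, 14, 15, 19} := by
    ext c
    constructor
    · rintro ⟨S, i, h, rfl⟩
      revert S i
      decide
    · rintro (rfl | rfl | rfl | rfl | rfl | rfl | rfl | rfl | rfl | rfl | rfl) <;> decide
  rw [hR, e1] at key
  exact key

theorem IsPlatonicCoprime.icosahedron (H : IsPlatonicCoprime p M 3 5) :
    (p % 5 = 1 ∨ p % 5 = 4 →
      HasCoverings M p (8 * p + 23) 31 (8 * (p - 1)) (Set.Icc 3 16 ∪ {19})) ∧
    (p % 5 = 2 ∨ p % 5 = 3 →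
      HasCoverings M p (4 * p + 11) 15 (4 * (p - 1)) {4, 5, 6, 8, 9, 10, 11, 13, 14, 15, 19}) := by
  have hp : 7 ≤ p := seven_le_of_ne_zero H.two_ne H.n_ne H.m_ne
  refine ⟨fun h => ?_, fun h => H.icosahedron_nonsplit fun hsq => ?_⟩
  · obtain ⟨s, hs⟩ := (isSquare_five_iff hp).2 h
    exact H.icosahedron_split hs.symm
  · have := (isSquare_five_iff hp).1 hsq
    omega

end

end OMap

end

namespace OMap

/-! ### Types of Platonic maps -/

/-- Euler's formula amounts to (n - 2)(m - 2) < 4 together with an exact count of darts, which is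
needed only to exclude loops and monogons. -/
theorem HasType.platonic_cases {M : OMap} {n m : ℕ} (h : M.HasType n m) (hg : M.genus = 0) :
    n = 2 ∨ m = 2 ∨ (n = 3 ∧ m = 3) ∨ (n = 4 ∧ m = 3) ∨ (n = 3 ∧ m = 4) ∨ (n = 5 ∧ m = 3) ∨
      (n = 3 ∧ m = 5) := by
  have hn := h.n_pos
  have hm := h.m_pos
  have h1 := h.card_eq hg
  have hF := h.numFaces_mul
  have hV := h.numVertices_mul
  have hnq : (n : ℚ) ≠ 0 := by positivity
  have hmq : (m : ℚ) ≠ 0 := by positivity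
  have h2 : Nat.card M.D * (2 * n + 2 * m) = Nat.card M.D * (n * m) + 4 * n * m := by
    have : (Nat.card M.D : ℚ) * (2 * n + 2 * m) = Nat.card M.D * (n * m) + 4 * n * m := by
      field_simp at h1
      linarith
    exact_mod_cast this
  have h3 : n * m < 2 * n + 2 * m := by
    have : 0 < 4 * n * m := by positivity
    by_contra! hle
    nlinarith
  rcases Nat.lt_or_ge n 3 with hn3 | hn3
  · obtain rfl | rfl : n = 1 ∨ n = 2 := by omega
    · rw [← hV] at h2
      -- For n = 1 the count of darts gives V (m + 2) = 4, so m = 2; the case m = 1 below is dual.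
      have h4 : M.numVertices * (m + 2) = 4 := Nat.eq_of_mul_eq_mul_right hm (by linarith)
      have : m + 2 ∣ 4 := Dvd.intro_left _ h4
      have := Nat.le_of_dvd (by norm_num) this
      obtain rfl | rfl : m = 1 ∨ m = 2 := by omega
      · omega
      · simp
    · simp
  · rcases Nat.lt_or_ge m 3 with hm3 | hm3
    · obtain rfl | rfl : m = 1 ∨ m = 2 := by omega
      · rw [← hF] at h2
        have h4 : M.numFaces * (n + 2) = 4 := Nat.eq_of_mul_eq_mul_right hn (by linarith)
        have : n + 2 ∣ 4 := Dvd.intro_left _ h4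
        have := Nat.le_of_dvd (by norm_num) this
        omega
      · simp
    · have hn6 : n < 6 := by nlinarith
      have hm6 : m < 6 := by nlinarith
      interval_cases n <;> interval_cases m <;> simp_all

end OMap

/-! ### Assembly of the cases. -/

theorem theorem1p1 (p : ℕ) [Fact p.Prime] (M : OMap) (n m : ℕ) (hM : M.IsPlatonic n m)
    (hp : ¬ p ∣ Nat.card M.aut) :
    -- tetrahedron
    (n = 3 ∧ m = 3 → HasRegularCoverings M p ![3]) ∧
    -- cube
    (n = 4 ∧ m = 3 → HasRegularCoverings M p ![2, 3, 5]) ∧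
    -- octahedron
    (n = 3 ∧ m = 4 → HasRegularCoverings M p ![1, 3, 3, 4, 4, 6, 7]) ∧
    -- dodecahedron
    (n = 5 ∧ m = 3 →
      (p % 5 = 1 ∨ p % 5 = 4 → HasRegularCoverings M p ![3, 3, 5, 6, 8, 8, 11]) ∧
      (p % 5 = 2 ∨ p % 5 = 3 → HasRegularCoverings M p ![5, 6, 11])) ∧
    -- icosahedron
    (n = 3 ∧ m = 5 →
      (p % 5 = 1 ∨ p % 5 = 4 →
        HasCoverings M p (8 * p + 23) 31 (8 * (p - 1)) (Set.Icc 3 16 ∪ {19})) ∧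
      (p % 5 = 2 ∨ p % 5 = 3 →
        HasCoverings M p (4 * p + 11) 15 (4 * (p - 1))
          {4, 5, 6, 8, 9, 10, 11, 13, 14, 15, 19})) ∧
    -- dihedron
    (m = 2 → HasRegularCoverings M p ![1]) ∧
    -- hosohedron
    (n = 2 → ∃ c : Fin (2 ^ numRootOrbits p m - 1) → ℕ, HasRegularCoverings M p c) ∧
    -- type and genus
    (∀ C : ElemAbCover M p, 1 ≤ C.c →
      C.N.HasType (n * p) m ∧
      C.N.genus = ((M.numFaces : ℚ) / 2 - 1) * (p : ℚ) ^ C.c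
        - (M.numFaces : ℚ) / 2 * (p : ℚ) ^ (C.c - 1) + 1) ∧
    -- the covering of which all others are quotients
    (∃ C₀ : ElemAbCover M p, C₀.c + 1 = M.numFaces ∧
      ∀ C : ElemAbCover M p, 1 ≤ C.c → C.IsQuotientOf C₀) ∧
    -- joins of irreducible coverings
    (¬ (n = 3 ∧ m = 5) → ∃ ν : ℕ, CoveringsAreJoins M p ν) := by
  -- Aut⁺ M is regular on the darts, so p does not divide their number; that makes 2, n, m and the
  -- group order invertible modulo p.
  have H : IsPlatonicCoprime p M n m := by
    refine ⟨hM.1, hM.2.2, hM.2.1, fun h0 => hp ?_⟩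
    rw [card_aut hM.1]
    exact (ZMod.natCast_eq_zero_iff _ _).1 h0
  refine ⟨?_, ?_, ?_, ?_, ?_, ?_, ?_, fun C hC => ⟨H.hasType_cover C hC, H.genus_cover C hC⟩, ?_, ?_⟩
  · rintro ⟨rfl, rfl⟩
    exact H.tetrahedron.1
  · rintro ⟨rfl, rfl⟩
    exact H.cube.1
  · rintro ⟨rfl, rfl⟩
    exact H.octahedron.1
  · rintro ⟨rfl, rfl⟩
    exact H.dodecahedron.1
  · rintro ⟨rfl, rfl⟩
    exact H.icosahedron
  · rintro rfl
    exact H.multFree_dihedron.1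
  · rintro rfl
    obtain ⟨μ, h⟩ := H.multFree_hosohedron
    exact h.exists_hasRegularCoverings H
  · obtain ⟨C₀, h0, h1⟩ := H.exists_universal
    exact ⟨C₀, h0, fun C _ => h1 C⟩
  · intro hne
    rcases H.type.platonic_cases H.genus_eq with
      rfl | rfl | ⟨rfl, rfl⟩ | ⟨rfl, rfl⟩ | ⟨rfl, rfl⟩ | ⟨rfl, rfl⟩ | h
    · obtain ⟨μ, h⟩ := H.multFree_hosohedron
      exact ⟨_, h.coveringsAreJoins H⟩
    · exact ⟨_, H.multFree_dihedron.2⟩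
    · exact ⟨_, H.tetrahedron.2⟩
    · exact ⟨_, H.cube.2⟩
    · exact ⟨_, H.octahedron.2⟩
    · exact H.dodecahedron.2
    · exact absurd h hne
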